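/- **Setting.** Fix $d$ and a scaling $\mathfrak s\in\{1,2,\dots\}^d$; write $|\mathfrak s|=\sum_i\mathfrak s_i$, $|k|_{\mathfrak s}=\sum_i\mathfrak s_ik_i$ for $k\in\mathbf N^d$, $\|x\|_{\mathfrak s}=\sum_i|x_i|^{1/\mathfrak s_i}$, and $\|K\|_{\alpha;p}=\sup\{\|x\|_{\mathfrak s}^{\alpha+|k|_{\mathfrak s}}|D^kK(x)| : 0<\|x\|_{\mathfrak s}\le1,\ |k|_{\mathfrak s}<p\}$. Let $\mathbb G=(\mathbb V,\mathbb E)$ be a finite directed multigraph without loops, every vertex of which lies on an edge; edges $e=(e_-,e_+)$ carry labels $a_e\ge0$ and $r_e\in\mathbf Z$. There are a distinguished vertex $0$ and $M\ge1$ distinguished edges $(0,v_{\star,i})$ with label $(0,0)$ and pairwise distinct $v_{\star,i}$; put $\mathbb V_\star=\{0,v_{\star,1},\dots,v_{\star,M}\}$ and $\mathbb V_0=\mathbb V\setminus\{0\}$. If several edges connect the same two vertices (in either direction), at most one of them has $r_e\ne0$, and then $r_e>0$. Let $\hat{\mathbb E}$ be obtained by merging all edges that connect the same two vertices into one edge,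 whose label $(\hat a_e,r_e)$ is the sum of their labels (and which, if $r_e>0$, is directed as its constituent with positive label). For $\bar{\mathbb V}\subset\mathbb V$ let $\hat{\mathbb E}_0(\bar{\mathbb V})$, $\hat{\mathbb E}(\bar{\mathbb V})$, $\hat{\mathbb E}^\uparrow_+(\bar{\mathbb V})$, $\hat{\mathbb E}^\downarrow_+(\bar{\mathbb V})$ be the merged edges that have both ends in $\bar{\mathbb V}$; have at least one end in $\bar{\mathbb V}$; have $r_e>0$ and leave $\bar{\mathbb V}$; have $r_e>0$ and enter $\bar{\mathbb V}$. **Power counting.** Assume that $r_e=0$ if $0\in e$ or if $e$ connects two elements of $\mathbb V_\star$, that at most one edge with $r_e<0$ emerges from any vertex, and: 1. $\hat a_e+(r_e\wedge0)<|\mathfrak s|$ for all $e\in\hat{\mathbb E}$; 2. $\sum_{e\in\hat{\mathbb E}_0(\bar{\mathbb V})}\hat a_e<(|\bar{\mathbb V}|-1)|\mathfrak s|$ for all $\bar{\mathbb V}\subset\mathbb V_0$ with $|\bar{\mathbb V}|\ge3$; 3. $\sum_{e\in\hat{\mathbb E}_0(\bar{\mathbb V})}\hat a_e+\sum_{e\in\hat{\mathbb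 E}^\uparrow_+(\bar{\mathbb V})}(\hat a_e+r_e-1)-\sum_{e\in\hat{\mathbb E}^\downarrow_+(\bar{\mathbb V})}r_e<(|\bar{\mathbb V}|-1)|\mathfrak s|$ for all $\bar{\mathbb V}\ni0$ with $|\bar{\mathbb V}|\ge2$; 4. $\sum_{e\in\hat{\mathbb E}(\bar{\mathbb V})\setminus\hat{\mathbb E}^\downarrow_+(\bar{\mathbb V})}\hat a_e+\sum_{e\in\hat{\mathbb E}^\uparrow_+(\bar{\mathbb V})}r_e-\sum_{e\in\hat{\mathbb E}^\downarrow_+(\bar{\mathbb V})}(r_e-1)>|\bar{\mathbb V}||\mathfrak s|$ for all non-empty $\bar{\mathbb V}\subset\mathbb V\setminus\mathbb V_\star$. **Kernels.** For every $e\in\mathbb E$ let $K_e$ be a smooth function on $\mathbf R^d\setminus\{0\}$, supported in $\{\|x\|_{\mathfrak s}\le1\}$, with $\|K_e\|_{a_e;p}<\infty$ for all $p$. If $r_e<0$, let also real numbers $I_{e,k}$, $|k|_{\mathfrak s}<|r_e|$, be given, such that $I_{e,k}=\int x^kK_e(x)\,dx$ whenever $a_e<|\mathfrak s|+|k|_{\mathfrak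 s}$ (they are arbitrary otherwise), and set $$(\mathscr RK_e)(\psi)=\int K_e(x)\Bigl(\psi(x)-\sum_{|k|_{\mathfrak s}<|r_e|}\tfrac{x^k}{k!}D^k\psi(0)\Bigr)dx+\sum_{|k|_{\mathfrak s}<|r_e|}\tfrac{I_{e,k}}{k!}D^k\psi(0).$$ If $r_e\ge0$, set $\hat K_e(x,y)=K_e(y-x)-\sum_{|j|_{\mathfrak s}<r_e}\frac{y^j}{j!}D^jK_e(-x)$; if $r_e<0$, let $\hat K_e(x,y)$ stand for $(\mathscr RK_e)(y-x)$. For $\phi\in C_c^\infty(\mathbf R^d)$ and $\lambda\in(0,1]$ let $\phi_\lambda(x)=\lambda^{-|\mathfrak s|}\phi(\lambda^{-\mathfrak s_1}x_1,\dots,\lambda^{-\mathfrak s_d}x_d)$. With $x_0=0$, the generalised convolution is $$\mathcal I^{\mathbb G}(\phi_\lambda,K)=\int_{(\mathbf R^d)^{\mathbb V_0}}\prod_{e\in\mathbb E}\hat K_e(x_{e_-},x_{e_+})\prod_{i=1}^M\phi_\lambda(x_{v_{\star,i}})\,dx ,$$ understood as follows: the distributions $\mathscr RK_e$ ($r_e<0$)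 are replaced by smooth functions $K_{e}^{(n)}$ supported in $\{\|x\|_{\mathfrak s}\le1\}$, with $\sup_n\|K_e^{(n)}\|_{a_e;p}<\infty$ for all $p$, such that as $n\to\infty$ $K_e^{(n)}\to K_e$ pointwise on $\mathbf R^d\setminus\{0\}$ and $K_e^{(n)}\to\mathscr RK_e$ as distributions; $\mathcal I^{\mathbb G}(\phi_\lambda,K)$ is *well defined* if for all such sequences the resulting integrals converge absolutely and tend, as $n\to\infty$, to one and the same limit, which is then its value (and if such sequences exist). If no $r_e$ is negative, this is the absolutely convergent integral itself. **Theorem.** There is $p<\infty$, depending only on $\mathfrak s$, the graph and the labels $r_e$, such that: * $\mathcal I^{\mathbb G}(\phi_\lambda,K)$ is well defined. * Suppose in addition that $a_e\ne|\mathfrak s|+|k|_{\mathfrak s}$ whenever $r_e<0$ and $|k|_{\mathfrak s}<|r_e|$. For every $R>0$ there is $C<\infty$, depending only on $\mathfrak s$, the graph, the labels $(a_e,r_e)$ and $R$, such that for all kernels and constants as above, all $\phi\in C_c^\infty$ supported in $\{\|x\|_{\mathfrak s}\le R\}$ and all $\lambda\in(0,1]$, $$|\mathcal I^{\mathbb G}(\phi_\lambda,K)|\le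 C\lambda^{\tilde\alpha}\Bigl(\sup_{|k|_{\mathfrak s}<p}\|D^k\phi\|_\infty\Bigr)^M\prod_{e\in\mathbb E}\Bigl(\|K_e\|_{a_e;p}+\sum_{|k|_{\mathfrak s}<|r_e|,\ r_e<0}|I_{e,k}|\Bigr),\qquad\tilde\alpha=|\mathfrak s||\mathbb V\setminus\mathbb V_\star|-\sum_{e\in\mathbb E}a_e .$$ * If $K_{e,m}\to K_e$ pointwise on $\mathbf R^d\setminus\{0\}$ as $m\to\infty$, $\sup_m\|K_{e,m}\|_{a_e;p}<\infty$ and $I_{e,k,m}\to I_{e,k}$ for all $e,k$ (all kernels and constants being as above), then $\mathcal I^{\mathbb G}(\phi_\lambda,K_m)\to\mathcal I^{\mathbb G}(\phi_\lambda,K)$. -/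

import Mathlib

open scoped ContDiff ENNReal NNReal

noncomputable section

namespace GenConv

/-! ### Scalings, multi-indices, derivatives -/

/-- The homogeneous dimension `|𝔰| = ∑ 𝔰ᵢ`. -/
def sdim {d : ℕ} (s : Fin d → ℕ) : ℕ := ∑ i, s i

/-- The scaled degree `|k|_𝔰 = ∑ 𝔰ᵢ kᵢ` of a multi-index. -/
def sdeg {d : ℕ} (s k : Fin d → ℕ) : ℕ := ∑ i, s i * k i

/-- The scaled norm `‖x‖_𝔰 = ∑ |xᵢ|^(1/𝔰ᵢ)`. -/
def snorm {d : ℕ} (s : Fin d → ℕ) (x : Fin d → ℝ) : ℝ := ∑ i, |x i| ^ (1 / (s i : ℝ))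

/-- The monomial `x^k`. -/
def monom {d : ℕ} (k : Fin d → ℕ) (x : Fin d → ℝ) : ℝ := ∏ i, x i ^ k i

/-- The multi-index factorial `k!`. -/
def mfact {d : ℕ} (k : Fin d → ℕ) : ℝ := ∏ i, ((k i).factorial : ℝ)

/-- The partial derivative `∂ᵢ f`. -/
def partialD {d : ℕ} (i : Fin d) (f : (Fin d → ℝ) → ℝ) : (Fin d → ℝ) → ℝ :=
  fun x => fderiv ℝ f x (Pi.single i 1)

/-- The iterated derivative `D^k f = ∂₀^{k₀} ∂₁^{k₁} ⋯ f`. -/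
def multiD {d : ℕ} (k : Fin d → ℕ) (f : (Fin d → ℝ) → ℝ) : (Fin d → ℝ) → ℝ :=
  (List.finRange d).foldr (fun i g => (partialD i)^[k i] g) f

/-- The finite set of multi-indices with `|k|_𝔰 < n` (see `mem_lowIdx`). -/
def lowIdx {d : ℕ} (s : Fin d → ℕ) (n : ℕ) : Finset (Fin d → ℕ) :=
  (Fintype.piFinset fun _ => Finset.range n).filter fun k => sdeg s k < n

theorem mem_lowIdx {d : ℕ} {s : Fin d → ℕ} (hs : ∀ i, 0 < s i) (n : ℕ) (k : Fin d → ℕ) :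
    k ∈ lowIdx s n ↔ sdeg s k < n := by
  simp only [lowIdx, Finset.mem_filter, Fintype.mem_piFinset, Finset.mem_range,
    and_iff_right_iff_imp]
  intro h i
  have h1 : s i * k i ≤ sdeg s k :=
    Finset.single_le_sum (f := fun i => s i * k i) (fun _ _ => Nat.zero_le _) (Finset.mem_univ i)
  have h2 : k i ≤ s i * k i := Nat.le_mul_of_pos_left _ (hs i)
  omega

/-! ### Kernels and test functions -/

/-- `‖K‖_{α;p} = sup { ‖x‖_𝔰^(α + |k|_𝔰) |D^k K(x)| : 0 < ‖x‖_𝔰 ≤ 1, |k|_𝔰 < p }`,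
as an element of `[0, ∞]`. -/
def kernelNorm {d : ℕ} (s : Fin d → ℕ) (α : ℝ) (p : ℕ) (K : (Fin d → ℝ) → ℝ) : ℝ≥0∞ :=
  ⨆ (x : Fin d → ℝ) (_ : x ≠ 0 ∧ snorm s x ≤ 1) (k : Fin d → ℕ) (_ : sdeg s k < p),
    ENNReal.ofReal (snorm s x ^ (α + (sdeg s k : ℝ)) * |multiD k K x|)

/-- A kernel on `ℝ^d ∖ {0}` with a singularity of order `α` at the origin: smooth away from `0`,
supported in the unit ball, and with all norms `‖K‖_{α;p}` finite. The value `K 0` is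
irrelevant everywhere below. -/
structure IsKernel {d : ℕ} (s : Fin d → ℕ) (α : ℝ) (K : (Fin d → ℝ) → ℝ) : Prop where
  smooth : ContDiffOn ℝ ∞ K {0}ᶜ
  support : ∀ x, 1 < snorm s x → K x = 0
  finite : ∀ p : ℕ, kernelNorm s α p K < ⊤

/-- Smooth test functions supported in the ball of radius `R` around `0`. -/
structure IsTest {d : ℕ} (s : Fin d → ℕ) (R : ℝ) (φ : (Fin d → ℝ) → ℝ) : Prop where
  smooth : ContDiff ℝ ∞ φ
  support : ∀ x, R < snorm s x → φ x = 0

/-- `sup { |D^k φ(x)| : x, |k|_𝔰 < p }`. -/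
def testNorm {d : ℕ} (s : Fin d → ℕ) (p : ℕ) (φ : (Fin d → ℝ) → ℝ) : ℝ≥0∞ :=
  ⨆ (x : Fin d → ℝ) (k : Fin d → ℕ) (_ : sdeg s k < p), ENNReal.ofReal |multiD k φ x|

/-- `φ_λ(x) = λ^(-|𝔰|) φ(λ^(-𝔰₁) x₁, …, λ^(-𝔰_d) x_d)`. -/
def rescale {d : ℕ} (s : Fin d → ℕ) (lam : ℝ) (φ : (Fin d → ℝ) → ℝ) : (Fin d → ℝ) → ℝ :=
  fun x => (lam ^ sdim s)⁻¹ * φ fun i => x i / lam ^ s i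

/-- The renormalised distribution attached to a kernel `K` with label `r < 0` and constants `I`:
`(ℛK)(ψ) = ∫ K(x) (ψ(x) - ∑_{|k|<|r|} x^k/k! D^kψ(0)) dx + ∑_{|k|<|r|} I_k/k! D^kψ(0)`. -/
def renorm {d : ℕ} (s : Fin d → ℕ) (r : ℤ) (K : (Fin d → ℝ) → ℝ) (I : (Fin d → ℕ) → ℝ)
    (ψ : (Fin d → ℝ) → ℝ) : ℝ :=
  (∫ x, K x * (ψ x - ∑ k ∈ lowIdx s (-r).toNat, monom k x / mfact k * multiD k ψ 0))
    + ∑ k ∈ lowIdx s (-r).toNat, I k / mfact k * multiD k ψ 0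

/-- A sequence of smooth functions approximating the distribution `ℛK` given by `renorm`:
supported in the unit ball, bounded in every `‖·‖_{α;p}` uniformly along the sequence, convergent
to `K` pointwise away from `0` and to `ℛK` in the sense of distributions. -/
structure IsRegularisation {d : ℕ} (s : Fin d → ℕ) (α : ℝ) (r : ℤ) (K : (Fin d → ℝ) → ℝ)
    (I : (Fin d → ℕ) → ℝ) (Kn : ℕ → (Fin d → ℝ) → ℝ) : Prop where
  smooth : ∀ n, ContDiff ℝ ∞ (Kn n)
  support : ∀ n x, 1 < snorm s x → Kn n x = 0
  bounded : ∀ p : ℕ, ∃ B : ℝ≥0, ∀ n, kernelNorm s α p (Kn n) ≤ B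
  pointwise : ∀ x, x ≠ 0 → Filter.Tendsto (fun n => Kn n x) Filter.atTop (nhds (K x))
  distrib : ∀ ψ : (Fin d → ℝ) → ℝ, ContDiff ℝ ∞ ψ → HasCompactSupport ψ →
    Filter.Tendsto (fun n => ∫ x, Kn n x * ψ x) Filter.atTop (nhds (renorm s r K I ψ))

/-- The constants `I_k` with `x^k K(x)` integrable at the origin by power counting
(`α < |𝔰| + |k|_𝔰`) are the true moments of `K`; the others are free. -/
def MomentsCompatible {d : ℕ} (s : Fin d → ℕ) (α : ℝ) (r : ℤ) (K : (Fin d → ℝ) → ℝ)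
    (I : (Fin d → ℕ) → ℝ) : Prop :=
  ∀ k ∈ lowIdx s (-r).toNat, α < (sdim s : ℝ) + sdeg s k → I k = ∫ x, monom k x * K x

/-! ### Graphs -/

/-- A finite directed multigraph without loops, with renormalisation labels `r`, a distinguished
vertex `root` (the vertex `0`) and `M ≥ 1` distinguished edges from `root` to `M` distinct
vertices. Edges that connect the same two vertices (in whichever direction) are regarded as
parallel; among several parallel edges at most one has `r ≠ 0`, and then `r > 0`. -/
structure RGraph (V E : Type*) where
  src : E → V
  tgt : E → V
  r : E → ℤ
  root : V
  M : ℕ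
  star : Fin M → E
  no_loop : ∀ e, src e ≠ tgt e
  covered : ∀ v, ∃ e, src e = v ∨ tgt e = v
  M_pos : 1 ≤ M
  star_src : ∀ i, src (star i) = root
  star_tgt : Function.Injective fun i => tgt (star i)
  star_r : ∀ i, r (star i) = 0
  parallel : ∀ e e', e ≠ e' → s(src e, tgt e) = s(src e', tgt e') →
    0 ≤ r e ∧ 0 ≤ r e' ∧ (r e = 0 ∨ r e' = 0)

namespace RGraph

variable {V E : Type*} [Fintype V] [DecidableEq V] [Fintype E]

/-- The pair of endpoints of an edge. -/
def ends (G : RGraph V E) (e : E) : Sym2 V := s(G.src e, G.tgt e)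

/-- The edges of the graph obtained by merging parallel edges. -/
def hatE (G : RGraph V E) : Finset (Sym2 V) := Finset.univ.image G.ends

/-- The label `â` of a merged edge: the sum of the labels `a` of its constituents. -/
def hatA (G : RGraph V E) (a : E → ℝ) (c : Sym2 V) : ℝ :=
  ∑ e ∈ Finset.univ.filter (fun e => G.ends e = c), a e

/-- The label `r` of a merged edge: the sum of the labels `r` of its constituents. -/
def hatR (G : RGraph V E) (c : Sym2 V) : ℤ :=
  ∑ e ∈ Finset.univ.filter (fun e => G.ends e = c), G.r e

/-- Merged edges internal to `U`. -/
def internal (G : RGraph V E) (U : Finset V) : Finset (Sym2 V) :=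
  G.hatE.filter fun c => ∀ v ∈ c, v ∈ U

/-- Merged edges incident to `U`. -/
def incident (G : RGraph V E) (U : Finset V) : Finset (Sym2 V) :=
  G.hatE.filter fun c => ∃ v ∈ c, v ∈ U

/-- Merged edges with positive `r` that leave `U`. The direction of such an edge is that of its
unique constituent with `r > 0`. -/
def outPos (G : RGraph V E) (U : Finset V) : Finset (Sym2 V) :=
  (Finset.univ.filter fun e => 0 < G.r e ∧ G.src e ∈ U ∧ G.tgt e ∉ U).image G.ends

/-- Merged edges with positive `r` that enter `U`. -/
def inPos (G : RGraph V E) (U : Finset V) : Finset (Sym2 V) :=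
  (Finset.univ.filter fun e => 0 < G.r e ∧ G.src e ∉ U ∧ G.tgt e ∈ U).image G.ends

/-- `V_⋆`: the root and the end points of the distinguished edges. -/
def Vstar (G : RGraph V E) : Finset V :=
  insert G.root (Finset.univ.image fun i => G.tgt (G.star i))

/-- The power-counting assumption on the labels `(a_e, r_e)`. -/
structure PowerCounting {d : ℕ} (s : Fin d → ℕ) (G : RGraph V E) (a : E → ℝ) : Prop where
  a_nonneg : ∀ e, 0 ≤ a e
  a_star : ∀ i, a (G.star i) = 0
  r_root : ∀ e, G.src e = G.root ∨ G.tgt e = G.root → G.r e = 0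
  r_star : ∀ e, G.src e ∈ G.Vstar → G.tgt e ∈ G.Vstar → G.r e = 0
  r_neg : ∀ e e', G.r e < 0 → G.r e' < 0 → G.src e = G.src e' → e = e'
  edge : ∀ c ∈ G.hatE, G.hatA a c + (min (G.hatR c) 0 : ℤ) < sdim s
  subgraph : ∀ U : Finset V, G.root ∉ U → 3 ≤ U.card →
    ∑ c ∈ G.internal U, G.hatA a c < ((U.card : ℝ) - 1) * sdim s
  subgraph_root : ∀ U : Finset V, G.root ∈ U → 2 ≤ U.card →
    ∑ c ∈ G.internal U, G.hatA a c + ∑ c ∈ G.outPos U, (G.hatA a c + G.hatR c - 1)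
      - ∑ c ∈ G.inPos U, (G.hatR c : ℝ) < ((U.card : ℝ) - 1) * sdim s
  large : ∀ U : Finset V, U.Nonempty → Disjoint U G.Vstar →
    (U.card : ℝ) * sdim s < ∑ c ∈ G.incident U \ G.inPos U, G.hatA a c
      + ∑ c ∈ G.outPos U, (G.hatR c : ℝ) - ∑ c ∈ G.inPos U, ((G.hatR c : ℝ) - 1)

/-- No exponent `a_e` of an edge with `r_e < 0` equals a logarithmic threshold `|𝔰| + |k|_𝔰`,
`|k|_𝔰 < |r_e|`. -/
def NonCritical {d : ℕ} (s : Fin d → ℕ) (G : RGraph V E) (a : E → ℝ) : Prop :=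
  ∀ e, ∀ k ∈ lowIdx s (-G.r e).toNat, a e ≠ (sdim s : ℝ) + sdeg s k

/-! ### Generalised convolutions -/

/-- A configuration of points indexed by `V ∖ {0}`, extended by `x_0 = 0`. -/
def extend {d : ℕ} (G : RGraph V E) (x : {v : V // v ≠ G.root} → Fin d → ℝ) (v : V) :
    Fin d → ℝ :=
  if h : v = G.root then 0 else x ⟨v, h⟩

/-- `K(y - x) - ∑_{|j|<r} y^j/j! D^jK(-x)`; the sum is empty for `r ≤ 0`. -/
def hatK {d : ℕ} (s : Fin d → ℕ) (r : ℤ) (K : (Fin d → ℝ) → ℝ) (x y : Fin d → ℝ) : ℝ :=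
  K (y - x) - ∑ j ∈ lowIdx s r.toNat, monom j y / mfact j * multiD j K (-x)

/-- The integrand `∏_e K̂_e(x_{e₋}, x_{e₊}) ∏_i φ(x_{v_{⋆,i}})`. -/
def integrand {d : ℕ} (s : Fin d → ℕ) (G : RGraph V E) (φ : (Fin d → ℝ) → ℝ)
    (K : E → (Fin d → ℝ) → ℝ) (x : {v : V // v ≠ G.root} → Fin d → ℝ) : ℝ :=
  (∏ e, hatK s (G.r e) (K e) (G.extend x (G.src e)) (G.extend x (G.tgt e)))
    * ∏ i, φ (G.extend x (G.tgt (G.star i)))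

/-- `L` is the value of the generalised convolution `ℐ^G(φ, K)`: whenever the distributions `ℛK_e`
of the edges with `r_e < 0` are replaced by smooth approximations (the other kernels being left
as they are), the integral over `(ℝ^d)^(V ∖ {0})` converges absolutely, and it tends to `L` as the
approximation is removed. If no `r_e` is negative, then `L` is the absolutely convergent
integral itself. -/
def IsGenConv {d : ℕ} (s : Fin d → ℕ) (G : RGraph V E) (a : E → ℝ) (φ : (Fin d → ℝ) → ℝ)
    (K : E → (Fin d → ℝ) → ℝ) (I : E → (Fin d → ℕ) → ℝ) (L : ℝ) : Prop :=
  ∀ Kn : E → ℕ → (Fin d → ℝ) → ℝ,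
    (∀ e, G.r e < 0 → IsRegularisation s (a e) (G.r e) (K e) (I e) (Kn e)) →
    (∀ e, 0 ≤ G.r e → ∀ n, Kn e n = K e) →
    (∀ n, MeasureTheory.Integrable (integrand s G φ fun e => Kn e n)) ∧
      Filter.Tendsto (fun n => ∫ x, integrand s G φ (fun e => Kn e n) x) Filter.atTop (nhds L)

/-- A collection of kernels `K_e` with singularities of order `a_e`, together with constants
`I_{e,k}` for the edges with `r_e < 0` (entries of `I` outside `|k|_𝔰 < |r_e|` are not used). -/
def IsKernelFamily {d : ℕ} (s : Fin d → ℕ) (G : RGraph V E) (a : E → ℝ)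
    (K : E → (Fin d → ℝ) → ℝ) (I : E → (Fin d → ℕ) → ℝ) : Prop :=
  ∀ e, IsKernel s (a e) (K e) ∧ MomentsCompatible s (a e) (G.r e) (K e) (I e)

/-- `‖K_e‖_{a_e;p} + ∑_{|k|<|r_e|} |I_{e,k}|`, the sum being empty for `r_e ≥ 0`. -/
def edgeSize {d : ℕ} (s : Fin d → ℕ) (G : RGraph V E) (a : E → ℝ) (p : ℕ)
    (K : E → (Fin d → ℝ) → ℝ) (I : E → (Fin d → ℕ) → ℝ) (e : E) : ℝ :=
  (kernelNorm s (a e) p (K e)).toReal + ∑ k ∈ lowIdx s (-G.r e).toNat, |I e k|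

/-- The exponent `α̃ = |𝔰| |V ∖ V_⋆| - ∑ a_e`. -/
def expo {d : ℕ} (s : Fin d → ℕ) (G : RGraph V E) (a : E → ℝ) : ℝ :=
  (sdim s : ℝ) * ((Finset.univ \ G.Vstar).card : ℝ) - ∑ e, a e

end RGraph

end GenConv

end

open GenConv

noncomputable section
namespace GenConv
open MeasureTheory Filter Finset Real

notation:max "ℝ^" d:max => Fin d → ℝ

notation:max "ℕ^" d:max => Fin d → ℕ

notation:max "𝕍" G:max => {v // v ≠ RGraph.root G}

notation:max "Scale" V:max => Sym2 V → ℤ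

notation:max "Smooth" f:max => ContDiff ℝ ∞ f

notation:max "SmoothOn" f:max D:max => ContDiffOn ℝ ∞ f D

/-- All weights of the scaling are positive, and there is at least one. -/
class Scaling {d : ℕ} (s : outParam ℕ^d) : Prop where
  pos : ∀ i, 0 < s i
  dim : 0 < sdim s

variable {d : ℕ} {s : ℕ^d} [hs : Scaling s] {X : Type*} [NormedAddCommGroup X] [NormedSpace ℝ X]
  {V E : Type*} [Fintype V] [DecidableEq V] [Fintype E] {G : RGraph V E} {a : E → ℝ}

lemma two_zpow_le {m n : ℤ} (h : m ≤ n) : (2 : ℝ) ^ m ≤ 2 ^ n := zpow_le_zpow_right₀ one_le_two h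

lemma two_zpow_lt {m n : ℤ} (h : m < n) : (2 : ℝ) ^ m < 2 ^ n := zpow_lt_zpow_right₀ one_lt_two h

lemma two_zpow_add (m n : ℤ) : (2 : ℝ) ^ (m + n) = 2 ^ m * 2 ^ n := zpow_add₀ two_ne_zero m n

lemma two_zpow_sub (m n : ℤ) : (2 : ℝ) ^ (m - n) = 2 ^ m / 2 ^ n := zpow_sub₀ two_ne_zero m n

/-! ### The scaled norm -/

lemma snorm_nonneg (x : ℝ^d) : 0 ≤ snorm s x := sum_nonneg fun _ _ => rpow_nonneg (abs_nonneg _) _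

lemma snorm_zero : snorm s (0 : ℝ^d) = 0 := by
  refine sum_eq_zero fun i _ => ?_
  have : (s i : ℝ) ≠ 0 := by exact_mod_cast (hs.pos i).ne'
  simp only [Pi.zero_apply, abs_zero]
  exact zero_rpow (by positivity)

lemma snorm_neg (x : ℝ^d) : snorm s (-x) = snorm s x := by simp [snorm]

lemma snorm_sub_comm (x y : ℝ^d) : snorm s (x - y) = snorm s (y - x) := by rw [← snorm_neg, neg_sub]

lemma snorm_add_le (x y : ℝ^d) : snorm s (x + y) ≤ snorm s x + snorm s y := by
  unfold snorm
  rw [← sum_add_distrib]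
  refine sum_le_sum fun i _ => ?_
  have h1 : (1 : ℝ) ≤ s i := by exact_mod_cast hs.pos i
  have h2 : 1 / (s i : ℝ) ≤ 1 := by rw [div_le_one (by linarith)]; exact h1
  calc |(x + y) i| ^ (1 / (s i : ℝ)) ≤ (|x i| + |y i|) ^ (1 / (s i : ℝ)) :=
        rpow_le_rpow (abs_nonneg _) (abs_add_le _ _) (by positivity)
    _ ≤ _ := rpow_add_le_add_rpow (abs_nonneg _) (abs_nonneg _) (by positivity) h2

lemma snorm_sub_le (x y : ℝ^d) : snorm s (x - y) ≤ snorm s x + snorm s y := by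
  rw [sub_eq_add_neg, ← snorm_neg y]; exact snorm_add_le _ _

lemma snorm_tri (x y z : ℝ^d) : snorm s (x - z) ≤ snorm s (x - y) + snorm s (y - z) := by
  rw [← sub_add_sub_cancel x y z]; exact snorm_add_le _ _

lemma abs_rpow_le_snorm (x : ℝ^d) (i : Fin d) : |x i| ^ (1 / (s i : ℝ)) ≤ snorm s x :=
  single_le_sum (f := fun i => |x i| ^ (1 / (s i : ℝ)))
    (fun _ _ => rpow_nonneg (abs_nonneg _) _) (mem_univ i)

lemma abs_le_snorm_pow (x : ℝ^d) (i : Fin d) :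
    |x i| ≤ snorm s x ^ s i := by
  have h0 : (s i : ℝ) ≠ 0 := by exact_mod_cast (hs.pos i).ne'
  calc |x i| = (|x i| ^ (1 / (s i : ℝ))) ^ s i := by
        rw [← rpow_natCast, ← rpow_mul (abs_nonneg _), one_div, inv_mul_cancel₀ h0, rpow_one]
    _ ≤ _ := pow_le_pow_left₀ (rpow_nonneg (abs_nonneg _) _) (abs_rpow_le_snorm x i) _

lemma snorm_pos {x : ℝ^d} (hx : x ≠ 0) : 0 < snorm s x := by
  refine lt_of_le_of_ne (snorm_nonneg x) fun h => hx ?_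
  funext i
  have := abs_le_snorm_pow x i
  rw [← h, zero_pow (hs.pos i).ne'] at this
  exact abs_nonpos_iff.1 this

lemma continuous_snorm : Continuous (snorm s) := by
  unfold snorm
  refine continuous_finsetSum _ fun i _ => ?_
  have : (0 : ℝ) < s i := by exact_mod_cast hs.pos i
  exact ((continuous_apply i).abs).rpow_const fun x => Or.inr (by positivity)

/-- The anisotropic dilation. -/
def dil (s : ℕ^d) (t : ℝ) (x : ℝ^d) : ℝ^d := fun i => t ^ s i * x i

lemma snorm_dil {t : ℝ} (ht : 0 ≤ t) (x : ℝ^d) : snorm s (dil s t x) = t * snorm s x := by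
  unfold snorm dil
  rw [mul_sum]
  refine sum_congr rfl fun i _ => ?_
  have h0 : (s i : ℝ) ≠ 0 := by exact_mod_cast (hs.pos i).ne'
  rw [abs_mul, abs_of_nonneg (pow_nonneg ht _), mul_rpow (pow_nonneg ht _) (abs_nonneg _),
    ← rpow_natCast, ← rpow_mul ht, one_div, mul_inv_cancel₀ h0, rpow_one]

lemma abs_monom_le (k : ℕ^d) (x : ℝ^d) :
    |monom k x| ≤ snorm s x ^ sdeg s k := by
  unfold monom sdeg
  rw [abs_prod, ← prod_pow_eq_pow_sum]
  refine prod_le_prod (fun _ _ => abs_nonneg _) fun i _ => ?_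
  rw [abs_pow, pow_mul]
  exact pow_le_pow_left₀ (abs_nonneg _) (abs_le_snorm_pow x i) _

lemma monom_dil (k : ℕ^d) (t : ℝ) (x : ℝ^d) : monom k (dil s t x) = t ^ sdeg s k * monom k x := by
  unfold monom sdeg dil
  rw [← prod_pow_eq_pow_sum, ← prod_mul_distrib]
  refine prod_congr rfl fun i _ => ?_
  rw [mul_pow, pow_mul]

lemma volume_snorm_le {ρ : ℝ} (hρ : 0 ≤ ρ) :
    volume {x : ℝ^d | snorm s x ≤ ρ} ≤ ENNReal.ofReal (2 ^ d * ρ ^ sdim s) := by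
  have hsub : {x : ℝ^d | snorm s x ≤ ρ} ⊆
      Set.pi Set.univ fun i => Set.Icc (-(ρ ^ s i)) (ρ ^ s i) := by
    intro x hx i _
    have := (abs_le_snorm_pow x i).trans (pow_le_pow_left₀ (snorm_nonneg x) hx (s i))
    exact abs_le.1 this
  refine (measure_mono hsub).trans ?_
  rw [volume_pi_pi]
  simp only [volume_Icc, sub_neg_eq_add, ← two_mul]
  rw [← ENNReal.ofReal_prod_of_nonneg fun i _ => by positivity, prod_mul_distrib]
  simp [sdim, prod_pow_eq_pow_sum]

/-- The integrable profile at scale `Λ` that bounds every edge of a spanning tree. -/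
def profile (s : ℕ^d) (ε Λ : ℝ) (h : ℝ^d) : ℝ :=
  snorm s h ^ (-(sdim s : ℝ)) * min ((snorm s h / Λ) ^ ε) ((snorm s h / Λ) ^ (-ε))

lemma profile_nonneg {ε Λ : ℝ} (hΛ : 0 < Λ) (h : ℝ^d) : 0 ≤ profile s ε Λ h := by
  have := snorm_nonneg (s := s) h
  unfold profile
  positivity

lemma sdeg_add_single (k : ℕ^d) (i : Fin d) : sdeg s (k + Pi.single i 1) = sdeg s k + s i := by
  simp [sdeg, mul_add, sum_add_distrib, Pi.single_apply]

lemma le_sdim (i : Fin d) : s i ≤ sdim s :=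
  single_le_sum (f := s) (fun _ _ => Nat.zero_le _) (mem_univ i)

lemma exists_eq_add_single {k : ℕ^d} {i : Fin d} (hi : k i ≠ 0) :
    ∃ k' : ℕ^d, k = k' + Pi.single i 1 := ⟨k - Pi.single i 1, by
  refine (tsub_add_cancel_of_le fun j => ?_).symm
  by_cases hj : j = i
  · subst hj; simp; omega
  · simp [hj]⟩

lemma exists_eq_add_single_of_sum {k : ℕ^d} {l : ℕ} (h : ∑ i, k i = l + 1) :
    ∃ (i : Fin d) (k' : ℕ^d), k = k' + Pi.single i 1 ∧ ∑ j, k' j = l := by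
  obtain ⟨i, hi⟩ : ∃ i, k i ≠ 0 := by by_contra! h0; simp [h0] at h
  obtain ⟨k', rfl⟩ := exists_eq_add_single hi
  exact ⟨i, k', rfl, by simpa [sum_add_distrib] using h⟩

lemma lt_snorm_subset {c : ℝ} (hc : 0 ≤ c) : {x : ℝ^d | c < snorm s x} ⊆ {0}ᶜ := fun x hx h0 => by
  rw [Set.mem_singleton_iff.1 h0, Set.mem_ofPred_eq, snorm_zero] at hx; linarith

lemma measurable_profile (ε Λ : ℝ) : Measurable (profile s ε Λ) := by
  have := (continuous_snorm (s := s)).measurable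
  unfold profile
  fun_prop

lemma summable_geometric_natAbs {q : ℝ} (h0 : 0 ≤ q) (h1 : q < 1) :
    Summable fun j : ℤ => q ^ j.natAbs := by
  refine Summable.of_nat_of_neg ?_ ?_ <;> simpa using summable_geometric_of_lt_one h0 h1

lemma lintegral_profile_le {ε : ℝ} (hε : 0 < ε) :
    ∃ C : ℝ≥0, ∀ Λ : ℝ, 0 < Λ → ∫⁻ h, ENNReal.ofReal (profile s ε Λ h) ≤ C := by
  set q : ℝ := 2 ^ (-ε) with hq
  have hq0 : 0 < q := by positivity
  have hq1 : q < 1 := rpow_lt_one_of_one_lt_of_neg (by norm_num) (by linarith)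
  have hsum := summable_geometric_natAbs hq0.le hq1
  set c : ℝ := 2 ^ d * 2 ^ sdim s * 2 ^ ε with hc
  have hc0 : 0 < c := by positivity
  refine ⟨(c * ∑' j : ℤ, q ^ j.natAbs).toNNReal, fun Λ hΛ => ?_⟩
  have key : ∀ h : ℝ^d, ENNReal.ofReal (profile s ε Λ h) ≤ ∑' j : ℤ, {x : ℝ^d | snorm s x ≤ 2 ^ (j +
    1) * Λ}.indicator (fun _ => ENNReal.ofReal ((2 ^ j * Λ) ^ (-(sdim s : ℝ)) * (2 ^ ε * q ^
    j.natAbs))) h := by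
    intro h; rcases eq_or_ne h 0 with rfl | hh
    · have : (-(sdim s : ℝ)) ≠ 0 := by
        have : (0 : ℝ) < sdim s := by exact_mod_cast hs.dim
        linarith
      simp [profile, snorm_zero, zero_rpow this]
    have hpos := snorm_pos hh
    obtain ⟨j, hj1, hj2⟩ := exists_mem_Ico_zpow (div_pos hpos hΛ) (one_lt_two)
    refine le_trans ?_ (ENNReal.le_tsum j)
    have hj1' : 2 ^ j * Λ ≤ snorm s h := (le_div_iff₀ hΛ).1 hj1
    have hj2' : snorm s h < 2 ^ (j + 1) * Λ := (div_lt_iff₀ hΛ).1 hj2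
    rw [Set.indicator_of_mem (by exact hj2'.le)]
    refine ENNReal.ofReal_le_ofReal (mul_le_mul ?_ ?_ (by positivity) (by positivity))
    · exact rpow_le_rpow_of_nonpos (by positivity) hj1' (by simp)
    · have hqj : ∀ m : ℕ, q ^ m = (2 : ℝ) ^ (-ε * m) := fun m => by
        rw [hq, ← rpow_natCast, ← rpow_mul (by norm_num)]
      rw [hqj, ← rpow_add (by norm_num)]; rcases le_total 0 j with hj | hj
      · refine (min_le_right _ _).trans ?_
        refine (rpow_le_rpow_of_nonpos (by positivity) hj1 (by linarith)).trans ?_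
        rw [← rpow_intCast, ← rpow_mul (by norm_num)]
        refine rpow_le_rpow_of_exponent_le (by norm_num) ?_
        have : ((j.natAbs : ℕ) : ℝ) = j := by rw [Nat.cast_natAbs, abs_of_nonneg hj]
        rw [this]; nlinarith
      · refine (min_le_left _ _).trans ?_
        refine (rpow_le_rpow (by positivity) hj2.le hε.le).trans ?_
        rw [← rpow_intCast, ← rpow_mul (by norm_num)]
        refine rpow_le_rpow_of_exponent_le (by norm_num) ?_
        have : ((j.natAbs : ℕ) : ℝ) = -j := by
          rw [Nat.cast_natAbs, abs_of_nonpos hj]; push_cast; rfl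
        rw [this]; push_cast; nlinarith
  have hmeas : ∀ r : ℝ, MeasurableSet {x : ℝ^d | snorm s x ≤ r} := fun r =>
    (isClosed_le continuous_snorm continuous_const).measurableSet
  calc ∫⁻ h, ENNReal.ofReal (profile s ε Λ h) ≤ _ := lintegral_mono key
    _ = ∑' j : ℤ, ENNReal.ofReal ((2 ^ j * Λ) ^ (-(sdim s : ℝ)) * (2 ^ ε * q ^ j.natAbs)) *
        volume {x : ℝ^d | snorm s x ≤ 2 ^ (j + 1) * Λ} := by
      rw [lintegral_tsum fun j => (measurable_const.indicator (hmeas _)).aemeasurable]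
      refine tsum_congr fun j => ?_; rw [lintegral_indicator (hmeas _), setLIntegral_const]
    _ ≤ ∑' j : ℤ, ENNReal.ofReal (c * q ^ j.natAbs) := by
      refine ENNReal.tsum_le_tsum fun j => ?_
      refine (mul_le_mul_right (volume_snorm_le (by positivity)) _).trans ?_
      rw [← ENNReal.ofReal_mul (by positivity)]; refine ENNReal.ofReal_le_ofReal (le_of_eq ?_)
      rw [rpow_neg (by positivity), rpow_natCast, zpow_add_one₀ (by norm_num), hc]; field_simp
      rw [mul_pow, mul_pow]
    _ = _ := by
      rw [← ENNReal.ofReal_tsum_of_nonneg (fun j => by positivity) (hsum.mul_left c), tsum_mul_left]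
      rfl

/-! ### Integrals over trees -/

lemma lintegral_tree {ι : Type*} [Fintype ι] [DecidableEq ι] {g : ℝ^d → ℝ≥0∞} (hg : Measurable g)
    (par : ι → Option ι) (rank : ι → ℕ) (hrank : ∀ i j, par i = some j → rank j < rank i) : ∫⁻ x : ι
    → ℝ^d, ∏ i, g (x i - (par i).elim 0 x) = (∫⁻ h, g h) ^ Fintype.card ι := by
  have hm : ∀ i, Measurable fun x : ι → ℝ^d => g (x i - (par i).elim 0 x) := by
    intro i; refine hg.comp ((measurable_pi_apply i).sub ?_)
    cases par i with
    | none => exact measurable_const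
    | some j => exact measurable_pi_apply j
  have key : ∀ n : ℕ, ∀ S : Finset ι, S.card = n → ∀ x : ι → ℝ^d, (∫⋯∫⁻_S, (fun x : ι → ℝ^d => ∏ i ∈
    S, g (x i - (par i).elim 0 x)) ∂(fun _ => (volume : Measure ℝ^d))) x = (∫⁻ h, g h) ^ n := by
    intro n
    induction n with
    | zero => intro S hS x; rw [card_eq_zero.1 hS]; simp
    | succ n ih =>
      intro S hS x; obtain ⟨i, hi, hmax⟩ := exists_max_image S rank (card_pos.1 (by omega))
      have hSi : S = insert i (S.erase i) := (insert_erase hi).symm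
      have hfun : (fun x : ι → ℝ^d => ∫⁻ y, ∏ j ∈ S, g (Function.update x i y j - (par j).elim 0
        (Function.update x i y))) = fun x => (∏ j ∈ S.erase i, g (x j - (par j).elim 0 x)) * ∫⁻ h, g
        h := by
        funext x
        have h1 : ∀ y : ℝ^d, ∏ j ∈ S, g (Function.update x i y j - (par j).elim 0 (Function.update x
          i y)) = (∏ j ∈ S.erase i, g (x j - (par j).elim 0 x)) * g (y - (par i).elim 0 x) := by
          intro y
          have hpar : ∀ j ∈ S, (par j).elim 0 (Function.update x i y) = (par j).elim 0 x := by
            intro j hj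
            cases hp : par j with
            | none => rfl
            | some l =>
              have : l ≠ i := by rintro rfl; exact absurd (hrank j l hp) (not_lt.2 (hmax j hj))
              simp [this]
          rw [← prod_erase_mul S _ hi]; congr 1
          · refine prod_congr rfl fun j hj => ?_
            rw [hpar j (mem_of_mem_erase hj), Function.update_of_ne (ne_of_mem_erase hj)]
          · rw [hpar i hi, Function.update_self]
        simp_rw [h1]
        have h2 : Measurable fun y : ℝ^d => g (y - (par i).elim 0 x) :=
          hg.comp (measurable_id.sub_const _)
        rw [lintegral_const_mul _ h2, lintegral_sub_right_eq_self g]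
      have hmS : Measurable fun x : ι → ℝ^d => ∏ j ∈ S, g (x j - (par j).elim 0 x) :=
        measurable_fun_prod _ fun j _ => hm j
      have hmE : Measurable fun x : ι → ℝ^d => ∏ j ∈ S.erase i, g (x j - (par j).elim 0 x) :=
        measurable_fun_prod _ fun j _ => hm j
      rw [lmarginal_erase' _ hmS hi, hfun]
      have := ih (S.erase i) (by rw [card_erase_of_mem hi, hS]; rfl) x; rw [lmarginal] at this ⊢
      have h3 : Measurable fun y : (j : ↥(S.erase i)) → ℝ^d => ∏ j ∈ S.erase i, g
        (Function.updateFinset x (S.erase i) y j - (par j).elim 0 (Function.updateFinset x (S.erase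
        i) y)) := hmE.comp measurable_updateFinset
      rw [lintegral_mul_const _ h3, this, pow_succ]
  have := key _ univ rfl 0
  rw [lmarginal_univ] at this
  exact this

/-! ### Minimal spanning trees and the associated ultrametric -/

lemma exists_spanning_order (D : V → V → ℝ) (r₀ : V) : ∃ (idx : V → ℕ) (par : V → V),
    Function.Injective idx ∧ idx r₀ = 0 ∧ (∀ v, idx v < Fintype.card V) ∧ (∀ v, v ≠ r₀ → idx (par v)
    < idx v) ∧ ∀ v, v ≠ r₀ → ∀ y z, idx y < idx v → idx v ≤ idx z → D (par v) v ≤ D y z := by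
  have key : ∀ m : ℕ, m + 1 ≤ Fintype.card V → ∃ (S : Finset V) (idx : V → ℕ) (par : V → V), r₀ ∈ S
    ∧ S.card = m + 1 ∧ Set.InjOn idx S ∧ idx r₀ = 0 ∧ (∀ v ∈ S, idx v ≤ m) ∧ ∀ v ∈ S, v ≠ r₀ → par v
    ∈ S ∧ idx (par v) < idx v ∧ ∀ y ∈ S, ∀ z, idx y < idx v → (z ∈ S → idx v ≤ idx z) → D (par v) v
    ≤ D y z := by
    intro m
    induction m with
    | zero =>
      intro _; refine ⟨{r₀}, fun _ => 0, id, by simp, by simp, by simp, rfl, by simp, ?_⟩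
      intro v hv hne; exact absurd (mem_singleton.1 hv) hne
    | succ m ih =>
      intro hm; obtain ⟨S, idx, par, hr, hc, hinj, h0, hle, hpar⟩ := ih (by omega)
      have hne : (S ×ˢ Sᶜ).Nonempty := by
        refine Nonempty.product ⟨r₀, hr⟩ ?_; rw [← card_pos, card_compl]; omega
      obtain ⟨⟨y₀, z₀⟩, hyz, hmin⟩ := exists_min_image (S ×ˢ Sᶜ) (fun q => D q.1 q.2) hne
      simp only [mem_product, mem_compl] at hyz hmin; obtain ⟨hy₀, hz₀⟩ := hyz
      have hS : ∀ v ∈ S, v ≠ z₀ := fun v hv h => hz₀ (h ▸ hv)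
      refine ⟨insert z₀ S, Function.update idx z₀ (m + 1), Function.update par z₀ y₀,
        mem_insert_of_mem hr, by rw [card_insert_of_notMem hz₀, hc], ?_, ?_, ?_, ?_⟩
      · intro v hv w hw hvw; simp only [coe_insert, Set.mem_insert_iff, mem_coe] at hv hw
        rcases hv with rfl | hv <;> rcases hw with rfl | hw
        · rfl
        · rw [Function.update_self, Function.update_of_ne (hS w hw)] at hvw; have := hle w hw; omega
        · rw [Function.update_self, Function.update_of_ne (hS v hv)] at hvw; have := hle v hv; omega
        · rw [Function.update_of_ne (hS w hw), Function.update_of_ne (hS v hv)] at hvw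
          exact hinj hv hw hvw
      · rw [Function.update_of_ne (hS r₀ hr), h0]
      · intro v hv; rcases mem_insert.1 hv with rfl | hv
        · simp
        · rw [Function.update_of_ne (hS v hv)]; have := hle v hv; omega
      · intro v hv hvr; rcases mem_insert.1 hv with rfl | hvS
        · rw [Function.update_self, Function.update_self, Function.update_of_ne (hS y₀ hy₀)]
          refine ⟨mem_insert_of_mem hy₀, by have := hle y₀ hy₀; omega, ?_⟩; intro y hy z hyv hz
          have hy' : y ∈ S := by
            rcases mem_insert.1 hy with rfl | h
            · simp at hyv
            · exact h
          have hz' : z ∉ S := by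
            intro h; have := hz (mem_insert_of_mem h); rw [Function.update_of_ne (hS z h)] at this
            have := hle z h; omega
          exact hmin (y, z) ⟨hy', hz'⟩
        · obtain ⟨h1, h2, h3⟩ := hpar v hvS hvr
          rw [Function.update_of_ne (hS v hvS), Function.update_of_ne (hS v hvS),
            Function.update_of_ne (hS _ h1)]
          refine ⟨mem_insert_of_mem h1, h2, ?_⟩; intro y hy z hyv hz
          have hy' : y ∈ S := by
            rcases mem_insert.1 hy with rfl | h
            · rw [Function.update_self] at hyv; have := hle v hvS; omega
            · exact h
          rw [Function.update_of_ne (hS y hy')] at hyv; refine h3 y hy' z hyv fun hzS => ?_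
          have := hz (mem_insert_of_mem hzS)
          rwa [Function.update_of_ne (hS z hzS)] at this
  have hpos : 0 < Fintype.card V := Fintype.card_pos_iff.2 ⟨r₀⟩
  obtain ⟨S, idx, par, -, hc, hinj, h0, hle, hpar⟩ := key (Fintype.card V - 1) (by omega)
  have hS : S = univ := by rw [← card_eq_iff_eq_univ]; omega
  subst hS
  refine ⟨idx, par, fun v w h => hinj (by simp) (by simp) h, h0, fun v => ?_, fun v hv =>
    (hpar v (mem_univ v) hv).2.1, fun v hv y z h1 h2 =>
    (hpar v (mem_univ v) hv).2.2 y (mem_univ _) z h1 fun _ => h2⟩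
  have := hle v (mem_univ v); omega

lemma exists_ultrametric (D : V → V → ℝ) (r₀ : V) (hself : ∀ v, D v v = 0) (hpos : ∀ v w, v ≠ w → 0
    < D v w) (hsymm : ∀ v w, D v w = D w v) (htri : ∀ u v w, D u w ≤ D u v + D v w) : ∃ (par : V →
    V) (idx : V → ℕ) (U : V → V → ℝ) (b : ℝ → V → V), (∀ v, v ≠ r₀ → idx (par v) < idx v) ∧ (∀ y z,
    y ≠ z → 0 < U y z ∧ U y z ≤ D y z ∧ D y z ≤ 2 * Fintype.card V * U y z) ∧ (∀ y z, U y z = U z y)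
    ∧ (∀ τ, 0 ≤ τ → ∀ y z, U y z ≤ τ ↔ b τ y = b τ z) ∧ ∀ τ, (univ.image (b τ)).card = 1 +
    (univ.filter fun v => v ≠ r₀ ∧ τ < D (par v) v).card := by
  obtain ⟨idx, par, hinj, h0, hcard, hpar, hmin⟩ := exists_spanning_order D r₀
  set ρ : V → ℝ := fun v => D (par v) v with hρ
  have hρpos : ∀ v, v ≠ r₀ → 0 < ρ v := fun v hv =>
    hpos _ _ fun h => by have := hpar v hv; rw [h] at this; omega
  have hcand : ∀ (τ : ℝ) (y : V), ((univ : Finset V).filter fun v =>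
      idx v ≤ idx y ∧ (v = r₀ ∨ τ < ρ v)).Nonempty := fun τ y => ⟨r₀, by simp [h0]⟩
  choose b hb using fun (τ : ℝ) (y : V) => exists_max_image _ idx (hcand τ y)
  simp only [mem_filter, mem_univ, true_and] at hb
  have hb1 : ∀ τ y, idx (b τ y) ≤ idx y := fun τ y => (hb τ y).1.1
  have hb2 : ∀ τ y, b τ y = r₀ ∨ τ < ρ (b τ y) := fun τ y => (hb τ y).1.2
  have hb3 : ∀ τ y v, idx v ≤ idx y → (v = r₀ ∨ τ < ρ v) → idx v ≤ idx (b τ y) :=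
    fun τ y v h1 h2 => (hb τ y).2 v ⟨h1, h2⟩
  have hne0 : ∀ v, 0 < idx v → v ≠ r₀ := fun v h e => by rw [e, h0] at h; omega
  have hfix : ∀ τ v, b τ v = v ↔ (v = r₀ ∨ τ < ρ v) := fun τ v =>
    ⟨fun h => h ▸ hb2 τ v, fun h => hinj (le_antisymm (hb1 τ v) (hb3 τ v v le_rfl h))⟩
  let btw : V → V → V → Prop := fun y z v =>
    min (idx y) (idx z) < idx v ∧ idx v ≤ max (idx y) (idx z)
  let U : V → V → ℝ := fun y z => (((univ.filter (btw y z)).sup fun v => (ρ v).toNNReal : ℝ≥0) : ℝ)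
  have hUle : ∀ τ, 0 ≤ τ → ∀ y z, U y z ≤ τ ↔ ∀ v, btw y z v → ρ v ≤ τ := by
    intro τ hτ y z
    lift τ to ℝ≥0 using hτ
    simp only [U, NNReal.coe_le_coe, Finset.sup_le_iff, mem_filter, mem_univ,
      true_and, toNNReal_le_iff_le_coe]
  have hUsymm : ∀ y z, U y z = U z y := by intro y z; simp only [U, btw, min_comm, max_comm]
  have hUb' : ∀ τ, 0 ≤ τ → ∀ y z, idx y ≤ idx z → (U y z ≤ τ ↔ b τ y = b τ z) := by
    intro τ hτ y z hyz; rw [hUle τ hτ]; simp only [btw, min_eq_left hyz, max_eq_right hyz]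
    constructor
    · intro h; refine hinj (le_antisymm (hb3 _ _ _ ((hb1 τ y).trans hyz) (hb2 τ y)) ?_)
      refine hb3 _ _ _ ?_ (hb2 τ z); by_contra! hlt; rcases hb2 τ z with h1 | h1
      · rw [h1, h0] at hlt; omega
      · exact absurd (h _ ⟨hlt, hb1 τ z⟩) (not_le.2 h1)
    · intro h v hv; by_contra! hlt; have := hb3 τ z v hv.2 (Or.inr hlt); rw [← h] at this
      have := hb1 τ y; omega
  have hUb : ∀ τ, 0 ≤ τ → ∀ y z, U y z ≤ τ ↔ b τ y = b τ z := by
    intro τ hτ y z; rcases le_total (idx y) (idx z) with h | h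
    · exact hUb' τ hτ y z h
    · rw [hUsymm, hUb' τ hτ z y h, eq_comm]
  have hchain : ∀ τ, 0 ≤ τ → ∀ n y, idx y = n → D y (b τ y) ≤ n * τ := by
    intro τ hτ n
    induction n using Nat.strong_induction_on with
    | _ n ih =>
      intro y hy
      by_cases hfy : b τ y = y
      · rw [hfy, hself]; positivity
      · have hn := (hfix τ y).not.1 hfy; push Not at hn; have hp := hpar y hn.1
        have hbp : b τ (par y) = b τ y := by
          refine hinj (le_antisymm (hb3 _ _ _ ((hb1 τ _).trans hp.le) (hb2 τ _)) ?_)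
          refine hb3 _ _ _ ?_ (hb2 τ y); by_contra! hlt; rcases hb2 τ y with h1 | h1
          · rw [h1, h0] at hlt; omega
          · have h2 := hmin _ (hne0 _ (lt_of_le_of_lt (Nat.zero_le _) hlt)) _ _ hlt (hb1 τ y)
            exact absurd (h1.trans_le (h2.trans hn.2)) (lt_irrefl _)
        have h1 := ih (idx (par y)) (by omega) (par y) rfl; rw [hbp] at h1
        have h2 : D y (par y) ≤ τ := by rw [hsymm]; exact hn.2
        have h3 : ((idx (par y) : ℕ) : ℝ) + 1 ≤ n := by exact_mod_cast (by omega : idx (par y) + 1 ≤ n)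
        calc D y (b τ y) ≤ _ := htri y (par y) _
          _ ≤ τ + idx (par y) * τ := add_le_add h2 h1
          _ = (idx (par y) + 1) * τ := by ring
          _ ≤ n * τ := mul_le_mul_of_nonneg_right h3 hτ
  have hUD : ∀ y z, y ≠ z → U y z ≤ D y z := by
    intro y z hyz; rw [hUle _ (hpos y z hyz).le]; intro v hv
    rcases le_total (idx y) (idx z) with h | h
    · simp only [btw, min_eq_left h, max_eq_right h] at hv
      exact hmin v (hne0 v (by omega)) y z hv.1 hv.2
    · simp only [btw, min_eq_right h, max_eq_left h] at hv; rw [hsymm]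
      exact hmin v (hne0 v (by omega)) z y hv.1 hv.2
  have hU0 : ∀ y z, 0 ≤ U y z := fun y z => NNReal.coe_nonneg _
  have hDU : ∀ y z, y ≠ z → D y z ≤ 2 * Fintype.card V * U y z := by
    intro y z _; have hb := (hUb _ (hU0 y z) y z).1 le_rfl; have h1 := hchain _ (hU0 y z) _ y rfl
    have h2 := hchain _ (hU0 y z) _ z rfl
    have h3 : (idx y : ℝ) ≤ Fintype.card V := by exact_mod_cast (hcard y).le
    have h4 : (idx z : ℝ) ≤ Fintype.card V := by exact_mod_cast (hcard z).le
    have h5 := htri y (b (U y z) y) z; rw [hb] at h1 h5; rw [hsymm] at h2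
    have h6 := mul_le_mul_of_nonneg_right h3 (hU0 y z)
    have h7 := mul_le_mul_of_nonneg_right h4 (hU0 y z); linarith
  refine ⟨par, idx, U, b, hpar, fun y z hyz => ⟨?_, hUD y z hyz, hDU y z hyz⟩, hUsymm, hUb, ?_⟩
  · refine lt_of_le_of_ne (hU0 y z) fun h => ?_; have := hDU y z hyz; rw [← h, mul_zero] at this
    exact absurd (hpos y z hyz) (not_lt.2 this)
  · intro τ
    have : univ.image (b τ) = insert r₀ (univ.filter fun v => v ≠ r₀ ∧ τ < ρ v) := by
      ext v; simp only [mem_image, mem_univ, true_and, mem_insert, mem_filter]; constructor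
      · rintro ⟨y, rfl⟩; rcases hb2 τ y with h | h
        · exact Or.inl h
        · by_cases h' : b τ y = r₀
          · exact Or.inl h'
          · exact Or.inr ⟨h', h⟩
      · intro h; refine ⟨v, (hfix τ v).2 ?_⟩; rcases h with h | h
        · exact Or.inl h
        · exact Or.inr h.2
    rw [this, card_insert_of_notMem (by simp), add_comm]

/-! ### Power counting over partitions -/

section Partitions

/-- Power counting in terms of the edges of the multigraph itself. The edges with `r < 0` come
with a gain `κ` that is effective when the two end points of the edge form a cluster. -/
structure EdgeCounting (σ : ℝ) (G : RGraph V E) (a κ : E → ℝ) (W : Finset V) : Prop where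
  a_nonneg : ∀ e, 0 ≤ a e
  gain_nonneg : ∀ e, 0 ≤ κ e
  root_mem : G.root ∈ W
  r_root : ∀ e, G.src e = G.root ∨ G.tgt e = G.root → G.r e = 0
  inner : ∀ U : Finset V, G.root ∉ U → 2 ≤ U.card → (∑ e, if G.src e ∈ U ∧ G.tgt e ∈ U then a e else
    0) - (∑ e, if G.r e < 0 ∧ U = {G.src e, G.tgt e} then κ e else 0) < ((U.card : ℝ) - 1) * σ
  inner_root : ∀ U : Finset V, G.root ∈ U → 2 ≤ U.card → (∑ e, if G.src e ∈ U ∧ G.tgt e ∈ U then a e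
    else 0) + (∑ e, if 0 < G.r e ∧ G.src e ∈ U ∧ G.tgt e ∉ U then a e + G.r e - 1 else 0) - (∑ e, if
    0 < G.r e ∧ G.src e ∉ U ∧ G.tgt e ∈ U then (G.r e : ℝ) else 0) < ((U.card : ℝ) - 1) * σ
  outer : ∀ U : Finset V, U.Nonempty → Disjoint U W → (U.card : ℝ) * σ < (∑ e, if G.src e ∈ U ∨
    G.tgt e ∈ U then a e else 0) - (∑ e, if 0 < G.r e ∧ G.src e ∉ U ∧ G.tgt e ∈ U then a e + G.r e -
    1 else 0) + (∑ e, if 0 < G.r e ∧ G.src e ∈ U ∧ G.tgt e ∉ U then (G.r e : ℝ) else 0)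

lemma sum_ite_eq_fiber {b : V → V} (src tgt : E → V) (f : E → ℝ) :
    (∑ e, if b (src e) = b (tgt e) then f e else 0) =
      ∑ t ∈ univ.image b, ∑ e, if b (src e) = t ∧ b (tgt e) = t then f e else 0 := by
  rw [sum_comm]
  refine sum_congr rfl fun e _ => ?_
  by_cases h : b (src e) = b (tgt e)
  · rw [if_pos h, sum_eq_single (b (src e))]
    · simp [h]
    · intro t _ ht; exact if_neg fun h' => ht h'.1.symm
    · intro h'; simp at h'
  · rw [if_neg h]; exact (sum_eq_zero fun t _ => if_neg fun h' => h (h'.1.trans h'.2.symm)).symm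

lemma sum_card_fiber_sub_one (b : V → V) (σ : ℝ) : ∑ t ∈ univ.image b, (((univ.filter fun v => b v =
    t).card : ℝ) - 1) * σ = ((Fintype.card V : ℝ) - (univ.image b).card) * σ := by
  rw [← sum_mul, sum_sub_distrib]
  congr 2
  · rw [← Nat.cast_sum]; congr 1; exact (card_eq_sum_card_image b univ).symm
  · simp

/-- The events at a fixed scale, for an edge with end points `y`, `z`: does the cluster of `y`
consist of `y` and `z` only? -/
def IsPair (b : V → V) (y z : V) : Prop := b y = b z ∧ ∀ v, b v = b y → v = y ∨ v = z

variable {σ : ℝ} {κ : E → ℝ} {W : Finset V}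

open scoped Classical in
/-- The degree of the clusters of a partition. -/
def lowDeg (G : RGraph V E) (a κ : E → ℝ) (b : V → V) : ℝ :=
  (∑ e, if b (G.src e) = b (G.tgt e) then a e else 0) + (∑ e, if 0 < G.r e ∧ b (G.src e) = b G.root
    ∧ b (G.tgt e) ≠ b G.root then a e + G.r e - 1 else 0) - (∑ e, if 0 < G.r e ∧ b (G.src e) ≠ b
    G.root ∧ b (G.tgt e) = b G.root then (G.r e : ℝ) else 0) - (∑ e, if G.r e < 0 ∧ IsPair b (G.src
    e) (G.tgt e) then κ e else 0)

open scoped Classical in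
/-- The degree of the quotient by a partition. -/
def highDeg (G : RGraph V E) (a κ : E → ℝ) (b : V → V) : ℝ :=
  (∑ e, if b (G.src e) ≠ b (G.tgt e) then a e else 0) - (∑ e, if 0 < G.r e ∧ b (G.src e) = b G.root
    ∧ b (G.tgt e) ≠ b G.root then a e + G.r e - 1 else 0) + (∑ e, if 0 < G.r e ∧ b (G.src e) ≠ b
    G.root ∧ b (G.tgt e) = b G.root then (G.r e : ℝ) else 0) + (∑ e, if G.r e < 0 ∧ IsPair b (G.src
    e) (G.tgt e) then κ e else 0)

open scoped Classical in
lemma sum_isPair_eq_fiber (hr : ∀ e, G.src e = G.root ∨ G.tgt e = G.root → G.r e = 0) (b : V → V) :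
    (∑ e, if G.r e < 0 ∧ IsPair b (G.src e) (G.tgt e) then κ e else 0) =
      ∑ t ∈ (univ.image b).erase (b G.root), ∑ e,
        if G.r e < 0 ∧ (univ.filter fun v => b v = t) = {G.src e, G.tgt e} then κ e else 0 := by
  rw [sum_comm]
  refine sum_congr rfl fun e _ => ?_
  have hiff : ∀ t, (univ.filter fun v => b v = t) = {G.src e, G.tgt e} ↔ (b (G.src e) = t ∧ IsPair b
    (G.src e) (G.tgt e)) := by
    intro t; constructor
    · intro h
      have h1 : b (G.src e) = t := by
        have : G.src e ∈ univ.filter fun v => b v = t := by rw [h]; simp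
        simpa using this
      have h2 : b (G.tgt e) = t := by
        have : G.tgt e ∈ univ.filter fun v => b v = t := by rw [h]; simp
        simpa using this
      refine ⟨h1, h1.trans h2.symm, fun v hv => ?_⟩
      have : v ∈ univ.filter fun v => b v = t := by simp [hv, h1]
      rw [h] at this; simpa using this
    · rintro ⟨h1, h2, h3⟩; ext v
      simp only [mem_filter, mem_univ, true_and, mem_insert, mem_singleton]; constructor
      · intro hv; exact h3 v (hv.trans h1.symm)
      · rintro (rfl | rfl)
        · exact h1
        · rw [← h2]; exact h1
  by_cases h : G.r e < 0 ∧ IsPair b (G.src e) (G.tgt e)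
  · rw [if_pos h, sum_eq_single (b (G.src e))]
    · rw [if_pos ⟨h.1, (hiff _).2 ⟨rfl, h.2⟩⟩]
    · intro t _ ht; exact if_neg fun h' => ht ((hiff t).1 h'.2).1.symm
    · intro h'; exfalso; refine h' (mem_erase.2 ⟨fun hb => ?_, by simp⟩)
      have := hr e ((h.2.2 G.root hb.symm).imp Eq.symm Eq.symm); omega
  · rw [if_neg h]
    refine (sum_eq_zero fun t _ => if_neg fun h' => h ⟨h'.1, ((hiff t).1 h'.2).2⟩).symm

open scoped Classical in
lemma EdgeCounting.fiber_le (h : EdgeCounting σ G a κ W) (b : V → V) {t : V}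
    (ht : t ∈ (univ.image b).erase (b G.root)) :
    let U := univ.filter fun v => b v = t
    (∑ e, if b (G.src e) = t ∧ b (G.tgt e) = t then a e else 0)
      - (∑ e, if G.r e < 0 ∧ U = {G.src e, G.tgt e} then κ e else 0) ≤ ((U.card : ℝ) - 1) * σ ∧
    (2 ≤ U.card → (∑ e, if b (G.src e) = t ∧ b (G.tgt e) = t then a e else 0)
      - (∑ e, if G.r e < 0 ∧ U = {G.src e, G.tgt e} then κ e else 0) < ((U.card : ℝ) - 1) * σ) := by
  intro U
  have hU : ∀ v, v ∈ U ↔ b v = t := fun v => by simp [U]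
  obtain ⟨ht0, ht1⟩ := mem_erase.1 ht
  have hroot : G.root ∉ U := fun h' => ht0 ((hU _).1 h').symm
  have hstrict : 2 ≤ U.card → (∑ e, if b (G.src e) = t ∧ b (G.tgt e) = t then a e else 0) - (∑ e, if
    G.r e < 0 ∧ U = {G.src e, G.tgt e} then κ e else 0) < ((U.card : ℝ) - 1) * σ := by
    intro hc; have := h.inner U hroot hc; simpa only [hU] using this
  refine ⟨?_, hstrict⟩
  rcases le_or_gt 2 U.card with hc | hc
  · exact (hstrict hc).le
  · obtain ⟨v, -, hv⟩ := mem_image.1 ht1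
    have hc1 : U.card = 1 := by have : 0 < U.card := card_pos.2 ⟨v, (hU v).2 hv⟩; omega
    obtain ⟨w, hw⟩ := card_eq_one.1 hc1
    have h1 : (∑ e, if b (G.src e) = t ∧ b (G.tgt e) = t then a e else 0) = 0 := by
      refine sum_eq_zero fun e _ => if_neg fun h' => G.no_loop e ?_; have h1 := (hU _).2 h'.1
      have h2 := (hU _).2 h'.2; rw [hw, mem_singleton] at h1 h2; rw [h1, h2]
    have h2 : 0 ≤ ∑ e, if G.r e < 0 ∧ U = {G.src e, G.tgt e} then κ e else 0 :=
      sum_nonneg fun e _ => by split_ifs <;> [exact h.gain_nonneg e; rfl]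
    rw [hc1, h1]; simp; linarith

lemma EdgeCounting.lowDeg_lt (h : EdgeCounting σ G a κ W) (b : V → V) : lowDeg G a κ b ≤
    ((Fintype.card V : ℝ) - (univ.image b).card) * σ ∧ ((univ.image b).card < Fintype.card V →
    lowDeg G a κ b < ((Fintype.card V : ℝ) - (univ.image b).card) * σ) := by
  classical
  set im := univ.image b with him
  have h0 : b G.root ∈ im := by simp [im]
  set U₀ := univ.filter fun v => b v = b G.root with hU₀
  have hU : ∀ v, v ∈ U₀ ↔ b v = b G.root := fun v => by simp [U₀]
  have hroot : G.root ∈ U₀ := by simp [U₀]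
  set X₀ : ℝ := (∑ e, if b (G.src e) = b G.root ∧ b (G.tgt e) = b G.root then a e else 0)
    + (∑ e, if 0 < G.r e ∧ b (G.src e) = b G.root ∧ b (G.tgt e) ≠ b G.root then a e + G.r e - 1 else
      0)
    - (∑ e, if 0 < G.r e ∧ b (G.src e) ≠ b G.root ∧ b (G.tgt e) = b G.root
        then (G.r e : ℝ) else 0) with hX₀
  set X : V → ℝ := fun t => (∑ e, if b (G.src e) = t ∧ b (G.tgt e) = t then a e else 0)
      - (∑ e, if G.r e < 0 ∧ (univ.filter fun v => b v = t) = {G.src e, G.tgt e}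
          then κ e else 0) with hX
  have hlow : lowDeg G a κ b = X₀ + ∑ t ∈ im.erase (b G.root), X t := by
    unfold lowDeg
    rw [sum_ite_eq_fiber, sum_isPair_eq_fiber h.r_root, ← him, hX, sum_sub_distrib,
      ← add_sum_erase _ _ h0]
    ring
  have hstrict₀ : 2 ≤ U₀.card → X₀ < ((U₀.card : ℝ) - 1) * σ := by
    intro hc; have := h.inner_root U₀ hroot hc; simpa only [hU, hX₀] using this
  have hle₀ : X₀ ≤ ((U₀.card : ℝ) - 1) * σ := by
    rcases le_or_gt 2 U₀.card with hc | hc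
    · exact (hstrict₀ hc).le
    · have hc1 : U₀.card = 1 := by have : 0 < U₀.card := card_pos.2 ⟨_, hroot⟩; omega
      have hw : ∀ v, b v = b G.root → v = G.root := by
        intro v hv; obtain ⟨w, hw⟩ := card_eq_one.1 hc1; have h1 := (hU v).2 hv; have h2 := hroot
        rw [hw, mem_singleton] at h1 h2; rw [h1, h2]
      have h1 : (∑ e, if b (G.src e) = b G.root ∧ b (G.tgt e) = b G.root then a e else 0) = 0 :=
        sum_eq_zero fun e _ => if_neg fun h' => G.no_loop e ((hw _ h'.1).trans (hw _ h'.2).symm)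
      have h2 : (∑ e, if 0 < G.r e ∧ b (G.src e) = b G.root ∧ b (G.tgt e) ≠ b G.root
        then a e + G.r e - 1 else 0) = 0 :=
        sum_eq_zero fun e _ => if_neg fun h' => by have := h.r_root e (Or.inl (hw _ h'.2.1)); omega
      have h3 : (∑ e, if 0 < G.r e ∧ b (G.src e) ≠ b G.root ∧ b (G.tgt e) = b G.root
        then (G.r e : ℝ) else 0) = 0 :=
        sum_eq_zero fun e _ => if_neg fun h' => by have := h.r_root e (Or.inr (hw _ h'.2.2)); omega
      rw [hX₀, h1, h2, h3, hc1]; simp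
  have hcard := sum_card_fiber_sub_one b σ
  rw [← him, ← add_sum_erase _ _ h0] at hcard
  rw [← hcard, hlow]
  refine ⟨add_le_add hle₀ (sum_le_sum fun t ht => (h.fiber_le b ht).1), fun hlt => ?_⟩
  have : ∃ t ∈ im, 1 < (univ.filter fun v => b v = t).card := by
    have := exists_lt_card_fiber_of_mul_lt_card_of_maps_to
      (f := b) (s := univ) (t := im) (n := 1) (fun v _ => by simp [im])
      (by simpa using hlt)
    exact this
  obtain ⟨t, ht, hc⟩ := this
  by_cases ht0 : t = b G.root
  · subst ht0
    exact add_lt_add_of_lt_of_le (hstrict₀ hc) (sum_le_sum fun t ht => (h.fiber_le b ht).1)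
  · have ht' : t ∈ im.erase (b G.root) := mem_erase.2 ⟨ht0, ht⟩
    exact add_lt_add_of_le_of_lt hle₀ (sum_lt_sum
      (fun t ht => (h.fiber_le b ht).1) ⟨t, ht', (h.fiber_le b ht').2 hc⟩)

lemma EdgeCounting.lt_highDeg (h : EdgeCounting σ G a κ W) (b : V → V) (hW : ∀ w ∈ W, b w = b
    G.root) : (((univ.image b).card : ℝ) - 1) * σ ≤ highDeg G a κ b ∧ (1 < (univ.image b).card →
    (((univ.image b).card : ℝ) - 1) * σ < highDeg G a κ b) := by
  classical
  set im := univ.image b with him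
  have h0 : b G.root ∈ im := by simp [im]
  set U := univ.filter fun v => b v ≠ b G.root with hU
  have hmem : ∀ v, v ∈ U ↔ b v ≠ b G.root := fun v => by simp [U]
  set X : V → ℝ := fun t => (∑ e, if b (G.src e) = t ∧ b (G.tgt e) = t then a e else 0)
      - (∑ e, if G.r e < 0 ∧ (univ.filter fun v => b v = t) = {G.src e, G.tgt e}
          then κ e else 0) with hX
  set Y : ℝ := (∑ e, if G.src e ∈ U ∨ G.tgt e ∈ U then a e else 0)
      - (∑ e, if 0 < G.r e ∧ G.src e ∉ U ∧ G.tgt e ∈ U then a e + G.r e - 1 else 0)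
      + (∑ e, if 0 < G.r e ∧ G.src e ∈ U ∧ G.tgt e ∉ U then (G.r e : ℝ) else 0) with hY
  have hsplit : (∑ e, if b (G.src e) ≠ b (G.tgt e) then a e else 0) = (∑ e, if G.src e ∈ U ∨ G.tgt e
    ∈ U then a e else 0) - ∑ t ∈ im.erase (b G.root), ∑ e, if b (G.src e) = t ∧ b (G.tgt e) = t then
    a e else 0 := by
    have h1 := sum_ite_eq_fiber (b := b) G.src G.tgt a; rw [← him, ← add_sum_erase _ _ h0] at h1
    rw [← sub_eq_iff_eq_add'.2 h1, ← sum_sub_distrib, ← sum_sub_distrib]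
    refine sum_congr rfl fun e _ => ?_; simp only [hmem]
    by_cases h2 : b (G.src e) = b G.root <;> by_cases h3 : b (G.tgt e) = b G.root <;>
      by_cases h4 : b (G.src e) = b (G.tgt e) <;> simp_all
  have hhigh : highDeg G a κ b = Y - ∑ t ∈ im.erase (b G.root), X t := by
    unfold highDeg; rw [hsplit, sum_isPair_eq_fiber h.r_root, ← him, hX, sum_sub_distrib, hY]
    simp only [hmem, not_not]; ring
  have hsum : ∑ t ∈ im.erase (b G.root), X t ≤ (U.card : ℝ) * σ - ((im.card : ℝ) - 1) * σ := by
    refine (sum_le_sum fun t ht => (h.fiber_le b ht).1).trans (le_of_eq ?_)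
    have hcard := sum_card_fiber_sub_one b σ; rw [← him, ← add_sum_erase _ _ h0] at hcard
    have hc : (univ.filter fun v => b v = b G.root).card + U.card = Fintype.card V :=
      card_filter_add_card_filter_not (s := univ) (fun v => b v = b G.root)
    have hc' : ((univ.filter fun v => b v = b G.root).card : ℝ) + U.card =
        Fintype.card V := by exact_mod_cast hc
    rw [← hc'] at hcard
    linear_combination hcard
  have hdisj : Disjoint U W := disjoint_left.2 fun v hv hw => (hmem v).1 hv (hW v hw)
  rcases U.eq_empty_or_nonempty with hUe | hUn
  · have hall : ∀ v, b v = b G.root := fun v => by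
      by_contra hv; have := (hmem v).2 hv; simp [hUe] at this
    have him1 : im.card = 1 := by
      rw [card_eq_one]; refine ⟨b G.root, ?_⟩; ext t
      simp only [im, mem_image, mem_univ, true_and, mem_singleton]
      exact ⟨fun ⟨v, hv⟩ => hv ▸ hall v, fun ht => ⟨G.root, ht.symm⟩⟩
    have : 0 ≤ highDeg G a κ b := by
      unfold highDeg
      simp only [hall, ne_eq, not_true_eq_false, and_false, if_false, sum_const_zero,
        sub_zero, zero_add]
      simp only [if_false, sum_const_zero, zero_add, false_and, and_false]
      exact sum_nonneg fun e _ => by split_ifs <;> [exact h.gain_nonneg e; rfl]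
    rw [him1]; exact ⟨by simpa using this, fun h' => absurd h' (lt_irrefl 1)⟩
  · have := h.outer U hUn hdisj; rw [← hY] at this
    have hlt : ((im.card : ℝ) - 1) * σ < highDeg G a κ b := by rw [hhigh]; linarith
    exact ⟨hlt.le, fun _ => hlt⟩

/-- Strictness of finitely many inequalities leaves room for a small `ε`. -/
lemma EdgeCounting.exists_gap (h : EdgeCounting σ G a κ W) : ∃ ε : ℝ, 0 < ε ∧ (∀ b : V → V, lowDeg G
    a κ b ≤ ((Fintype.card V : ℝ) - (univ.image b).card) * (σ - ε)) ∧ ∀ b : V → V, (∀ w ∈ W, b w = b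
    G.root) → (((univ.image b).card : ℝ) - 1) * (σ + ε) ≤ highDeg G a κ b := by
  have hev : ∀ᶠ ε : ℝ in nhdsWithin 0 (Set.Ioi 0), (∀ b : V → V, lowDeg G a κ b ≤
      ((Fintype.card V : ℝ) - (univ.image b).card) * (σ - ε)) ∧
    ∀ b : V → V, (∀ w ∈ W, b w = b G.root) →
      (((univ.image b).card : ℝ) - 1) * (σ + ε) ≤ highDeg G a κ b := by
    refine Filter.Eventually.and ?_ ?_
    · refine Filter.eventually_all.2 fun b => ?_; obtain ⟨h1, h2⟩ := h.lowDeg_lt b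
      rcases lt_or_ge (univ.image b).card (Fintype.card V) with hc | hc
      · refine Filter.Eventually.filter_mono nhdsWithin_le_nhds ?_
        have hcont : Continuous fun ε : ℝ =>
          ((Fintype.card V : ℝ) - (univ.image b).card) * (σ - ε) := by fun_prop
        have := (hcont.tendsto 0).eventually_const_lt (u := lowDeg G a κ b) (by simpa using h2 hc)
        exact this.mono fun _ h => h.le
      · have hc' : (univ.image b).card = Fintype.card V := le_antisymm (card_le_univ _) hc
        rw [hc'] at h1 ⊢; exact Filter.Eventually.of_forall fun ε => by simpa using h1
    · refine Filter.eventually_all.2 fun b => ?_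
      by_cases hW : ∀ w ∈ W, b w = b G.root
      · obtain ⟨h1, h2⟩ := h.lt_highDeg b hW; rcases lt_or_ge 1 (univ.image b).card with hc | hc
        · refine Filter.Eventually.filter_mono nhdsWithin_le_nhds ?_
          have hcont : Continuous fun ε : ℝ =>
            (((univ.image b).card : ℝ) - 1) * (σ + ε) := by fun_prop
          have := (hcont.tendsto 0).eventually_lt_const (u := highDeg G a κ b)
            (by simpa using h2 hc)
          exact this.mono fun _ h _ => h.le
        · have hc' : (univ.image b).card = 1 := le_antisymm hc (card_pos.2 ⟨b G.root, by simp⟩)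
          rw [hc'] at h1 ⊢; exact Filter.Eventually.of_forall fun ε _ => by simpa using h1
      · exact Filter.Eventually.of_forall fun ε h => absurd h hW
  obtain ⟨ε, hε, hpos⟩ := (hev.and self_mem_nhdsWithin).exists
  exact ⟨ε, hpos, hε.1, hε.2⟩

end Partitions

/-! ### Layer cake -/

lemma integral_ite_lt {y T : ℝ} (h0 : 0 ≤ T) (hT : y ≤ T) :
    ∫ t in (0 : ℝ)..T, (if t < y then (1 : ℝ) else 0) = max y 0 := by
  have : (fun t : ℝ => if t < y then (1 : ℝ) else 0) = (Set.Iio y).indicator fun _ => (1 : ℝ) := by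
    funext t; simp [Set.indicator, Set.mem_Iio]
  rw [this, intervalIntegral.integral_of_le h0, setIntegral_indicator measurableSet_Iio]
  have h2 : Set.Ioc 0 T ∩ Set.Iio y = Set.Ioo 0 y := by
    ext t; simp only [Set.mem_inter_iff, Set.mem_Ioc, Set.mem_Iio, Set.mem_Ioo]; constructor
    · rintro ⟨⟨h1, _⟩, h3⟩; exact ⟨h1, h3⟩
    · rintro ⟨h1, h3⟩; exact ⟨⟨h1, by linarith⟩, h3⟩
  rw [h2]
  simp

lemma integral_ite_le_neg {y T : ℝ} (h0 : 0 ≤ T) (hT : -y ≤ T) :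
    ∫ t in (0 : ℝ)..T, (if y ≤ -t then (1 : ℝ) else 0) = max (-y) 0 := by
  have : (fun t : ℝ => if y ≤ -t then (1 : ℝ) else 0) =
      (Set.Iic (-y)).indicator fun _ => (1 : ℝ) := by
    funext t; simp [Set.indicator, Set.mem_Iic, le_neg]
  rw [this, intervalIntegral.integral_of_le h0, setIntegral_indicator measurableSet_Iic]
  have h2 : Set.Ioc 0 T ∩ Set.Iic (-y) = Set.Ioc 0 (-y) := by
    ext t; simp only [Set.mem_inter_iff, Set.mem_Ioc, Set.mem_Iic]; constructor
    · rintro ⟨⟨h1, _⟩, h3⟩; exact ⟨h1, h3⟩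
    · rintro ⟨h1, h3⟩; exact ⟨⟨h1, by linarith⟩, h3⟩
  rw [h2]
  simp

lemma intervalIntegrable_ite_lt (y A B : ℝ) :
    IntervalIntegrable (fun t : ℝ => if t < y then (1 : ℝ) else 0) volume A B := by
  refine AntitoneOn.intervalIntegrable fun u _ v _ huv => ?_
  split_ifs with h1 h2 <;> first | exact absurd (huv.trans_lt h1) h2 | norm_num

lemma intervalIntegrable_ite_le_neg (y A B : ℝ) :
    IntervalIntegrable (fun t : ℝ => if y ≤ -t then (1 : ℝ) else 0) volume A B := by
  refine AntitoneOn.intervalIntegrable fun u _ v _ huv => ?_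
  split_ifs with h1 h2 <;> first | exact absurd (h1.trans (neg_le_neg huv)) h2 | norm_num

lemma intervalIntegrable_fun_sum {ι : Type*} [Fintype ι] {f : ι → ℝ → ℝ} {A B : ℝ} (h : ∀ i,
    IntervalIntegrable (f i) volume A B) : IntervalIntegrable (fun t => ∑ i, f i t) volume A B := by
  have := IntervalIntegrable.sum univ fun i (_ : i ∈ univ) => h i
  rwa [sum_fn] at this

/-- An inequality between linear combinations of levels follows from the corresponding
inequalities at all thresholds. -/
lemma layer_cake {ι κ : Type*} [Fintype ι] [Fintype κ] (c y : ι → ℝ) (z : κ → ℝ) (σ ε : ℝ)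
    (hhigh : ∀ t, 0 < t → ∑ k, (σ + ε) * (if t < z k then 1 else 0) ≤
      ∑ i, c i * (if t < y i then 1 else 0))
    (hlow : ∀ t, 0 < t → ∑ i, c i * (if y i ≤ -t then 1 else 0) ≤
      ∑ k, (σ - ε) * (if z k ≤ -t then 1 else 0)) :
    ∑ k, (σ * z k + ε * |z k|) ≤ ∑ i, c i * y i := by
  set T : ℝ := ∑ i, |y i| + ∑ k, |z k| with hT
  have hT0 : 0 ≤ T := by positivity
  have hy : ∀ i, |y i| ≤ T := fun i =>
    (single_le_sum (f := fun i => |y i|) (fun _ _ => abs_nonneg _)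
      (mem_univ i)).trans (le_add_of_nonneg_right (by positivity))
  have hz : ∀ k, |z k| ≤ T := fun k =>
    (single_le_sum (f := fun i => |z i|) (fun _ _ => abs_nonneg _)
      (mem_univ k)).trans (le_add_of_nonneg_left (by positivity))
  have h1 : ∑ k, (σ + ε) * max (z k) 0 ≤ ∑ i, c i * max (y i) 0 := by
    have := intervalIntegral.integral_mono_on_of_le_Ioo (a := 0) (b := T) (μ := volume) hT0
      (f := fun t => ∑ k, (σ + ε) * (if t < z k then (1 : ℝ) else 0))
      (g := fun t => ∑ i, c i * (if t < y i then (1 : ℝ) else 0))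
      (intervalIntegrable_fun_sum fun k => (intervalIntegrable_ite_lt _ _ _).const_mul _)
      (intervalIntegrable_fun_sum fun k => (intervalIntegrable_ite_lt _ _ _).const_mul _)
      (fun t ht => hhigh t ht.1)
    rw [intervalIntegral.integral_finsetSum fun k _ => (intervalIntegrable_ite_lt _ _ _).const_mul _,
      intervalIntegral.integral_finsetSum fun k _ =>
        (intervalIntegrable_ite_lt _ _ _).const_mul _] at this
    simp only [intervalIntegral.integral_const_mul] at this
    simpa only [integral_ite_lt hT0 ((le_abs_self _).trans (hz _)),
      integral_ite_lt hT0 ((le_abs_self _).trans (hy _))] using this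
  have h2 : ∑ i, c i * max (-y i) 0 ≤ ∑ k, (σ - ε) * max (-z k) 0 := by
    have := intervalIntegral.integral_mono_on_of_le_Ioo (a := 0) (b := T) (μ := volume) hT0
      (f := fun t => ∑ i, c i * (if y i ≤ -t then (1 : ℝ) else 0))
      (g := fun t => ∑ k, (σ - ε) * (if z k ≤ -t then (1 : ℝ) else 0))
      (intervalIntegrable_fun_sum fun k => (intervalIntegrable_ite_le_neg _ _ _).const_mul _)
      (intervalIntegrable_fun_sum fun k => (intervalIntegrable_ite_le_neg _ _ _).const_mul _)
      (fun t ht => hlow t ht.1)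
    rw [intervalIntegral.integral_finsetSum fun k _ =>
        (intervalIntegrable_ite_le_neg _ _ _).const_mul _,
      intervalIntegral.integral_finsetSum fun k _ =>
        (intervalIntegrable_ite_le_neg _ _ _).const_mul _] at this
    simp only [intervalIntegral.integral_const_mul] at this
    simpa only [integral_ite_le_neg hT0 ((neg_le_abs _).trans (hz _)),
      integral_ite_le_neg hT0 ((neg_le_abs _).trans (hy _))] using this
  have hd : ∀ r : ℝ, r = max r 0 - max (-r) 0 := fun r => by
    rcases le_total 0 r with h | h
    · rw [max_eq_left h, max_eq_right (by linarith)]; ring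
    · rw [max_eq_right h, max_eq_left (by linarith)]; ring
  have ha : ∀ r : ℝ, |r| = max r 0 + max (-r) 0 := fun r => by
    rcases le_total 0 r with h | h
    · rw [max_eq_left h, max_eq_right (by linarith), abs_of_nonneg h]; ring
    · rw [max_eq_right h, max_eq_left (by linarith), abs_of_nonpos h]; ring
  calc ∑ k, (σ * z k + ε * |z k|)
      = ∑ k, (σ + ε) * max (z k) 0 - ∑ k, (σ - ε) * max (-z k) 0 := by
        rw [← sum_sub_distrib]; refine sum_congr rfl fun k _ => ?_
        have h1 := hd (z k); have h2 := ha (z k); rw [h2]; nth_rewrite 1 [h1]; ring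
    _ ≤ ∑ i, c i * max (y i) 0 - ∑ i, c i * max (-y i) 0 := by linarith
    _ = ∑ i, c i * y i := by
        rw [← sum_sub_distrib]; refine sum_congr rfl fun i _ => ?_
        nth_rewrite 3 [hd (y i)]; ring

/-! ### The power-counting weight of a configuration -/

/-- The distance from `y` to the nearest point other than `y` and `z`. -/
def nearDist (q : V → V → ℝ) (y z : V) : ℝ := ⨅ v : {v : V // v ≠ y ∧ v ≠ z}, q y v

/-- The power-counting weight of an edge in a configuration with distances `q`. -/
def edgeWeight (G : RGraph V E) (a κ : E → ℝ) (q : V → V → ℝ) (e : E) : ℝ :=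
  q (G.src e) (G.tgt e) ^ (-a e)
  * (if 0 < G.r e then (q G.root (G.tgt e) / max (q G.root (G.src e)) (q G.root (G.tgt e))) ^ (G.r e
    : ℝ) * (max (q G.root (G.src e)) (q G.root (G.tgt e)) / q G.root (G.src e)) ^ (a e + G.r e - 1)
    else 1)
  * (if G.r e < 0 then (q (G.src e) (G.tgt e) / max (q (G.src e) (G.tgt e)) (nearDist q (G.src e)
    (G.tgt e))) ^ κ e else 1)

lemma nearDist_le (q : V → V → ℝ) {y z v : V} (h1 : v ≠ y) (h2 : v ≠ z) : nearDist q y z ≤ q y v :=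
  ciInf_le (Set.finite_range fun v : {v : V // v ≠ y ∧ v ≠ z} => q y v).bddBelow ⟨v, h1, h2⟩

lemma exists_nearDist (q : V → V → ℝ) {y z r₀ : V} (h1 : r₀ ≠ y) (h2 : r₀ ≠ z) :
    ∃ v, v ≠ y ∧ v ≠ z ∧ nearDist q y z = q y v := by
  have : Nonempty {v : V // v ≠ y ∧ v ≠ z} := ⟨⟨r₀, h1, h2⟩⟩
  obtain ⟨v, hv⟩ := exists_eq_ciInf_of_finite (f := fun v : {v : V // v ≠ y ∧ v ≠ z} => q y v)
  exact ⟨v, v.2.1, v.2.2, hv.symm⟩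

lemma rpow_le_const_mul {c x y p : ℝ} (hc : 0 ≤ c) (hx : 0 ≤ x) (hy : 0 ≤ y) (h : x ≤ c * y)
    (hp : 0 ≤ p) : x ^ p ≤ c ^ p * y ^ p :=
  (rpow_le_rpow hx h hp).trans (by rw [mul_rpow hc hy])

lemma div_max_le {c x x' y y' : ℝ} (hc : 1 ≤ c) (hx : 0 < x) (hx' : 0 < x') (h1 : x ≤ c * x')
    (h2 : x' ≤ c * x) (h3 : y' ≤ c * y) : x / max x y ≤ c ^ 2 * (x' / max x' y') := by
  have hm : 0 < max x y := lt_max_of_lt_left hx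
  have hm' : 0 < max x' y' := lt_max_of_lt_left hx'
  have : max x' y' ≤ c * max x y := max_le
    (h2.trans (mul_le_mul_of_nonneg_left (le_max_left _ _) (by linarith)))
    (h3.trans (mul_le_mul_of_nonneg_left (le_max_right _ _) (by linarith)))
  rw [div_le_iff₀ hm, mul_div_assoc', div_mul_eq_mul_div, le_div_iff₀ hm']
  calc x * max x' y' ≤ (c * x') * (c * max x y) :=
        mul_le_mul h1 this hm'.le (by positivity)
    _ = _ := by ring

lemma root_ne_ends {e : E} (hr : G.src e = G.root ∨ G.tgt e = G.root → G.r e = 0) (h : G.r e ≠ 0) :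
    G.root ≠ G.src e ∧ G.root ≠ G.tgt e :=
  ⟨fun h' => h (hr (Or.inl h'.symm)), fun h' => h (hr (Or.inr h'.symm))⟩

lemma edgeWeight_le_of_comparable (G : RGraph V E) (a κ : E → ℝ) (ha : ∀ e, 0 ≤ a e) (hκ : ∀ e, 0 ≤
    κ e) (hr : ∀ e, G.src e = G.root ∨ G.tgt e = G.root → G.r e = 0) {c : ℝ} (hc : 1 ≤ c) (q q' : V
    → V → ℝ) (hq : ∀ y z, y ≠ z → 0 < q y z) (hq' : ∀ y z, y ≠ z → 0 < q' y z) (h1 : ∀ y z, y ≠ z →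
    q y z ≤ c * q' y z) (h2 : ∀ y z, y ≠ z → q' y z ≤ c * q y z) (e : E) : 0 < edgeWeight G a κ q e
    ∧ edgeWeight G a κ q e ≤ (c ^ a e * ((c ^ 2) ^ |(G.r e : ℝ)| * (c ^ 2) ^ (a e + |(G.r e : ℝ)|))
    * (c ^ 2) ^ κ e) * edgeWeight G a κ q' e := by
  have hst := G.no_loop e
  have hroot := root_ne_ends (hr e)
  have hc0 : 0 ≤ c := by linarith
  have hc2 : 1 ≤ c ^ 2 := one_le_pow₀ hc
  have hp := hq _ _ hst
  have hp' := hq' _ _ hst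
  have hA : q (G.src e) (G.tgt e) ^ (-a e) ≤ c ^ a e * q' (G.src e) (G.tgt e) ^ (-a e) := by
    rw [rpow_neg hp.le, rpow_neg hp'.le, ← div_eq_mul_inv, ← one_div,
      div_le_div_iff₀ (by positivity) (by positivity), one_mul]
    exact rpow_le_const_mul hc0 hp'.le hp.le (h2 _ _ hst) (ha e)
  have hB : ∃ B B' : ℝ, 0 < B ∧ 0 < B' ∧ (if 0 < G.r e then (q G.root (G.tgt e) / max (q G.root
    (G.src e)) (q G.root (G.tgt e))) ^ (G.r e : ℝ) * (max (q G.root (G.src e)) (q G.root (G.tgt e))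
    / q G.root (G.src e)) ^ (a e + G.r e - 1) else 1) = B ∧ (if 0 < G.r e then (q' G.root (G.tgt e)
    / max (q' G.root (G.src e)) (q' G.root (G.tgt e))) ^ (G.r e : ℝ) * (max (q' G.root (G.src e))
    (q' G.root (G.tgt e)) / q' G.root (G.src e)) ^ (a e + G.r e - 1) else 1) = B' ∧ B ≤ ((c ^ 2) ^
    |(G.r e : ℝ)| * (c ^ 2) ^ (a e + |(G.r e : ℝ)|)) * B' := by
    refine ⟨_, _, ?_, ?_, rfl, rfl, ?_⟩ <;> split_ifs with hre
    · obtain ⟨hs, ht⟩ := hroot hre.ne'; have hs := hq _ _ hs; have ht := hq _ _ ht; positivity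
    · norm_num
    · obtain ⟨hs, ht⟩ := hroot hre.ne'; have hs := hq' _ _ hs; have ht := hq' _ _ ht; positivity
    · norm_num
    · obtain ⟨hs, ht⟩ := hroot hre.ne'; have hr1 : (1 : ℝ) ≤ G.r e := by exact_mod_cast hre
      have hS := hq _ _ hs; have hT := hq _ _ ht; have hS' := hq' _ _ hs; have hT' := hq' _ _ ht
      rw [abs_of_nonneg (by linarith), mul_mul_mul_comm]
      refine mul_le_mul ?_ ?_ (by positivity) (by positivity)
      · refine rpow_le_const_mul (by positivity) (by positivity) (by positivity) ?_ (by linarith)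
        rw [max_comm (q _ _), max_comm (q' _ _)]
        exact div_max_le hc hT hT' (h1 _ _ ht) (h2 _ _ ht) (h2 _ _ hs)
      · refine (rpow_le_const_mul (c := c ^ 2) (by positivity) (by positivity) (by positivity)
          (?_ : _ ≤ c ^ 2 * (max (q' G.root (G.src e)) (q' G.root (G.tgt e)) /
            q' G.root (G.src e))) (by linarith [ha e])).trans ?_
        · have := div_max_le hc hS' hS (h2 _ _ hs) (h1 _ _ hs) (h1 _ _ ht)
          have hi := one_div_le_one_div_of_le (by positivity) this
          rw [one_div_div, one_div, mul_inv, inv_div] at hi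
          rw [mul_comm, ← div_le_iff₀ (by positivity), div_eq_inv_mul]; exact hi
        · refine mul_le_mul_of_nonneg_right ?_ (by positivity)
          exact rpow_le_rpow_of_exponent_le hc2 (by linarith)
    · have h1 : 1 ≤ (c ^ 2) ^ |(G.r e : ℝ)| := one_le_rpow hc2 (abs_nonneg _)
      have h2 : 1 ≤ (c ^ 2) ^ (a e + |(G.r e : ℝ)|) :=
        one_le_rpow hc2 (add_nonneg (ha e) (abs_nonneg _))
      nlinarith
  have hC : ∃ B B' : ℝ, 0 < B ∧ 0 < B' ∧ (if G.r e < 0 then (q (G.src e) (G.tgt e) / max (q (G.src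
    e) (G.tgt e)) (nearDist q (G.src e) (G.tgt e))) ^ κ e else 1) = B ∧ (if G.r e < 0 then (q'
    (G.src e) (G.tgt e) / max (q' (G.src e) (G.tgt e)) (nearDist q' (G.src e) (G.tgt e))) ^ κ e else
    1) = B' ∧ B ≤ (c ^ 2) ^ κ e * B' := by
    refine ⟨_, _, ?_, ?_, rfl, rfl, ?_⟩ <;> split_ifs with hre
    · have := lt_max_of_lt_left (c := nearDist q (G.src e) (G.tgt e)) hp; positivity
    · norm_num
    · have := lt_max_of_lt_left (c := nearDist q' (G.src e) (G.tgt e)) hp'; positivity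
    · norm_num
    · obtain ⟨hs, ht⟩ := hroot hre.ne
      have hm := lt_max_of_lt_left (c := nearDist q (G.src e) (G.tgt e)) hp
      have hm' := lt_max_of_lt_left (c := nearDist q' (G.src e) (G.tgt e)) hp'
      refine rpow_le_const_mul (by positivity) (by positivity) (by positivity) ?_ (hκ e)
      refine div_max_le hc hp hp' (h1 _ _ hst) (h2 _ _ hst) ?_
      obtain ⟨v, hv1, hv2, hv⟩ := exists_nearDist q hs ht; rw [hv]
      exact (nearDist_le q' hv1 hv2).trans (h2 _ _ hv1.symm)
    · rw [mul_one]; exact one_le_rpow hc2 (hκ e)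
  obtain ⟨B, B', hB0, hB0', hB1, hB2, hB3⟩ := hB
  obtain ⟨D, D', hD0, hD0', hD1, hD2, hD3⟩ := hC
  unfold edgeWeight
  rw [hB1, hB2, hD1, hD2]
  refine ⟨by positivity, ?_⟩
  calc _ ≤ (c ^ a e * q' (G.src e) (G.tgt e) ^ (-a e)) *
        (((c ^ 2) ^ |(G.r e : ℝ)| * (c ^ 2) ^ (a e + |(G.r e : ℝ)|)) * B') *
        ((c ^ 2) ^ κ e * D') := by gcongr
    _ = _ := by ring

/-- The power-counting weight of a configuration. -/
def weight (G : RGraph V E) (a κ : E → ℝ) (q : V → V → ℝ) : ℝ := ∏ e, edgeWeight G a κ q e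

lemma exists_weight_le (G : RGraph V E) (a κ : E → ℝ) (ha : ∀ e, 0 ≤ a e)
    (hκ : ∀ e, 0 ≤ κ e) (hr : ∀ e, G.src e = G.root ∨ G.tgt e = G.root → G.r e = 0)
    {c : ℝ} (hc : 1 ≤ c) : ∃ C : ℝ, 0 < C ∧ ∀ q q' : V → V → ℝ, (∀ y z, y ≠ z → 0 < q y z) →
    (∀ y z, y ≠ z → 0 < q' y z) → (∀ y z, y ≠ z → q y z ≤ c * q' y z) →
    (∀ y z, y ≠ z → q' y z ≤ c * q y z) →
    0 < weight G a κ q ∧ weight G a κ q ≤ C * weight G a κ q' := by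
  refine ⟨∏ e, (c ^ a e * ((c ^ 2) ^ |(G.r e : ℝ)| * (c ^ 2) ^ (a e + |(G.r e : ℝ)|)) *
    (c ^ 2) ^ κ e), prod_pos fun e _ => by positivity, fun q q' hq hq' h1 h2 => ?_⟩
  have := edgeWeight_le_of_comparable G a κ ha hκ hr hc q q' hq hq' h1 h2
  refine ⟨prod_pos fun e _ => (this e).1, ?_⟩
  unfold weight
  rw [← prod_mul_distrib]
  exact prod_le_prod (fun e _ => (this e).1.le) fun e _ => (this e).2

/-! ### The power-counting theorem -/

section PowerCount

variable {σ : ℝ} {κ : E → ℝ} {W : Finset V}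

/-- The coefficients of the logarithm of `edgeWeight`. -/
def formCoef (G : RGraph V E) (a κ : E → ℝ) (e : E) : Fin 5 → ℝ :=
  ![a e - (if G.r e < 0 then κ e else 0), if 0 < G.r e then a e + G.r e - 1 else 0, if 0 < G.r e
    then -(G.r e : ℝ) else 0, if 0 < G.r e then (G.r e : ℝ) - (a e + G.r e - 1) else 0, if G.r e < 0
    then κ e else 0]

/-- The lengths whose logarithms enter the logarithm of `edgeWeight`. -/
def formVal (G : RGraph V E) (q : V → V → ℝ) (e : E) : Fin 5 → ℝ :=
  ![q (G.src e) (G.tgt e), q G.root (G.src e), q G.root (G.tgt e), max (q G.root (G.src e)) (q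
    G.root (G.tgt e)), max (q (G.src e) (G.tgt e)) (nearDist q (G.src e) (G.tgt e))]

lemma formVal_pos (hr : ∀ e, G.src e = G.root ∨ G.tgt e = G.root → G.r e = 0)
    {q : V → V → ℝ} (hq : ∀ y z, y ≠ z → 0 < q y z) {e : E} {i : Fin 5}
    (hi : formCoef G a κ e i ≠ 0) : 0 < formVal G q e i := by
  have hroot := root_ne_ends (hr e)
  have h0 := hq _ _ (G.no_loop e)
  fin_cases i <;> simp only [formCoef, formVal, Fin.zero_eta, Fin.mk_one, Fin.reduceFinMk,
    Matrix.cons_val] at hi ⊢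
  · exact h0
  · have : 0 < G.r e := by by_contra h; simp [h] at hi
    exact hq _ _ (hroot this.ne').1
  · have : 0 < G.r e := by by_contra h; simp [h] at hi
    exact hq _ _ (hroot this.ne').2
  · have : 0 < G.r e := by by_contra h; simp [h] at hi
    exact lt_max_of_lt_left (hq _ _ (hroot this.ne').1)
  · exact lt_max_of_lt_left h0

lemma log_edgeWeight (hr : ∀ e, G.src e = G.root ∨ G.tgt e = G.root → G.r e = 0) {q : V → V → ℝ} (hq
    : ∀ y z, y ≠ z → 0 < q y z) {Λ : ℝ} (hΛ : 0 < Λ) (e : E) : edgeWeight G a κ q e = Λ ^ (-a e) *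
    exp (-∑ i, formCoef G a κ e i * log (formVal G q e i / Λ)) := by
  have hroot := root_ne_ends (hr e)
  have h0 := hq _ _ (G.no_loop e)
  have hm := lt_max_of_lt_left (c := nearDist q (G.src e) (G.tgt e)) h0
  have hl0 : log (q (G.src e) (G.tgt e) / Λ) = _ := log_div h0.ne' hΛ.ne'
  have hl5 : log (max (q (G.src e) (G.tgt e)) (nearDist q (G.src e) (G.tgt e)) / Λ) = _ :=
    log_div hm.ne' hΛ.ne'
  have hA : Λ ^ (-a e) = exp (log Λ * -a e) := rpow_def_of_pos hΛ _
  unfold edgeWeight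
  rw [Fin.sum_univ_five]
  simp only [formCoef, formVal, Matrix.cons_val]
  rw [hA, ← exp_add, hl0, hl5, rpow_def_of_pos h0]
  rcases lt_trichotomy (G.r e) 0 with h | h | h
  · have h1 : ¬ 0 < G.r e := by omega
    simp only [h, h1, if_true, if_false, mul_one]
    rw [rpow_def_of_pos (by positivity), ← exp_add, log_div h0.ne' hm.ne']; congr 1; ring
  · simp only [h, lt_irrefl, if_false, mul_one]; congr 1; ring
  · have h1 : ¬ G.r e < 0 := by omega
    obtain ⟨hs, ht⟩ := hroot h.ne'; have hs := hq _ _ hs; have ht := hq _ _ ht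
    have hM := lt_max_of_lt_left (c := q G.root (G.tgt e)) hs
    simp only [h, h1, if_true, if_false, mul_one]
    rw [log_div hs.ne' hΛ.ne', log_div ht.ne' hΛ.ne', log_div hM.ne' hΛ.ne',
      rpow_def_of_pos (by positivity), rpow_def_of_pos (by positivity),
      log_div ht.ne' hM.ne', log_div hM.ne' hs.ne', ← exp_add, ← exp_add]
    congr 1; ring

variable {U : V → V → ℝ} {b : V → V} {τ : ℝ}

lemma isPair_iff (hr : ∀ e, G.src e = G.root ∨ G.tgt e = G.root → G.r e = 0) (hb : ∀ y z, U y z ≤ τ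
    ↔ b y = b z) {e : E} (he : G.r e ≠ 0) : IsPair b (G.src e) (G.tgt e) ↔ U (G.src e) (G.tgt e) ≤ τ
    ∧ τ < max (U (G.src e) (G.tgt e)) (nearDist U (G.src e) (G.tgt e)) := by
  have hs : G.root ≠ G.src e := fun h' => he (hr e (Or.inl h'.symm))
  have ht : G.root ≠ G.tgt e := fun h' => he (hr e (Or.inr h'.symm))
  unfold IsPair
  rw [← hb]
  refine and_congr_right fun h => ?_
  constructor
  · intro h1; obtain ⟨v, hv1, hv2, hv⟩ := exists_nearDist U hs ht; refine lt_max_of_lt_right ?_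
    rw [hv]; by_contra! h2; rcases h1 v ((hb _ _).1 h2).symm with h3 | h3
    · exact hv1 h3
    · exact hv2 h3
  · intro h1 v hv; by_contra! h2; rcases lt_max_iff.1 h1 with h3 | h3
    · exact absurd h (not_le.2 h3)
    · exact absurd ((hb _ _).2 hv.symm) (not_le.2 (h3.trans_le (nearDist_le U h2.1 h2.2)))

lemma sum_form_eq_highDeg (hr : ∀ e, G.src e = G.root ∨ G.tgt e = G.root → G.r e = 0)
    (hb : ∀ y z, U y z ≤ τ ↔ b y = b z) :
    ∑ e, ∑ i, formCoef G a κ e i * (if τ < formVal G U e i then 1 else 0) = highDeg G a κ b := by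
  classical
  unfold highDeg
  rw [← sum_sub_distrib, ← sum_add_distrib, ← sum_add_distrib]
  refine sum_congr rfl fun e _ => ?_
  rw [Fin.sum_univ_five]
  simp only [formCoef, formVal, Matrix.cons_val]
  have h0 : τ < U (G.src e) (G.tgt e) ↔ b (G.src e) ≠ b (G.tgt e) := by rw [← not_le, hb]
  have hs : τ < U G.root (G.src e) ↔ b (G.src e) ≠ b G.root := by rw [← not_le, hb, eq_comm]
  have ht : τ < U G.root (G.tgt e) ↔ b (G.tgt e) ≠ b G.root := by rw [← not_le, hb, eq_comm]
  rcases lt_trichotomy (G.r e) 0 with h | h | h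
  · have h1 : ¬ 0 < G.r e := by omega
    have hp := isPair_iff hr hb (e := e) h.ne
    simp only [h, h1, if_true, if_false, true_and, false_and, hp, zero_mul, ← h0]
    by_cases h2 : τ < U (G.src e) (G.tgt e)
    · simp [h2]
    · simp [not_lt.1 h2, h2]
  · simp [h, h0]
  · have h1 : ¬ G.r e < 0 := by omega
    simp only [h, h1, if_true, if_false, true_and, false_and, lt_max_iff, h0, hs, ht]
    by_cases h2 : b (G.src e) = b G.root <;> by_cases h3 : b (G.tgt e) = b G.root <;>
      simp [h2, h3] <;> ring

lemma sum_form_eq_lowDeg (hr : ∀ e, G.src e = G.root ∨ G.tgt e = G.root → G.r e = 0)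
    (hb : ∀ y z, U y z ≤ τ ↔ b y = b z) :
    ∑ e, ∑ i, formCoef G a κ e i * (if formVal G U e i ≤ τ then 1 else 0) = lowDeg G a κ b := by
  classical
  unfold lowDeg
  rw [← sum_add_distrib, ← sum_sub_distrib, ← sum_sub_distrib]
  refine sum_congr rfl fun e _ => ?_
  rw [Fin.sum_univ_five]
  simp only [formCoef, formVal, Matrix.cons_val]
  have h0 : U (G.src e) (G.tgt e) ≤ τ ↔ b (G.src e) = b (G.tgt e) := by rw [hb]
  have hs : U G.root (G.src e) ≤ τ ↔ b (G.src e) = b G.root := by rw [hb, eq_comm]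
  have ht : U G.root (G.tgt e) ≤ τ ↔ b (G.tgt e) = b G.root := by rw [hb, eq_comm]
  rcases lt_trichotomy (G.r e) 0 with h | h | h
  · have h1 : ¬ 0 < G.r e := by omega
    have hp := isPair_iff hr hb (e := e) h.ne
    simp only [h, h1, if_true, if_false, true_and, false_and, hp, zero_mul, ← h0]
    by_cases h2 : U (G.src e) (G.tgt e) ≤ τ
    · simp only [h2, max_le_iff, true_and, if_true, lt_max_iff, not_lt.2 h2, false_or]
      by_cases h3 : nearDist U (G.src e) (G.tgt e) ≤ τ
      · simp [h3, not_lt.2 h3]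
      · simp [h3, not_le.1 h3]
    · simp [h2]
  · simp [h, h0]
  · have h1 : ¬ G.r e < 0 := by omega
    simp only [h, h1, if_true, if_false, true_and, false_and, max_le_iff, h0, hs, ht]
    by_cases h2 : b (G.src e) = b G.root <;> by_cases h3 : b (G.tgt e) = b G.root <;>
      (simp [h2, h3]; try ring)

/-- Parent functions of rooted spanning trees. -/
def IsTreeFun (r₀ : V) (par : V → V) : Prop := ∃ idx : V → ℕ, ∀ v, v ≠ r₀ → idx (par v) < idx v

/-- Power counting for a single configuration. -/
lemma EdgeCounting.exists_tree (h : EdgeCounting σ G a κ W) : ∃ ε : ℝ, 0 < ε ∧ ∃ C : ℝ, 0 < C ∧ ∀ (Λ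
    : ℝ), 0 < Λ → ∀ D : V → V → ℝ, (∀ v, D v v = 0) → (∀ v w, v ≠ w → 0 < D v w) → (∀ v w, D v w = D
    w v) → (∀ u v w, D u w ≤ D u v + D v w) → (∀ w ∈ W, D G.root w ≤ Λ) → ∃ par : V → V, IsTreeFun
    G.root par ∧ weight G a κ D ≤ C * Λ ^ (-∑ e, a e) * ∏ v : 𝕍 G, exp (-(σ * log (D (par v) v / Λ)
    + ε * |log (D (par v) v / Λ)|)) := by
  obtain ⟨ε, hε, hlow, hhigh⟩ := h.exists_gap
  have hcard : (1 : ℝ) ≤ Fintype.card V := by exact_mod_cast Fintype.card_pos_iff.2 ⟨G.root⟩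
  obtain ⟨C, hC, hcomp⟩ := exists_weight_le G a κ h.a_nonneg h.gain_nonneg h.r_root
    (c := 2 * Fintype.card V) (by linarith)
  refine ⟨ε, hε, C, hC, fun Λ hΛ D hself hpos hsymm htri hW => ?_⟩
  obtain ⟨par, idx, U, b, hidx, hU, hUs, hb, himg⟩ := exists_ultrametric D G.root hself hpos hsymm htri
  refine ⟨par, ⟨idx, hidx⟩, ?_⟩
  have hUpos : ∀ y z, y ≠ z → 0 < U y z := fun y z hyz => (hU y z hyz).1
  have h1 := (hcomp D U hpos hUpos (fun y z hyz => (hU y z hyz).2.2) (fun y z hyz => by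
    have := (hU y z hyz).2.1; have := hpos y z hyz; nlinarith)).2
  refine h1.trans ?_
  rw [mul_assoc]
  refine mul_le_mul_of_nonneg_left ?_ hC.le
  have hthr : ∀ {x : ℝ}, 0 < x → ∀ t, t < log (x / Λ) ↔ Λ * exp t < x := by
    intro x hx t; rw [lt_log_iff_exp_lt (by positivity), lt_div_iff₀ hΛ, mul_comm]
  have hthr' : ∀ {x : ℝ}, 0 < x → ∀ t, log (x / Λ) ≤ t ↔ x ≤ Λ * exp t := by
    intro x hx t; rw [log_le_iff_le_exp (by positivity), div_le_iff₀ hΛ, mul_comm]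
  have hρ : ∀ v : 𝕍 G, 0 < D (par v) v := fun v =>
    hpos _ _ fun h' => by have := hidx v v.2; rw [h'] at this; omega
  have hcount : ∀ t : ℝ, (∑ v : 𝕍 G, if Λ * exp t < D (par v) v then (1 : ℝ) else 0) = ((univ.image
    (b (Λ * exp t))).card : ℝ) - 1 := by
    intro t; rw [himg, sum_boole]; push_cast; rw [add_sub_cancel_left]
    congr 1; rw [← card_map (Function.Embedding.subtype _)]; congr 1; ext v
    simp only [Finset.mem_map, mem_filter, mem_univ, true_and, Function.Embedding.coe_subtype,
      Subtype.exists, exists_and_left, exists_prop, exists_eq_right_right]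
    exact and_comm
  have hlayer := layer_cake (ι := E × Fin 5) (κ := 𝕍 G) (fun p => formCoef G a κ p.1 p.2) (fun p =>
    log (formVal G U p.1 p.2 / Λ)) (fun v => log (D (par v) v / Λ)) σ ε ?_ ?_
  · rw [Fintype.sum_prod_type] at hlayer; unfold weight
    rw [prod_congr rfl fun e _ => log_edgeWeight h.r_root hUpos hΛ e, prod_mul_distrib, ← exp_sum, ←
      exp_sum, ← sum_neg_distrib, rpow_sum_of_pos hΛ]
    refine mul_le_mul_of_nonneg_left ?_ (prod_nonneg fun e _ => by positivity)
    rw [exp_le_exp, sum_neg_distrib, sum_neg_distrib]; exact neg_le_neg hlayer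
  · intro t ht; rw [Fintype.sum_prod_type]; have hτ : 0 ≤ Λ * exp t := by positivity
    have := hhigh (b (Λ * exp t)) fun w hw => by
      by_cases hwr : w = G.root
      · rw [hwr]
      · refine ((hb _ hτ _ _).1 ?_)
        refine ((hU _ _ hwr).2.1.trans ((hsymm _ _).le.trans (hW w hw))).trans ?_
        nlinarith [add_one_le_exp t]
    rw [← sum_form_eq_highDeg h.r_root (hb _ hτ), ← hcount] at this; rw [← mul_sum, mul_comm]
    simp only [hthr (hρ _)]; refine this.trans (le_of_eq ?_)
    refine sum_congr rfl fun e _ => sum_congr rfl fun i _ => ?_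
    by_cases hi : formCoef G a κ e i = 0
    · rw [hi, zero_mul, zero_mul]
    · simp only [hthr (formVal_pos h.r_root hUpos hi)]
  · intro t ht; rw [Fintype.sum_prod_type]; have hτ : 0 ≤ Λ * exp (-t) := by positivity
    have := hlow (b (Λ * exp (-t))); rw [← sum_form_eq_lowDeg h.r_root (hb _ hτ)] at this
    have hcount' : (∑ v : 𝕍 G, if D (par v) v ≤ Λ * exp (-t)
      then (1 : ℝ) else 0) = (Fintype.card V : ℝ) - (univ.image (b (Λ * exp (-t)))).card := by
      have h2 := hcount (-t)
      have h3 : (∑ v : 𝕍 G, if D (par v) v ≤ Λ * exp (-t) then (1 : ℝ) else 0) + (∑ v : 𝕍 G, if Λ *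
        exp (-t) < D (par v) v then (1 : ℝ) else 0) = (Fintype.card V : ℝ) - 1 := by
        rw [← sum_add_distrib]
        have : ∀ v : 𝕍 G, ((if D (par v) v ≤ Λ * exp (-t)
          then (1 : ℝ) else 0) + if Λ * exp (-t) < D (par v) v then (1 : ℝ) else 0) = 1 := by
          intro v
          by_cases hv : D (par v) v ≤ Λ * exp (-t)
          · simp [hv, not_lt.2 hv]
          · simp [hv, not_le.1 hv]
        simp only [this, sum_const, nsmul_eq_mul, mul_one, card_univ]
        rw [Fintype.card_subtype_compl, Fintype.card_subtype_eq, Nat.cast_sub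
          (Fintype.card_pos_iff.2 ⟨G.root⟩)]
        simp
      linarith
    rw [← mul_sum, mul_comm (σ - ε)]; simp only [hthr' (hρ _)]; rw [hcount']
    refine le_trans (le_of_eq ?_) this; refine sum_congr rfl fun e _ => sum_congr rfl fun i _ => ?_
    by_cases hi : formCoef G a κ e i = 0
    · rw [hi, zero_mul, zero_mul]
    · simp only [hthr' (formVal_pos h.r_root hUpos hi)]

/-- The mutual distances of a configuration of points. -/
def dist' (s : ℕ^d) (x : V → ℝ^d) (v w : V) : ℝ := snorm s (x v - x w)

lemma exp_neg_log_eq_profile {ε Λ : ℝ} (hΛ : 0 < Λ) (hε : 0 < ε) {h : ℝ^d} (hh : 0 < snorm s h) :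
    exp (-((sdim s : ℝ) * log (snorm s h / Λ) + ε * |log (snorm s h / Λ)|)) =
      Λ ^ (sdim s : ℝ) * profile s ε Λ h := by
  have hq : 0 < snorm s h / Λ := by positivity
  have h1 : min ((snorm s h / Λ) ^ ε) ((snorm s h / Λ) ^ (-ε)) = exp (-(ε * |log (snorm s h / Λ)|))
    := by
    rw [rpow_def_of_pos hq, rpow_def_of_pos hq, ← exp_monotone.map_min]; congr 1
    rcases le_total 0 (log (snorm s h / Λ)) with h0 | h0
    · rw [abs_of_nonneg h0, min_eq_right (by nlinarith)]; ring
    · rw [abs_of_nonpos h0, min_eq_left (by nlinarith)]; ring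
  unfold profile
  rw [h1, neg_add, exp_add, ← mul_assoc]
  congr 1
  rw [log_div hh.ne' hΛ.ne', rpow_def_of_pos hΛ, rpow_def_of_pos hh, ← exp_add]
  congr 1; ring

lemma measurable_extend (v : V) : Measurable fun x : 𝕍 G → ℝ^d => G.extend x v := by
  unfold RGraph.extend
  split_ifs with h
  · exact measurable_const
  · exact measurable_pi_apply _

/-- Power counting for the integral over all configurations. -/
theorem EdgeCounting.lintegral_weight_le
    (h : EdgeCounting (sdim s : ℝ) G a κ W) : ∃ C : ℝ≥0, ∀ Λ : ℝ, 0 < Λ →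
    ∫⁻ x : 𝕍 G → ℝ^d,
      {x | Function.Injective (G.extend x) ∧ ∀ w ∈ W, snorm s (G.extend x w) ≤ Λ}.indicator
        (fun x => ENNReal.ofReal (weight G a κ (dist' s (G.extend x)))) x ≤
      C * ENNReal.ofReal (Λ ^ ((sdim s : ℝ) * Fintype.card 𝕍 G - ∑ e, a e)) := by
  classical
  obtain ⟨ε, hε, C, hC, hbound⟩ := h.exists_tree
  obtain ⟨B, hB⟩ := lintegral_profile_le (s := s) hε
  set T := univ.filter fun par : V → V => IsTreeFun G.root par with hT
  set n := Fintype.card 𝕍 G with hn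
  refine ⟨C.toNNReal * (T.card * B ^ n), fun Λ hΛ => ?_⟩
  have hroot : ∀ x : 𝕍 G → ℝ^d, G.extend x G.root = 0 := fun x => by simp [RGraph.extend]
  have hv : ∀ (x : 𝕍 G → ℝ^d) (v : 𝕍 G),
      G.extend x v = x v := fun x v => by simp [RGraph.extend, v.2]
  have hpt : ∀ x : 𝕍 G → ℝ^d, {x | Function.Injective (G.extend x) ∧ ∀ w ∈ W, snorm s (G.extend x w)
    ≤ Λ}.indicator (fun x => ENNReal.ofReal (weight G a κ (dist' s (G.extend x)))) x ≤
    ENNReal.ofReal (C * Λ ^ ((sdim s : ℝ) * n - ∑ e, a e)) * ∑ par ∈ T, ∏ v : 𝕍 G, ENNReal.ofReal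
    (profile s ε Λ (x v - G.extend x (par v))) := by
    intro x
    by_cases hx : x ∈ {x | Function.Injective (G.extend x) ∧ ∀ w ∈ W, snorm s (G.extend x w) ≤ Λ}
    swap
    · rw [Set.indicator_of_notMem hx]; exact zero_le
    rw [Set.indicator_of_mem hx]
    have hne : ∀ v w, v ≠ w → 0 < dist' s (G.extend x) v w := fun v w hvw =>
      snorm_pos (sub_ne_zero.2 fun h' => hvw (hx.1 h'))
    obtain ⟨par, hpar, hle⟩ := hbound Λ hΛ (dist' s (G.extend x))
      (fun v => by simp [dist', snorm_zero]) hne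
      (fun v w => snorm_sub_comm _ _) (fun u v w => snorm_tri _ _ _)
      (fun w hw => by unfold dist'; rw [hroot, zero_sub, snorm_neg]; exact hx.2 w hw)
    have hprod : ∏ v : 𝕍 G, exp (-((sdim s : ℝ) * log (dist' s (G.extend x) (par v) v / Λ) + ε *
      |log (dist' s (G.extend x) (par v) v / Λ)|)) = Λ ^ ((sdim s : ℝ) * n) * ∏ v : 𝕍 G, profile s ε
      Λ (x v - G.extend x (par v)) := by
      have : ∀ v : 𝕍 G, exp (-((sdim s : ℝ) * log (dist' s (G.extend x) (par v) v / Λ) + ε * |log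
        (dist' s (G.extend x) (par v) v / Λ)|)) = Λ ^ (sdim s : ℝ) * profile s ε Λ (x v - G.extend x
        (par v)) := by
        intro v
        have hpv : par v ≠ v := by
          obtain ⟨idx, hidx⟩ := hpar; intro h'; have := hidx v v.2; rw [h'] at this; omega
        have h1 : dist' s (G.extend x) (par v) v = snorm s (x v - G.extend x (par v)) := by
          unfold dist'; rw [snorm_sub_comm, hv]
        have h2 := hne _ _ hpv; rw [h1] at h2 ⊢; exact exp_neg_log_eq_profile hΛ hε h2
      rw [prod_congr rfl fun v _ => this v, prod_mul_distrib, prod_const,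
        card_univ, ← hn, ← rpow_natCast, ← rpow_mul hΛ.le]
    rw [hprod, mul_assoc C, ← mul_assoc (Λ ^ (-∑ e, a e)), ← rpow_add hΛ, ← mul_assoc,
      neg_add_eq_sub] at hle
    refine (ENNReal.ofReal_le_ofReal hle).trans ?_; rw [ENNReal.ofReal_mul (by positivity)]
    refine mul_le_mul_right ?_ _; rw [ENNReal.ofReal_prod_of_nonneg fun v _ => profile_nonneg hΛ _]
    exact single_le_sum (f := fun par : V → V => ∏ v : 𝕍 G,
      ENNReal.ofReal (profile s ε Λ (x v - G.extend x (par v)))) (fun _ _ => zero_le)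
      (by simp [T, hpar])
  have hm : ∀ par : V → V, Measurable fun x : 𝕍 G → ℝ^d => ∏ v : 𝕍 G, ENNReal.ofReal (profile s ε Λ
    (x v - G.extend x (par v))) := fun par =>
    measurable_fun_prod _ fun v _ => ENNReal.measurable_ofReal.comp
      ((measurable_profile ε Λ).comp ((measurable_pi_apply v).sub (measurable_extend _)))
  refine (lintegral_mono hpt).trans ?_
  rw [lintegral_const_mul _ (measurable_fun_sum _ fun par _ => hm par),
    lintegral_finsetSum _ fun par _ => hm par, ENNReal.ofReal_mul hC.le]
  have htree : ∀ par ∈ T, ∫⁻ x : 𝕍 G → ℝ^d, ∏ v : 𝕍 G, ENNReal.ofReal (profile s ε Λ (x v - G.extend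
    x (par v))) ≤ (B : ℝ≥0∞) ^ n := by
    intro par hpar; obtain ⟨idx, hidx⟩ := (mem_filter.1 hpar).2
    set par' : 𝕍 G → Option 𝕍 G := fun v =>
      if h : par v = G.root then none else some ⟨par v, h⟩ with hpar'
    have hext : ∀ (x : 𝕍 G → ℝ^d) (v : 𝕍 G), G.extend x (par v) = (par' v).elim 0 x := by
      intro x v
      by_cases hvr : par v = G.root
      · simp [par', RGraph.extend, hvr]
      · simp [par', RGraph.extend, hvr]
    simp_rw [hext]
    have := lintegral_tree (g := fun h => ENNReal.ofReal (profile s ε Λ h))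
      (ENNReal.measurable_ofReal.comp (measurable_profile ε Λ)) par' (fun v => idx v) (by
        intro i j hij
        by_cases hvr : par i = G.root
        · simp [par', hvr] at hij
        · simp only [par', hvr, dif_neg, not_false_eq_true, Option.some.injEq] at hij
          rw [← hij]; exact hidx i i.2)
    rw [this]; exact pow_le_pow_left₀ zero_le (hB Λ hΛ) n
  refine (mul_le_mul_right (sum_le_sum htree) _).trans (le_of_eq ?_)
  rw [sum_const, nsmul_eq_mul]
  push_cast
  rw [ENNReal.ofReal, ENNReal.ofReal]
  ring

end PowerCount

/-! ### From merged edges to edges -/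

section Merge

lemma sum_hatA (S : Finset (Sym2 V)) :
    ∑ c ∈ S, G.hatA a c = ∑ e, if G.ends e ∈ S then a e else 0 := by
  unfold RGraph.hatA
  rw [sum_fiberwise_eq_sum_filter, sum_filter]

lemma ends_mem_internal {U : Finset V} {e : E} :
    G.ends e ∈ G.internal U ↔ G.src e ∈ U ∧ G.tgt e ∈ U := by
  have h : G.ends e ∈ G.hatE := mem_image_of_mem _ (mem_univ _)
  simp [RGraph.internal, h]
  simp [RGraph.ends]

lemma ends_mem_incident {U : Finset V} {e : E} :
    G.ends e ∈ G.incident U ↔ G.src e ∈ U ∨ G.tgt e ∈ U := by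
  have h : G.ends e ∈ G.hatE := mem_image_of_mem _ (mem_univ _)
  simp [RGraph.incident, h]
  simp [RGraph.ends]

lemma sum_internal (U : Finset V) :
    ∑ c ∈ G.internal U, G.hatA a c = ∑ e, if G.src e ∈ U ∧ G.tgt e ∈ U then a e else 0 := by
  simp only [sum_hatA, ends_mem_internal]

lemma eq_of_pos_of_ends_eq {e e' : E} (h : 0 < G.r e) (h' : 0 < G.r e')
    (hee : G.ends e = G.ends e') : e = e' := by
  by_contra hne
  rcases (G.parallel e e' hne hee).2.2 with h1 | h1 <;> omega

lemma eq_of_neg_of_ends_eq {e e' : E} (h : G.r e < 0) (hee : G.ends e = G.ends e') : e = e' := by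
  by_contra hne
  have := (G.parallel e e' hne hee).1
  omega

lemma hatR_of_pos {e : E} (h : 0 < G.r e) : G.hatR (G.ends e) = G.r e := by
  unfold RGraph.hatR
  refine sum_eq_single e (fun e' he' hne => ?_) (fun h' => by simp at h')
  rcases (G.parallel e' e hne (mem_filter.1 he').2).2.2 with h1 | h1
  · exact h1
  · omega

lemma filter_ends_of_neg {e : E} (h : G.r e < 0) :
    (univ.filter fun e' => G.ends e' = G.ends e) = {e} := by
  ext e'
  simp only [mem_filter, mem_univ, true_and, mem_singleton]
  exact ⟨fun h' => (eq_of_neg_of_ends_eq h h'.symm).symm, fun h' => by rw [h']⟩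

lemma hatA_of_neg {e : E} (h : G.r e < 0) : G.hatA a (G.ends e) = a e := by
  unfold RGraph.hatA; rw [filter_ends_of_neg h, sum_singleton]

lemma hatR_of_neg {e : E} (h : G.r e < 0) : G.hatR (G.ends e) = G.r e := by
  unfold RGraph.hatR; rw [filter_ends_of_neg h, sum_singleton]

lemma hatR_nonneg {c : Sym2 V} (h : ∀ e, G.ends e = c → 0 ≤ G.r e) : 0 ≤ G.hatR c :=
  sum_nonneg fun e he => h e (mem_filter.1 he).2

lemma le_hatA (ha : ∀ e, 0 ≤ a e) (e : E) : a e ≤ G.hatA a (G.ends e) :=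
  single_le_sum (f := a) (fun e _ => ha e) (by simp)

lemma sum_image_ends (P : E → Prop) [DecidablePred P] (hP : ∀ e, P e → 0 < G.r e)
    (f : Sym2 V → ℝ) : ∑ c ∈ (univ.filter P).image G.ends, f c =
      ∑ e, if P e then f (G.ends e) else 0 := by
  rw [sum_image, sum_filter]
  intro e he e' he' hee
  simp only [coe_filter, mem_univ, true_and, Set.mem_ofPred_eq] at he he'
  exact eq_of_pos_of_ends_eq (hP e he) (hP e' he') hee

variable {d : ℕ} {s : ℕ^d}

lemma star_ne_root (G : RGraph V E) (i : Fin G.M) : G.tgt (G.star i) ≠ G.root := by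
  rw [← G.star_src i]; exact (G.no_loop _).symm

lemma sdim_pos (h : G.PowerCounting s a) : 0 < sdim s := by
  set e₀ := G.star ⟨0, G.M_pos⟩ with he₀
  have hr0 : G.r e₀ = 0 := G.star_r _
  have h1 := h.edge (G.ends e₀) (mem_image_of_mem _ (mem_univ _))
  have h2 : 0 ≤ G.hatR (G.ends e₀) := hatR_nonneg fun e he => by
    by_cases hee : e = e₀
    · rw [hee, hr0]
    · exact (G.parallel e e₀ hee he).1
  rw [min_eq_right h2] at h1
  have h3 : 0 ≤ G.hatA a (G.ends e₀) := (h.a_nonneg e₀).trans (le_hatA h.a_nonneg e₀)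
  have : (0 : ℝ) < sdim s := by push_cast at h1; linarith
  exact_mod_cast this

lemma sum_pair_eq_hatA {y z : V} :
    (∑ e, if G.src e ∈ ({y, z} : Finset V) ∧ G.tgt e ∈ ({y, z} : Finset V) then a e else 0) =
      G.hatA a s(y, z) := by
  unfold RGraph.hatA
  rw [sum_filter]
  refine sum_congr rfl fun e _ => ?_
  congr 1
  simp only [mem_insert, mem_singleton, RGraph.ends, Sym2.eq_iff, eq_iff_iff]
  have := G.no_loop e
  constructor
  · rintro ⟨h1 | h1, h2 | h2⟩
    · exact absurd (h1.trans h2.symm) this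
    · exact Or.inl ⟨h1, h2⟩
    · exact Or.inr ⟨h1, h2⟩
    · exact absurd (h1.trans h2.symm) this
  · rintro (⟨h1, h2⟩ | ⟨h1, h2⟩)
    · exact ⟨Or.inl h1, Or.inr h2⟩
    · exact ⟨Or.inr h1, Or.inl h2⟩

lemma hatA_lt_of_nonneg (h : G.PowerCounting s a) {c : Sym2 V}
    (hc : ∀ e, G.ends e = c → 0 ≤ G.r e) : G.hatA a c < sdim s := by
  by_cases hcE : c ∈ G.hatE
  · have h1 := h.edge c hcE; rw [min_eq_right (hatR_nonneg hc)] at h1; simpa using h1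
  · have : G.hatA a c = 0 := by
      unfold RGraph.hatA; refine sum_eq_zero fun e he => absurd ?_ hcE; rw [← (mem_filter.1 he).2]
      exact mem_image_of_mem _ (mem_univ _)
    rw [this]; exact_mod_cast sdim_pos h

lemma inner_root_of_powerCounting (h : G.PowerCounting s a) {U : Finset V} (hU : G.root ∈ U) (hc : 2
    ≤ U.card) : (∑ e, if G.src e ∈ U ∧ G.tgt e ∈ U then a e else 0) + (∑ e, if 0 < G.r e ∧ G.src e ∈
    U ∧ G.tgt e ∉ U then a e + G.r e - 1 else 0) - (∑ e, if 0 < G.r e ∧ G.src e ∉ U ∧ G.tgt e ∈ U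
    then (G.r e : ℝ) else 0) < ((U.card : ℝ) - 1) * sdim s := by
  have h1 := h.subgraph_root U hU hc
  unfold RGraph.outPos RGraph.inPos at h1
  rw [sum_internal, sum_image_ends _ (fun e he => he.1), sum_image_ends _ (fun e he => he.1)] at h1
  refine lt_of_le_of_lt ?_ h1
  refine sub_le_sub (add_le_add_right (sum_le_sum fun e _ => ?_) _) (sum_le_sum fun e _ => ?_)
  · split_ifs with he
    · rw [hatR_of_pos he.1]; have := le_hatA h.a_nonneg (G := G) e; linarith
    · rfl
  · split_ifs with he
    · rw [hatR_of_pos he.1]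
    · rfl

/-- The gain of the edges with `r < 0`. -/
def gain (G : RGraph V E) (e : E) : ℝ := ((-G.r e).toNat : ℝ)

lemma edgeCounting_of_powerCounting (h : G.PowerCounting s a) :
    EdgeCounting (sdim s : ℝ) G a (gain G) G.Vstar where
  a_nonneg := h.a_nonneg
  gain_nonneg e := Nat.cast_nonneg _
  root_mem := mem_insert_self _ _
  r_root := h.r_root
  inner U hU hc := by
    have hk : 0 ≤ ∑ e, if G.r e < 0 ∧ U = {G.src e, G.tgt e} then gain G e else 0 :=
      sum_nonneg fun e _ => by split_ifs <;> [exact Nat.cast_nonneg _; rfl]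
    rcases Nat.lt_or_ge 2 U.card with hc3 | hc3
    · have := h.subgraph U hU hc3; rw [sum_internal] at this; linarith
    obtain ⟨y, z, hyz, rfl⟩ := card_eq_two.1 (le_antisymm hc3 hc)
    rw [sum_pair_eq_hatA, card_pair hyz]
    by_cases hneg : ∃ e, G.r e < 0 ∧ G.ends e = s(y, z)
    · obtain ⟨e, he, hee⟩ := hneg; have h1 := h.edge (G.ends e) (mem_image_of_mem _ (mem_univ _))
      rw [hatA_of_neg he, hatR_of_neg he, min_eq_left he.le] at h1
      have h2 : gain G e ≤ ∑ e', if G.r e' < 0 ∧ ({y, z} : Finset V) = {G.src e', G.tgt e'} then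
        gain G e' else 0 := by
        have : gain G e = if G.r e < 0 ∧ ({y, z} : Finset V) = {G.src e, G.tgt e} then gain G e else
          0 := by
          rw [if_pos]; refine ⟨he, ?_⟩; rcases Sym2.eq_iff.1 hee with ⟨h3, h4⟩ | ⟨h3, h4⟩
          · rw [h3, h4]
          · rw [h3, h4, pair_comm]
        rw [this]
        exact single_le_sum (f := fun e' => if G.r e' < 0 ∧
          ({y, z} : Finset V) = {G.src e', G.tgt e'} then gain G e' else 0)
          (fun e _ => by split_ifs <;> [exact Nat.cast_nonneg _; rfl])
          (mem_univ e)
      have h3 : gain G e = -(G.r e : ℝ) := by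
        unfold gain; have : (((-G.r e).toNat : ℤ)) = -G.r e := Int.toNat_of_nonneg (by omega)
        exact_mod_cast this
      rw [← hee, hatA_of_neg he]; push_cast; linarith
    · push Not at hneg
      have := hatA_lt_of_nonneg h (c := s(y, z)) fun e he => by by_contra! h'; exact hneg e h' he
      push_cast; linarith
  inner_root U hU hc := inner_root_of_powerCounting h hU hc
  outer U hU hd := by
    refine (h.large U hU hd).trans_le ?_; unfold RGraph.outPos
    rw [sum_hatA, sum_image_ends _ (fun e he => he.1)]
    have h1 : ∑ c ∈ G.inPos U, ((G.hatR c : ℝ) - 1) = ∑ e, if 0 < G.r e ∧ G.src e ∉ U ∧ G.tgt e ∈ U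
      then (G.hatR (G.ends e) : ℝ) - 1 else 0 := by
      unfold RGraph.inPos
      exact sum_image_ends (f := fun c => (G.hatR c : ℝ) - 1) _ (fun e he => he.1)
    rw [h1, add_sub_right_comm, ← sum_sub_distrib, ← sum_sub_distrib]
    refine add_le_add (sum_le_sum fun e _ => ?_) (sum_le_sum fun e _ => ?_)
    · by_cases hin : 0 < G.r e ∧ G.src e ∉ U ∧ G.tgt e ∈ U
      · have : G.ends e ∈ G.inPos U := mem_image_of_mem _ (by simp [hin])
        rw [if_neg (by simp [this]), if_pos hin, if_pos (Or.inr hin.2.2), if_pos hin,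
          hatR_of_pos hin.1]
        linarith
      · rw [if_neg hin, if_neg hin]; have := h.a_nonneg e
        by_cases h2 : G.ends e ∈ G.incident U \ G.inPos U
        · rw [if_pos h2, if_pos (ends_mem_incident.1 (mem_sdiff.1 h2).1)]
        · rw [if_neg h2]; split_ifs <;> simp [this]
    · split_ifs with he
      · rw [hatR_of_pos he.1]
      · rfl

/-- Power counting when the kernels with `r < 0` are bounded. -/
lemma edgeCounting_bounded (h : G.PowerCounting s a) :
    EdgeCounting (sdim s : ℝ) G (fun e => if G.r e < 0 then 0 else a e) 0 univ where
  a_nonneg e := by split_ifs <;> [rfl; exact h.a_nonneg e]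
  gain_nonneg e := le_rfl
  root_mem := mem_univ _
  r_root := h.r_root
  inner U hU hc := by
    have hle : (∑ e, if G.src e ∈ U ∧ G.tgt e ∈ U then (if G.r e < 0 then 0 else a e) else 0) ≤
        ∑ e, if G.src e ∈ U ∧ G.tgt e ∈ U then a e else 0 :=
      sum_le_sum fun e _ => by have := h.a_nonneg e; split_ifs <;> simp [this]
    simp only [Pi.zero_apply, ite_self, sum_const_zero, sub_zero]
    rcases Nat.lt_or_ge 2 U.card with hc3 | hc3
    · have := h.subgraph U hU hc3; rw [sum_internal] at this; linarith
    obtain ⟨y, z, hyz, rfl⟩ := card_eq_two.1 (le_antisymm hc3 hc); rw [card_pair hyz]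
    have hd : (0 : ℝ) < sdim s := by exact_mod_cast sdim_pos h
    by_cases hneg : ∃ e, G.r e < 0 ∧ G.ends e = s(y, z)
    · obtain ⟨e, he, hee⟩ := hneg
      rw [sum_pair_eq_hatA (a := fun e => if G.r e < 0 then 0 else a e), ← hee, hatA_of_neg he,
        if_pos he]
      push_cast; linarith
    · push Not at hneg
      have := hatA_lt_of_nonneg h (c := s(y, z)) fun e he => by by_contra! h'; exact hneg e h' he
      rw [sum_pair_eq_hatA (a := a)] at hle; push_cast; linarith
  inner_root U hU hc := by
    refine lt_of_le_of_lt ?_ (inner_root_of_powerCounting h hU hc)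
    refine sub_le_sub_right (add_le_add (sum_le_sum fun e _ => ?_) (sum_le_sum fun e _ => ?_)) _
    · have := h.a_nonneg e; split_ifs <;> simp [this]
    · by_cases he : 0 < G.r e ∧ G.src e ∈ U ∧ G.tgt e ∉ U
      · rw [if_pos he, if_pos he, if_neg (by omega)]
      · rw [if_neg he, if_neg he]
  outer U hU hd := by obtain ⟨v, hv⟩ := hU; exact absurd (mem_univ v) (disjoint_left.1 hd hv)

/-! ### Configurations in the support are bounded -/

lemma exists_boundary_edge (h : G.PowerCounting s a) {U : Finset V} (hU : U.Nonempty) (hd : Disjoint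
    U G.Vstar) : ∃ e, ¬ (0 < G.r e ∧ G.src e ∉ U ∧ G.tgt e ∈ U) ∧ ((G.src e ∈ U ∧ G.tgt e ∉ U) ∨
    (G.src e ∉ U ∧ G.tgt e ∈ U)) := by
  by_contra hcon
  have h1 := (edgeCounting_of_powerCounting h).outer U hU hd
  have hout : ∀ e, ¬ (G.src e ∈ U ∧ G.tgt e ∉ U) := by
    intro e he; exact hcon ⟨e, fun h' => h'.2.1 he.1, Or.inl he⟩
  have hin : ∀ e, G.src e ∉ U ∧ G.tgt e ∈ U → 0 < G.r e := by
    intro e he; by_contra h'; exact hcon ⟨e, fun h'' => h' h''.1, Or.inr he⟩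
  have h2 : (∑ e, if G.src e ∈ U ∨ G.tgt e ∈ U then a e else 0) - (∑ e, if 0 < G.r e ∧ G.src e ∉ U ∧
    G.tgt e ∈ U then a e + G.r e - 1 else 0) + (∑ e, if 0 < G.r e ∧ G.src e ∈ U ∧ G.tgt e ∉ U then
    (G.r e : ℝ) else 0) ≤ ∑ e, if G.src e ∈ U ∧ G.tgt e ∈ U then a e else 0 := by
    rw [← sum_sub_distrib, ← sum_add_distrib]; refine sum_le_sum fun e _ => ?_; have ho := hout e
    have hi := hin e
    by_cases h3 : G.src e ∈ U <;> by_cases h4 : G.tgt e ∈ U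
    · simp [h3, h4]
    · exact absurd ⟨h3, h4⟩ ho
    · have h5 := hi ⟨h3, h4⟩; have h6 : (1 : ℝ) ≤ G.r e := by exact_mod_cast h5
      simp [h3, h4, h5]; linarith
    · simp [h3, h4]
  have hσ : (0 : ℝ) < sdim s := by exact_mod_cast sdim_pos h
  set v := G.tgt (G.star ⟨0, G.M_pos⟩) with hv
  have hvs : v ∈ G.Vstar := mem_insert_of_mem (mem_image_of_mem _ (mem_univ _))
  have hvU : v ∉ U := fun h' => disjoint_left.1 hd h' hvs
  have hrU : G.root ∉ U := fun h' => disjoint_left.1 hd h' (mem_insert_self _ _)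
  have hvr : v ≠ G.root := fun h' => G.no_loop (G.star ⟨0, G.M_pos⟩) ((G.star_src _).trans h'.symm)
  have h3 : (∑ e, if G.src e ∈ U ∧ G.tgt e ∈ U then a e else 0) ≤ U.card * (sdim s : ℝ) := by
    rcases Nat.lt_or_ge 1 U.card with hc | hc
    · have hle : (∑ e, if G.src e ∈ U ∧ G.tgt e ∈ U then a e else 0) ≤ ∑ e, if G.src e ∈ insert v U
        ∧ G.tgt e ∈ insert v U then a e else 0 := sum_le_sum fun e _ => by
          have := h.a_nonneg e
          by_cases h5 : G.src e ∈ U ∧ G.tgt e ∈ U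
          · rw [if_pos h5, if_pos ⟨mem_insert_of_mem h5.1, mem_insert_of_mem h5.2⟩]
          · rw [if_neg h5]; split_ifs <;> simp [this]
      have := h.subgraph (insert v U) (by simp [hrU, hvr.symm])
        (by rw [card_insert_of_notMem hvU]; omega)
      rw [sum_internal, card_insert_of_notMem hvU] at this; push_cast at this; linarith
    · obtain ⟨w, rfl⟩ := card_eq_one.1 (le_antisymm hc (card_pos.2 hU))
      have : (∑ e, if G.src e ∈ ({w} : Finset V) ∧ G.tgt e ∈ ({w} : Finset V) then a e else 0) = 0
        := by
        refine sum_eq_zero fun e _ => if_neg fun h' => G.no_loop e ?_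
        simp only [mem_singleton] at h'; rw [h'.1, h'.2]
      rw [this]; simp
  linarith

lemma snorm_le_of_support [Scaling s] (h : G.PowerCounting s a) {x : V → ℝ^d} (hx0 : x G.root = 0)
    {R ϱ : ℝ} (hϱ : 0 ≤ ϱ) (hstar : ∀ i, snorm s (x (G.tgt (G.star i))) ≤ R) (hnpos : ∀ e, G.r e ≤ 0
    → snorm s (x (G.tgt e) - x (G.src e)) ≤ ϱ) (hpos : ∀ e, 0 < G.r e → snorm s (x (G.tgt e) - x
    (G.src e)) ≤ ϱ ∨ snorm s (x (G.src e)) ≤ ϱ) (v : V) : snorm s (x v) ≤ max R ϱ + Fintype.card V *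
    ϱ := by
  set m := max R ϱ with hm
  have hm0 : 0 ≤ m := hϱ.trans (le_max_right _ _)
  let U : ℕ → Finset V := fun j => univ.filter fun v => m + j * ϱ < snorm s (x v)
  have hU : ∀ j v, v ∈ U j ↔ m + j * ϱ < snorm s (x v) := fun j v => by simp [U]
  have key : ∀ j, U j = ∅ ∨ (U j).card + j ≤ Fintype.card V := by
    intro j
    induction j with
    | zero => exact Or.inr (by simpa using card_le_univ _)
    | succ j ih =>
      have hsub : U (j + 1) ⊆ U j := fun v hv => by rw [hU] at hv ⊢; push_cast at hv; nlinarith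
      rcases (U j).eq_empty_or_nonempty with he | hne
      · left; rw [he] at hsub; exact subset_empty.1 hsub
      right
      have ih := ih.resolve_left hne.ne_empty
      have hdisj : Disjoint (U j) G.Vstar := by
        refine disjoint_left.2 fun w hw hws => ?_; rw [hU] at hw
        have hjϱ : 0 ≤ (j : ℝ) * ϱ := by positivity
        rcases mem_insert.1 hws with rfl | hws
        · rw [hx0, snorm_zero] at hw; linarith
        · obtain ⟨i, -, rfl⟩ := mem_image.1 hws; have := (hstar i).trans (le_max_left R ϱ); linarith
      obtain ⟨e, he, hbd⟩ := exists_boundary_edge h hne hdisj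
      have hjϱ : 0 ≤ (j : ℝ) * ϱ := by positivity
      have hex : ∃ w ∈ U j, w ∉ U (j + 1) := by
        have hclose : snorm s (x (G.tgt e) - x (G.src e)) ≤ ϱ := by
          rcases le_or_gt (G.r e) 0 with hr | hr
          · exact hnpos e hr
          · rcases hpos e hr with h1 | h1
            · exact h1
            · exfalso; rcases hbd with h2 | h2
              · have := (hU _ _).1 h2.1; have := le_max_right R ϱ; linarith
              · exact he ⟨hr, h2⟩
        rcases hbd with h2 | h2
        · refine ⟨_, h2.1, ?_⟩; have h3 := (hU _ _).not.1 h2.2; rw [hU]; push_cast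
          have := snorm_tri (s := s) (x (G.src e)) (x (G.tgt e)) 0
          rw [sub_zero, sub_zero, snorm_sub_comm] at this; linarith
        · refine ⟨_, h2.2, ?_⟩; have h3 := (hU _ _).not.1 h2.1; rw [hU]; push_cast
          have := snorm_tri (s := s) (x (G.tgt e)) (x (G.src e)) 0; rw [sub_zero, sub_zero] at this
          linarith
      obtain ⟨w, hw1, hw2⟩ := hex
      have := card_lt_card (Finset.ssubset_iff_subset_ne.2 ⟨hsub, fun h' => hw2 (h' ▸ hw1)⟩); omega
  have hemp : U (Fintype.card V) = ∅ := by
    rcases key (Fintype.card V) with h1 | h1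
    · exact h1
    · exact card_eq_zero.1 (by omega)
  by_contra! hv
  have := (hU (Fintype.card V) v).2 hv
  rw [hemp] at this
  simp at this

end Merge

/-! ### Directional derivatives -/

section Deriv

/-- The derivative of `f` in the direction `v`. -/
def lineD (v : X) (f : X → ℝ) : X → ℝ := fun x => fderiv ℝ f x v

/-- Iterated derivatives along a family of directions. -/
def mD {d : ℕ} (b : Fin d → X) (k : ℕ^d) (f : X → ℝ) : X → ℝ :=
  (List.finRange d).foldr (fun i g => (lineD (b i))^[k i] g) f

lemma multiD_eq_mD {d : ℕ} (k : ℕ^d) (f : ℝ^d → ℝ) :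
    multiD k f = mD (fun i => Pi.single i 1) k f := rfl

variable {D : Set X} {f g : X → ℝ}

lemma diffAt (hD : IsOpen D) (hf : SmoothOn f D) {x : X} (hx : x ∈ D) : DifferentiableAt ℝ f x :=
  (hf.contDiffAt (hD.mem_nhds hx)).differentiableAt (by simp)

lemma contDiffOn_lineD (hD : IsOpen D) (hf : SmoothOn f D) (v : X) : SmoothOn (lineD v f) D := by
  have := hf.fderiv_of_isOpen hD (m := ∞) (by simp)
  exact this.clm_apply contDiffOn_const

lemma lineD_congr (hD : IsOpen D) (h : Set.EqOn f g D) (v : X) :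
    Set.EqOn (lineD v f) (lineD v g) D := fun x hx => by
  unfold lineD
  rw [(h.eventuallyEq_of_mem (hD.mem_nhds hx)).fderiv_eq]

lemma lineD_comm (hD : IsOpen D) (hf : SmoothOn f D) (v w : X) :
    Set.EqOn (lineD v (lineD w f)) (lineD w (lineD v f)) D := fun x hx => by
  have h1 : ContDiffAt ℝ ∞ f x := hf.contDiffAt (hD.mem_nhds hx)
  have h2 : DifferentiableAt ℝ (fderiv ℝ f) x :=
    (h1.fderiv_right (m := 1) (by norm_cast)).differentiableAt (by simp)
  have h3 : ∀ v w, lineD v (lineD w f) x = fderiv ℝ (fderiv ℝ f) x v w := fun v w => by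
    unfold lineD; rw [fderiv_clm_apply h2 (differentiableAt_const _)]; simp
  rw [h3, h3]
  exact (h1.isSymmSndFDerivAt (by simp; norm_cast)) v w

lemma lineD_add_apply (v : X) {x : X} (hf : DifferentiableAt ℝ f x) (hg : DifferentiableAt ℝ g x) :
    lineD v (fun y => f y + g y) x = lineD v f x + lineD v g x := by
  unfold lineD; rw [fderiv_fun_add hf hg]; rfl

lemma lineD_mul_apply (v : X) {x : X} (hf : DifferentiableAt ℝ f x) (hg : DifferentiableAt ℝ g x) :
    lineD v (fun y => f y * g y) x = lineD v f x * g x + f x * lineD v g x := by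
  unfold lineD; rw [fderiv_fun_mul hf hg]; simp; ring

lemma lineD_const_mul_apply (v : X) {x : X} (c : ℝ) (hf : DifferentiableAt ℝ f x) :
    lineD v (fun y => c * f y) x = c * lineD v f x := by
  unfold lineD; rw [fderiv_const_mul hf]; rfl

lemma lineD_comp_apply {Y : Type*} [NormedAddCommGroup Y] [NormedSpace ℝ Y] (L : X →L[ℝ] Y)
    {f : Y → ℝ} (v : X) {x : X} (hf : DifferentiableAt ℝ f (L x)) :
    lineD v (fun y => f (L y)) x = lineD (L v) f (L x) := by
  unfold lineD
  have := (hf.hasFDerivAt.comp x L.hasFDerivAt).fderiv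
  simp only [Function.comp_def] at this
  rw [this]; rfl

lemma lineD_eq_zero_of_eqOn (hD : IsOpen D) (h : ∀ x ∈ D, f x = 0) (v : X) :
    ∀ x ∈ D, lineD v f x = 0 := fun x hx => by
  have := lineD_congr (g := fun _ => 0) hD h v hx
  rw [this]; simp [lineD]

lemma iterate_lineD (hD : IsOpen D) (hf : SmoothOn f D) (w : X) (n : ℕ) : SmoothOn ((lineD w)^[n] f)
    D ∧ ∀ v, Set.EqOn (lineD v ((lineD w)^[n] f)) ((lineD w)^[n] (lineD v f)) D := by
  induction n generalizing f with
  | zero => exact ⟨hf, fun v x _ => rfl⟩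
  | succ n ih =>
    have h1 := ih (contDiffOn_lineD hD hf w); refine ⟨h1.1, fun v => ?_⟩
    simp only [Function.iterate_succ, Function.comp_apply]; refine (h1.2 v).trans ?_
    have : ∀ (n : ℕ) (f g : X → ℝ), Set.EqOn f g D → Set.EqOn ((lineD w)^[n] f) ((lineD w)^[n] g) D
      := by
      intro n
      induction n with
      | zero => exact fun f g h => h
      | succ n ih => exact fun f g h => ih _ _ (lineD_congr hD h w)
    exact this n _ _ (lineD_comm hD hf v w)

lemma iterate_lineD_congr (hD : IsOpen D) (w : X) (n : ℕ) (h : Set.EqOn f g D) :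
    Set.EqOn ((lineD w)^[n] f) ((lineD w)^[n] g) D := by
  induction n generalizing f g with
  | zero => exact h
  | succ n ih => exact ih (lineD_congr hD h w)

variable (b : Fin d → X)

lemma foldr_lineD (hD : IsOpen D) (hf : SmoothOn f D) (k : ℕ^d) (l : List (Fin d)) : SmoothOn
    (l.foldr (fun i g => (lineD (b i))^[k i] g) f) D ∧ ∀ v, Set.EqOn (lineD v (l.foldr (fun i g =>
    (lineD (b i))^[k i] g) f)) (l.foldr (fun i g => (lineD (b i))^[k i] g) (lineD v f)) D := by
  induction l with
  | nil => exact ⟨hf, fun v x _ => rfl⟩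
  | cons i l ih =>
    simp only [List.foldr_cons]; have h1 := iterate_lineD hD ih.1 (b i) (k i)
    exact ⟨h1.1, fun v => (h1.2 v).trans (iterate_lineD_congr hD _ _ (ih.2 v))⟩

lemma contDiffOn_mD (hD : IsOpen D) (hf : SmoothOn f D) (k : ℕ^d) :
    SmoothOn (mD b k f) D := (foldr_lineD b hD hf k _).1

lemma lineD_mD (hD : IsOpen D) (hf : SmoothOn f D) (k : ℕ^d) (v : X) :
    Set.EqOn (lineD v (mD b k f)) (mD b k (lineD v f)) D := (foldr_lineD b hD hf k _).2 v

lemma mD_congr (hD : IsOpen D) (h : Set.EqOn f g D) (k : ℕ^d) :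
    Set.EqOn (mD b k f) (mD b k g) D := by
  unfold mD
  induction List.finRange d with
  | nil => exact h
  | cons i l ih => exact iterate_lineD_congr hD _ _ ih

lemma mD_zero (f : X → ℝ) : mD b 0 f = f := by
  unfold mD
  induction List.finRange d with
  | nil => rfl
  | cons i l ih => simp

lemma mD_succ (hD : IsOpen D) (hf : SmoothOn f D) (k : ℕ^d) (i : Fin d) :
    Set.EqOn (mD b (k + Pi.single i 1) f) (mD b k (lineD (b i) f)) D := by
  have key : ∀ l : List (Fin d), l.Nodup → Set.EqOn (l.foldr (fun j g => (lineD (b j))^[(k +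
    Pi.single i 1 : ℕ^d) j] g) f) (l.foldr (fun j g => (lineD (b j))^[k j] g) (if i ∈ l then lineD
    (b i) f else f)) D := by
    intro l
    induction l with
    | nil => intro _ x _; simp
    | cons j l ih =>
      intro hl; rw [List.nodup_cons] at hl; have ih := ih hl.2; simp only [List.foldr_cons]
      by_cases hij : i = j
      · subst hij; rw [if_neg hl.1] at ih; rw [if_pos (by simp)]
        have h1 : (k + Pi.single i 1 : ℕ^d) i = k i + 1 := by simp
        rw [h1, Function.iterate_succ, Function.comp_apply]; refine iterate_lineD_congr hD _ _ ?_
        exact (lineD_congr hD ih _).trans ((foldr_lineD b hD hf k l).2 _)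
      · have h1 : (k + Pi.single i 1 : ℕ^d) j = k j := by simp [Ne.symm hij]
        have h2 : (i ∈ j :: l) ↔ i ∈ l := by simp [hij]
        rw [h1]; simp only [h2]; exact iterate_lineD_congr hD _ _ ih
  have := key (List.finRange d) (List.nodup_finRange d)
  rw [if_pos (List.mem_finRange i)] at this
  exact this

end Deriv

/-! ### Symbol classes -/

section Sym

variable {ι : Type*}

/-- `F` is bounded by `B` on `D`, and every one of up to `m` derivatives along the directions `b c`
costs a factor `μ c`. -/
def IsSymb (b : ι → X) (μ : ι → ℝ) (D : Set X) : ℕ → ℝ → (X → ℝ) → Prop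
  | 0, B, F => ∀ x ∈ D, |F x| ≤ B
  | m + 1, B, F => (∀ x ∈ D, |F x| ≤ B) ∧ ∀ c, IsSymb b μ D m (B * μ c) (lineD (b c) F)

variable {b : ι → X} {μ ν : ι → ℝ} {D D' : Set X} {m : ℕ} {B B' : ℝ} {F F' : X → ℝ}

namespace IsSymb

lemma bound (h : IsSymb b μ D m B F) : ∀ x ∈ D, |F x| ≤ B := by
  cases m with
  | zero => exact h
  | succ m => exact h.1

lemma of_succ (h : IsSymb b μ D (m + 1) B F) : IsSymb b μ D m B F := by
  induction m generalizing B F with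
  | zero => exact h.1
  | succ m ih => exact ⟨h.1, fun c => ih (h.2 c)⟩

lemma of_le {m' : ℕ} (hm : m' ≤ m) (h : IsSymb b μ D m B F) : IsSymb b μ D m' B F := by
  induction m, hm using Nat.le_induction with
  | base => exact h
  | succ m hm ih => exact ih h.of_succ

lemma mono (hμ : ∀ c, 0 ≤ μ c) (hμν : ∀ c, μ c ≤ ν c) (hB : 0 ≤ B) (hBB : B ≤ B')
    (hDD : D' ⊆ D) (h : IsSymb b μ D m B F) : IsSymb b ν D' m B' F := by
  induction m generalizing B B' F with
  | zero => exact fun x hx => (h x (hDD hx)).trans hBB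
  | succ m ih =>
    refine ⟨fun x hx => (h.1 x (hDD hx)).trans hBB, fun c => ih ?_ ?_ (h.2 c)⟩
    · exact mul_nonneg hB (hμ c)
    · exact mul_le_mul hBB (hμν c) (hμ c) (hB.trans hBB)

lemma congr (hD : IsOpen D) (hFF : Set.EqOn F F' D) (h : IsSymb b μ D m B F) :
    IsSymb b μ D m B F' := by
  induction m generalizing B F F' with
  | zero => exact fun x hx => by rw [← hFF hx]; exact h x hx
  | succ m ih =>
    exact ⟨fun x hx => by rw [← hFF hx]; exact h.1 x hx, fun c => ih (lineD_congr hD hFF _) (h.2 c)⟩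

lemma zero (hμ : ∀ c, 0 ≤ μ c) (hD : IsOpen D) (hB : 0 ≤ B) (h : ∀ x ∈ D, F x = 0) :
    IsSymb b μ D m B F := by
  induction m generalizing B F with
  | zero => exact fun x hx => by rw [h x hx]; simpa
  | succ m ih =>
    exact ⟨fun x hx => by rw [h x hx]; simpa,
      fun c => ih (mul_nonneg hB (hμ c)) (lineD_eq_zero_of_eqOn hD h _)⟩

lemma union (h : IsSymb b μ D m B F) (h' : IsSymb b μ D' m B F) : IsSymb b μ (D ∪ D') m B F := by
  induction m generalizing B F with
  | zero => exact fun x hx => hx.elim (h x) (h' x)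
  | succ m ih => exact ⟨fun x hx => hx.elim (h.1 x) (h'.1 x), fun c => ih (h.2 c) (h'.2 c)⟩

lemma const_mul (hD : IsOpen D) (hF : SmoothOn F D) (c₀ : ℝ) (h : IsSymb b μ D m B F) :
    IsSymb b μ D m (|c₀| * B) (fun x => c₀ * F x) := by
  induction m generalizing B F with
  | zero => exact fun x hx => by rw [abs_mul]; exact mul_le_mul_of_nonneg_left (h x hx) (abs_nonneg _)
  | succ m ih =>
    refine ⟨fun x hx => by
      rw [abs_mul]; exact mul_le_mul_of_nonneg_left (h.1 x hx) (abs_nonneg _), fun c => ?_⟩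
    rw [mul_assoc]
    exact (ih (contDiffOn_lineD hD hF _) (h.2 c)).congr hD fun x hx =>
      (lineD_const_mul_apply _ _ (diffAt hD hF hx)).symm

lemma add (hD : IsOpen D) (hF : SmoothOn F D) (hF' : SmoothOn F' D)
    (h : IsSymb b μ D m B F) (h' : IsSymb b μ D m B' F') :
    IsSymb b μ D m (B + B') (fun x => F x + F' x) := by
  induction m generalizing B B' F F' with
  | zero => exact fun x hx => (abs_add_le _ _).trans (add_le_add (h x hx) (h' x hx))
  | succ m ih =>
    refine ⟨fun x hx => (abs_add_le _ _).trans (add_le_add (h.1 x hx) (h'.1 x hx)), fun c => ?_⟩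
    rw [add_mul]
    exact (ih (contDiffOn_lineD hD hF _) (contDiffOn_lineD hD hF' _) (h.2 c) (h'.2 c)).congr hD
      fun x hx => (lineD_add_apply _ (diffAt hD hF hx) (diffAt hD hF' hx)).symm

lemma sum {κ : Type*} (S : Finset κ) {F : κ → X → ℝ} {B : κ → ℝ} (hμ : ∀ c, 0 ≤ μ c) (hD : IsOpen D)
    (hF : ∀ j ∈ S, SmoothOn (F j) D) (h : ∀ j ∈ S, IsSymb b μ D m (B j) (F j)) : IsSymb b μ D m (∑ j
    ∈ S, B j) (fun x => ∑ j ∈ S, F j x) := by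
  classical
  induction S using Finset.induction_on with
  | empty => exact zero hμ hD (by simp) (by simp)
  | insert j S hj ih =>
    simp only [sum_insert hj]
    refine add hD (hF j (by simp)) (ContDiffOn.sum fun i hi => hF i (by simp [hi])) (h j (by simp))
      (ih (fun i hi => hF i (by simp [hi])) fun i hi => h i (by simp [hi]))

lemma mul (hμ : ∀ c, 0 ≤ μ c) (hB : 0 ≤ B) (hB' : 0 ≤ B') (hD : IsOpen D)
    (hF : SmoothOn F D) (hF' : SmoothOn F' D)
    (h : IsSymb b μ D m B F) (h' : IsSymb b μ D m B' F') :
    IsSymb b μ D m (2 ^ m * (B * B')) (fun x => F x * F' x) := by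
  induction m generalizing B B' F F' with
  | zero =>
    intro x hx; rw [abs_mul, pow_zero, one_mul]
    exact mul_le_mul (h x hx) (h' x hx) (abs_nonneg _) hB
  | succ m ih =>
    refine ⟨fun x hx => ?_, fun c => ?_⟩
    · rw [abs_mul]; refine (mul_le_mul (h.1 x hx) (h'.1 x hx) (abs_nonneg _) hB).trans ?_
      exact le_mul_of_one_le_left (mul_nonneg hB hB') (one_le_pow₀ (by norm_num))
    · have h1 := ih (mul_nonneg hB (hμ c)) hB' (contDiffOn_lineD hD hF (b c)) hF' (h.2 c) h'.of_succ
      have h2 := ih hB (mul_nonneg hB' (hμ c)) hF (contDiffOn_lineD hD hF' (b c)) h.of_succ (h'.2 c)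
      have h3 := add hD ((contDiffOn_lineD hD hF (b c)).mul hF')
        (hF.mul (contDiffOn_lineD hD hF' (b c))) h1 h2
      have h4 : 2 ^ m * (B * μ c * B') + 2 ^ m * (B * (B' * μ c)) =
          2 ^ (m + 1) * (B * B') * μ c := by ring
      rw [h4] at h3
      exact h3.congr hD fun x hx => (lineD_mul_apply _ (diffAt hD hF hx) (diffAt hD hF' hx)).symm

lemma one (hμ : ∀ c, 0 ≤ μ c) : IsSymb b μ D m 1 (fun _ => 1) := by
  cases m with
  | zero => simp [IsSymb]
  | succ m =>
    refine ⟨by simp, fun c => ?_⟩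
    have : IsSymb b μ Set.univ m (1 * μ c) (lineD (b c) fun _ => 1) :=
      zero hμ isOpen_univ (by simpa using hμ c) fun x _ => by simp [lineD]
    exact this.mono hμ (fun _ => le_rfl) (by simpa using hμ c) le_rfl (Set.subset_univ _)

lemma prod {κ : Type*} (S : Finset κ) {F : κ → X → ℝ} {B : κ → ℝ} (hμ : ∀ c, 0 ≤ μ c) (hB : ∀ j ∈ S,
    0 ≤ B j) (hD : IsOpen D) (hF : ∀ j ∈ S, SmoothOn (F j) D) (h : ∀ j ∈ S, IsSymb b μ D m (B j) (F
    j)) : IsSymb b μ D m (2 ^ (m * S.card) * ∏ j ∈ S, B j) (fun x => ∏ j ∈ S, F j x) := by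
  classical
  induction S using Finset.induction_on with
  | empty => simpa using one hμ
  | insert j S hj ih =>
    simp only [prod_insert hj, card_insert_of_notMem hj]
    have := mul hμ (hB j (by simp)) (mul_nonneg (by positivity)
      (prod_nonneg fun i hi => hB i (by simp [hi]))) hD (hF j (by simp))
      (contDiffOn_prod fun i hi => hF i (by simp [hi])) (h j (by simp))
      (ih (fun i hi => hB i (by simp [hi])) (fun i hi => hF i (by simp [hi]))
        fun i hi => h i (by simp [hi]))
    refine this.mono hμ (fun _ => le_rfl) ?_ (le_of_eq ?_) le_rfl
    · exact mul_nonneg (by positivity) (mul_nonneg (hB j (by simp)) (mul_nonneg (by positivity)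
        (prod_nonneg fun i hi => hB i (by simp [hi]))))
    · ring

lemma comp {Y κ : Type*} [NormedAddCommGroup Y] [NormedSpace ℝ Y] {b' : κ → Y} {μ' : κ → ℝ}
    {D' : Set Y} {f : Y → ℝ} (L : X →L[ℝ] Y) (hD : IsOpen D) (hD' : IsOpen D')
    (hDD : ∀ x ∈ D, L x ∈ D') (hμ : ∀ c, 0 ≤ μ c) (hB : 0 ≤ B)
    (hμ' : ∀ c, 0 ≤ μ' c) (hf : SmoothOn f D')
    (hL : ∀ c, L (b c) = 0 ∨ ∃ i, (L (b c) = b' i ∨ L (b c) = -b' i) ∧ μ' i ≤ μ c)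
    (h : IsSymb b' μ' D' m B f) : IsSymb b μ D m B (fun x => f (L x)) := by
  induction m generalizing B f with
  | zero => exact fun x hx => h _ (hDD x hx)
  | succ m ih =>
    refine ⟨fun x hx => h.1 _ (hDD x hx), fun c => ?_⟩
    have key : Set.EqOn (lineD (b c) fun x => f (L x)) (fun x => lineD (L (b c)) f (L x)) D :=
      fun x hx => lineD_comp_apply L _ (diffAt hD' hf (hDD x hx))
    rcases hL c with h0 | ⟨i, h0, hi⟩
    · refine zero hμ hD (mul_nonneg hB (hμ c)) fun x hx => ?_; rw [key hx, h0]; simp [lineD]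
    · have h1 := ih (mul_nonneg hB (hμ' i)) (contDiffOn_lineD hD' hf (b' i)) (h.2 i)
      have h2 := h1.mono hμ (fun _ => le_rfl) (mul_nonneg hB (hμ' i))
        (mul_le_mul_of_nonneg_left hi hB) le_rfl
      rcases h0 with h0 | h0
      · exact h2.congr hD fun x hx => by rw [key hx, h0]
      · have h3 := h2.const_mul hD ((contDiffOn_lineD hD' hf (b' i)).comp
          L.contDiff.contDiffOn hDD) (-1)
        rw [abs_neg, abs_one, one_mul] at h3
        exact h3.congr hD fun x hx => by rw [key hx, h0]; simp [lineD]

end IsSymb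

lemma isSymb_mD {d : ℕ} {s : ℕ^d} [Scaling s] {b : Fin d → X} {Λ : ℝ} (hD : IsOpen D) (hF : SmoothOn F D) (k₀ : ℕ^d)
    (h : ∀ k, sdeg s k ≤ sdeg s k₀ + m * sdim s → ∀ x ∈ D, |mD b k F x| ≤ B * Λ ^ sdeg s k) :
    IsSymb b (fun i => Λ ^ s i) D m (B * Λ ^ sdeg s k₀) (mD b k₀ F) := by
  induction m generalizing k₀ with
  | zero => exact h k₀ (by simp)
  | succ m ih =>
    refine ⟨h k₀ (by simp), fun i => ?_⟩; have h2 : s i ≤ sdim s := le_sdim i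
    have h3 := ih (k₀ + Pi.single i 1) fun k hk =>
      h k (hk.trans (by rw [sdeg_add_single]; nlinarith))
    rw [sdeg_add_single, pow_add, ← mul_assoc] at h3
    exact h3.congr hD fun x hx => by rw [mD_succ b hD hF k₀ i hx, lineD_mD b hD hF k₀ _ hx]

lemma isSymb_of_mD {d : ℕ} {s : ℕ^d} [Scaling s] {b : Fin d → X} {Λ : ℝ} (hD : IsOpen D)
    (hF : SmoothOn F D)
    (h : ∀ k, sdeg s k ≤ m * sdim s → ∀ x ∈ D, |mD b k F x| ≤ B * Λ ^ sdeg s k) :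
    IsSymb b (fun i => Λ ^ s i) D m B F := by
  have := isSymb_mD hD hF 0 fun k hk => h k (by simpa [sdeg] using hk)
  rw [mD_zero] at this
  simpa [sdeg] using this

end Sym

/-! ### Taylor remainders adapted to the scaling -/

section Taylor

lemma mfact_pos (k : ℕ^d) : 0 < mfact k := prod_pos fun i _ => by exact_mod_cast (k i).factorial_pos

lemma mfact_add_single (k : ℕ^d) (i : Fin d) : mfact (k + Pi.single i 1) = (k i + 1) * mfact k := by
  unfold mfact
  rw [← mul_prod_erase _ _ (mem_univ i),
    ← mul_prod_erase _ (fun i => ((k i).factorial : ℝ)) (mem_univ i)]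
  have : ∀ j ∈ univ.erase i, ((((k + Pi.single i 1 : ℕ^d) j).factorial : ℕ) : ℝ) =
      (k j).factorial := fun j hj => by simp [ne_of_mem_erase hj]
  rw [prod_congr rfl this]
  simp [Nat.factorial_succ, mul_assoc]

lemma monom_eq_mul_erase (k : ℕ^d) (z : ℝ^d) (i : Fin d) :
    monom k z = z i ^ k i * ∏ j ∈ univ.erase i, z j ^ k j :=
  (mul_prod_erase _ (fun j => z j ^ k j) (mem_univ i)).symm

lemma hasFDerivAt_monom (k : ℕ^d) (z : ℝ^d) : HasFDerivAt (monom k) (∑ i, ((k i : ℝ) * monom (k -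
    Pi.single i 1) z) • (ContinuousLinearMap.proj i : ℝ^d →L[ℝ] ℝ)) z := by
  have h : ∀ i ∈ univ, HasFDerivAt (fun x : ℝ^d => x i ^ k i) (((k i : ℝ) * z i ^ (k i - 1)) •
    (ContinuousLinearMap.proj i : ℝ^d →L[ℝ] ℝ)) z := by
    intro i _
    have := (hasDerivAt_pow (k i) (z i)).comp_hasFDerivAt z
      (ContinuousLinearMap.proj i : ℝ^d →L[ℝ] ℝ).hasFDerivAt
    simpa [Function.comp_def] using this
  have h1 := HasFDerivAt.finsetProd h
  refine h1.congr_fderiv (sum_congr rfl fun i _ => ?_)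
  rw [smul_smul]
  congr 1
  rw [monom_eq_mul_erase _ _ i]
  have : ∀ j ∈ univ.erase i, z j ^ (k - Pi.single i 1 : ℕ^d) j = z j ^ k j :=
    fun j hj => by simp [ne_of_mem_erase hj]
  rw [prod_congr rfl this]
  simp only [Pi.sub_apply, Pi.single_eq_same]
  ring

lemma sum_lowIdx_deriv (N : ℕ) (i : Fin d) (z : ℝ^d) (c : ℕ^d → ℝ) : ∑ k ∈ lowIdx s N, ((k i : ℝ) *
    monom (k - Pi.single i 1) z) / mfact k * c k = ∑ k ∈ lowIdx s (N - s i), monom k z / mfact k * c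
    (k + Pi.single i 1) := by
  rw [← sum_filter_of_ne (p := fun k => k i ≠ 0)]
  swap
  · intro k _ h h0; exact h (by simp [h0])
  symm
  refine sum_nbij (fun k => k + Pi.single i 1) ?_ ?_ ?_ ?_
  · intro k hk; rw [mem_lowIdx hs.pos] at hk; rw [mem_filter, mem_lowIdx hs.pos, sdeg_add_single]
    exact ⟨by omega, by simp⟩
  · intro k _ k' _ h; exact add_right_cancel h
  · intro k hk; rw [mem_coe, mem_filter, mem_lowIdx hs.pos] at hk
    obtain ⟨k', rfl⟩ := exists_eq_add_single hk.2; rw [sdeg_add_single] at hk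
    exact ⟨k', (mem_lowIdx hs.pos _ _).2 (by omega), rfl⟩
  · intro k _; rw [add_tsub_cancel_right, mfact_add_single]; have h1 := (mfact_pos k).ne'
    have h2 : ((k i : ℝ) + 1) ≠ 0 := by positivity
    simp only [Pi.add_apply, Pi.single_eq_same, Nat.cast_add, Nat.cast_one]; field_simp

/-- The remainder of the Taylor expansion of `F` at `x₀`, up to scaled order `N`, along the
directions `b`. -/
def taylorRem (s : ℕ^d) (b : Fin d → X) (N : ℕ) (F : X → ℝ) (x₀ : X) (z : ℝ^d) : ℝ :=
  F (x₀ + ∑ i, z i • b i) - ∑ k ∈ lowIdx s N, monom k z / mfact k * mD b k F x₀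

variable {b : Fin d → X} {D : Set X} {F : X → ℝ}

lemma hasFDerivAt_taylorRem (hD : IsOpen D) (hF : SmoothOn F D) {x₀ : X} {z : ℝ^d} (h0 : x₀ ∈ D) (hz
    : x₀ + ∑ i, z i • b i ∈ D) (N : ℕ) : HasFDerivAt (taylorRem s b N F x₀) (∑ i, taylorRem s b (N -
    s i) (lineD (b i) F) x₀ z • (ContinuousLinearMap.proj i : ℝ^d →L[ℝ] ℝ)) z := by
  let L : ℝ^d →L[ℝ] X := ∑ i, (ContinuousLinearMap.proj i : ℝ^d →L[ℝ] ℝ).smulRight (b i)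
  have hL : ∀ y, x₀ + ∑ i, y i • b i = x₀ + L y := fun y => by simp [L]
  have h1 : HasFDerivAt (fun y : ℝ^d => F (x₀ + L y)) ((fderiv ℝ F (x₀ + L z)).comp L) z := by
    refine HasFDerivAt.comp (g := F) z ?_ (L.hasFDerivAt.const_add x₀); rw [hL] at hz
    exact (diffAt hD hF hz).hasFDerivAt
  have h2 : HasFDerivAt (fun y : ℝ^d => ∑ k ∈ lowIdx s N, monom k y / mfact k * mD b k F x₀) (∑ k ∈
    lowIdx s N, (mD b k F x₀ / mfact k) • ∑ i, ((k i : ℝ) * monom (k - Pi.single i 1) z) •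
    (ContinuousLinearMap.proj i : ℝ^d →L[ℝ] ℝ)) z := by
    refine HasFDerivAt.fun_sum fun k _ => ?_
    refine ((hasFDerivAt_monom k z).const_mul (mD b k F x₀ / mfact k)).congr_of_eventuallyEq ?_
    refine Filter.Eventually.of_forall fun y => ?_; simp only; ring
  unfold taylorRem
  simp only [hL]
  refine (h1.sub h2).congr_fderiv ?_
  ext y
  simp only [sub_apply, ContinuousLinearMap.comp_apply, _root_.sum_apply, smul_apply,
    ContinuousLinearMap.proj_apply, smul_eq_mul, mul_sum, sub_mul, sum_sub_distrib]
  congr 1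
  · have : L y = ∑ i, y i • b i := by simp [L]
    rw [this, map_sum]; refine sum_congr rfl fun i _ => ?_
    rw [map_smul, smul_eq_mul, mul_comm]; rfl
  · rw [sum_comm]; refine sum_congr rfl fun i _ => ?_
    have h3 : ∀ k ∈ lowIdx s (N - s i), monom k z / mfact k * mD b k (lineD (b i) F) x₀ = monom k z
      / mfact k * mD b (k + Pi.single i 1) F x₀ := fun k _ => by
      rw [mD_succ b hD hF k i h0]
    rw [sum_congr rfl h3, ← sum_lowIdx_deriv N i z fun k => mD b k F x₀, sum_mul]
    refine sum_congr rfl fun k _ => ?_; ring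

lemma taylorRem_zero_right {N : ℕ} (hN : 0 < N) (x₀ : X) : taylorRem s b N F x₀ 0 = 0 := by
  unfold taylorRem
  rw [sum_eq_single_of_mem 0 ((mem_lowIdx hs.pos _ _).2 (by simpa [sdeg] using hN))]
  · simp [monom, mfact, mD_zero]
  · intro k _ hk; obtain ⟨i, hi⟩ := Function.ne_iff.1 hk
    have : monom k (0 : ℝ^d) = 0 := prod_eq_zero (mem_univ i) (by simpa using hi); rw [this]; simp

lemma taylorRem_zero_left (x₀ : X) (z : ℝ^d) :
    taylorRem s b 0 F x₀ z = F (x₀ + ∑ i, z i • b i) := by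
  simp [taylorRem, lowIdx]

lemma abs_taylorRem_le (N : ℕ) : ∃ C : ℝ, 0 ≤ C ∧
    ∀ (b : Fin d → X) (D : Set X) (F : X → ℝ) (B M : ℝ), IsOpen D → SmoothOn F D → 0 ≤ B →
      0 ≤ M → IsSymb b (fun i => M ^ s i) D N B F → ∀ (x₀ : X) (z : ℝ^d),
      (∀ t ∈ Set.Icc (0 : ℝ) 1, x₀ + ∑ i, dil s t z i • b i ∈ D) → snorm s z * M ≤ 1 →
      |taylorRem s b N F x₀ z| ≤ C * B * (snorm s z * M) ^ N := by
  induction N using Nat.strong_induction_on with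
  | _ N ih =>
  rcases Nat.eq_zero_or_pos N with rfl | hN
  · refine ⟨1, zero_le_one, fun b D F B M _ _ _ _ h x₀ z hz _ => ?_⟩
    rw [taylorRem_zero_left, one_mul, pow_zero, mul_one]; refine h _ ?_
    simpa [dil] using hz 1 (by simp)
  choose C hC0 hC using fun i => ih (N - s i) (by have := hs.pos i; omega)
  refine ⟨∑ i, C i * s i, sum_nonneg fun i _ => mul_nonneg (hC0 i) (Nat.cast_nonneg _), ?_⟩
  intro b D F B M hD hF hB hM h x₀ z hz hzM
  have hn := snorm_nonneg (s := s) z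
  have h0 : x₀ ∈ D := by
    have := hz 0 (by simp); have h1 : ∀ i, dil s 0 z i = 0 := fun i => by simp [dil, (hs.pos i).ne']
    simpa [h1] using this
  have hderiv : ∀ t ∈ Set.Icc (0 : ℝ) 1, HasDerivWithinAt (fun t => taylorRem s b N F x₀ (dil s t
    z)) (∑ i, taylorRem s b (N - s i) (lineD (b i) F) x₀ (dil s t z) * ((s i : ℝ) * t ^ (s i - 1) *
    z i)) (Set.Icc 0 1) t := by
    intro t ht; have h1 := hasFDerivAt_taylorRem hD hF h0 (hz t ht) N
    have h2 : HasDerivAt (fun t => dil s t z) (fun i => (s i : ℝ) * t ^ (s i - 1) * z i) t := by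
      refine hasDerivAt_pi.2 fun i => ?_; exact (hasDerivAt_pow (s i) t).mul_const (z i)
    have h3 := h1.comp_hasDerivAt t h2; refine (h3.congr_deriv ?_).hasDerivWithinAt; simp
  have hbound : ∀ t ∈ Set.Ico (0 : ℝ) 1, ‖∑ i, taylorRem s b (N - s i) (lineD (b i) F) x₀ (dil s t
    z) * ((s i : ℝ) * t ^ (s i - 1) * z i)‖ ≤ (∑ i, C i * s i) * B * (snorm s z * M) ^ N := by
    intro t ht
    have hd1 : snorm s (dil s t z) ≤ snorm s z := by
      rw [snorm_dil ht.1]; exact mul_le_of_le_one_left hn ht.2.le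
    refine (norm_sum_le _ _).trans ?_; rw [mul_assoc, sum_mul]; refine sum_le_sum fun i _ => ?_
    have hsymb : IsSymb b (fun i => M ^ s i) D (N - s i) (B * M ^ s i) (lineD (b i) F) := by
      obtain ⟨N', rfl⟩ := Nat.exists_eq_add_of_lt hN; have hsi := hs.pos i; have := h
      rw [show 0 + N' + 1 = N' + 1 by ring] at this ⊢; exact (this.2 i).of_le (by omega)
    have h1 := hC i b D (lineD (b i) F) (B * M ^ s i) M hD (contDiffOn_lineD hD hF _)
      (by positivity) hM hsymb x₀ (dil s t z) (fun t' ht' => by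
        have h2 : ∀ i, dil s t' (dil s t z) i = dil s (t' * t) z i := fun i => by
          simp [dil, mul_pow, mul_assoc]
        simp only [h2]; exact hz _ ⟨mul_nonneg ht'.1 ht.1, mul_le_one₀ ht'.2 ht.1 ht.2.le⟩)
      ((mul_le_mul_of_nonneg_right hd1 hM).trans hzM)
    have h2 : |(s i : ℝ) * t ^ (s i - 1) * z i| ≤ s i * snorm s z ^ s i := by
      rw [abs_mul, abs_mul, abs_of_nonneg (pow_nonneg ht.1 _), abs_of_nonneg (Nat.cast_nonneg _)]
      refine mul_le_mul (mul_le_of_le_one_right (Nat.cast_nonneg _) (pow_le_one₀ ht.1 ht.2.le))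
        (abs_le_snorm_pow z i) (abs_nonneg _) (Nat.cast_nonneg _)
    rw [norm_eq_abs, abs_mul]; have hzM0 : 0 ≤ snorm s z * M := mul_nonneg hn hM; have hCi := hC0 i
    calc _ ≤ (C i * (B * M ^ s i) * (snorm s z * M) ^ (N - s i)) * (s i * snorm s z ^ s i) := by
          refine mul_le_mul (h1.trans ?_) h2 (abs_nonneg _) (by positivity)
          refine mul_le_mul_of_nonneg_left (pow_le_pow_left₀ (mul_nonneg (snorm_nonneg _) hM) ?_ _)
            (by positivity)
          exact mul_le_mul_of_nonneg_right hd1 hM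
      _ = C i * s i * (B * (snorm s z * M) ^ (s i + (N - s i))) := by rw [pow_add, mul_pow]; ring
      _ ≤ C i * s i * (B * (snorm s z * M) ^ N) := by
          refine mul_le_mul_of_nonneg_left (mul_le_mul_of_nonneg_left ?_ hB) (by positivity)
          exact pow_le_pow_of_le_one hzM0 hzM (by omega)
  have := norm_image_sub_le_of_norm_deriv_le_segment_01' hderiv hbound
  have e1 : dil s 1 z = z := by funext i; simp [dil]
  have e0 : dil s 0 z = 0 := by funext i; simp [dil, (hs.pos i).ne']
  rw [e1, e0, taylorRem_zero_right hN, sub_zero] at this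
  exact this

lemma hatK_eq_taylorRem (r : ℤ) (K : ℝ^d → ℝ) (x y : ℝ^d) :
    RGraph.hatK s r K x y = taylorRem s (fun i => Pi.single i 1) r.toNat K (-x) y := by
  unfold RGraph.hatK taylorRem
  have : -x + ∑ i, y i • (Pi.single i 1 : ℝ^d) = y - x := by funext j; simp [Pi.single_apply]; ring
  rw [this]
  rfl

end Taylor

/-! ### Cutoff functions -/

lemma isCompact_snorm_le (ρ : ℝ) : IsCompact {x : ℝ^d | snorm s x ≤ ρ} := by
  refine (isCompact_univ_pi fun i => isCompact_Icc (a := -(ρ ^ s i)) (b := ρ ^ s i)).of_isClosed_subset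
    (isClosed_le continuous_snorm continuous_const) fun x hx i _ => ?_
  exact abs_le.1 ((abs_le_snorm_pow x i).trans (pow_le_pow_left₀ (snorm_nonneg _) hx _))

lemma hasCompactSupport_of_snorm {Y : Type*} [Zero Y] {f : ℝ^d → Y}
    {ρ : ℝ} (h : ∀ x, ρ < snorm s x → f x = 0) : HasCompactSupport f :=
  HasCompactSupport.intro (isCompact_snorm_le ρ) fun x hx => h x (by simpa using hx)

/-- A smooth cutoff: `1` on the unit ball, `0` off the ball of radius `2`. -/
structure IsCutoff (s : ℕ^d) (χ : ℝ^d → ℝ) : Prop where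
  smooth : Smooth χ
  nonneg : ∀ x, 0 ≤ χ x
  le_one : ∀ x, χ x ≤ 1
  one : ∀ x, snorm s x ≤ 1 → χ x = 1
  zero : ∀ x, 2 ≤ snorm s x → χ x = 0

lemma exists_cutoff : ∃ χ, IsCutoff s χ := by
  have h1 : IsClosed {x : ℝ^d | 2 ≤ snorm s x} := isClosed_le continuous_const continuous_snorm
  have h2 : IsClosed {x : ℝ^d | snorm s x ≤ 1} := isClosed_le continuous_snorm continuous_const
  obtain ⟨f, h0, h1, h01⟩ := exists_contMDiffMap_zero_one_of_isClosed (n := (⊤ : ℕ∞))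
    (modelWithCornersSelf ℝ ℝ^d) h1 h2 (Set.disjoint_left.2 fun x hx hx' => by
      simp only [Set.mem_ofPred_eq] at hx hx'; linarith)
  exact ⟨f, f.contMDiff.contDiff, fun x => (h01 x).1, fun x => (h01 x).2,
    fun x hx => h1 hx, fun x hx => h0 hx⟩

/-- A fixed cutoff function. -/
def chi (s : ℕ^d) : ℝ^d → ℝ := Classical.epsilon (IsCutoff s)

lemma isCutoff_chi : IsCutoff s (chi s) := Classical.epsilon_spec exists_cutoff

/-- The cutoff at scale `2⁻ⁿ`. -/
def chiN (s : ℕ^d) (n : ℤ) (x : ℝ^d) : ℝ := chi s (dil s (2 ^ n) x)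

lemma chiN_mem (n : ℤ) (x : ℝ^d) : chiN s n x ∈ Set.Icc 0 1 :=
  ⟨isCutoff_chi.nonneg _, isCutoff_chi.le_one _⟩

lemma chiN_eq_one {n : ℤ} {x : ℝ^d} (h : snorm s x ≤ 2 ^ (-n)) : chiN s n x = 1 := by
  refine isCutoff_chi.one _ ?_
  rw [snorm_dil (by positivity)]
  rw [zpow_neg] at h
  calc (2 : ℝ) ^ n * snorm s x ≤ 2 ^ n * (2 ^ n)⁻¹ := by gcongr
    _ = 1 := mul_inv_cancel₀ (by positivity)

lemma chiN_eq_zero {n : ℤ} {x : ℝ^d} (h : 2 ^ (-n + 1) ≤ snorm s x) : chiN s n x = 0 := by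
  refine isCutoff_chi.zero _ ?_
  rw [snorm_dil (by positivity)]
  rw [two_zpow_add, zpow_neg, zpow_one] at h
  calc (2 : ℝ) = 2 ^ n * ((2 ^ n)⁻¹ * 2) := by
        rw [← mul_assoc, mul_inv_cancel₀ (by positivity), one_mul]
    _ ≤ 2 ^ n * snorm s x := by gcongr

/-- The dilation as a continuous linear map. -/
def dilL (s : ℕ^d) (t : ℝ) : ℝ^d →L[ℝ] ℝ^d :=
  ContinuousLinearMap.pi fun i => (t ^ s i) • ContinuousLinearMap.proj i

lemma dilL_apply (t : ℝ) (x : ℝ^d) : dilL s t x = dil s t x := by funext i; simp [dilL, dil]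

/-- The coordinate directions. -/
abbrev stdB (i : Fin d) : ℝ^d := Pi.single i 1

lemma contDiff_comp_dil {f : ℝ^d → ℝ} (hf : Smooth f) (t : ℝ) : Smooth fun x => f (dil s t x) := by
  simp only [← dilL_apply]
  exact hf.comp (dilL s t).contDiff

lemma contDiff_chiN (n : ℤ) : Smooth (chiN s n) := contDiff_comp_dil isCutoff_chi.smooth _

lemma IsSymb.comp_dil {f : ℝ^d → ℝ} {μ : ℝ^d} {m : ℕ} {B t : ℝ} (ht : 0 ≤ t)
    (hf : Smooth f) (h : IsSymb stdB μ Set.univ m B f) :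
    IsSymb stdB (fun i => t ^ s i * μ i) Set.univ m B (fun x => f (dil s t x)) := by
  induction m generalizing B f with
  | zero => exact fun x _ => h _ trivial
  | succ m ih =>
    refine ⟨fun x _ => h.1 _ trivial, fun i => ?_⟩
    have hsm := (contDiffOn_univ.1 (contDiffOn_lineD isOpen_univ hf.contDiffOn (stdB i)))
    have h1 := (ih hsm (h.2 i)).const_mul isOpen_univ (contDiff_comp_dil hsm t).contDiffOn (t ^ s i)
    rw [abs_of_nonneg (by positivity), show t ^ s i * (B * μ i) = B * (t ^ s i * μ i) by ring] at h1
    refine h1.congr isOpen_univ fun x _ => ?_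
    have h2 := lineD_comp_apply (dilL s t) (stdB i) (x := x) (f := f)
      (hf.differentiable (by simp) _)
    have h3 : dilL s t (stdB i) = t ^ s i • stdB i := by
      funext j; rw [dilL_apply]
      by_cases hj : j = i
      · subst hj; simp [dil]
      · simp [dil, hj]
    simp only [dilL_apply] at h2; rw [h2, ← dilL_apply t (stdB i), h3]; simp [lineD]

lemma exists_isSymb {f : ℝ^d → ℝ} (hf : Smooth f) (hc : HasCompactSupport f) (m : ℕ) :
    ∃ B, 0 ≤ B ∧ IsSymb stdB (fun _ => 1) Set.univ m B f := by
  induction m generalizing f with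
  | zero =>
    obtain ⟨B, hB⟩ := hc.exists_bound_of_continuous hf.continuous
    exact ⟨B, (norm_nonneg _).trans (hB 0), fun x _ => hB x⟩
  | succ m ih =>
    obtain ⟨B, hB⟩ := hc.exists_bound_of_continuous hf.continuous
    choose B' hB' h' using fun i => ih (f := lineD (stdB i) f)
      (contDiffOn_univ.1 (contDiffOn_lineD isOpen_univ hf.contDiffOn _)) (hc.fderiv_apply (𝕜 := ℝ) _)
    have hB0 := (norm_nonneg _).trans (hB 0)
    have hB'0 : 0 ≤ ∑ i, B' i := sum_nonneg fun i _ => hB' i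
    refine ⟨B + ∑ i, B' i, by positivity, fun x _ => (hB x).trans (by linarith), fun i => ?_⟩
    refine (h' i).mono (fun _ => zero_le_one) (fun _ => le_rfl) (hB' i) ?_ subset_rfl
    have := single_le_sum (f := B') (fun i _ => hB' i) (mem_univ i); linarith

lemma exists_isSymb_comp_dil {f : ℝ^d → ℝ} (hf : Smooth f)
    (hc : HasCompactSupport f) (m : ℕ) : ∃ B, 0 ≤ B ∧ ∀ t : ℝ, 0 ≤ t →
      IsSymb stdB (fun i => t ^ s i) Set.univ m B (fun x => f (dil s t x)) := by
  obtain ⟨B, hB, h⟩ := exists_isSymb hf hc m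
  exact ⟨B, hB, fun t ht => by simpa using h.comp_dil (s := s) ht hf⟩

lemma exists_isSymb_chiN (m : ℕ) : ∃ B, 0 ≤ B ∧ ∀ n : ℤ,
    IsSymb stdB (fun i => ((2 : ℝ) ^ n) ^ s i) Set.univ m B (chiN s n) := by
  obtain ⟨B, hB, h⟩ := exists_isSymb_comp_dil (s := s) isCutoff_chi.smooth
    (hasCompactSupport_of_snorm (ρ := 2) fun x hx => isCutoff_chi.zero x hx.le) m
  exact ⟨B, hB, fun n => h _ (by positivity)⟩

lemma integral_comp_dil {t : ℝ} (ht : 0 < t) (f : ℝ^d → ℝ) :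
    ∫ x, f (dil s t x) = (t ^ sdim s)⁻¹ * ∫ x, f x := by
  have hdet : (Matrix.diagonal fun i => t ^ s i).det = t ^ sdim s := by
    rw [Matrix.det_diagonal, prod_pow_eq_pow_sum, sdim]
  have h1 := smul_map_diagonal_volume_pi (D := fun i => t ^ s i) (by rw [hdet]; positivity)
  have hfun : ∀ x, Matrix.toLin' (Matrix.diagonal fun i => t ^ s i) x = dil s t x := fun x => by
    funext i; simp [dil, Matrix.mulVec_diagonal]
  have hemb : MeasurableEmbedding (Matrix.toLin' (Matrix.diagonal fun i : Fin d => t ^ s i)) := by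
    refine (LinearMap.continuous_of_finiteDimensional _).measurableEmbedding ?_; intro x y hxy
    rw [hfun, hfun] at hxy; funext i; have := congrFun hxy i; simp only [dil] at this
    exact mul_left_cancel₀ (by positivity) this
  conv_rhs => rw [← h1]
  rw [integral_smul_measure, hemb.integral_map, hdet, ENNReal.toReal_ofReal (abs_nonneg _),
    abs_of_pos (by positivity), smul_eq_mul, ← mul_assoc, inv_mul_cancel₀ (by positivity), one_mul]
  simp only [hfun]

/-! ### Functions dual to the monomials -/

/-- Smooth functions supported in an annulus, dual to the monomials of scaled degree `< N`. -/
structure IsDual (s : ℕ^d) (N : ℕ) (ρ : ℕ^d → ℝ^d → ℝ) : Prop where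
  smooth : ∀ k, Smooth (ρ k)
  support : ∀ k x, ρ k x ≠ 0 → 1 ≤ snorm s x ∧ snorm s x ≤ 4
  dual : ∀ j ∈ lowIdx s N, ∀ k ∈ lowIdx s N, ∫ x, monom j x * ρ k x = if j = k then 1 else 0

lemma contDiff_monom (k : ℕ^d) : Smooth (monom k) := by
  unfold monom
  exact contDiff_prod fun i _ => (contDiff_apply ℝ ℝ i).pow _

lemma eq_zero_of_polynomial_eq_zero {U : Set ℝ^d} (hU : IsOpen U) (hne : U.Nonempty) (S : Finset
    ℕ^d) (c : ℕ^d → ℝ) (h : ∀ x ∈ U, ∑ k ∈ S, c k * monom k x = 0) : ∀ k ∈ S, c k = 0 := by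
  obtain ⟨x, hx⟩ := hne
  obtain ⟨ε, hε, hball⟩ := Metric.isOpen_iff.1 hU x hx
  let P : MvPolynomial (Fin d) ℝ :=
    ∑ k ∈ S, MvPolynomial.monomial (Finsupp.equivFunOnFinite.symm k) (c k)
  have hP : P = 0 := by
    refine MvPolynomial.funext_set (fun i => Metric.ball (x i) ε) (fun i => ?_) fun y hy => ?_
    · rw [ball_eq_Ioo]; exact Set.Ioo_infinite (by linarith)
    · have hy' : y ∈ U := hball ((ball_pi x hε).symm ▸ hy); rw [map_zero, ← h y hy']
      simp [P, MvPolynomial.eval_monomial, monom, Finsupp.prod_fintype]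
  intro k hk
  have h1 := congrArg (MvPolynomial.coeff (Finsupp.equivFunOnFinite.symm k)) hP
  rw [MvPolynomial.coeff_zero, MvPolynomial.coeff_sum, sum_eq_single_of_mem k hk] at h1
  · simpa using h1
  · intro j _ hj; rw [MvPolynomial.coeff_monomial, if_neg]
    exact fun h => hj (Finsupp.equivFunOnFinite.symm.injective h)

lemma exists_dual (N : ℕ) : ∃ ρ, IsDual s N ρ := by
  classical
  let w : ℝ^d → ℝ := fun x => (chiN s (-1) x - chiN s 0 x) ^ 2
  have hw : Smooth w := ((contDiff_chiN _).sub (contDiff_chiN _)).pow 2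
  have hwsupp : ∀ x, w x ≠ 0 → 1 ≤ snorm s x ∧ snorm s x ≤ 4 := by
    intro x hx; constructor
    · by_contra! h; refine hx ?_; simp only [w]
      rw [chiN_eq_one (by norm_num; linarith), chiN_eq_one (by norm_num; linarith)]; simp
    · by_contra! h; refine hx ?_; simp only [w]
      rw [chiN_eq_zero (by norm_num; linarith), chiN_eq_zero (by norm_num; linarith)]; simp
  have hsupp' : ∀ (g : ℝ^d → ℝ), HasCompactSupport fun x => g x * w x := fun g =>
    hasCompactSupport_of_snorm (ρ := 4) fun x hx => by
      have : w x = 0 := by by_contra h; linarith [(hwsupp x h).2]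
      simp [this]
  have hne : {x | w x ≠ 0}.Nonempty := by
    obtain ⟨i⟩ : Nonempty (Fin d) := by
      by_contra h; rw [not_nonempty_iff] at h; simpa [sdim] using hs.dim
    refine ⟨dil s 2 (stdB i), ?_⟩
    have h1 : snorm s (stdB i : ℝ^d) = 1 := by
      unfold snorm; rw [sum_eq_single i]
      · simp
      · intro j _ hj; have := hs.pos j; simp [hj, this.ne']
      · simp
    have h2 : snorm s (dil s 2 (stdB i)) = 2 := by rw [snorm_dil (by norm_num), h1, mul_one]
    simp only [w, Set.mem_ofPred_eq]
    rw [chiN_eq_one (by norm_num [h2]), chiN_eq_zero (by norm_num [h2])]; simp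
  have hopen : IsOpen {x | w x ≠ 0} := isOpen_ne_fun hw.continuous continuous_const
  let S := lowIdx s N
  let ρ' : (S → ℝ) → ℝ^d → ℝ := fun c x => (∑ k : S, c k * monom k.1 x) * w x
  have hρ' : ∀ c, Smooth (ρ' c) := fun c =>
    (ContDiff.sum fun k _ => contDiff_const.mul (contDiff_monom _)).mul hw
  have hin : ∀ (g : ℝ^d → ℝ), Continuous g → Integrable fun x => g x * w x := fun g hg =>
    (hg.mul hw.continuous).integrable_of_hasCompactSupport (hsupp' g)
  have hmc : ∀ k : ℕ^d, Continuous (monom k) := fun k => (contDiff_monom k).continuous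
  let Φ : (S → ℝ) →ₗ[ℝ] (S → ℝ) := ∑ k : S, LinearMap.pi fun j : S =>
    (∫ x, (monom j.1 x * monom k.1 x) * w x) • LinearMap.proj k
  have hΦ : ∀ c j, Φ c j = ∫ x, monom j.1 x * ρ' c x := by
    intro c j
    have h1 : ∀ x, monom j.1 x * ρ' c x = ∑ k : S, c k * ((monom j.1 x * monom k.1 x) * w x) := by
      intro x; simp only [ρ', sum_mul, mul_sum]; exact sum_congr rfl fun k _ => by ring
    simp only [h1]
    rw [integral_finsetSum _ fun k _ => (hin (fun x => monom j.1 x * monom k.1 x)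
      ((hmc _).mul (hmc _))).const_mul _]
    simp only [Φ, LinearMap.sum_apply, Finset.sum_apply, LinearMap.pi_apply, LinearMap.smul_apply,
      LinearMap.proj_apply, smul_eq_mul]
    exact sum_congr rfl fun k _ => by rw [integral_const_mul, mul_comm]
  have hinj : Function.Injective Φ := by
    refine (injective_iff_map_eq_zero Φ).2 fun c hc => ?_
    let P : ℝ^d → ℝ := fun x => ∑ k : S, c k * monom k.1 x
    have hPc : Continuous P := continuous_finsetSum _ fun k _ => continuous_const.mul (hmc _)
    have h0 : ∫ x, (P x * P x) * w x = 0 := by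
      have h1 : ∀ x, (P x * P x) * w x = ∑ j : S, c j * (monom j.1 x * ρ' c x) := by
        intro x; have : ρ' c x = P x * w x := rfl; simp only [this]
        conv_lhs => rw [mul_assoc]
        simp only [P]; rw [sum_mul]; exact sum_congr rfl fun k _ => by ring
      simp only [h1]; rw [integral_finsetSum]
      · refine sum_eq_zero fun j _ => ?_; rw [integral_const_mul, ← hΦ, hc]; simp
      · intro j _; refine Integrable.const_mul ?_ _
        have := hin (fun x => monom j.1 x * P x) ((hmc _).mul hPc)
        simpa [ρ', P, mul_assoc] using this
    have hz : ∀ x, w x ≠ 0 → P x = 0 := by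
      intro x hx; by_contra hPx
      have := ((hPc.mul hPc).mul hw.continuous).integral_pos_of_hasCompactSupport_nonneg_nonzero (μ
        := volume) (hsupp' fun x => P x * P x) (fun y => mul_nonneg (mul_self_nonneg _) (sq_nonneg
        _)) (x := x) (mul_ne_zero (mul_ne_zero hPx hPx) hx)
      exact this.ne' h0
    let c' : ℕ^d → ℝ := fun k => if h : k ∈ S then c ⟨k, h⟩ else 0
    have h3 := eq_zero_of_polynomial_eq_zero hopen hne S c' fun x hx => by
      rw [← hz x hx, ← sum_coe_sort]; exact sum_congr rfl fun k _ => by simp [c']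
    funext k; have := h3 k.1 k.2; simpa [c'] using this
  have hsurj : Function.Surjective Φ := LinearMap.injective_iff_surjective.1 hinj
  choose c hc using fun k : S => hsurj (Pi.single k 1)
  refine ⟨fun k => if h : k ∈ S then ρ' (c ⟨k, h⟩) else 0, ⟨fun k => ?_, fun k x hx => ?_,
    fun j hj k hk => ?_⟩⟩
  · split_ifs
    · exact hρ' _
    · exact contDiff_const
  · split_ifs at hx with h
    · exact hwsupp x (right_ne_zero_of_mul hx)
    · simp at hx
  · rw [dif_pos hk]; rw [← hΦ (c ⟨k, hk⟩) ⟨j, hj⟩, hc]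
    by_cases hjk : j = k
    · subst hjk; simp
    · rw [if_neg hjk, Pi.single_eq_of_ne]; simpa using hjk

/-- A fixed dual family. -/
def rho (s : ℕ^d) (N : ℕ) : ℕ^d → ℝ^d → ℝ := Classical.epsilon (IsDual s N)

lemma isDual_rho (N : ℕ) : IsDual s N (rho s N) := Classical.epsilon_spec (exists_dual N)

/-- The dual family at scale `2⁻ⁿ`. -/
def rhoN (s : ℕ^d) (N : ℕ) (n : ℤ) (k : ℕ^d) (x : ℝ^d) : ℝ :=
  ((2 : ℝ) ^ n) ^ (sdim s + sdeg s k) * rho s N k (dil s (2 ^ n) x)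

lemma contDiff_rhoN (N : ℕ) (n : ℤ) (k : ℕ^d) : Smooth (rhoN s N n k) :=
  contDiff_const.mul (contDiff_comp_dil ((isDual_rho N).smooth k) _)

lemma rhoN_support {N : ℕ} {n : ℤ} {k : ℕ^d}
    {x : ℝ^d} (h : rhoN s N n k x ≠ 0) : 2 ^ (-n) ≤ snorm s x ∧ snorm s x ≤ 2 ^ (-n + 2) := by
  have h1 := (isDual_rho N).support k _ (right_ne_zero_of_mul h)
  rw [snorm_dil (by positivity)] at h1
  have h2 : (0 : ℝ) < 2 ^ n := by positivity
  have h3 : (2 : ℝ) ^ (-n) * 2 ^ n = 1 := by rw [← two_zpow_add]; simp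
  have h4 : (2 : ℝ) ^ (-n + 2) = 2 ^ (-n) * 4 := by rw [two_zpow_add]; norm_num
  rw [h4]
  have h5 : (0 : ℝ) < 2 ^ (-n) := by positivity
  constructor <;> nlinarith

lemma integral_monom_mul_rhoN {N : ℕ} (n : ℤ) {j k : ℕ^d} (hj : j ∈ lowIdx s N) (hk : k ∈ lowIdx s
    N) : ∫ x, monom j x * rhoN s N n k x = if j = k then 1 else 0 := by
  have h2 : (0 : ℝ) < 2 ^ n := by positivity
  have h1 : ∀ x, monom j x * rhoN s N n k x = (((2 : ℝ) ^ n) ^ (sdim s + sdeg s k) * (((2 : ℝ) ^ n)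
    ^ sdeg s j)⁻¹) * (monom j (dil s (2 ^ n) x) * rho s N k (dil s (2 ^ n) x)) := by
    intro x; rw [monom_dil, rhoN]; field_simp
  simp only [h1]
  rw [integral_const_mul, integral_comp_dil h2 (fun x => monom j x * rho s N k x),
    (isDual_rho N).dual j hj k hk]
  split_ifs with h
  · subst h; rw [pow_add]; field_simp
  · simp

lemma exists_isSymb_rhoN (N m : ℕ) (k : ℕ^d) : ∃ B, 0 ≤ B ∧ ∀ n : ℤ, IsSymb stdB (fun i => ((2 : ℝ)
    ^ n) ^ s i) Set.univ m (((2 : ℝ) ^ n) ^ (sdim s + sdeg s k) * B) (rhoN s N n k) := by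
  have hsm := (isDual_rho N).smooth k
  obtain ⟨B, hB, h⟩ := exists_isSymb_comp_dil (s := s) hsm
    (hasCompactSupport_of_snorm (ρ := 4) fun x hx => by
      by_contra h0; linarith [((isDual_rho N).support k x h0).2]) m
  refine ⟨B, hB, fun n => ?_⟩
  have := (h (2 ^ n) (by positivity)).const_mul isOpen_univ
    (contDiff_comp_dil hsm _).contDiffOn (((2 : ℝ) ^ n) ^ (sdim s + sdeg s k))
  rwa [abs_of_nonneg (by positivity)] at this

section Kernel

/-! ### Bounds on kernels -/

lemma mD_eq_zero {D : Set X} {f : X → ℝ}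
    (b : Fin d → X) (hD : IsOpen D) (h : ∀ x ∈ D, f x = 0) (k : ℕ^d) :
    ∀ x ∈ D, mD b k f x = 0 := by
  unfold mD
  induction List.finRange d with
  | nil => exact h
  | cons i l ih =>
    simp only [List.foldr_cons]
    generalize k i = n
    revert ih
    generalize List.foldr (fun i g => (lineD (b i))^[k i] g) f l = g
    intro hg
    induction n generalizing g with
    | zero => exact hg
    | succ n ih => exact ih _ (lineD_eq_zero_of_eqOn hD hg _)

lemma isOpen_lt_snorm (ρ : ℝ) : IsOpen {x : ℝ^d | ρ < snorm s x} :=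
  isOpen_lt continuous_const continuous_snorm

lemma isOpen_snorm_lt (ρ : ℝ) : IsOpen {x : ℝ^d | snorm s x < ρ} :=
  isOpen_lt continuous_snorm continuous_const

/-- The quantitative content of `IsKernel`, with `N` an upper bound for `‖K‖_{a;p}`. -/
structure KerBound (s : ℕ^d) (a : ℝ) (p : ℕ) (N : ℝ) (K : ℝ^d → ℝ) : Prop where
  smooth : SmoothOn K {0}ᶜ
  support : ∀ x, 1 < snorm s x → K x = 0
  nonneg : 0 ≤ N
  bound : ∀ k, sdeg s k < p → ∀ x, x ≠ 0 → |multiD k K x| ≤ N * snorm s x ^ (-(a + sdeg s k))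

lemma kerBound_of_kernelNorm {a : ℝ} {p : ℕ} {N : ℝ≥0}
    {K : ℝ^d → ℝ} (hK : SmoothOn K {0}ᶜ) (hsupp : ∀ x, 1 < snorm s x → K x = 0)
    (hN : kernelNorm s a p K ≤ N) : KerBound s a p N K := by
  refine ⟨hK, hsupp, N.2, fun k hk x hx => ?_⟩
  have hpos := snorm_pos hx
  rcases lt_or_ge 1 (snorm s x) with h1 | h1
  · rw [multiD_eq_mD, mD_eq_zero _ (isOpen_lt_snorm 1) hsupp k x h1]; simp only [abs_zero]
    have := N.2; positivity
  · have h2 : ENNReal.ofReal (snorm s x ^ (a + (sdeg s k : ℝ)) * |multiD k K x|) ≤ N := by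
      refine le_trans ?_ hN; unfold kernelNorm
      refine le_trans ?_ (le_iSup₂ (f := fun (x : ℝ^d) (_ : x ≠ 0 ∧ snorm s x ≤ 1) =>
        ⨆ (k : ℕ^d) (_ : sdeg s k < p), ENNReal.ofReal (snorm s x ^ (a + (sdeg s k : ℝ)) *
          |multiD k K x|)) x ⟨hx, h1⟩)
      exact le_iSup₂ (f := fun (k : ℕ^d) (_ : sdeg s k < p) =>
        ENNReal.ofReal (snorm s x ^ (a + (sdeg s k : ℝ)) * |multiD k K x|)) k hk
    rw [ENNReal.ofReal_le_iff_le_toReal (by simp)] at h2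
    rw [rpow_neg hpos.le, ← div_eq_mul_inv, le_div_iff₀ (by positivity), mul_comm]; simpa using h2

lemma IsKernel.kerBound {a : ℝ} {K : ℝ^d → ℝ} (h : IsKernel s a K)
    (p : ℕ) : KerBound s a p (kernelNorm s a p K).toReal K :=
  kerBound_of_kernelNorm (N := (kernelNorm s a p K).toNNReal) h.smooth h.support
    (by rw [ENNReal.coe_toNNReal (h.finite p).ne])

namespace KerBound

variable {a : ℝ} {p : ℕ} {N : ℝ} {K : ℝ^d → ℝ}

lemma mono_exponent (h : KerBound s a p N K) {a' : ℝ} (ha : a ≤ a') : KerBound s a' p N K := by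
  refine ⟨h.smooth, h.support, h.nonneg, fun k hk x hx => ?_⟩
  have hpos := snorm_pos hx
  rcases lt_or_ge 1 (snorm s x) with h1 | h1
  · rw [multiD_eq_mD, mD_eq_zero _ (isOpen_lt_snorm 1) h.support k x h1]; simp only [abs_zero]
    have := h.nonneg; positivity
  · refine (h.bound k hk x hx).trans (mul_le_mul_of_nonneg_left ?_ h.nonneg)
    exact rpow_le_rpow_of_exponent_ge hpos h1 (by linarith)

lemma mono {N' : ℝ} (hN : N ≤ N') {p' : ℕ} (hp : p' ≤ p) (h : KerBound s a p N K) :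
    KerBound s a p' N' K :=
  ⟨h.smooth, h.support, h.nonneg.trans hN, fun k hk x hx =>
    (h.bound k (by omega) x hx).trans (mul_le_mul_of_nonneg_right hN
      (rpow_nonneg (snorm_nonneg _) _))⟩

lemma abs_le (h : KerBound s a p N K) (hp : 0 < p) {x : ℝ^d} (hx : x ≠ 0) :
    |K x| ≤ N * snorm s x ^ (-a) := by
  have := h.bound 0 (by simpa [sdeg] using hp) x hx
  rw [multiD_eq_mD, mD_zero] at this
  simpa [sdeg] using this

lemma isSymb_multiD (ha : 0 ≤ a) (h : KerBound s a p N K) {m : ℕ} (k₀ : ℕ^d) (hm : sdeg s k₀ + m *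
    sdim s < p) {Λ : ℝ} (hΛ : 0 < Λ) : IsSymb stdB (fun i => Λ ^ s i) {x | Λ⁻¹ < snorm s x} m (N * Λ
    ^ a * Λ ^ sdeg s k₀) (multiD k₀ K) := by
  have hsub : {x : ℝ^d | Λ⁻¹ < snorm s x} ⊆ {0}ᶜ := lt_snorm_subset (by positivity)
  refine isSymb_mD (isOpen_lt_snorm _) (h.smooth.mono hsub) k₀ fun k hk x hx => ?_
  refine (h.bound k (by omega) x (hsub hx)).trans ?_
  rw [mul_assoc, ← rpow_natCast, ← rpow_add hΛ]
  refine mul_le_mul_of_nonneg_left ?_ h.nonneg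
  rw [rpow_neg (snorm_nonneg _), ← inv_rpow (snorm_nonneg _)]
  exact rpow_le_rpow (inv_nonneg.2 (snorm_nonneg _)) (inv_le_of_inv_le₀ hΛ hx.le) (by positivity)

lemma isSymb (ha : 0 ≤ a) (h : KerBound s a p N K) {m : ℕ} (hm : m * sdim s < p) {Λ : ℝ}
    (hΛ : 0 < Λ) : IsSymb stdB (fun i => Λ ^ s i) {x | Λ⁻¹ < snorm s x} m (N * Λ ^ a) K := by
  have := isSymb_multiD ha h 0 (by simpa [sdeg] using hm) hΛ
  rw [multiD_eq_mD, mD_zero] at this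
  simpa [sdeg] using this

end KerBound

/-! ### Integrals of powers -/

lemma volume_singleton_zero {s : ℕ^d} [hs : Scaling s] : volume ({0} : Set ℝ^d) = 0 := by
  obtain ⟨i⟩ : Nonempty (Fin d) := by
    by_contra h; rw [not_nonempty_iff] at h; simpa [sdim] using hs.dim
  have : Nontrivial ℝ^d := @Function.nontrivial _ _ ⟨i⟩ _
  simp

lemma ae_ne_zero {s : ℕ^d} [hs : Scaling s] : ∀ᵐ x : ℝ^d, x ≠ 0 := by
  rw [ae_iff]; simpa using volume_singleton_zero

lemma aestronglyMeasurable_of_continuousOn {s : ℕ^d} [hs : Scaling s] {f : ℝ^d → ℝ}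
    (hf : ContinuousOn f {0}ᶜ) : AEStronglyMeasurable f volume := by
  have h1 := hf.aestronglyMeasurable (μ := volume) (measurableSet_singleton (0 : ℝ^d)).compl
  rwa [Measure.restrict_eq_self_of_ae_mem] at h1
  filter_upwards [ae_ne_zero] with x hx using hx

lemma abs_integral_le_of_lintegral {f : ℝ^d → ℝ} {g : ℝ^d → ℝ} {C N : ℝ}
    (hC : 0 ≤ C) (hN : 0 ≤ N) (hfg : ∀ᵐ x, |f x| ≤ N * g x)
    (hg : ∫⁻ x, ENNReal.ofReal (g x) ≤ ENNReal.ofReal C) :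
    |∫ x, f x| ≤ N * C ∧ ∫⁻ x, ENNReal.ofReal |f x| < ⊤ := by
  have h1 : ∫⁻ x, ENNReal.ofReal |f x| ≤ ENNReal.ofReal (N * C) := by
    calc ∫⁻ x, ENNReal.ofReal |f x| ≤ ∫⁻ x, ENNReal.ofReal N * ENNReal.ofReal (g x) := by
          refine lintegral_mono_ae ?_; filter_upwards [hfg] with x hx; rw [← ENNReal.ofReal_mul hN]
          exact ENNReal.ofReal_le_ofReal hx
      _ = ENNReal.ofReal N * ∫⁻ x, ENNReal.ofReal (g x) :=
          lintegral_const_mul' _ _ ENNReal.ofReal_ne_top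
      _ ≤ _ := by
          rw [ENNReal.ofReal_mul hN]; gcongr
  refine ⟨?_, h1.trans_lt ENNReal.ofReal_lt_top⟩
  have h2 := norm_integral_le_lintegral_norm (μ := volume) f
  rw [norm_eq_abs] at h2
  refine h2.trans (ENNReal.toReal_le_of_le_ofReal (by positivity) ?_)
  simpa only [norm_eq_abs] using h1

lemma abs_integral_inner_le {ε : ℝ} (hε : 0 < ε) :
    ∃ C : ℝ, 0 ≤ C ∧ ∀ (f : ℝ^d → ℝ) (N Λ : ℝ), 0 ≤ N → 0 < Λ →
      (∀ x, x ≠ 0 → |f x| ≤ N * snorm s x ^ (-(sdim s : ℝ) + ε)) →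
      (∀ x, Λ < snorm s x → f x = 0) →
      |∫ x, f x| ≤ N * (C * Λ ^ ε) ∧ ∫⁻ x, ENNReal.ofReal |f x| < ⊤ := by
  obtain ⟨C, hC⟩ := lintegral_profile_le (s := s) hε
  refine ⟨C, C.2, fun f N Λ hN hΛ hf hsupp => ?_⟩
  refine abs_integral_le_of_lintegral (g := fun x => Λ ^ ε * profile s ε Λ x)
    (mul_nonneg C.2 (by positivity)) hN ?_ ?_
  · filter_upwards [ae_ne_zero] with x hx; rcases lt_or_ge Λ (snorm s x) with h1 | h1
    · rw [hsupp x h1, abs_zero]; have := profile_nonneg (s := s) (ε := ε) hΛ x; positivity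
    · refine (hf x hx).trans (mul_le_mul_of_nonneg_left ?_ hN); have hpos := snorm_pos hx
      have h2 : snorm s x / Λ ≤ 1 := (div_le_one hΛ).2 h1
      have h3 : (snorm s x / Λ) ^ ε ≤ (snorm s x / Λ) ^ (-ε) :=
        rpow_le_rpow_of_exponent_ge (by positivity) h2 (by linarith)
      rw [profile, min_eq_left h3, rpow_add hpos, div_rpow hpos.le hΛ.le]; apply le_of_eq
      field_simp
  · simp only [ENNReal.ofReal_mul (rpow_nonneg hΛ.le ε)]
    rw [lintegral_const_mul' _ _ ENNReal.ofReal_ne_top, mul_comm (C : ℝ),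
      ENNReal.ofReal_mul (by positivity), ENNReal.ofReal_coe_nnreal]
    gcongr; exact hC Λ hΛ

lemma abs_integral_outer_le {ε : ℝ} (hε : 0 < ε) :
    ∃ C : ℝ, 0 ≤ C ∧ ∀ (f : ℝ^d → ℝ) (N Λ : ℝ), 0 ≤ N → 0 < Λ →
      (∀ x, x ≠ 0 → |f x| ≤ N * snorm s x ^ (-(sdim s : ℝ) - ε)) →
      (∀ x, snorm s x < Λ → f x = 0) →
      |∫ x, f x| ≤ N * (C * Λ ^ (-ε)) ∧ ∫⁻ x, ENNReal.ofReal |f x| < ⊤ := by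
  obtain ⟨C, hC⟩ := lintegral_profile_le (s := s) hε
  refine ⟨C, C.2, fun f N Λ hN hΛ hf hsupp => ?_⟩
  refine abs_integral_le_of_lintegral (g := fun x => Λ ^ (-ε) * profile s ε Λ x)
    (mul_nonneg C.2 (by positivity)) hN ?_ ?_
  · filter_upwards [ae_ne_zero] with x hx; rcases lt_or_ge (snorm s x) Λ with h1 | h1
    · rw [hsupp x h1, abs_zero]; have := profile_nonneg (s := s) (ε := ε) hΛ x; positivity
    · refine (hf x hx).trans (mul_le_mul_of_nonneg_left ?_ hN); have hpos := snorm_pos hx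
      have h2 : 1 ≤ snorm s x / Λ := (one_le_div hΛ).2 h1
      have h3 : (snorm s x / Λ) ^ (-ε) ≤ (snorm s x / Λ) ^ ε :=
        rpow_le_rpow_of_exponent_le h2 (by linarith)
      rw [profile, min_eq_right h3, sub_eq_add_neg, rpow_add hpos, div_rpow hpos.le hΛ.le]
      apply le_of_eq; have := rpow_pos_of_pos hΛ (-ε); field_simp
  · simp only [ENNReal.ofReal_mul (rpow_nonneg hΛ.le (-ε))]
    rw [lintegral_const_mul' _ _ ENNReal.ofReal_ne_top, mul_comm (C : ℝ),
      ENNReal.ofReal_mul (by positivity), ENNReal.ofReal_coe_nnreal]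
    gcongr; exact hC Λ hΛ

lemma integrable_of_lintegral {f : ℝ^d → ℝ} (hf : AEStronglyMeasurable f volume)
    (h : ∫⁻ x, ENNReal.ofReal |f x| < ⊤) : Integrable f := by
  refine ⟨hf, ?_⟩
  rw [hasFiniteIntegral_iff_norm]
  exact h

/-! ### Truncated moments -/

/-- The part of the prescribed moment `I_k` not carried by `K` at scales above `2⁻ⁿ`. -/
def tailMom (s : ℕ^d) (K : ℝ^d → ℝ) (I : ℕ^d → ℝ) (n : ℤ) (k : ℕ^d) :
    ℝ := I k - ∫ x, monom k x * (K x * (1 - chiN s n x))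

lemma contDiff_mul_one_sub_chiN {K : ℝ^d → ℝ}
    (hK : SmoothOn K {0}ᶜ) (n : ℤ) : Smooth fun x => K x * (1 - chiN s n x) := by
  rw [contDiff_iff_contDiffAt]
  intro x
  by_cases hx : x = 0
  · subst hx
    have h0 : (fun x => K x * (1 - chiN s n x)) =ᶠ[nhds 0] fun _ => 0 := by
      have : {x : ℝ^d | snorm s x < 2 ^ (-n)} ∈ nhds 0 := (isOpen_snorm_lt _).mem_nhds (by
          rw [Set.mem_ofPred_eq, snorm_zero]; positivity)
      filter_upwards [this] with y hy; rw [chiN_eq_one (le_of_lt hy)]; ring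
    exact contDiffAt_const.congr_of_eventuallyEq h0
  · exact (hK.contDiffAt (isOpen_compl_singleton.mem_nhds hx)).mul
      (contDiffAt_const.sub (contDiff_chiN n).contDiffAt)

variable {a : ℝ} {p : ℕ} {N : ℝ} {K : ℝ^d → ℝ} {I : ℕ^d → ℝ}

lemma abs_monom_mul_le (h : KerBound s a p N K) (hp : 0 < p) (k : ℕ^d)
    {x : ℝ^d} (hx : x ≠ 0) {c : ℝ} (hc : |c| ≤ 1) :
    |monom k x * (K x * c)| ≤ N * snorm s x ^ ((sdeg s k : ℝ) - a) := by
  have hpos := snorm_pos hx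
  rw [abs_mul, abs_mul]
  calc |monom k x| * (|K x| * |c|) ≤ snorm s x ^ sdeg s k * (N * snorm s x ^ (-a) * 1) := by
        refine mul_le_mul (abs_monom_le k x) ?_ (by positivity) (by positivity)
        refine mul_le_mul (h.abs_le hp hx) hc (abs_nonneg _) ?_; have := h.nonneg; positivity
    _ = N * snorm s x ^ ((sdeg s k : ℝ) - a) := by
        rw [sub_eq_add_neg, rpow_add hpos, rpow_natCast]; ring

lemma exists_tailMom_le {k : ℕ^d}
    (hak : a ≠ (sdim s : ℝ) + sdeg s k) : ∃ C : ℝ, 0 ≤ C ∧ ∀ (K : ℝ^d → ℝ)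
      (I : ℕ^d → ℝ) (N : ℝ) (p : ℕ), 0 < p → KerBound s a p N K →
      (a < (sdim s : ℝ) + sdeg s k → I k = ∫ x, monom k x * K x) → ∀ n : ℤ, 0 ≤ n →
      |tailMom s K I n k| ≤ C * (N + |I k|) * ((2 : ℝ) ^ n) ^ (a - sdim s - sdeg s k) := by
  have hcm := fun n (x : ℝ^d) => chiN_mem n x
  rcases lt_or_gt_of_ne hak with hlt | hgt
  · obtain ⟨C, hC0, hC⟩ := abs_integral_inner_le (s := s) (ε := (sdim s : ℝ) + sdeg s k - a)
      (by linarith)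
    refine ⟨C * 2 ^ ((sdim s : ℝ) + sdeg s k - a), by positivity, fun K I N p hp h hI n hn => ?_⟩
    have hexp : -(sdim s : ℝ) + ((sdim s : ℝ) + sdeg s k - a) = (sdeg s k : ℝ) - a := by ring
    rw [hexp] at hC
    have hbd : ∀ c : ℝ^d → ℝ, (∀ x, |c x| ≤ 1) → ∀ x, x ≠ 0 →
        |monom k x * (K x * c x)| ≤ N * snorm s x ^ ((sdeg s k : ℝ) - a) := fun c hc x hx =>
      abs_monom_mul_le h hp k hx (hc x)
    have hin : ∀ c : ℝ^d → ℝ, Continuous c → (∀ x, |c x| ≤ 1) → Integrable fun x => monom k x * (K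
      x * c x) := fun c hc hc1 => by
      refine integrable_of_lintegral (aestronglyMeasurable_of_continuousOn ?_)
        (hC _ N 1 h.nonneg one_pos (hbd c hc1) fun x hx => by rw [h.support x hx]; simp).2
      exact (contDiff_monom k).continuous.continuousOn.mul
        (h.smooth.continuousOn.mul hc.continuousOn)
    have hχ : Continuous (chiN s n) := (contDiff_chiN n).continuous
    have h1 := hin (fun _ => 1) continuous_const (by simp)
    have h2 := hin (fun x => 1 - chiN s n x) (continuous_const.sub hχ) fun x => by
      have := hcm n x; rw [abs_le]; constructor <;> linarith [this.1, this.2]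
    have h3 : tailMom s K I n k = ∫ x, monom k x * (K x * chiN s n x) := by
      rw [tailMom, hI hlt]; simp only [mul_one] at h1; rw [← integral_sub h1 h2]
      congr 1; funext x; ring
    rw [h3]
    have h4 := (hC (fun x => monom k x * (K x * chiN s n x)) N (2 ^ (-n + 1)) h.nonneg (by positivity)
      (hbd _ fun x => by rw [abs_of_nonneg (hcm n x).1]; exact (hcm n x).2)
      fun x hx => by rw [chiN_eq_zero hx.le]; simp).1
    refine h4.trans ?_
    have h5 : ((2 : ℝ) ^ (-n + 1)) ^ ((sdim s : ℝ) + sdeg s k - a) = 2 ^ ((sdim s : ℝ) + sdeg s k -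
      a) * ((2 : ℝ) ^ n) ^ (a - sdim s - sdeg s k) := by
      rw [two_zpow_add, mul_rpow (by positivity) (by positivity), zpow_one, mul_comm,
        zpow_neg, inv_rpow (by positivity), ← rpow_neg (by positivity)]
      congr 2; ring
    rw [h5]; have := h.nonneg
    have : 0 ≤ C * (2 : ℝ) ^ ((sdim s : ℝ) + sdeg s k - a) *
      ((2 : ℝ) ^ n) ^ (a - sdim s - sdeg s k) := by positivity
    nlinarith [abs_nonneg (I k), mul_nonneg this (abs_nonneg (I k))]
  · obtain ⟨C, hC0, hC⟩ := abs_integral_outer_le (s := s) (ε := a - sdim s - sdeg s k) (by linarith)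
    refine ⟨C + 1, by positivity, fun K I N p hp h _ n hn => ?_⟩
    have hexp : -(sdim s : ℝ) - (a - sdim s - sdeg s k) = (sdeg s k : ℝ) - a := by ring
    rw [hexp] at hC
    have h4 := (hC (fun x => monom k x * (K x * (1 - chiN s n x))) N (2 ^ (-n)) h.nonneg
      (by positivity) (fun x hx => abs_monom_mul_le h hp k hx (by
        have := hcm n x; rw [abs_le]; constructor <;> linarith [this.1, this.2]))
      fun x hx => by rw [chiN_eq_one hx.le]; simp).1
    have h5 : ((2 : ℝ) ^ (-n)) ^ (-(a - sdim s - sdeg s k)) = ((2 : ℝ) ^ n) ^ (a - sdim s - sdeg s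
      k) := by
      rw [zpow_neg, inv_rpow (by positivity), ← rpow_neg (by positivity), neg_neg]
    rw [h5] at h4
    have h6 : 1 ≤ ((2 : ℝ) ^ n) ^ (a - sdim s - sdeg s k) :=
      one_le_rpow (one_le_zpow₀ (by norm_num) hn) (by linarith)
    have h7 : |tailMom s K I n k| ≤ |I k| + N * (C * ((2 : ℝ) ^ n) ^ (a - sdim s - sdeg s k)) :=
      (abs_sub _ _).trans (add_le_add_right h4 _)
    refine h7.trans ?_; have := h.nonneg; have h8 := abs_nonneg (I k)
    nlinarith [mul_nonneg h8 (sub_nonneg.2 h6), mul_nonneg hC0 h8,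
      mul_nonneg (mul_nonneg hC0 h8) (zero_le_one.trans h6), mul_nonneg this (zero_le_one.trans h6)]

end Kernel

section Pieces

/-! ### Dyadic pieces of a renormalised kernel -/

/-- The kernel `K` cut off at scale `2⁻ⁿ`, with moments of degree `< q` corrected to `I`. -/
def regK (s : ℕ^d) (q : ℕ) (K : ℝ^d → ℝ) (I : ℕ^d → ℝ) (n : ℤ) (x : ℝ^d) : ℝ :=
  if 1 ≤ n then K x * (1 - chiN s n x) + ∑ k ∈ lowIdx s q, tailMom s K I n k * rhoN s q n k x else 0

/-- The piece of the renormalised kernel at scale `2⁻ⁿ`. -/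
def pieceK (s : ℕ^d) (q : ℕ) (K : ℝ^d → ℝ) (I : ℕ^d → ℝ) (n : ℤ) (x : ℝ^d) : ℝ :=
  regK s q K I n x - regK s q K I (n - 1) x

variable {a : ℝ} {p q : ℕ} {N : ℝ} {K : ℝ^d → ℝ} {I : ℕ^d → ℝ}

lemma contDiff_regK (hK : SmoothOn K {0}ᶜ) (n : ℤ) : Smooth (regK s q K I n) := by
  unfold regK
  split_ifs
  · exact (contDiff_mul_one_sub_chiN hK n).add
      (ContDiff.sum fun k _ => contDiff_const.mul (contDiff_rhoN q n k))
  · exact contDiff_const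

lemma contDiff_pieceK (hK : SmoothOn K {0}ᶜ) (n : ℤ) :
    Smooth (pieceK s q K I n) := (contDiff_regK hK n).sub (contDiff_regK hK _)

lemma regK_eq_zero {n : ℤ} {x : ℝ^d} (hx : snorm s x < 2 ^ (-n)) : regK s q K I n x = 0 := by
  unfold regK
  split_ifs
  · rw [chiN_eq_one hx.le, sum_eq_zero]
    · simp
    · intro k _; have : rhoN s q n k x = 0 := by by_contra h; linarith [(rhoN_support h).1]
      rw [this, mul_zero]
  · rfl

lemma regK_eq_of_lt {n : ℤ} (hn : 1 ≤ n) {x : ℝ^d}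
    (hx : 2 ^ (-n + 2) < snorm s x) : regK s q K I n x = K x := by
  have h1 : (2 : ℝ) ^ (-n + 1) ≤ 2 ^ (-n + 2) := two_zpow_le (by omega)
  rw [regK, if_pos hn, chiN_eq_zero (h1.trans hx.le), sum_eq_zero]
  · simp
  · intro k _; have : rhoN s q n k x = 0 := by by_contra h; linarith [(rhoN_support h).2]
    rw [this, mul_zero]

lemma regK_of_lt_one {n : ℤ} (hn : n < 1) (x : ℝ^d) : regK s q K I n x = 0 := by
  rw [regK, if_neg (by omega)]

lemma pieceK_of_lt_one {n : ℤ} (hn : n < 1) (x : ℝ^d) : pieceK s q K I n x = 0 := by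
  rw [pieceK, regK_of_lt_one hn, regK_of_lt_one (by omega), sub_zero]

lemma pieceK_support (hK : ∀ x, 1 < snorm s x → K x = 0) {n : ℤ} {x : ℝ^d} (h : pieceK s q K I n x ≠
    0) : 1 ≤ n ∧ 2 ^ (-n) ≤ snorm s x ∧ snorm s x ≤ 2 ^ (-n + 3) := by
  have hn : 1 ≤ n := by by_contra! hn; exact h (pieceK_of_lt_one hn x)
  refine ⟨hn, ?_, ?_⟩
  · by_contra! hx; have : (2 : ℝ) ^ (-n) ≤ 2 ^ (-(n - 1)) := two_zpow_le (by omega)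
    exact h (by rw [pieceK, regK_eq_zero hx, regK_eq_zero (hx.trans_le this), sub_zero])
  · by_contra! hx; have h2 : (2 : ℝ) ^ (-n + 2) ≤ 2 ^ (-n + 3) := two_zpow_le (by omega)
    refine h ?_; rw [pieceK, regK_eq_of_lt hn (h2.trans_lt hx)]
    rcases eq_or_lt_of_le hn with rfl | hn2
    · rw [regK_of_lt_one (by omega), hK x, sub_zero]; refine lt_trans ?_ hx; norm_num
    · rw [regK_eq_of_lt (by omega), sub_self]; rw [show -(n - 1) + 2 = -n + 3 by ring]; exact hx

lemma sum_Icc_sub (f : ℤ → ℝ) (m : ℕ) :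
    ∑ n ∈ Icc (-(m : ℤ)) m, (f n - f (n - 1)) = f m - f (-m - 1) := by
  induction m with
  | zero => simp
  | succ m ih =>
    have h1 : Icc (-((m + 1 : ℕ) : ℤ)) (m + 1 : ℕ) = insert (m + 1 : ℤ) (insert (-m - 1 : ℤ) (Icc
      (-(m : ℤ)) m)) := by
      ext n; simp only [mem_Icc, mem_insert]; push_cast; omega
    rw [h1, sum_insert (by simp; omega), sum_insert (by simp), ih]; push_cast
    rw [show (m : ℤ) + 1 - 1 = m by ring, show -((m : ℤ) + 1) - 1 = -m - 1 - 1 by ring]; ring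

lemma sum_pieceK (m : ℕ) (x : ℝ^d) :
    ∑ n ∈ Icc (-(m : ℤ)) m, pieceK s q K I n x = regK s q K I m x := by
  unfold pieceK
  rw [sum_Icc_sub fun n => regK s q K I n x, regK_of_lt_one (n := -(m : ℤ) - 1) (by omega),
    sub_zero]

lemma integral_monom_mul_regK (hK : SmoothOn K {0}ᶜ)
    (hsupp : ∀ x, 1 < snorm s x → K x = 0) {k : ℕ^d} (hk : k ∈ lowIdx s q) {n : ℤ}
    (hn : 1 ≤ n) : Integrable (fun x => monom k x * regK s q K I n x) ∧
      ∫ x, monom k x * regK s q K I n x = I k := by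
  have hmc := (contDiff_monom k).continuous
  have h1 : Integrable fun x => monom k x * (K x * (1 - chiN s n x)) :=
    (hmc.mul (contDiff_mul_one_sub_chiN hK n).continuous).integrable_of_hasCompactSupport
      (hasCompactSupport_of_snorm (ρ := 1) fun x hx => by simp [hsupp x hx])
  have h2 : ∀ j ∈ lowIdx s q, Integrable fun x => tailMom s K I n j * (monom k x * rhoN s q n j x)
    := fun j _ => ((hmc.mul (contDiff_rhoN q n j).continuous).integrable_of_hasCompactSupport
    (hasCompactSupport_of_snorm (ρ := 2 ^ (-n + 2)) fun x hx => by
        have : rhoN s q n j x = 0 := by by_contra h; linarith [(rhoN_support h).2]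
        simp [this])).const_mul _
  have h3 : (fun x => monom k x * regK s q K I n x) = fun x => monom k x * (K x * (1 - chiN s n x))
    + ∑ j ∈ lowIdx s q, tailMom s K I n j * (monom k x * rhoN s q n j x) := by
    funext x; rw [regK, if_pos hn, mul_add, mul_sum]; congr 1
    exact sum_congr rfl fun j _ => by ring
  rw [h3]
  refine ⟨h1.add (integrable_finsetSum _ h2), ?_⟩
  rw [integral_add h1 (integrable_finsetSum _ h2), integral_finsetSum _ h2,
    sum_eq_single_of_mem k hk]
  · rw [integral_const_mul, integral_monom_mul_rhoN n hk hk, if_pos rfl, tailMom]; ring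
  · intro j hj hjk
    rw [integral_const_mul, integral_monom_mul_rhoN n hk hj, if_neg hjk.symm, mul_zero]

lemma integral_monom_mul_pieceK (hK : SmoothOn K {0}ᶜ)
    (hsupp : ∀ x, 1 < snorm s x → K x = 0) {k : ℕ^d} (hk : k ∈ lowIdx s q) {n : ℤ}
    (hn : 2 ≤ n) : ∫ x, monom k x * pieceK s q K I n x = 0 := by
  have h1 := integral_monom_mul_regK (I := I) hK hsupp hk (n := n) (by omega)
  have h2 := integral_monom_mul_regK (I := I) hK hsupp hk (n := n - 1) (by omega)
  simp only [pieceK, mul_sub]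
  rw [integral_sub h1.1 h2.1, h1.2, h2.2, sub_self]

lemma exists_isSymb_mul_cutoff (ha : 0 ≤ a) (m : ℕ) {B : ℝ} (hB : 0 ≤ B) :
    ∃ C : ℝ, 0 ≤ C ∧ ∀ (K : ℝ^d → ℝ) (N : ℝ) (p : ℕ), m * sdim s < p →
      KerBound s a p N K → ∀ (n : ℤ) (g : ℝ^d → ℝ), Smooth g →
      IsSymb stdB (fun i => ((2 : ℝ) ^ n) ^ s i) Set.univ m B g →
      (∀ x, snorm s x < 2 ^ (-n) → g x = 0) →
      IsSymb stdB (fun i => ((2 : ℝ) ^ (n + 1)) ^ s i) Set.univ m (C * N * ((2 : ℝ) ^ n) ^ a)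
        (fun x => K x * g x) := by
  refine ⟨2 ^ m * B * 2 ^ a, by positivity, fun K N p hp h n g hg hgs hg0 => ?_⟩
  have hN := h.nonneg
  have hle : ∀ i : Fin d, ((2 : ℝ) ^ n) ^ s i ≤ ((2 : ℝ) ^ (n + 1)) ^ s i := fun i => by
    gcongr
    · norm_num
    · omega
  have h1 := h.isSymb ha hp (Λ := 2 ^ (n + 1)) (by positivity)
  have hD : IsOpen {x : ℝ^d | ((2 : ℝ) ^ (n + 1))⁻¹ < snorm s x} := isOpen_lt_snorm _
  have hsub : {x : ℝ^d | ((2 : ℝ) ^ (n + 1))⁻¹ < snorm s x} ⊆ {0}ᶜ :=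
    lt_snorm_subset (by positivity)
  have h2 := h1.mul (fun i => by positivity) (by positivity) hB hD (h.smooth.mono hsub) hg.contDiffOn
    (hgs.mono (fun i => by positivity) hle hB le_rfl (Set.subset_univ _))
  have heq : 2 ^ m * (N * ((2 : ℝ) ^ (n + 1)) ^ a * B) = 2 ^ m * B * 2 ^ a * N * ((2 : ℝ) ^ n) ^ a
    := by
    rw [two_zpow_add, mul_rpow (by positivity) (by positivity), zpow_one]; ring
  rw [heq] at h2
  have h3 : IsSymb stdB (fun i => ((2 : ℝ) ^ (n + 1)) ^ s i) {x | snorm s x < 2 ^ (-n)} m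
      (2 ^ m * B * 2 ^ a * N * ((2 : ℝ) ^ n) ^ a) (fun x => K x * g x) :=
    IsSymb.zero (fun i => by positivity) (isOpen_snorm_lt _) (by positivity)
      fun x hx => by rw [hg0 x hx, mul_zero]
  have h4 := h2.union h3
  refine h4.mono (fun i => by positivity) (fun _ => le_rfl) (by positivity) le_rfl fun x _ => ?_
  by_cases hx : snorm s x < 2 ^ (-n)
  · exact Or.inr hx
  · left
    rw [Set.mem_ofPred_eq, ← zpow_neg]; refine lt_of_lt_of_le ?_ (not_lt.1 hx)
    exact two_zpow_lt (by omega)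

lemma exists_isSymb_tail (m : ℕ) (hcrit : ∀ k ∈ lowIdx s q, a ≠ (sdim s : ℝ) + sdeg s k) : ∃ C : ℝ,
    0 ≤ C ∧ ∀ (K : ℝ^d → ℝ) (I : ℕ^d → ℝ) (N : ℝ) (p : ℕ), 0 < p → KerBound s a p N K → (∀ k ∈
    lowIdx s q, a < (sdim s : ℝ) + sdeg s k → I k = ∫ x, monom k x * K x) → ∀ n : ℤ, 0 ≤ n → IsSymb
    stdB (fun i => ((2 : ℝ) ^ n) ^ s i) Set.univ m (C * (N + ∑ k ∈ lowIdx s q, |I k|) * ((2 : ℝ) ^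
    n) ^ a) (fun x => ∑ k ∈ lowIdx s q, tailMom s K I n k * rhoN s q n k x) := by
  choose! C1 hC1 hC1' using fun (k : ℕ^d) (hk : k ∈ lowIdx s q) => exists_tailMom_le (hcrit k hk)
  choose C2 hC2 hC2' using exists_isSymb_rhoN (s := s) q m
  refine ⟨∑ k ∈ lowIdx s q, C1 k * C2 k, sum_nonneg fun k hk => mul_nonneg (hC1 k hk) (hC2 k), ?_⟩
  intro K I N p hp h hI n hn
  have h1 := IsSymb.sum (lowIdx s q) (m := m) (fun i => by positivity) isOpen_univ
    (fun k _ => (contDiff_const.mul (contDiff_rhoN q n k)).contDiffOn) fun k _ =>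
    (hC2' k n).const_mul isOpen_univ (contDiff_rhoN q n k).contDiffOn (tailMom s K I n k)
  refine h1.mono (fun i => by positivity) (fun _ => le_rfl)
    (sum_nonneg fun k _ => mul_nonneg (abs_nonneg _) (mul_nonneg (by positivity) (hC2 k))) ?_ le_rfl
  rw [sum_mul, sum_mul]
  refine sum_le_sum fun k hk => ?_
  have h2 := hC1' k hk K I N p hp h (hI k hk) n hn
  have h3 : |I k| ≤ ∑ k ∈ lowIdx s q, |I k| :=
    single_le_sum (f := fun k => |I k|) (fun _ _ => abs_nonneg _) hk
  have hN := h.nonneg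
  have hc1 := hC1 k hk
  have hc2 := hC2 k
  calc |tailMom s K I n k| * (((2 : ℝ) ^ n) ^ (sdim s + sdeg s k) * C2 k)
      ≤ (C1 k * (N + ∑ k ∈ lowIdx s q, |I k|) * ((2 : ℝ) ^ n) ^ (a - sdim s - sdeg s k)) *
        (((2 : ℝ) ^ n) ^ (sdim s + sdeg s k) * C2 k) := by
        refine mul_le_mul_of_nonneg_right (h2.trans ?_) (by positivity); gcongr
    _ = C1 k * C2 k * (N + ∑ k ∈ lowIdx s q, |I k|) * (((2 : ℝ) ^ n) ^ (a - sdim s - sdeg s k) *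
          ((2 : ℝ) ^ n) ^ ((sdim s + sdeg s k : ℕ) : ℝ)) := by rw [rpow_natCast]; ring
    _ = C1 k * C2 k * (N + ∑ k ∈ lowIdx s q, |I k|) * ((2 : ℝ) ^ n) ^ a := by
        rw [← rpow_add (by positivity)]; congr 2; push_cast; ring

lemma exists_isSymb_pieceK (ha : 0 ≤ a) (m : ℕ)
    (hcrit : ∀ k ∈ lowIdx s q, a ≠ (sdim s : ℝ) + sdeg s k) :
    ∃ C : ℝ, 0 ≤ C ∧ ∀ (K : ℝ^d → ℝ) (I : ℕ^d → ℝ) (N : ℝ) (p : ℕ),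
      m * sdim s < p → KerBound s a p N K →
      (∀ k ∈ lowIdx s q, a < (sdim s : ℝ) + sdeg s k → I k = ∫ x, monom k x * K x) →
      ∀ n : ℤ, IsSymb stdB (fun i => ((2 : ℝ) ^ (n + 1)) ^ s i) Set.univ m
        (C * (N + ∑ k ∈ lowIdx s q, |I k|) * ((2 : ℝ) ^ n) ^ a) (pieceK s q K I n) := by
  obtain ⟨B, hB, hχ⟩ := exists_isSymb_chiN (s := s) m
  obtain ⟨C1, hC1, h1⟩ := exists_isSymb_mul_cutoff (s := s) ha m (B := B + (1 + B)) (by positivity)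
  obtain ⟨C2, hC2, h2⟩ := exists_isSymb_tail (s := s) m hcrit
  refine ⟨C1 + C2 + C2, by positivity, fun K I N p hp h hI n => ?_⟩
  set T := N + ∑ k ∈ lowIdx s q, |I k| with hT
  have hN := h.nonneg
  have hNT : N ≤ T := by
    have : 0 ≤ ∑ k ∈ lowIdx s q, |I k| := sum_nonneg fun _ _ => abs_nonneg _; linarith
  have hT0 : 0 ≤ T := hN.trans hNT
  rcases lt_or_ge n 1 with hn | hn
  · exact IsSymb.zero (fun i => by positivity) isOpen_univ (by positivity)
      fun x _ => pieceK_of_lt_one hn x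
  have hle : ∀ i : Fin d, ((2 : ℝ) ^ n) ^ s i ≤ ((2 : ℝ) ^ (n + 1)) ^ s i := fun i => by
    gcongr
    · norm_num
    · omega
  have hle' : ∀ i : Fin d, ((2 : ℝ) ^ (n - 1)) ^ s i ≤ ((2 : ℝ) ^ n) ^ s i := fun i => by
    gcongr
    · norm_num
    · omega
  have hle'' : ∀ i : Fin d, ((2 : ℝ) ^ (n - 1)) ^ s i ≤ ((2 : ℝ) ^ (n + 1)) ^ s i := fun i =>
    (hle' i).trans (hle i)
  have hχsm := fun n => contDiff_chiN (s := s) n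
  -- the part carried by `K`
  let g : ℝ^d → ℝ := fun x => (-1) * chiN s n x + if 2 ≤ n then chiN s (n - 1) x else 1
  have hgsm : Smooth g := (contDiff_const.mul (hχsm n)).add (by
    split_ifs
    · exact hχsm _
    · exact contDiff_const)
  have hgs : IsSymb stdB (fun i => ((2 : ℝ) ^ n) ^ s i) Set.univ m (B + (1 + B)) g := by
    refine IsSymb.add isOpen_univ (contDiff_const.mul (hχsm n)).contDiffOn ?_ ?_ ?_
    · split_ifs
      · exact (hχsm _).contDiffOn
      · exact contDiffOn_const
    · simpa using (hχ n).const_mul isOpen_univ (hχsm n).contDiffOn (-1)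
    · split_ifs
      · exact (hχ (n - 1)).mono (fun i => by positivity) hle' hB (by linarith) le_rfl
      · exact (IsSymb.one fun i => by positivity).mono (fun i => by positivity) (fun _ => le_rfl)
          zero_le_one (by linarith) le_rfl
  have hg0 : ∀ x, snorm s x < 2 ^ (-n) → g x = 0 := by
    intro x hx; have : (2 : ℝ) ^ (-n) ≤ 2 ^ (-(n - 1)) := two_zpow_le (by omega)
    simp only [g]; rw [chiN_eq_one hx.le]; split_ifs
    · rw [chiN_eq_one (hx.le.trans this)]; ring
    · ring
  have e1 := h1 K N p hp h n g hgsm hgs hg0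
  have hp0 : 0 < p := by omega
  have e2 := h2 K I N p hp0 h hI n (by omega)
  have hsm2 : ∀ n : ℤ, Smooth fun x => ∑ k ∈ lowIdx s q, tailMom s K I n k * rhoN s q n k x :=
    fun n => ContDiff.sum fun k _ => contDiff_const.mul (contDiff_rhoN q n k)
  have hsm1 : Smooth fun x => K x * g x := by
    rw [contDiff_iff_contDiffAt]; intro x
    by_cases hx : x = 0
    · subst hx
      have h0 : (fun x => K x * g x) =ᶠ[nhds 0] fun _ => 0 := by
        have : {x : ℝ^d | snorm s x < 2 ^ (-n)} ∈ nhds 0 := (isOpen_snorm_lt _).mem_nhds (by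
            rw [Set.mem_ofPred_eq, snorm_zero]; positivity)
        filter_upwards [this] with y hy; rw [hg0 y hy, mul_zero]
      exact contDiffAt_const.congr_of_eventuallyEq h0
    · exact (h.smooth.contDiffAt (isOpen_compl_singleton.mem_nhds hx)).mul hgsm.contDiffAt
  have e12 := (e1.add isOpen_univ hsm1.contDiffOn (hsm2 n).contDiffOn
    (e2.mono (fun i => by positivity) hle (by positivity) le_rfl le_rfl))
  have ha1 : (0 : ℝ) ≤ ((2 : ℝ) ^ n) ^ a := by positivity
  have hCN : C1 * N * ((2 : ℝ) ^ n) ^ a ≤ C1 * T * ((2 : ℝ) ^ n) ^ a := by gcongr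
  rcases eq_or_lt_of_le hn with rfl | hn2
  · refine (e12.congr isOpen_univ ?_).mono (fun i => by positivity) (fun _ => le_rfl)
      (by positivity) ?_ le_rfl
    · intro x _; rw [pieceK, regK_of_lt_one (n := 1 - 1) (by omega), regK, if_pos le_rfl]
      simp only [g]; rw [if_neg (by omega)]; ring
    · have : 0 ≤ C2 * T * ((2 : ℝ) ^ (1 : ℤ)) ^ a := by positivity
      nlinarith
  · have e3 := h2 K I N p hp0 h hI (n - 1) (by omega)
    have e3' := (e3.const_mul isOpen_univ (hsm2 (n - 1)).contDiffOn (-1)).mono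
      (fun i => by positivity) hle'' (by positivity) le_rfl le_rfl
    have e123 := e12.add isOpen_univ (hsm1.add (hsm2 n)).contDiffOn
      (contDiff_const.mul (hsm2 (n - 1))).contDiffOn e3'
    refine (e123.congr isOpen_univ ?_).mono (fun i => by positivity) (fun _ => le_rfl)
      (by positivity) ?_ le_rfl
    · intro x _; rw [pieceK, regK, if_pos hn, regK, if_pos (by omega)]; simp only [g]
      rw [if_pos (by omega)]; ring
    · have h5 : C2 * T * ((2 : ℝ) ^ (n - 1)) ^ a ≤ C2 * T * ((2 : ℝ) ^ n) ^ a := by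
        gcongr
        · norm_num
        · omega
      rw [abs_neg, abs_one, one_mul]; nlinarith

/-! ### Convergence of the pieces -/

lemma tendsto_pieceK (ha : 0 ≤ a) (hp : 0 < p) {Km : ℕ → ℝ^d → ℝ} {Im : ℕ → ℕ^d → ℝ} (hKm : ∀ m,
    KerBound s a p N (Km m)) (hlim : ∀ x, x ≠ 0 → Tendsto (fun m => Km m x) atTop (nhds (K x))) (hI
    : ∀ k ∈ lowIdx s q, Tendsto (fun m => Im m k) atTop (nhds (I k))) (n : ℤ) (x : ℝ^d) : Tendsto
    (fun m => pieceK s q (Km m) (Im m) n x) atTop (nhds (pieceK s q K I n x)) := by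
  have h0 : ∀ n x, Tendsto (fun m => Km m x * (1 - chiN s n x)) atTop (nhds (K x * (1 - chiN s n
    x))) := by
    intro n x
    by_cases hx : x = 0
    · have : chiN s n x = 1 := chiN_eq_one (by rw [hx, snorm_zero]; positivity); simp [this]
    · exact (hlim x hx).mul_const _
  have hN := (hKm 0).nonneg
  have htail : ∀ n, ∀ k ∈ lowIdx s q, Tendsto (fun m => tailMom s (Km m) (Im m) n k) atTop (nhds
    (tailMom s K I n k)) := by
    intro n k hk; refine (hI k hk).sub ?_
    have hmeas : MeasurableSet {x : ℝ^d | snorm s x ≤ 1} :=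
      (isCompact_snorm_le 1).isClosed.measurableSet
    refine tendsto_integral_of_dominated_convergence
      ({x : ℝ^d | snorm s x ≤ 1}.indicator fun _ => N * ((2 : ℝ) ^ n) ^ a) ?_ ?_ ?_ ?_
    · intro m
      exact ((contDiff_monom k).continuous.mul
        (contDiff_mul_one_sub_chiN (hKm m).smooth n).continuous).aestronglyMeasurable
    · exact (integrable_indicator_iff hmeas).2 (integrableOn_const
        ((isCompact_snorm_le 1).measure_lt_top.ne))
    · intro m; refine Eventually.of_forall fun x => ?_; rw [norm_eq_abs]
      rcases lt_or_ge 1 (snorm s x) with h1 | h1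
      · rw [(hKm m).support x h1, Set.indicator_of_notMem (by simpa using h1)]; simp
      · rw [Set.indicator_of_mem (show x ∈ {x : ℝ^d | snorm s x ≤ 1} from h1)]
        rcases lt_or_ge (snorm s x) (2 ^ (-n)) with h2 | h2
        · rw [chiN_eq_one h2.le]; simp; positivity
        · have hpos : 0 < snorm s x := lt_of_lt_of_le (by positivity) h2
          have hx : x ≠ 0 := fun h => by rw [h, snorm_zero] at hpos; exact lt_irrefl _ hpos
          have hc := chiN_mem n x; rw [abs_mul, abs_mul]
          have h3 : |monom k x| ≤ 1 := (abs_monom_le k x).trans (pow_le_one₀ hpos.le h1)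
          have h4 : |1 - chiN s n x| ≤ 1 := by rw [abs_le]; constructor <;> linarith [hc.1, hc.2]
          have h5 : |Km m x| ≤ N * ((2 : ℝ) ^ n) ^ a := by
            refine ((hKm m).abs_le hp hx).trans (mul_le_mul_of_nonneg_left ?_ hN)
            rw [rpow_neg hpos.le, ← inv_rpow hpos.le]; refine rpow_le_rpow (by positivity) ?_ ha
            rw [zpow_neg] at h2; exact inv_le_of_inv_le₀ (by positivity) h2
          calc |monom k x| * (|Km m x| * |1 - chiN s n x|)
              ≤ 1 * (N * ((2 : ℝ) ^ n) ^ a * 1) := by gcongr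
            _ = _ := by ring
    · exact Eventually.of_forall fun x => (h0 n x).const_mul _
  have hreg : ∀ n, Tendsto (fun m => regK s q (Km m) (Im m) n x) atTop
      (nhds (regK s q K I n x)) := by
    intro n; unfold regK; split_ifs
    · exact (h0 n x).add (tendsto_finsetSum _ fun k hk => (htail n k hk).mul_const _)
    · exact tendsto_const_nhds
  exact (hreg n).sub (hreg _)

/-! ### Smooth kernels -/

lemma kerBound_zero_of_contDiff (hK : Smooth K)
    (hsupp : ∀ x, 1 < snorm s x → K x = 0) : ∃ N, KerBound s 0 1 N K := by
  obtain ⟨B, hB⟩ := (hasCompactSupport_of_snorm hsupp).exists_bound_of_continuous hK.continuous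
  refine ⟨B, hK.contDiffOn, hsupp, (norm_nonneg _).trans (hB 0), fun k hk x hx => ?_⟩
  have hk0 : k = 0 := by
    have h0 : sdeg s k = 0 := by omega
    funext i
    have : s i * k i ≤ sdeg s k :=
      single_le_sum (f := fun i => s i * k i) (fun _ _ => Nat.zero_le _) (mem_univ i)
    have h3 : s i * k i = 0 := by omega
    have h4 := hs.pos i; rcases Nat.mul_eq_zero.1 h3 with h5 | h5
    · omega
    · simpa using h5
  rw [hk0, multiD_eq_mD, mD_zero]
  simpa [sdeg] using hB x

lemma exists_abs_regK_le (hK : Smooth K) (hsupp : ∀ x, 1 < snorm s x → K x = 0) (hI : ∀ k ∈ lowIdx s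
    q, I k = ∫ x, monom k x * K x) : ∃ C, ∀ n x, |regK s q K I n x| ≤ C := by
  obtain ⟨N, hN⟩ := kerBound_zero_of_contDiff hK hsupp
  obtain ⟨B, hB⟩ := (hasCompactSupport_of_snorm hsupp).exists_bound_of_continuous hK.continuous
  obtain ⟨C, hC, h⟩ := exists_isSymb_tail (s := s) (q := q) (a := 0) 0 fun k _ => by
    have : (0 : ℝ) < sdim s := by exact_mod_cast hs.dim
    positivity
  have hB0 := (norm_nonneg _).trans (hB 0)
  have hTnn : 0 ≤ C * (N + ∑ k ∈ lowIdx s q, |I k|) :=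
    mul_nonneg hC (add_nonneg hN.nonneg (sum_nonneg fun _ _ => abs_nonneg _))
  refine ⟨B + C * (N + ∑ k ∈ lowIdx s q, |I k|), fun n x => ?_⟩
  unfold regK
  split_ifs with hn
  · refine (abs_add_le _ _).trans (add_le_add ?_ ?_)
    · have hc := chiN_mem n x; rw [abs_mul]
      have h4 : |1 - chiN s n x| ≤ 1 := by rw [abs_le]; constructor <;> linarith [hc.1, hc.2]
      calc |K x| * |1 - chiN s n x| ≤ B * 1 := mul_le_mul (hB x) h4 (abs_nonneg _) hB0
        _ = B := mul_one _
    · have := h K I N 1 one_pos hN (fun k hk _ => hI k hk) n (by omega) x trivial; simpa using this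
  · rw [abs_zero]; positivity

lemma tendsto_regK {x : ℝ^d} (hx : x ≠ 0) :
    Tendsto (fun m : ℕ => regK s q K I m x) atTop (nhds (K x)) := by
  have hpos := snorm_pos hx
  obtain ⟨m₀, hm₀⟩ := exists_pow_lt_of_lt_one (show 0 < snorm s x / 4 by positivity)
    (show (1 / 2 : ℝ) < 1 by norm_num)
  refine tendsto_const_nhds.congr' ?_
  filter_upwards [eventually_ge_atTop (m₀ + 1)] with m hm
  refine (regK_eq_of_lt (by omega) ?_).symm
  rw [two_zpow_add, zpow_neg, zpow_natCast]
  have h1 : ((2 : ℝ) ^ m)⁻¹ ≤ (1 / 2) ^ m₀ := by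
    rw [← inv_pow, one_div]; exact pow_le_pow_of_le_one (by norm_num) (by norm_num) (by omega)
  have : ((2 : ℝ) ^ m)⁻¹ * 2 ^ (2 : ℤ) < snorm s x / 4 * 4 := by norm_num; linarith
  linarith

end Pieces

/-! ### Symbol estimates for Taylor remainders -/

lemma IsSymb.reindex {X ι κ : Type*} [NormedAddCommGroup X] [NormedSpace ℝ X] {b : ι → X}
    {μ : ι → ℝ} {D : Set X} {m : ℕ} {B : ℝ} {F : X → ℝ} (g : κ → ι) (h : IsSymb b μ D m B F) :
    IsSymb (fun j => b (g j)) (fun j => μ (g j)) D m B F := by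
  induction m generalizing B F with
  | zero => exact h
  | succ m ih => exact ⟨h.1, fun j => ih (h.2 (g j))⟩

lemma lineD_monom (k : ℕ^d) (i : Fin d) (z : ℝ^d) :
    lineD (stdB i) (monom k) z = k i * monom (k - Pi.single i 1) z := by
  unfold lineD
  rw [(hasFDerivAt_monom k z).fderiv, _root_.sum_apply, sum_eq_single i]
  · simp
  · intro j _ hj; simp [hj]
  · simp

lemma isSymb_monom {ρ Λ : ℝ} (hρ : 0 < ρ) (hΛ : 1 ≤ ρ * Λ) (m : ℕ) (k : ℕ^d) : IsSymb stdB (fun i =>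
    Λ ^ s i) {x | snorm s x < ρ} m (((sdeg s k : ℝ) + 1) ^ m * ρ ^ sdeg s k) (monom k) := by
  have hb : ∀ x ∈ {x : ℝ^d | snorm s x < ρ}, |monom k x| ≤ ρ ^ sdeg s k := fun x hx =>
    (abs_monom_le k x).trans (pow_le_pow_left₀ (snorm_nonneg _) (le_of_lt hx) _)
  have hΛ0 : 0 ≤ Λ := by by_contra! h; nlinarith
  have hO := isOpen_snorm_lt (d := d) ρ
  induction m generalizing k with
  | zero => intro x hx; simpa using hb x hx
  | succ m ih =>
    have hk1 : (1 : ℝ) ≤ (sdeg s k : ℝ) + 1 := by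
      have : (0 : ℝ) ≤ sdeg s k := Nat.cast_nonneg _; linarith
    refine ⟨fun x hx => (hb x hx).trans (le_mul_of_one_le_left (by positivity)
      (one_le_pow₀ hk1)), fun i => ?_⟩
    by_cases hki : k i = 0
    · exact IsSymb.zero (fun i => by positivity) hO (by positivity) fun x _ => by
        rw [lineD_monom, hki]; simp
    have hkk : k - Pi.single i 1 + Pi.single i 1 = k := by
      funext j
      by_cases hj : j = i
      · subst hj; simp; omega
      · simp [hj]
    have hdeg : sdeg s k = sdeg s (k - Pi.single i 1) + s i := by rw [← sdeg_add_single, hkk]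
    have hle : k i ≤ sdeg s k := by
      have h1 : s i * k i ≤ sdeg s k :=
        single_le_sum (f := fun i => s i * k i) (fun _ _ => Nat.zero_le _) (mem_univ i)
      exact (Nat.le_mul_of_pos_left _ (hs.pos i)).trans h1
    have h1 := (ih (k - Pi.single i 1) fun x hx => (abs_monom_le _ x).trans (pow_le_pow_left₀
      (snorm_nonneg _) (le_of_lt hx) _)).const_mul hO (contDiff_monom _).contDiffOn (k i : ℝ)
    refine (h1.mono (fun i => by positivity) (fun _ => le_rfl) (by positivity) ?_ le_rfl).congr hO
      fun x _ => (lineD_monom k i x).symm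
    rw [abs_of_nonneg (Nat.cast_nonneg _)]
    have h2 : (k i : ℝ) ≤ (sdeg s k : ℝ) + 1 := by
      have : (k i : ℝ) ≤ sdeg s k := by exact_mod_cast hle
      linarith
    have h3 : ((sdeg s (k - Pi.single i 1) : ℕ) : ℝ) ≤ sdeg s k := by
      exact_mod_cast (by omega : sdeg s (k - Pi.single i 1) ≤ sdeg s k)
    calc (k i : ℝ) * (((sdeg s (k - Pi.single i 1) : ℝ) + 1) ^ m * ρ ^ sdeg s (k - Pi.single i 1))
        ≤ ((sdeg s k : ℝ) + 1) * (((sdeg s k : ℝ) + 1) ^ m *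
          (ρ ^ sdeg s (k - Pi.single i 1) * (ρ * Λ) ^ s i)) := by
          gcongr; exact le_mul_of_one_le_right (by positivity) (one_le_pow₀ hΛ)
      _ = ((sdeg s k : ℝ) + 1) ^ (m + 1) * ρ ^ sdeg s k * Λ ^ s i := by
          rw [hdeg, pow_add ρ, mul_pow]; ring

lemma hasDerivAt_taylorRem_base {b : Fin d → X} {D : Set X} {F : X → ℝ} (hD : IsOpen D)
    (hF : SmoothOn F D) {x₀ : X} {z : ℝ^d} (h0 : x₀ ∈ D)
    (hz : x₀ + ∑ i, z i • b i ∈ D) (N : ℕ) (w : X) :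
    HasDerivAt (fun t : ℝ => taylorRem s b N F (x₀ + t • w) z)
      (taylorRem s b N (lineD w F) x₀ z) 0 := by
  have hl : ∀ y : X, HasDerivAt (fun t : ℝ => y + t • w) w 0 := fun y => by
    simpa using ((hasDerivAt_id (0 : ℝ)).smul_const w).const_add y
  have key : ∀ (g : X → ℝ) (y : X), DifferentiableAt ℝ g y → HasDerivAt (fun t : ℝ => g (y + t • w))
    (lineD w g y) 0 := fun g y hg => by
    have h1 : HasFDerivAt g (fderiv ℝ g y) (y + (0 : ℝ) • w) := by simpa using hg.hasFDerivAt
    exact h1.comp_hasDerivAt (0 : ℝ) (hl y)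
  unfold taylorRem
  refine HasDerivAt.sub ?_ ?_
  · have h1 := key F _ (diffAt hD hF hz)
    refine h1.congr_of_eventuallyEq (Eventually.of_forall fun t => ?_); simp only; congr 1
    abel
  · refine HasDerivAt.fun_sum fun k _ => ?_
    have h1 := (key (mD b k F) x₀ (diffAt hD (contDiffOn_mD b hD hF k) h0)).const_mul
      (monom k z / mfact k)
    rwa [lineD_mD b hD hF k w h0] at h1

lemma eq_of_hasDerivAt_line {f : X → ℝ} {x v : X} {c : ℝ} (hf : DifferentiableAt ℝ f x)
    (h : HasDerivAt (fun t : ℝ => f (x + t • v)) c 0) : lineD v f x = c := by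
  have h1 : HasFDerivAt f (fderiv ℝ f x) (x + (0 : ℝ) • v) := by simpa using hf.hasFDerivAt
  have h2 : HasDerivAt (fun t : ℝ => x + t • v) v 0 := by
    simpa using ((hasDerivAt_id (0 : ℝ)).smul_const v).const_add x
  exact (h1.comp_hasDerivAt (0 : ℝ) h2).unique h

lemma stdB_sum (y : ℝ^d) : ∑ i, y i • (stdB i : ℝ^d) = y := by
  funext j
  simp [Finset.sum_apply, Pi.single_apply]

lemma contDiffOn_taylorRem {D : Set X} {D' : Set ℝ^d} (hD' : IsOpen D') {f : ℝ^d → ℝ} (hf : SmoothOn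
    f D') (Lx Ly : X →L[ℝ] ℝ^d) (h0 : ∀ x ∈ D, -Lx x ∈ D') (h1 : ∀ x ∈ D, -Lx x + Ly x ∈ D') (N : ℕ)
    : SmoothOn (fun x => taylorRem s stdB N f (-Lx x) (Ly x)) D := by
  unfold taylorRem
  simp only [stdB_sum]
  refine ContDiffOn.sub ?_ (ContDiffOn.sum fun k _ => ?_)
  · exact hf.comp (Lx.contDiff.neg.add Ly.contDiff).contDiffOn h1
  · refine ((((contDiff_monom k).comp Ly.contDiff).div_const _).contDiffOn).mul ?_
    exact (contDiffOn_mD stdB hD' hf k).comp Lx.contDiff.neg.contDiffOn h0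

lemma exists_isSymb_taylorRem {ι : Type*} {b : ι → X} (m N : ℕ) : ∃ C : ℝ, 0 ≤ C ∧ ∀ (ν : ι → ℝ) (D
    : Set X) (D' : Set ℝ^d) (f : ℝ^d → ℝ) (Lx Ly : X →L[ℝ] ℝ^d) (B Λx Λy ρ : ℝ), IsOpen D → IsOpen
    D' → SmoothOn f D' → (∀ c, 0 ≤ ν c) → 0 ≤ B → 0 ≤ Λx → 0 ≤ Λy → 0 ≤ ρ → ρ * Λx ≤ 1 → 1 ≤ ρ * Λy
    → (∀ x ∈ D, snorm s (Ly x) ≤ ρ) → (∀ x ∈ D, ∀ t ∈ Set.Icc (0 : ℝ) 1, -Lx x + dil s t (Ly x) ∈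
    D') → (∀ c, (Lx (b c) = 0 ∧ Ly (b c) = 0) ∨ (∃ i, Lx (b c) = stdB i ∧ Ly (b c) = 0 ∧ Λx ^ s i ≤
    ν c) ∨ (∃ i, Lx (b c) = 0 ∧ Ly (b c) = stdB i ∧ Λy ^ s i ≤ ν c)) → IsSymb stdB (fun i => Λx ^ s
    i) D' (m + N) B f → IsSymb b ν D m (C * B * (ρ * Λx) ^ N) (fun x => taylorRem s stdB N f (-Lx x)
    (Ly x)) := by
  induction m generalizing N with
  | zero =>
    obtain ⟨C, hC, h⟩ := abs_taylorRem_le (s := s) (X := ℝ^d) N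
    refine ⟨C, hC, fun ν D D' f Lx Ly B Λx Λy ρ hD hD' hf hν hB hΛx hΛy hρ hρx hρy hy hpath hc hsy
      x hx => ?_⟩
    have hyρ : snorm s (Ly x) * Λx ≤ ρ * Λx := mul_le_mul_of_nonneg_right (hy x hx) hΛx
    refine (h stdB D' f B Λx hD' hf hB hΛx (by simpa using hsy) (-Lx x) (Ly x) (fun t ht => ?_)
      (hyρ.trans hρx)).trans ?_
    · rw [stdB_sum]; exact hpath x hx t ht
    · have := snorm_nonneg (s := s) (Ly x); gcongr
  | succ m ih =>
    obtain ⟨C₀, hC₀, h₀⟩ := abs_taylorRem_le (s := s) (X := ℝ^d) N; obtain ⟨C₁, hC₁, h₁⟩ := ih N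
    choose C₂ hC₂ h₂ using fun i : Fin d => ih (N - s i)
    have hS : 0 ≤ ∑ i, C₂ i := sum_nonneg fun i _ => hC₂ i
    refine ⟨C₀ + C₁ + ∑ i, C₂ i, by positivity, fun ν D D' f Lx Ly B Λx Λy ρ hD hD' hf hν hB hΛx hΛy
      hρ hρx hρy hy hpath hc hsy => ?_⟩
    have hbase : ∀ x ∈ D, -Lx x ∈ D' := fun x hx => by
      have := hpath x hx 0 (by simp)
      have e0 : dil s 0 (Ly x) = 0 := by funext i; simp [dil, (hs.pos i).ne']
      rwa [e0, add_zero] at this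
    have hend : ∀ x ∈ D, -Lx x + Ly x ∈ D' := fun x hx => by
      have := hpath x hx 1 (by simp); have e0 : dil s 1 (Ly x) = Ly x := by funext i; simp [dil]
      rwa [e0] at this
    have hsm := contDiffOn_taylorRem (s := s) hD' hf Lx Ly hbase hend N
    refine ⟨fun x hx => ?_, fun c => ?_⟩
    · have hyρ : snorm s (Ly x) * Λx ≤ ρ * Λx := mul_le_mul_of_nonneg_right (hy x hx) hΛx
      refine (h₀ stdB D' f B Λx hD' hf hB hΛx (hsy.of_le (by omega)) (-Lx x) (Ly x)
        (fun t ht => ?_) (hyρ.trans hρx)).trans ?_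
      · rw [stdB_sum]; exact hpath x hx t ht
      · have := snorm_nonneg (s := s) (Ly x); gcongr; linarith
    rw [show m + 1 + N = (m + N) + 1 by ring] at hsy
    rcases hc c with ⟨hx0, hy0⟩ | ⟨i, hx1, hy0, hνc⟩ | ⟨i, hx0, hy1, hνc⟩
    · refine IsSymb.zero hν hD (mul_nonneg (by positivity) (hν c)) fun x hx => ?_
      refine eq_of_hasDerivAt_line (diffAt hD hsm hx) ?_
      simp only [map_add, map_smul, hx0, hy0, smul_zero, add_zero]; exact hasDerivAt_const _ _
    · have h4 := h₁ ν D D' (lineD (stdB i) f) Lx Ly (B * Λx ^ s i) Λx Λy ρ hD hD'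
        (contDiffOn_lineD hD' hf _) hν (by positivity) hΛx hΛy hρ hρx hρy hy hpath hc (hsy.2 i)
      have h5 := h4.const_mul hD (contDiffOn_taylorRem hD' (contDiffOn_lineD hD' hf _) Lx Ly
        hbase hend N) (-1)
      refine (h5.mono hν (fun _ => le_rfl) (by positivity) ?_ le_rfl).congr hD fun x hx => ?_
      · rw [abs_neg, abs_one, one_mul]
        calc C₁ * (B * Λx ^ s i) * (ρ * Λx) ^ N = C₁ * B * (ρ * Λx) ^ N * Λx ^ s i := by ring
          _ ≤ (C₀ + C₁ + ∑ i, C₂ i) * B * (ρ * Λx) ^ N * ν c := by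
            gcongr; linarith
      · symm
        refine eq_of_hasDerivAt_line (diffAt hD hsm hx) ?_
        have h6 := hasDerivAt_taylorRem_base (s := s) (b := stdB) (z := Ly x) hD' hf (hbase x hx)
          (by rw [stdB_sum]; exact hend x hx) N (-stdB i)
        have h7 : taylorRem s stdB N (lineD (-stdB i) f) (-Lx x) (Ly x) = -1 * taylorRem s stdB N
          (lineD (stdB i) f) (-Lx x) (Ly x) := by
          have e1 : lineD (-stdB i) f = fun y => (-1) * lineD (stdB i) f y := by
            funext y; simp [lineD]
          have e2 : ∀ k, mD stdB k (lineD (-stdB i) f) (-Lx x) = -1 * mD stdB k (lineD (stdB i) f)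
            (-Lx x) := fun k => by
            rw [← lineD_mD stdB hD' hf k _ (hbase x hx), ← lineD_mD stdB hD' hf k _ (hbase x hx)]
            simp [lineD]
          unfold taylorRem; simp only [e2]; rw [e1, mul_sub, mul_sum]; congr 1
          exact sum_congr rfl fun k _ => by ring
        rw [h7] at h6; refine h6.congr_of_eventuallyEq (Eventually.of_forall fun t => ?_)
        simp only [map_add, map_smul, hx1, hy0, smul_zero, add_zero]; congr 1
        rw [neg_add, smul_neg]
    · have h4 := h₂ i ν D D' (lineD (stdB i) f) Lx Ly (B * Λx ^ s i) Λx Λy ρ hD hD'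
        (contDiffOn_lineD hD' hf _) hν (by positivity) hΛx hΛy hρ hρx hρy hy hpath hc
        ((hsy.2 i).of_le (by omega))
      refine (h4.mono hν (fun _ => le_rfl) (mul_nonneg (mul_nonneg (hC₂ i) (by positivity))
        (by positivity)) ?_ le_rfl).congr hD fun x hx => ?_
      · have hCi : C₂ i ≤ C₀ + C₁ + ∑ i, C₂ i := by
          have := single_le_sum (f := C₂) (fun i _ => hC₂ i) (mem_univ i); linarith
        have hCi0 := hC₂ i
        calc C₂ i * (B * Λx ^ s i) * (ρ * Λx) ^ (N - s i)
            ≤ C₂ i * (B * Λx ^ s i) * (ρ * Λx) ^ (N - s i) * (ρ * Λy) ^ s i :=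
              le_mul_of_one_le_right (by positivity) (one_le_pow₀ hρy)
          _ = C₂ i * B * (ρ * Λx) ^ (s i + (N - s i)) * Λy ^ s i := by
              rw [pow_add, mul_pow, mul_pow]; ring
          _ ≤ (C₀ + C₁ + ∑ i, C₂ i) * B * (ρ * Λx) ^ N * ν c := by
              have : (ρ * Λx) ^ (s i + (N - s i)) ≤ (ρ * Λx) ^ N :=
                pow_le_pow_of_le_one (by positivity) hρx (by omega)
              gcongr
      · symm
        refine eq_of_hasDerivAt_line (diffAt hD hsm hx) ?_
        have h6 := hasFDerivAt_taylorRem (s := s) (b := stdB) (z := Ly x) hD' hf (hbase x hx)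
          (by rw [stdB_sum]; exact hend x hx) N
        have h7 : HasDerivAt (fun t : ℝ => Ly x + t • (stdB i : ℝ^d)) (stdB i) 0 := by
          simpa using ((hasDerivAt_id (0 : ℝ)).smul_const (stdB i : ℝ^d)).const_add (Ly x)
        have h8 : HasFDerivAt (taylorRem s stdB N f (-Lx x)) (∑ j, taylorRem s stdB (N - s j) (lineD
          (stdB j) f) (-Lx x) (Ly x) • (ContinuousLinearMap.proj j : ℝ^d →L[ℝ] ℝ)) (Ly x + (0 : ℝ) •
          stdB i) := by
          simpa using h6
        have h9 := (h8.comp_hasDerivAt (0 : ℝ) h7)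
        have h10 : (∑ j, taylorRem s stdB (N - s j) (lineD (stdB j) f) (-Lx x) (Ly x) •
          (ContinuousLinearMap.proj j : ℝ^d →L[ℝ] ℝ)) (stdB i) = taylorRem s stdB (N - s i) (lineD
          (stdB i) f) (-Lx x) (Ly x) := by
          rw [_root_.sum_apply, sum_eq_single i]
          · simp
          · intro j _ hj; simp [hj]
          · simp
        rw [h10] at h9; refine h9.congr_of_eventuallyEq (Eventually.of_forall fun t => ?_)
        simp only [map_add, map_smul, hx0, hy1, smul_zero, add_zero, Function.comp_apply]

/-! ### Comparison of edge factors with the power-counting weight -/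

lemma le_weight_of_comparable {qe x y a : ℝ} {r : ℕ} (hr : 1 ≤ r) (ha : 0 ≤ a) (hq : 0 < qe) (hx : 0
    < x) (hy : 0 < y) (hxy : x ≤ 2 ^ 8 * y) (htri : qe ≤ 8 * (x + y)) : qe ^ (-a) ≤ (2 ^ 8) ^ r * 16
    ^ a * (qe ^ (-a) * ((y / max x y) ^ (r : ℝ) * (max x y / x) ^ (a + r - 1))) ∧ ∀ j < r, y ^ j * x
    ^ (-a) * (x ^ j)⁻¹ ≤ (2 ^ 8) ^ r * 16 ^ a * (qe ^ (-a) * ((y / max x y) ^ (r : ℝ) * (max x y /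
    x) ^ (a + r - 1))) := by
  set M := max x y with hM
  have hM0 : 0 < M := lt_max_of_lt_left hx
  have hr' : (1 : ℝ) ≤ r := by exact_mod_cast hr
  have hMy : M ≤ 2 ^ 8 * y := max_le hxy (by linarith)
  have h1 : 1 ≤ (2 ^ 8) ^ r * (y / M) ^ (r : ℝ) := by
    rw [rpow_natCast, ← mul_pow]; refine one_le_pow₀ ?_
    rw [mul_div_assoc', le_div_iff₀ hM0, one_mul]; exact hMy
  have hMx : 1 ≤ M / x := (one_le_div hx).2 (le_max_left _ _)
  have h2 : 1 ≤ (M / x) ^ (a + r - 1) := one_le_rpow hMx (by linarith)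
  have h16 : (1 : ℝ) ≤ 16 ^ a := one_le_rpow (by norm_num) ha
  have hqa : 0 < qe ^ (-a) := by positivity
  constructor
  · calc qe ^ (-a) = qe ^ (-a) * (1 * 1 * 1) := by ring
      _ ≤ qe ^ (-a) * (((2 ^ 8) ^ r * (y / M) ^ (r : ℝ)) * 16 ^ a * (M / x) ^ (a + r - 1)) := by
          gcongr
      _ = _ := by ring
  · intro j hj; have hyM : y ≤ M := le_max_right _ _
    have h3 : qe ≤ 16 * M := by linarith [le_max_left x y]
    have h4 : M ^ (-a) ≤ 16 ^ a * qe ^ (-a) := by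
      rw [rpow_neg hM0.le, rpow_neg hq.le, ← div_eq_mul_inv, le_div_iff₀ (by positivity),
        inv_mul_le_iff₀ (by positivity), mul_comm, ← mul_rpow (by norm_num) hM0.le]
      exact rpow_le_rpow hq.le h3 ha
    have h5 : y ^ j * x ^ (-a) * (x ^ j)⁻¹ ≤ M ^ (-a) * (M / x) ^ (a + r - 1) := by
      calc y ^ j * x ^ (-a) * (x ^ j)⁻¹ ≤ M ^ j * x ^ (-a) * (x ^ j)⁻¹ := by gcongr
        _ = M ^ (-a) * ((M / x) ^ a * (M / x) ^ j) := by
            rw [div_rpow hM0.le hx.le, rpow_neg hx.le, rpow_neg hM0.le, div_pow]; field_simp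
        _ = M ^ (-a) * (M / x) ^ (a + j) := by
            rw [rpow_add (by positivity), rpow_natCast]
        _ ≤ M ^ (-a) * (M / x) ^ (a + r - 1) := by
            refine mul_le_mul_of_nonneg_left (rpow_le_rpow_of_exponent_le hMx ?_) (by positivity)
            have : (j : ℝ) + 1 ≤ r := by exact_mod_cast hj
            linarith
    calc y ^ j * x ^ (-a) * (x ^ j)⁻¹ ≤ M ^ (-a) * (M / x) ^ (a + r - 1) := h5
      _ ≤ (16 ^ a * qe ^ (-a)) * (M / x) ^ (a + r - 1) := by gcongr
      _ = (16 ^ a * qe ^ (-a)) * 1 * (M / x) ^ (a + r - 1) := by ring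
      _ ≤ (16 ^ a * qe ^ (-a)) * ((2 ^ 8) ^ r * (y / M) ^ (r : ℝ)) * (M / x) ^ (a + r - 1) := by
          gcongr
      _ = _ := by ring

lemma le_weight_of_small {qe x y a : ℝ} {r : ℕ} (ha : 0 ≤ a) (hq : 0 < qe) (hx : 0 < x) (hy : 0 < y)
    (hxy : y ≤ x) (htri : qe ≤ 8 * (x + y)) : x ^ (-a) * (y / x) ^ r ≤ 16 ^ a * (qe ^ (-a) * ((y /
    max x y) ^ (r : ℝ) * (max x y / x) ^ (a + r - 1))) := by
  rw [max_eq_left hxy, div_self hx.ne', one_rpow, mul_one, rpow_natCast, ← mul_assoc]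
  refine mul_le_mul_of_nonneg_right ?_ (by positivity)
  rw [rpow_neg hx.le, rpow_neg hq.le, ← div_eq_mul_inv, le_div_iff₀ (by positivity),
    inv_mul_le_iff₀ (by positivity), mul_comm, ← mul_rpow (by norm_num) hx.le]
  exact rpow_le_rpow hq.le (by linarith) ha

/-- The configuration space. -/
abbrev Conf (G : RGraph V E) (d : ℕ) : Type _ := 𝕍 G → ℝ^d

/-- The position of the vertex `v` as a linear function of the configuration. -/
def pos (G : RGraph V E) (v : V) : Conf G d →L[ℝ] ℝ^d :=
  if h : v = G.root then 0 else ContinuousLinearMap.proj ⟨v, h⟩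

lemma pos_apply (x : Conf G d) (v : V) : pos G v x = G.extend x v := by
  unfold pos RGraph.extend
  split_ifs <;> rfl

/-- The coordinate directions of the configuration space. -/
def dir (G : RGraph V E) (c : 𝕍 G × Fin d) : Conf G d := Pi.single c.1 (stdB c.2)

lemma pos_dir (v : V) (c : 𝕍 G × Fin d) :
    pos G v (dir G c) = if c.1.1 = v then stdB c.2 else 0 := by
  unfold pos dir
  split_ifs with h1 h2 h2
  · exact absurd (h2.trans h1) c.1.2
  · simp
  · subst h2; simp
  · simp only [ContinuousLinearMap.proj_apply]; rw [Pi.single_eq_of_ne]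
    exact fun h => h2 (by rw [← h])

/-- The distances prescribed by the scales `n`. -/
def scl (n : Scale V) (v w : V) : ℝ := 2 ^ (-n s(v, w))

notation:max "ew" G:max a:max n:max e:max => edgeWeight G a (gain G) (scl n) e

lemma scl_pos (n : Scale V) (v w : V) : 0 < scl n v w := by unfold scl; positivity

/-- Configurations whose distances, for the pairs not in `P`, are of the order prescribed by `n`. -/
def scaleDom (s : ℕ^d) (G : RGraph V E) (n : Scale V) (P : Finset (Sym2 V)) : Set (Conf G d) :=
  {x | ∀ v w, v ≠ w → s(v, w) ∉ P → 2 ^ (-n s(v, w) - 1) < snorm s (pos G v x - pos G w x) ∧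
    snorm s (pos G v x - pos G w x) < 2 ^ (-n s(v, w) + 4)}

lemma isOpen_scaleDom (n : Scale V) (P : Finset (Sym2 V)) : IsOpen (scaleDom s G n P) := by
  have : scaleDom s G n P = ⋂ (v : V) (w : V) (_ : v ≠ w) (_ : s(v, w) ∉ P), {x | 2 ^ (-n s(v, w) -
    1) < snorm s (pos G v x - pos G w x) ∧ snorm s (pos G v x - pos G w x) < 2 ^ (-n s(v, w) + 4)}
    := by
    ext x; simp [scaleDom]
  rw [this]
  have hc : ∀ v w, Continuous fun x : Conf G d => snorm s (pos G v x - pos G w x) := fun v w =>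
    continuous_snorm.comp ((pos G v).continuous.sub (pos G w).continuous)
  refine isOpen_iInter_of_finite fun v => isOpen_iInter_of_finite fun w =>
    isOpen_iInter_of_finite fun _ => isOpen_iInter_of_finite fun _ => ?_
  exact (isOpen_lt continuous_const (hc v w)).inter (isOpen_lt (hc v w) continuous_const)

/-- The cost of derivatives in the direction of a vertex. -/
def cost (s : ℕ^d) (G : RGraph V E) (M : V → ℝ) (c : 𝕍 G × Fin d) : ℝ := M c.1.1 ^ s c.2

lemma isSymb_diff {M : V → ℝ} (hM0 : ∀ v, 0 ≤ M v) {D : Set (Conf G d)}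
    {D' : Set ℝ^d} {f : ℝ^d → ℝ} {m : ℕ} {B Λ : ℝ} (hΛ : 0 ≤ Λ) {v w : V}
    (hvw : v ≠ w) (hD : IsOpen D) (hD' : IsOpen D')
    (hDD : ∀ x ∈ D, pos G v x - pos G w x ∈ D') (hB : 0 ≤ B) (hf : SmoothOn f D')
    (hv : v ≠ G.root → Λ ≤ M v) (hw : w ≠ G.root → Λ ≤ M w)
    (h : IsSymb stdB (fun i => Λ ^ s i) D' m B f) :
    IsSymb (dir G) (cost s G M) D m B (fun x => f (pos G v x - pos G w x)) := by
  refine IsSymb.comp (pos G v - pos G w) hD hD' (fun x hx => by simpa using hDD x hx)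
    (fun c => pow_nonneg (hM0 _) _) hB (fun i => by positivity) hf (fun c => ?_) h
  rw [sub_apply, pos_dir, pos_dir]
  by_cases h1 : c.1.1 = v
  · right
    refine ⟨c.2, Or.inl ?_, ?_⟩
    · rw [if_pos h1, if_neg (fun h2 => hvw (h1.symm.trans h2)), sub_zero]
    · change Λ ^ s c.2 ≤ M c.1.1 ^ s c.2; rw [h1]; exact pow_le_pow_left₀ hΛ (hv (h1 ▸ c.1.2)) _
  · by_cases h2 : c.1.1 = w
    · right
      refine ⟨c.2, Or.inr ?_, ?_⟩
      · rw [if_neg h1, if_pos h2, zero_sub]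
      · change Λ ^ s c.2 ≤ M c.1.1 ^ s c.2; rw [h2]; exact pow_le_pow_left₀ hΛ (hw (h2 ▸ c.1.2)) _
    · left
      rw [if_neg h1, if_neg h2, sub_zero]

lemma pos_root (x : Conf G d) : pos G G.root x = 0 := by simp [pos]

lemma contDiffOn_kernel_diff {K : ℝ^d → ℝ} (hK : SmoothOn K {0}ᶜ)
    {n : Scale V} {P : Finset (Sym2 V)} {v w : V} (hvw : v ≠ w) (hP : s(v, w) ∉ P) :
    SmoothOn (fun x => K (pos G v x - pos G w x)) (scaleDom s G n P) := by
  refine hK.comp ((pos G v).contDiff.sub (pos G w).contDiff).contDiffOn fun x hx =>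
    lt_snorm_subset (by positivity) (hx v w hvw hP).1

/-- Symbol estimates for the factors of edges with `r ≥ 0`. -/
lemma exists_isSymb_hatK {a κ : E → ℝ} {e : E} (ha : 0 ≤ a e) (hr : 0 ≤ G.r e) (hroot : 0 < G.r e →
    G.src e ≠ G.root ∧ G.tgt e ≠ G.root) (m : ℕ) : ∃ C : ℝ, 0 ≤ C ∧ ∀ (K : ℝ^d → ℝ) (N : ℝ) (p : ℕ)
    (n : Scale V) (P : Finset (Sym2 V)) (M : V → ℝ), KerBound s (a e) p N K → (m + (G.r e).toNat) *
    sdim s < p → (∀ v, 0 ≤ M v) → (∀ v w, v ≠ w → s(v, w) ∉ P → 4 * 2 ^ n s(v, w) ≤ M v) → (∀ v,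
    s(G.root, v) ∉ P) → s(G.src e, G.tgt e) ∉ P → (∀ u v w, u ≠ v → v ≠ w → u ≠ w → scl n u w ≤ 8 *
    (scl n u v + scl n v w)) → SmoothOn (fun x => RGraph.hatK s (G.r e) K (pos G (G.src e) x) (pos G
    (G.tgt e) x)) (scaleDom s G n P) ∧ IsSymb (dir G) (cost s G M) (scaleDom s G n P) m (C * N *
    edgeWeight G a κ (scl n) e) (fun x => RGraph.hatK s (G.r e) K (pos G (G.src e) x) (pos G (G.tgt
    e) x)) := by
  have hst := G.no_loop e
  -- the undifferentiated kernel
  have hK0 : ∀ (K : ℝ^d → ℝ) (N : ℝ) (p : ℕ) (n : Scale V) (P : Finset (Sym2 V)) (M : V → ℝ),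
    KerBound s (a e) p N K → m * sdim s < p → (∀ v, 0 ≤ M v) → (∀ v w, v ≠ w → s(v, w) ∉ P → 4 * 2 ^
    n s(v, w) ≤ M v) → s(G.src e, G.tgt e) ∉ P → IsSymb (dir G) (cost s G M) (scaleDom s G n P) m (N
    * 2 ^ a e * scl n (G.src e) (G.tgt e) ^ (-a e)) (fun x => K (pos G (G.tgt e) x - pos G (G.src e)
    x)) := by
    intro K N p n P M hK hp hM0 hM hP
    have h1 := hK.isSymb ha hp (Λ := 2 ^ (n s(G.src e, G.tgt e) + 1)) (by positivity)
    have hN := hK.nonneg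
    have hle : (2 : ℝ) ^ (n s(G.src e, G.tgt e) + 1) ≤ 4 * 2 ^ n s(G.src e, G.tgt e) := by
      rw [two_zpow_add, zpow_one]; have : (0 : ℝ) < 2 ^ n s(G.src e, G.tgt e) := by positivity
      linarith
    have hB : N * ((2 : ℝ) ^ (n s(G.src e, G.tgt e) + 1)) ^ a e = N * 2 ^ a e * scl n (G.src e)
      (G.tgt e) ^ (-a e) := by
      unfold scl
      rw [two_zpow_add, mul_rpow (by positivity) (by positivity), zpow_one, zpow_neg,
        inv_rpow (by positivity), ← rpow_neg (by positivity), neg_neg]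
      ring
    rw [hB] at h1
    refine isSymb_diff hM0 (Λ := 2 ^ (n s(G.src e, G.tgt e) + 1)) (by positivity) hst.symm
      (isOpen_scaleDom n P) (isOpen_lt_snorm _) (fun x hx => ?_) ?_ ?_ (fun _ => ?_)
      (fun _ => ?_) h1
    · rw [Set.mem_ofPred_eq, snorm_sub_comm, ← zpow_neg, neg_add]; exact (hx _ _ hst hP).1
    · have := scl_pos n (G.src e) (G.tgt e); positivity
    · exact hK.smooth.mono (lt_snorm_subset (by positivity))
    · rw [Sym2.eq_swap] at hle ⊢; rw [Sym2.eq_swap] at hP; exact hle.trans (hM _ _ hst.symm hP)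
    · exact hle.trans (hM _ _ hst hP)
  rcases hr.eq_or_lt with hr0 | hr0
  · refine ⟨2 ^ a e, by positivity, fun K N p n P M hK hp hM0 hM _ hP _ => ?_⟩
    have hfun : (fun x : Conf G d => RGraph.hatK s (G.r e) K (pos G (G.src e) x) (pos G (G.tgt e)
      x)) = fun x => K (pos G (G.tgt e) x - pos G (G.src e) x) := by
      funext x; simp [RGraph.hatK, ← hr0, lowIdx]
    rw [hfun]; refine ⟨contDiffOn_kernel_diff hK.smooth hst.symm (by rwa [Sym2.eq_swap]), ?_⟩
    have := hK0 K N p n P M hK (lt_of_le_of_lt (Nat.mul_le_mul_right _ (by omega)) hp) hM0 hM hP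
    have he : edgeWeight G a κ (scl n) e = scl n (G.src e) (G.tgt e) ^ (-a e) := by
      unfold edgeWeight; rw [if_neg (by omega), if_neg (by omega), mul_one, mul_one]
    rwa [he, mul_comm (2 ^ a e) N]
  obtain ⟨hsr, htr⟩ := hroot hr0
  set r := (G.r e).toNat with hrdef
  have hr1 : 1 ≤ r := by omega
  have hrcast : ((r : ℕ) : ℝ) = (G.r e : ℝ) := by
    have : ((r : ℕ) : ℤ) = G.r e := Int.toNat_of_nonneg hr; exact_mod_cast this
  obtain ⟨C₁, hC₁, h₁⟩ := exists_isSymb_taylorRem (s := s) (b := dir (d := d) G) m r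
  -- termwise estimates
  let cj : ℕ^d → ℝ := fun j => 2 ^ m * (((sdeg s j : ℝ) + 1) ^ m * (2 ^ 4) ^ sdeg s j *
    2 ^ a e * 2 ^ sdeg s j)
  have hcj : ∀ j, 0 ≤ cj j := fun j => by positivity
  have hScj : 0 ≤ ∑ j ∈ lowIdx s r, |(-(mfact j)⁻¹)| * cj j :=
    sum_nonneg fun j _ => mul_nonneg (abs_nonneg _) (hcj j)
  refine ⟨C₁ * 4 ^ a e * (2 ^ 6) ^ r * 16 ^ a e + (2 ^ a e + ∑ j ∈ lowIdx s r,
    |(-(mfact j)⁻¹)| * cj j) * ((2 ^ 8) ^ r * 16 ^ a e), by positivity, ?_⟩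
  intro K N p n P M hK hp hM0 hM hPr hP htri
  have hN := hK.nonneg
  set Ps := s(G.root, G.src e) with hPs
  set Pt := s(G.root, G.tgt e) with hPt
  set qe := scl n (G.src e) (G.tgt e) with hqe
  set x₀ := scl n G.root (G.src e) with hx₀
  set y₀ := scl n G.root (G.tgt e) with hy₀
  have hqe0 : 0 < qe := scl_pos _ _ _
  have hx0 : 0 < x₀ := scl_pos _ _ _
  have hy0 : 0 < y₀ := scl_pos _ _ _
  have hx₀' : x₀ = 2 ^ (-n Ps) := rfl
  have hy₀' : y₀ = 2 ^ (-n Pt) := rfl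
  have hswap : s(G.src e, G.root) = Ps := Sym2.eq_swap
  have hswap' : s(G.tgt e, G.root) = Pt := Sym2.eq_swap
  have hW : edgeWeight G a κ (scl n) e = qe ^ (-a e) * ((y₀ / max x₀ y₀) ^ (r : ℝ) * (max x₀ y₀ /
    x₀) ^ (a e + r - 1)) := by
    unfold edgeWeight; rw [if_pos hr0, if_neg (by omega), mul_one, hrcast]
  set W := edgeWeight G a κ (scl n) e with hWdef
  have hW0 : 0 ≤ W := by rw [hW]; positivity
  have htri' : qe ≤ 8 * (x₀ + y₀) := by
    have := htri (G.src e) G.root (G.tgt e) hsr htr.symm hst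
    rw [show scl n (G.src e) G.root = x₀ by rw [hx₀']; unfold scl; rw [hswap]] at this; exact this
  have hDx : ∀ x ∈ scaleDom s G n P, 2 ^ (-n Ps - 1) < snorm s (pos G (G.src e) x) ∧ snorm s (pos G
    (G.src e) x) < 2 ^ (-n Ps + 4) := fun x hx => by
    have := hx (G.src e) G.root hsr (by rw [hswap]; exact hPr _)
    rwa [pos_root, sub_zero, hswap] at this
  have hDy : ∀ x ∈ scaleDom s G n P, 2 ^ (-n Pt - 1) < snorm s (pos G (G.tgt e) x) ∧ snorm s (pos G
    (G.tgt e) x) < 2 ^ (-n Pt + 4) := fun x hx => by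
    have := hx (G.tgt e) G.root htr (by rw [hswap']; exact hPr _)
    rwa [pos_root, sub_zero, hswap'] at this
  have hMs : 4 * 2 ^ n Ps ≤ M (G.src e) := by
    rw [← hswap]; exact hM _ _ hsr (by rw [hswap]; exact hPr _)
  have hMt : 4 * 2 ^ n Pt ≤ M (G.tgt e) := by
    rw [← hswap']; exact hM _ _ htr (by rw [hswap']; exact hPr _)
  have hO := isOpen_scaleDom (s := s) (G := G) n P
  have hν : ∀ c, 0 ≤ cost s G M c := fun c => pow_nonneg (hM0 _) _
  have hsm1 : SmoothOn (fun x : Conf G d => K (pos G (G.tgt e) x - pos G (G.src e) x))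
      (scaleDom s G n P) := contDiffOn_kernel_diff hK.smooth hst.symm (by rwa [Sym2.eq_swap])
  have hne0 : ∀ x ∈ scaleDom s G n P, -pos G (G.src e) x ∈ ({0}ᶜ : Set ℝ^d) := fun x hx h0 => by
      have h1 := (hDx x hx).1; rw [neg_eq_zero.1 (Set.mem_singleton_iff.1 h0), snorm_zero] at h1
      exact absurd h1 (not_lt.2 (by positivity))
  have hsm2 : ∀ j, SmoothOn (fun x : Conf G d => multiD j K (-pos G (G.src e) x)) (scaleDom s G n P)
    := fun j =>
    (contDiffOn_mD stdB isOpen_compl_singleton hK.smooth j).comp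
      (pos G (G.src e)).contDiff.neg.contDiffOn hne0
  have hsm3 : ∀ j, SmoothOn (fun x : Conf G d => monom j (pos G (G.tgt e) x))
      (scaleDom s G n P) := fun j => ((contDiff_monom j).comp (pos G (G.tgt e)).contDiff).contDiffOn
  have hform : (fun x : Conf G d => RGraph.hatK s (G.r e) K (pos G (G.src e) x) (pos G (G.tgt e) x))
    = fun x => K (pos G (G.tgt e) x - pos G (G.src e) x) + ∑ j ∈ lowIdx s r, (-(mfact j)⁻¹) * (monom
    j (pos G (G.tgt e) x) * multiD j K (-pos G (G.src e) x)) := by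
    funext x; unfold RGraph.hatK; rw [sub_eq_add_neg, ← sum_neg_distrib]; congr 1
    exact sum_congr rfl fun j _ => by rw [div_eq_mul_inv]; ring
  have hsmT : ∀ j ∈ lowIdx s r, SmoothOn (fun x : Conf G d => (-(mfact j)⁻¹) * (monom j (pos G
    (G.tgt e) x) * multiD j K (-pos G (G.src e) x))) (scaleDom s G n P) := fun j _ =>
    contDiffOn_const.mul ((hsm3 j).mul (hsm2 j))
  refine ⟨by rw [hform]; exact hsm1.add (ContDiffOn.sum hsmT), ?_⟩
  rcases le_or_gt (n Ps + 8) (n Pt) with hcase | hcase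
  · -- cancellation
    have hfun : (fun x : Conf G d => RGraph.hatK s (G.r e) K (pos G (G.src e) x) (pos G (G.tgt e)
      x)) = fun x => taylorRem s stdB r K (-pos G (G.src e) x) (pos G (G.tgt e) x) := by
      funext x; rw [hatK_eq_taylorRem]
    rw [hfun]; have hΛ : (0 : ℝ) < 2 ^ (n Ps + 2) := by positivity
    have hsy := hK.isSymb ha hp hΛ
    have hDsub : {x : ℝ^d | ((2 : ℝ) ^ (n Ps + 2))⁻¹ < snorm s x} ⊆ {0}ᶜ :=
    lt_snorm_subset (by positivity)
    have hρ : (2 : ℝ) ^ (-n Pt + 4) * 2 ^ (n Ps + 2) = 2 ^ 6 * (y₀ / x₀) := by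
      rw [hx₀', hy₀', two_zpow_add, two_zpow_add, zpow_neg _ (n Ps)]; field_simp
    have hyx : 2 ^ 8 * y₀ ≤ x₀ := by
      rw [hx₀', hy₀', ← zpow_natCast, ← two_zpow_add]; exact two_zpow_le (by push_cast; omega)
    have hyx1 : y₀ / x₀ ≤ (2 ^ 8)⁻¹ := by
      rw [div_le_iff₀ hx0, le_inv_mul_iff₀ (by norm_num)]; exact hyx
    have h5 := h₁ (cost s G M) (scaleDom s G n P) {x | ((2 : ℝ) ^ (n Ps + 2))⁻¹ < snorm s x} K
      (pos G (G.src e)) (pos G (G.tgt e)) (N * ((2 : ℝ) ^ (n Ps + 2)) ^ a e) (2 ^ (n Ps + 2))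
      (2 ^ n Pt) (2 ^ (-n Pt + 4)) hO (isOpen_lt_snorm _) (hK.smooth.mono hDsub) hν
      (by positivity) hΛ.le (by positivity) (by positivity) (by rw [hρ]; norm_num at hyx1 ⊢; linarith)
      (by rw [← two_zpow_add]; exact one_le_zpow₀ (by norm_num) (by omega))
      (fun x hx => (hDy x hx).2.le) (fun x hx t ht => ?_) (fun c => ?_) hsy
    · refine h5.mono hν (fun _ => le_rfl) (by positivity) ?_ le_rfl; rw [hρ]
      have h6 := le_weight_of_small (r := r) ha hqe0 hx0 hy0 (by linarith) htri'; rw [← hW] at h6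
      have h7 : ((2 : ℝ) ^ (n Ps + 2)) ^ a e = 4 ^ a e * x₀ ^ (-a e) := by
        rw [hx₀', two_zpow_add, mul_rpow (by positivity) (by positivity), zpow_neg,
          inv_rpow (by positivity), ← rpow_neg (by positivity), neg_neg]
        norm_num; ring
      rw [h7, mul_pow]
      calc C₁ * (N * (4 ^ a e * x₀ ^ (-a e))) * ((2 ^ 6) ^ r * (y₀ / x₀) ^ r)
          = C₁ * 4 ^ a e * (2 ^ 6) ^ r * N * (x₀ ^ (-a e) * (y₀ / x₀) ^ r) := by ring
        _ ≤ C₁ * 4 ^ a e * (2 ^ 6) ^ r * N * (16 ^ a e * W) := by gcongr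
        _ = (C₁ * 4 ^ a e * (2 ^ 6) ^ r * 16 ^ a e + 0) * N * W := by ring
        _ ≤ _ := by gcongr; positivity
    · rw [Set.mem_ofPred_eq, ← zpow_neg]; have h1 := (hDx x hx).1; have h2 := (hDy x hx).2
      have h3 : snorm s (dil s t (pos G (G.tgt e) x)) ≤ snorm s (pos G (G.tgt e) x) := by
        rw [snorm_dil ht.1]; exact mul_le_of_le_one_left (snorm_nonneg _) ht.2
      have h4 := snorm_add_le (-(-pos G (G.src e) x + dil s t (pos G (G.tgt e) x)))
        (dil s t (pos G (G.tgt e) x))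
      rw [snorm_neg, neg_add, neg_neg, neg_add_cancel_right] at h4
      have h5 : (2 : ℝ) ^ (-n Pt + 4) ≤ 2 ^ (-n Ps - 4) := two_zpow_le (by omega)
      have h6 : (2 : ℝ) ^ (-n Ps - 1) = 2 ^ (-n Ps) / 2 := by rw [two_zpow_sub, zpow_one]
      have h7 : (2 : ℝ) ^ (-n Ps - 4) = 2 ^ (-n Ps) / 16 := by rw [two_zpow_sub]; norm_num
      have h8 : (2 : ℝ) ^ (-(n Ps + 2)) = 2 ^ (-n Ps) / 4 := by
        rw [neg_add, two_zpow_add]; norm_num; ring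
      have h9 : (0 : ℝ) < 2 ^ (-n Ps) := by positivity
      rw [h8]; linarith
    · rw [pos_dir, pos_dir]
      by_cases h1 : c.1.1 = G.src e
      · right; left
        refine ⟨c.2, if_pos h1, if_neg fun h2 => hst (h1.symm.trans h2), ?_⟩; unfold cost; rw [h1]
        refine pow_le_pow_left₀ hΛ.le (le_trans (le_of_eq ?_) hMs) _
        rw [two_zpow_add]; norm_num; ring
      · by_cases h2 : c.1.1 = G.tgt e
        · right; right
          refine ⟨c.2, if_neg h1, if_pos h2, ?_⟩; unfold cost; rw [h2]
          refine pow_le_pow_left₀ (by positivity) (le_trans ?_ hMt) _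
          have : (0 : ℝ) < 2 ^ n Pt := by positivity
          linarith
        · left
          exact ⟨if_neg h1, if_neg h2⟩
  · -- no cancellation
    have hxy : x₀ ≤ 2 ^ 8 * y₀ := by
      rw [hx₀', hy₀', ← zpow_natCast, ← two_zpow_add]; exact two_zpow_le (by push_cast; omega)
    have hnum := le_weight_of_comparable (r := r) hr1 ha hqe0 hx0 hy0 hxy htri'; rw [← hW] at hnum
    rw [hform]; have hmp : m * sdim s < p := lt_of_le_of_lt (Nat.mul_le_mul_right _ (by omega)) hp
    have hT := IsSymb.sum (b := dir G) (μ := cost s G M) (m := m) (lowIdx s r) (B := fun j =>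
      |(-(mfact j)⁻¹)| * (cj j * N * (y₀ ^ sdeg s j * x₀ ^ (-a e) * (x₀ ^ sdeg s j)⁻¹))) hν hO hsmT
      fun j hj => by
      rw [mem_lowIdx hs.pos] at hj; refine IsSymb.const_mul hO ((hsm3 j).mul (hsm2 j)) _ ?_
      have e1 := isSymb_monom (ρ := 2 ^ (-n Pt + 4)) (Λ := 2 ^ n Pt) (by positivity)
        (by rw [← two_zpow_add]; exact one_le_zpow₀ (by norm_num) (by omega)) m j
      have e1' : IsSymb (dir G) (cost s G M) (scaleDom s G n P) m
          (((sdeg s j : ℝ) + 1) ^ m * ((2 : ℝ) ^ (-n Pt + 4)) ^ sdeg s j)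
          (fun x => monom j (pos G (G.tgt e) x)) := by
        have := isSymb_diff (G := G) (D := scaleDom s G n P) hM0 (Λ := 2 ^ n Pt) (by positivity) htr hO
          (isOpen_snorm_lt _) (fun x hx => by
            rw [pos_root, sub_zero]; exact (hDy x hx).2) (by positivity)
          (contDiff_monom j).contDiffOn (fun _ => le_trans (by
            have : (0 : ℝ) < 2 ^ n Pt := by positivity
            linarith) hMt) (fun h => absurd rfl h) e1
        simpa only [pos_root, sub_zero] using this
      have e2 := hK.isSymb_multiD ha (m := m) j (lt_of_le_of_lt (by nlinarith [hs.dim]) hp)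
        (Λ := 2 ^ (n Ps + 1)) (by positivity)
      have e2' : IsSymb (dir G) (cost s G M) (scaleDom s G n P) m (N * ((2 : ℝ) ^ (n Ps + 1)) ^ a e
        * ((2 : ℝ) ^ (n Ps + 1)) ^ sdeg s j) (fun x => multiD j K (-pos G (G.src e) x)) := by
        have := isSymb_diff (G := G) (D := scaleDom s G n P) hM0 (Λ := 2 ^ (n Ps + 1)) (by positivity)
          hsr.symm hO (isOpen_lt_snorm _) (fun x hx => by
            rw [pos_root, zero_sub, Set.mem_ofPred_eq, snorm_neg, ← zpow_neg, neg_add]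
            exact (hDx x hx).1) (by positivity)
          ((contDiffOn_mD stdB isOpen_compl_singleton hK.smooth j).mono
            (lt_snorm_subset (by positivity)))
          (fun h => absurd rfl h) (fun _ => le_trans (by
            rw [two_zpow_add, zpow_one]; have : (0 : ℝ) < 2 ^ n Ps := by positivity
            linarith) hMs) e2
        simpa only [pos_root, zero_sub, multiD_eq_mD] using this
      have e3 := e1'.mul hν (by positivity) (by positivity) hO (hsm3 j) (hsm2 j) e2'
      refine e3.mono hν (fun _ => le_rfl) (by positivity) (le_of_eq ?_) le_rfl
      have h7 : ((2 : ℝ) ^ (n Ps + 1)) ^ a e = 2 ^ a e * x₀ ^ (-a e) := by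
        rw [hx₀', two_zpow_add, mul_rpow (by positivity) (by positivity), zpow_neg,
          inv_rpow (by positivity), ← rpow_neg (by positivity), neg_neg, zpow_one]
        ring
      have h8 : (2 : ℝ) ^ (n Ps + 1) = 2 * x₀⁻¹ := by
        rw [hx₀', two_zpow_add, zpow_neg, inv_inv, zpow_one]; ring
      have h9 : (2 : ℝ) ^ (-n Pt + 4) = 2 ^ 4 * y₀ := by rw [hy₀', two_zpow_add]; norm_num; ring
      rw [h7, h8, h9, mul_pow, mul_pow, inv_pow]; simp only [cj]; ring
    have hA := (hK0 K N p n P M hK hmp hM0 hM hP).add hO hsm1 (ContDiffOn.sum hsmT) hT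
    refine hA.mono hν (fun _ => le_rfl) (by
      refine add_nonneg (by positivity) (sum_nonneg fun j _ => ?_); have := hcj j
      positivity) ?_ le_rfl
    have hsum : ∑ j ∈ lowIdx s r, |(-(mfact j)⁻¹)| * (cj j * N * (y₀ ^ sdeg s j * x₀ ^ (-a e) * (x₀
      ^ sdeg s j)⁻¹)) ≤ (∑ j ∈ lowIdx s r, |(-(mfact j)⁻¹)| * cj j) * (N * ((2 ^ 8) ^ r * 16 ^ a e *
      W)) := by
      rw [sum_mul]; refine sum_le_sum fun j hj => ?_
      have h1 := hnum.2 (sdeg s j) ((mem_lowIdx hs.pos _ _).1 hj); have := hcj j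
      calc |(-(mfact j)⁻¹)| * (cj j * N * (y₀ ^ sdeg s j * x₀ ^ (-a e) * (x₀ ^ sdeg s j)⁻¹))
          ≤ |(-(mfact j)⁻¹)| * (cj j * N * ((2 ^ 8) ^ r * 16 ^ a e * W)) := by gcongr
        _ = _ := by ring
    have hfirst : N * 2 ^ a e * qe ^ (-a e) ≤ N * 2 ^ a e * ((2 ^ 8) ^ r * 16 ^ a e * W) := by
      have := hnum.1; gcongr
    refine (add_le_add hfirst hsum).trans ?_
    calc N * 2 ^ a e * ((2 ^ 8) ^ r * 16 ^ a e * W) + (∑ j ∈ lowIdx s r, |(-(mfact j)⁻¹)| * cj j) *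
          (N * ((2 ^ 8) ^ r * 16 ^ a e * W))
        = (0 + (2 ^ a e + ∑ j ∈ lowIdx s r, |(-(mfact j)⁻¹)| * cj j) *
            ((2 ^ 8) ^ r * 16 ^ a e)) * N * W := by ring
      _ ≤ _ := by gcongr; positivity

/-! ### Integrating out one variable -/

lemma integral_eq_zero_of_update {I Y : Type*} [Fintype I] [DecidableEq I] [MeasureSpace Y]
    [SigmaFinite (volume : Measure Y)] [Nonempty Y] (u : I) {f : (I → Y) → ℝ}
    (h : ∀ x, ∫ y, f (Function.update x u y) = 0) : ∫ x, f x = 0 := by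
  by_cases hf : Integrable f
  swap
  · exact integral_undef hf
  obtain ⟨p, hp⟩ : ∃ p : I → Prop, ∀ i, p i ↔ i = u := ⟨fun i => i = u, fun _ => Iff.rfl⟩
  classical
  let e := MeasurableEquiv.piEquivPiSubtypeProd (fun _ : I => Y) p
  have hmp := (volume_preserving_piEquivPiSubtypeProd (fun _ : I => Y) p).symm
  rw [← hmp.integral_comp' f]
  have hf' := (hmp.integrable_comp_emb e.symm.measurableEmbedding).2 hf
  rw [Measure.volume_eq_prod] at hf' ⊢
  refine (integral_prod_symm _ hf').trans ?_
  refine integral_eq_zero_of_ae (Eventually.of_forall fun z => ?_)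
  let : Unique {i : I // p i} := ⟨⟨⟨u, (hp u).2 rfl⟩⟩, fun i => Subtype.ext ((hp _).1 i.2)⟩
  have hu : MeasurePreserving (MeasurableEquiv.funUnique {i : I // p i} Y) volume volume := by
    convert volume_preserving_funUnique {i : I // p i} Y
  obtain ⟨y₀⟩ := ‹Nonempty Y›
  let x : I → Y := e.symm (fun _ => y₀, z)
  have key : ∀ y : {i : I // p i} → Y, f (e.symm (y, z)) = f (Function.update x u
    (MeasurableEquiv.funUnique {i : I // p i} Y y)) := by
    intro y; congr 1; funext i
    by_cases hi : i = u
    · subst hi; have hi := (hp i).2 rfl; rw [Function.update_self]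
      simp [e, MeasurableEquiv.piEquivPiSubtypeProd, Equiv.piEquivPiSubtypeProd,
        MeasurableEquiv.funUnique, hi]
      rfl
    · rw [Function.update_of_ne hi]; have hi := mt (hp i).1 hi
      simp [e, x, MeasurableEquiv.piEquivPiSubtypeProd, Equiv.piEquivPiSubtypeProd, hi]
  simp only [Pi.zero_apply]
  refine (integral_congr_ae (Eventually.of_forall key)).trans ?_
  rw [hu.integral_comp' fun y => f (Function.update x u y)]
  exact h x

section LocRem

variable {I : Type*} [Fintype I] [DecidableEq I]

/-! ### Subtraction of the Taylor expansion of one point at another -/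

/-- The coordinate directions of a space of configurations. -/
def cdir (c : I × Fin d) : I → ℝ^d := Pi.single c.1 (stdB c.2)

/-- Moving the point `u` to the point `w`. -/
def moveTo (u w : I) : (I → ℝ^d) →L[ℝ] (I → ℝ^d) :=
  ContinuousLinearMap.pi fun i => ContinuousLinearMap.proj (if i = u then w else i)

lemma moveTo_apply (u w : I) (x : I → ℝ^d) (i : I) :
    moveTo u w x i = if i = u then x w else x i := by
  simp only [moveTo, ContinuousLinearMap.pi_apply, ContinuousLinearMap.proj_apply]
  split_ifs <;> rfl

lemma moveTo_add (u w : I) (x : I → ℝ^d) : moveTo u w x + ∑ i, (x u - x w) i • cdir (u, i) = x := by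
  have h1 : ∑ i, (x u - x w) i • cdir (u, i) = Pi.single u (x u - x w) := by
    funext j; rw [Finset.sum_apply]
    by_cases hj : j = u
    · subst hj; simp only [Pi.smul_apply, cdir, Pi.single_eq_same]; exact stdB_sum _
    · simp [cdir, hj]
  rw [h1]
  funext j
  rw [Pi.add_apply, moveTo_apply]
  by_cases hj : j = u
  · subst hj; simp
  · simp [hj]

lemma moveTo_update (u w : I) (hw : w ≠ u) (x : I → ℝ^d) (y : ℝ^d) :
    moveTo u w (Function.update x u y) = moveTo u w x := by
  funext j
  rw [moveTo_apply, moveTo_apply, Function.update_of_ne hw]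
  split_ifs with h
  · rfl
  · rw [Function.update_of_ne h]

/-- The remainder of the Taylor expansion of `F` in the point `u` at the point `w`, cut off at
distances `2⁻ⁿ`. -/
def locRem (s : ℕ^d) (u w : I) (N : ℕ) (n : ℤ) (F : (I → ℝ^d) → ℝ) (x : I → ℝ^d) : ℝ :=
  chiN s (n - 3) (x u - x w) * taylorRem s (fun i => cdir (u, i)) N F (moveTo u w x) (x u - x w)

lemma contDiff_sub_apply (u w : I) : Smooth fun x : I → ℝ^d => x u - x w :=
  (contDiff_apply ℝ ℝ^d u).sub (contDiff_apply ℝ ℝ^d w)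

lemma contDiff_locRem (u w : I) (N : ℕ) (n : ℤ) {F : (I → ℝ^d) → ℝ}
    (hF : Smooth F) : Smooth (locRem s u w N n F) := by
  unfold locRem taylorRem
  simp only [moveTo_add]
  refine ((contDiff_chiN _).comp (contDiff_sub_apply u w)).mul (hF.sub (ContDiff.sum fun k _ => ?_))
  refine (((contDiff_monom k).comp (contDiff_sub_apply u w)).div_const _).mul ?_
  exact (contDiffOn_univ.1 (contDiffOn_mD _ isOpen_univ hF.contDiffOn k)).comp (moveTo u w).contDiff

lemma lineD_locRem {u w : I} (N : ℕ) (n : ℤ) {F : (I → ℝ^d) → ℝ}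
    (hF : Smooth F) {c : I × Fin d} (hu : c.1 ≠ u) (hw : c.1 ≠ w) :
    lineD (cdir c) (locRem s u w N n F) = locRem s u w N n (lineD (cdir c) F) := by
  funext x
  refine eq_of_hasDerivAt_line ((contDiff_locRem u w N n hF).differentiable (by simp) x) ?_
  have h1 := (hasDerivAt_taylorRem_base (s := s) (b := fun i => cdir (u, i)) (z := x u - x w)
    isOpen_univ hF.contDiffOn (x₀ := moveTo u w x) trivial trivial N (cdir c)).const_mul
    (chiN s (n - 3) (x u - x w))
  refine h1.congr_of_eventuallyEq (Eventually.of_forall fun t => ?_)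
  have e1 : ∀ v, c.1 ≠ v → (x + t • cdir c) v = x v := fun v hv => by
    simp [cdir, Pi.single_eq_of_ne (Ne.symm hv)]
  have e2 : moveTo u w (cdir c) = (cdir c : I → ℝ^d) := by
    funext j; rw [moveTo_apply]; split_ifs with h
    · subst h; simp [cdir, Pi.single_eq_of_ne (Ne.symm hu), Pi.single_eq_of_ne (Ne.symm hw)]
    · rfl
  simp only [locRem]
  rw [e1 u hu, e1 w hw, map_add, map_smul, e2]

lemma exists_isSymb_locRem (N m : ℕ) : ∃ C : ℝ, 0 ≤ C ∧ ∀ (u w : I) (n : ℤ) (T T' : Set I) (M : I →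
    ℝ) (B : ℝ) (F : (I → ℝ^d) → ℝ), u ∈ T → (∀ v ∈ T', v ∈ T ∧ v ≠ u ∧ v ≠ w) → (∀ v, 0 ≤ M v) → 0 ≤
    B → 2 ^ (-n + 4) * M u ≤ 1 → Smooth F → IsSymb (fun c : {c : I × Fin d // c.1 ∈ T} => cdir c.1)
    (fun c => M c.1.1 ^ s c.1.2) Set.univ (m + N) B F → IsSymb (fun c : {c : I × Fin d // c.1 ∈ T'}
    => cdir c.1) (fun c => M c.1.1 ^ s c.1.2) Set.univ m (C * B * (2 ^ (-n + 4) * M u) ^ N) (locRem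
    s u w N n F) := by
  obtain ⟨C, hC, h⟩ := abs_taylorRem_le (s := s) (X := I → ℝ^d) N
  refine ⟨C, hC, fun u w n T T' M B F hu hT hM hB hnM hF hsy => ?_⟩
  have hval : ∀ (B : ℝ) (F : (I → ℝ^d) → ℝ), 0 ≤ B → Smooth F → IsSymb (fun c : {c : I × Fin d //
    c.1 ∈ T} => cdir c.1) (fun c => M c.1.1 ^ s c.1.2) Set.univ N B F → ∀ x, |locRem s u w N n F x|
    ≤ C * B * (2 ^ (-n + 4) * M u) ^ N := by
    intro B F hB hF hsy x; have hMu := hM u; unfold locRem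
    rcases lt_or_ge (2 ^ (-n + 4)) (snorm s (x u - x w)) with h1 | h1
    · rw [chiN_eq_zero (by rw [show -(n - 3) + 1 = -n + 4 by ring]; exact h1.le), zero_mul,
        abs_zero]
      positivity
    · have h2 : snorm s (x u - x w) * M u ≤ 2 ^ (-n + 4) * M u := by gcongr
      have h3 := h (fun i => cdir (u, i)) Set.univ F B (M u) isOpen_univ hF.contDiffOn hB (hM u)
        (hsy.reindex fun i => ⟨(u, i), hu⟩) (moveTo u w x) (x u - x w) (fun _ _ => trivial)
        (h2.trans hnM)
      have h4 := chiN_mem (n - 3) (x u - x w); rw [abs_mul, abs_of_nonneg h4.1]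
      calc _ ≤ 1 * (C * B * (snorm s (x u - x w) * M u) ^ N) :=
            mul_le_mul h4.2 h3 (abs_nonneg _) zero_le_one
        _ ≤ C * B * (2 ^ (-n + 4) * M u) ^ N := by
            rw [one_mul]; have := snorm_nonneg (s := s) (x u - x w); gcongr
  induction m generalizing B F with
  | zero => exact fun x _ => hval B F hB hF (by simpa using hsy) x
  | succ m ih =>
    refine ⟨fun x _ => hval B F hB hF (hsy.of_le (by omega)) x, fun c => ?_⟩; have hc := hT _ c.2
    rw [lineD_locRem N n hF hc.2.1 hc.2.2]; rw [show m + 1 + N = (m + N) + 1 by ring] at hsy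
    have := ih (B * M c.1.1 ^ s c.1.2) (lineD (cdir c.1) F) (mul_nonneg hB (pow_nonneg (hM _) _))
      (contDiffOn_univ.1 (contDiffOn_lineD isOpen_univ hF.contDiffOn _)) (hsy.2 ⟨c.1, hc.1⟩)
    rwa [show C * (B * M c.1.1 ^ s c.1.2) * (2 ^ (-n + 4) * M u) ^ N =
      C * B * (2 ^ (-n + 4) * M u) ^ N * M c.1.1 ^ s c.1.2 by ring] at this

lemma locRem_support {u w : I} {N : ℕ} {n : ℤ} {F : (I → ℝ^d) → ℝ}
    {Z : Set (I → ℝ^d)} (hZ : IsClosed Z) (hF : ∀ x, x ∉ Z → F x = 0) {x : I → ℝ^d}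
    (h : locRem s u w N n F x ≠ 0) :
    snorm s (x u - x w) ≤ 2 ^ (-n + 4) ∧ (x ∈ Z ∨ moveTo u w x ∈ Z) := by
  constructor
  · by_contra! h1; refine left_ne_zero_of_mul h (chiN_eq_zero ?_)
    rw [show -(n - 3) + 1 = -n + 4 by ring]; exact h1.le
  · by_contra! h1; refine right_ne_zero_of_mul h ?_; unfold taylorRem
    rw [moveTo_add, hF x h1.1, sum_eq_zero, sub_zero]; intro k _
    rw [mD_eq_zero _ hZ.isOpen_compl hF k _ h1.2, mul_zero]

lemma hasCompactSupport_of_moveTo {u w : I} {ρ : ℝ} {F g : (I → ℝ^d) → ℝ} (hF : HasCompactSupport F)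
    (hg : ∀ x, g x ≠ 0 → snorm s (x u - x w) ≤ ρ ∧ (x ∈ tsupport F ∨ moveTo u w x ∈ tsupport F)) :
    HasCompactSupport g := by
  obtain ⟨R, hR⟩ := hF.isCompact.isBounded.exists_norm_le
  obtain ⟨R', hR'⟩ := (isCompact_snorm_le (d := d) ρ).isBounded.exists_norm_le
  refine HasCompactSupport.intro (isCompact_closedBall (0 : I → ℝ^d) (max R 0 + max R' 0))
    fun x hx => ?_
  by_contra h
  refine hx ?_
  rw [mem_closedBall_zero_iff]
  obtain ⟨h1, h2⟩ := hg x h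
  have h3 : ‖x u - x w‖ ≤ max R' 0 := (hR' _ h1).trans (le_max_left _ _)
  rcases h2 with h2 | h2
  · have := hR x h2; have h4 := le_max_left R 0; have h5 := le_max_right R' 0; linarith
  · have h4 : ‖moveTo u w x‖ ≤ max R 0 := (hR _ h2).trans (le_max_left _ _)
    refine (pi_norm_le_iff_of_nonneg (by positivity)).2 fun i => ?_
    have h5 := (norm_le_pi_norm (moveTo u w x) i).trans h4; rw [moveTo_apply] at h5
    split_ifs at h5 with hi
    · subst hi
      calc ‖x i‖ = ‖x w + (x i - x w)‖ := by rw [add_sub_cancel]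
        _ ≤ ‖x w‖ + ‖x i - x w‖ := norm_add_le _ _
        _ ≤ _ := add_le_add h5 h3
    · have := le_max_right R' 0; linarith

lemma integral_mul_locRem {u w : I} (huw : u ≠ w) {N : ℕ} {n : ℤ} {F Q : (I → ℝ^d) → ℝ} {f : ℝ^d →
    ℝ} (hF : Smooth F) (hFc : HasCompactSupport F) (hQ : Continuous Q) (hQu : ∀ x y, Q
    (Function.update x u y) = Q x) (hf : Continuous f) (hfs : ∀ x, f x ≠ 0 → snorm s x ≤ 2 ^ (-n +
    3)) (hmom : ∀ k ∈ lowIdx s N, ∫ x, monom k x * f x = 0) : ∫ x, f (x w - x u) * Q x * F x = ∫ x,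
    f (x w - x u) * Q x * locRem s u w N n F x := by
  have hfc : Continuous fun x : I → ℝ^d => f (x w - x u) :=
    hf.comp (contDiff_sub_apply w u).continuous
  have hmDc : ∀ k, Continuous fun x => mD (fun i => cdir (u, i)) k F (moveTo u w x) := fun k =>
    (contDiffOn_univ.1 (contDiffOn_mD _ isOpen_univ hF.contDiffOn k)).continuous.comp
      (moveTo u w).continuous
  have hFz : ∀ x, x ∉ tsupport F → F x = 0 := fun x hx => image_eq_zero_of_notMem_tsupport hx
  have hpt : ∀ x : I → ℝ^d, f (x w - x u) * Q x * locRem s u w N n F x = f (x w - x u) * Q x * F x -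
    ∑ k ∈ lowIdx s N, (mfact k)⁻¹ * (f (x w - x u) * (monom k (x u - x w) * (Q x * mD (fun i => cdir
    (u, i)) k F (moveTo u w x)))) := by
    intro x
    by_cases h0 : f (x w - x u) = 0
    · simp [h0]
    · have h1 : chiN s (n - 3) (x u - x w) = 1 := by
        refine chiN_eq_one ?_; rw [snorm_sub_comm, show -(n - 3) = -n + 3 by ring]; exact hfs _ h0
      unfold locRem taylorRem; rw [h1, one_mul, moveTo_add, mul_sub, mul_sum]; congr 1
      exact sum_congr rfl fun k _ => by rw [div_eq_mul_inv]; ring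
  have hI0 : Integrable fun x => f (x w - x u) * Q x * F x :=
    ((hfc.mul hQ).mul hF.continuous).integrable_of_hasCompactSupport hFc.mul_left
  have hIk : ∀ k ∈ lowIdx s N, Integrable fun x : I → ℝ^d => (mfact k)⁻¹ * (f (x w - x u) * (monom k
    (x u - x w) * (Q x * mD (fun i => cdir (u, i)) k F (moveTo u w x)))) := by
    intro k _; refine Integrable.const_mul (Continuous.integrable_of_hasCompactSupport ?_ ?_) _
    · exact hfc.mul (((contDiff_monom k).continuous.comp (contDiff_sub_apply u w).continuous).mul
        (hQ.mul (hmDc k)))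
    · refine hasCompactSupport_of_moveTo (u := u) (w := w) (ρ := 2 ^ (-n + 3)) hFc
        fun x hx => ⟨?_, Or.inr ?_⟩
      · rw [snorm_sub_comm]; exact hfs _ (left_ne_zero_of_mul hx)
      · by_contra h; refine right_ne_zero_of_mul (right_ne_zero_of_mul (right_ne_zero_of_mul hx)) ?_
        exact mD_eq_zero _ (isClosed_tsupport F).isOpen_compl hFz k _ h
  simp only [hpt]
  rw [integral_sub hI0 (integrable_finsetSum _ hIk), integral_finsetSum _ hIk,
    sum_eq_zero, sub_zero]
  intro k hk
  rw [integral_const_mul]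
  refine mul_eq_zero_of_right _ (integral_eq_zero_of_update u fun x => ?_)
  have hneg : ∀ z : ℝ^d, monom k (-z) = (-1) ^ (∑ i, k i) * monom k z := fun z => by
    unfold monom; rw [← prod_pow_eq_pow_sum, ← prod_mul_distrib]
    exact prod_congr rfl fun i _ => by rw [Pi.neg_apply, neg_pow]
  have h1 : ∀ y, f (Function.update x u y w - Function.update x u y u) * (monom k (Function.update x
    u y u - Function.update x u y w) * (Q (Function.update x u y) * mD (fun i => cdir (u, i)) k F
    (moveTo u w (Function.update x u y)))) = ((-1) ^ (∑ i, k i) * (Q x * mD (fun i => cdir (u, i)) k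
    F (moveTo u w x))) * (fun z => monom k z * f z) (x w - y) := fun y => by
    rw [hQu, moveTo_update u w huw.symm, Function.update_self, Function.update_of_ne huw.symm,
      ← neg_sub (x w) y, hneg]
    ring
  simp only [h1]
  rw [integral_const_mul, integral_sub_left_eq_self (fun z => monom k z * f z) volume (x w),
    hmom k hk, mul_zero]

lemma exists_iterated_locRem {E' : Type*} (u w : E' → I) (N : E' → ℕ) (A : Finset E') (huw : ∀ e ∈
    A, u e ≠ w e) (hdisj : ∀ e ∈ A, ∀ e' ∈ A, e ≠ e' → u e ≠ u e' ∧ u e ≠ w e') (m : ℕ) : ∃ C : ℝ, 0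
    ≤ C ∧ ∀ (n : E' → ℤ) (M : I → ℝ) (B : ℝ) (F : (I → ℝ^d) → ℝ) (f : E' → ℝ^d → ℝ) (Z : Set (I →
    ℝ^d)), (∀ v, 0 ≤ M v) → 0 ≤ B → (∀ e ∈ A, 2 ^ (-n e + 4) * M (u e) ≤ 1) → Smooth F →
    HasCompactSupport F → IsClosed Z → (∀ x ∉ Z, F x = 0) → (∀ e ∈ A, Continuous (f e)) → (∀ e ∈ A,
    ∀ x, f e x ≠ 0 → snorm s x ≤ 2 ^ (-n e + 3)) → (∀ e ∈ A, ∀ k ∈ lowIdx s (N e), ∫ x, monom k x *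
    f e x = 0) → IsSymb cdir (fun c => M c.1 ^ s c.2) Set.univ (m + ∑ e ∈ A, N e) B F → ∃ (F' : (I →
    ℝ^d) → ℝ) (Z' : Set (I → ℝ^d)), Smooth F' ∧ HasCompactSupport F' ∧ IsSymb (fun c : {c : I × Fin
    d // c.1 ∈ {v | ∀ e ∈ A, v ≠ u e ∧ v ≠ w e}} => cdir c.1) (fun c => M c.1.1 ^ s c.1.2) Set.univ
    m (C * B * ∏ e ∈ A, (2 ^ (-n e + 4) * M (u e)) ^ N e) F' ∧ IsClosed Z' ∧ (∀ x ∉ Z', F' x = 0) ∧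
    (∀ x ∈ Z', ∃ x' ∈ Z, ∀ v, x v = x' v ∨ ∃ e ∈ A, u e = v ∧ snorm s (x v - x' v) ≤ 2 ^ (-n e + 4))
    ∧ ∀ Q : (I → ℝ^d) → ℝ, Continuous Q → (∀ e ∈ A, ∀ x y, Q (Function.update x (u e) y) = Q x) → ∫
    x, Q x * (∏ e ∈ A, f e (x (w e) - x (u e))) * F x = ∫ x, Q x * (∏ e ∈ A, f e (x (w e) - x (u
    e))) * F' x := by
  classical
  induction A using Finset.induction_on generalizing m with
  | empty =>
    refine ⟨1, zero_le_one, fun n M B F f Z hM hB _ hF hFc hZ hFZ _ _ _ hsy => ⟨F, Z, hF, hFc, ?_,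
      hZ, hFZ, fun x hx => ⟨x, hx, fun v => Or.inl rfl⟩, fun Q _ _ => rfl⟩⟩
    simpa using hsy.reindex fun c : {c : I × Fin d // c.1 ∈ {v | ∀ e ∈ (∅ : Finset E'),
      v ≠ u e ∧ v ≠ w e}} => c.1
  | insert e A he ih =>
    have hne : ∀ e' ∈ A, e ≠ e' := fun e' h' h => he (h ▸ h')
    have hAi : ∀ e' ∈ A, e' ∈ insert e A := fun e' h' => mem_insert_of_mem h'
    have hei := mem_insert_self e A
    obtain ⟨C₁, hC₁, h₁⟩ := ih (fun e' h' => huw e' (hAi e' h'))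
      (fun e' h' e'' h'' => hdisj e' (hAi e' h') e'' (hAi e'' h'')) (m + N e)
    obtain ⟨C₂, hC₂, h₂⟩ := exists_isSymb_locRem (s := s) (I := I) (N e) m
    refine ⟨C₂ * C₁, mul_nonneg hC₂ hC₁,
      fun n M B F f Z hM hB hnM hF hFc hZ hFZ hf hfs hmom hsy => ?_⟩
    rw [sum_insert he, ← add_assoc] at hsy
    obtain ⟨F', Z', hF', hFc', hsy', hZ', hFZ', hsupp, hin⟩ := h₁ n M B F f Z hM hB
      (fun e' h' => hnM e' (hAi e' h')) hF hFc hZ hFZ (fun e' h' => hf e' (hAi e' h'))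
      (fun e' h' => hfs e' (hAi e' h')) (fun e' h' => hmom e' (hAi e' h')) hsy
    have hcl : IsClosed {x : I → ℝ^d | snorm s (x (u e) - x (w e)) ≤ 2 ^ (-n e + 4)} :=
      isClosed_le (continuous_snorm.comp (contDiff_sub_apply _ _).continuous) continuous_const
    have hls := fun x => locRem_support (u := u e) (w := w e) (N := N e) (n := n e) hZ' hFZ'
      (x := x)
    have hP : 0 ≤ ∏ e ∈ A, (2 ^ (-n e + 4) * M (u e)) ^ N e := prod_nonneg fun e' _ => by
      have := hM (u e'); positivity
    refine ⟨locRem s (u e) (w e) (N e) (n e) F', (Z' ∪ moveTo (u e) (w e) ⁻¹' Z') ∩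
      {x | snorm s (x (u e) - x (w e)) ≤ 2 ^ (-n e + 4)}, contDiff_locRem _ _ _ _ hF', ?_, ?_,
      (hZ'.union (hZ'.preimage (moveTo _ _).continuous)).inter hcl, ?_, ?_, ?_⟩
    · refine hasCompactSupport_of_moveTo (u := u e) (w := w e) (ρ := 2 ^ (-n e + 4)) hFc' fun x hx
        => locRem_support (isClosed_tsupport F') (fun x hx => image_eq_zero_of_notMem_tsupport hx)
        hx
    · have := h₂ (u e) (w e) (n e) {v | ∀ e ∈ A, v ≠ u e ∧ v ≠ w e}
        {v | ∀ e' ∈ insert e A, v ≠ u e' ∧ v ≠ w e'} M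
        (C₁ * B * ∏ e ∈ A, (2 ^ (-n e + 4) * M (u e)) ^ N e) F'
        (fun e' h' => hdisj e hei e' (hAi e' h') (hne e' h'))
        (fun v hv => ⟨fun e' h' => hv e' (hAi e' h'), hv e hei⟩) hM (by positivity) (hnM e hei) hF'
        hsy'
      rw [prod_insert he]; convert this using 1; ring
    · intro x hx; by_contra h; exact hx ⟨(hls x h).2, (hls x h).1⟩
    · rintro x ⟨hx | hx, hxs⟩
      · obtain ⟨x', hx', h⟩ := hsupp x hx
        exact ⟨x', hx', fun v => (h v).imp_right fun ⟨e', h', h''⟩ => ⟨e', hAi e' h', h''⟩⟩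
      · obtain ⟨x', hx', h⟩ := hsupp _ hx; refine ⟨x', hx', fun v => ?_⟩; have hv := h v
        rw [moveTo_apply] at hv
        by_cases hvu : v = u e
        · subst hvu; rw [if_pos rfl] at hv; rcases hv with hv | ⟨e', h', h'', -⟩
          · exact Or.inr ⟨e, hei, rfl, by rw [← hv]; exact hxs⟩
          · exact absurd h''.symm (hdisj e hei e' (hAi e' h') (hne e' h')).1
        · rw [if_neg hvu] at hv; exact hv.imp_right fun ⟨e', h', h''⟩ => ⟨e', hAi e' h', h''⟩
    · intro Q hQ hQu
      have hfc : ∀ e' ∈ insert e A, Continuous fun x : I → ℝ^d =>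
          f e' (x (w e') - x (u e')) := fun e' h' =>
        (hf e' h').comp (contDiff_sub_apply _ _).continuous
      have e1 := hin (fun x => Q x * f e (x (w e) - x (u e))) (hQ.mul (hfc e hei))
        (fun e' h' x y => by
          have h3 := hdisj e' (hAi e' h') e hei (hne e' h').symm
          rw [hQu e' (hAi e' h'), Function.update_of_ne h3.1.symm, Function.update_of_ne h3.2.symm])
      have e2 := integral_mul_locRem (u := u e) (w := w e) (huw e hei) (N := N e) (n := n e) hF'
        hFc' (Q := fun x => Q x * ∏ e ∈ A, f e (x (w e) - x (u e))) (hQ.mul (continuous_finsetProd _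
        fun e' h' => hfc e' (hAi e' h'))) (fun x y => by
          rw [hQu e hei]; congr 1; refine prod_congr rfl fun e' h' => ?_
          have h3 := hdisj e hei e' (hAi e' h') (hne e' h')
          rw [Function.update_of_ne h3.1.symm, Function.update_of_ne h3.2.symm])
        (hf e hei) (hfs e hei) (hmom e hei)
      simp only [prod_insert he]
      calc _ = ∫ x, Q x * f e (x (w e) - x (u e)) * (∏ e ∈ A, f e (x (w e) - x (u e))) * F x := by
            simp only [mul_assoc]
        _ = _ := e1
        _ = ∫ x, f e (x (w e) - x (u e)) * (Q x * ∏ e ∈ A, f e (x (w e) - x (u e))) * F' x :=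
            integral_congr_ae (Eventually.of_forall fun x => by ring)
        _ = _ := e2
        _ = _ := integral_congr_ae (Eventually.of_forall fun x => by ring)

end LocRem

section Scales

/-! ### Decomposition of the integrand according to the distances of the points -/

/-- A partition of unity on dyadic annuli. -/
def ann (s : ℕ^d) (n : ℤ) (z : ℝ^d) : ℝ := chiN s (n - 1) z - chiN s n z

lemma contDiff_ann (n : ℤ) : Smooth (ann s n) := (contDiff_chiN _).sub (contDiff_chiN _)

lemma ann_support {n : ℤ} {z : ℝ^d} (h : ann s n z ≠ 0) :
    2 ^ (-n) ≤ snorm s z ∧ snorm s z ≤ 2 ^ (-n + 3) := by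
  refine ⟨?_, ?_⟩ <;> by_contra! h1 <;> refine h ?_ <;> unfold ann
  · rw [chiN_eq_one h1.le, chiN_eq_one (h1.le.trans (two_zpow_le (by omega))), sub_self]
  · rw [chiN_eq_zero ((two_zpow_le (by omega)).trans h1.le),
      chiN_eq_zero ((two_zpow_le (by omega)).trans h1.le), sub_self]

lemma exists_isSymb_ann (m : ℕ) : ∃ B, 1 ≤ B ∧ ∀ n : ℤ,
    IsSymb stdB (fun i => ((2 : ℝ) ^ n) ^ s i) Set.univ m B (ann s n) := by
  obtain ⟨B, hB, h⟩ := exists_isSymb_chiN (s := s) m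
  refine ⟨B + |(-1)| * B + 1, by simp [hB], fun n => ?_⟩
  have h0 : ∀ i, 0 ≤ ((2 : ℝ) ^ n) ^ s i := fun i => by positivity
  have h1 := (h (n - 1)).mono (ν := fun i => ((2 : ℝ) ^ n) ^ s i) (fun i => by positivity)
    (fun i => pow_le_pow_left₀ (by positivity) (two_zpow_le (by omega)) _) hB le_rfl le_rfl
  have h2 := h1.add isOpen_univ (contDiff_chiN _).contDiffOn (contDiffOn_const.mul (contDiff_chiN
    n).contDiffOn) ((h n).const_mul isOpen_univ (contDiff_chiN n).contDiffOn (-1))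
  refine (h2.mono h0 (fun _ => le_rfl) (by positivity) (by linarith) le_rfl).congr isOpen_univ
    fun x _ => ?_
  simp only [ann]
  ring

/-- The edges with `r < 0`. -/
abbrev Neg (G : RGraph V E) : Type _ := {e : E // G.r e < 0}

variable (s) (G : RGraph V E) (K : E → ℝ^d → ℝ) (I : E → ℕ^d → ℝ)

/-- The piece of scale `n` of the kernel of an edge with `r < 0`. -/
def epiece (e : E) (n : ℤ) (x : Conf G d) : ℝ :=
  pieceK s (-G.r e).toNat (K e) (I e) n (pos G (G.tgt e) x - pos G (G.src e) x)

open scoped Classical in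
/-- The localisation of a pair of vertices that is not joined by an edge with `r < 0`. -/
def freeFac (c : Sym2 V) (n : ℤ) (x : Conf G d) : ℝ :=
  if ∃ e : Neg G, G.ends e.1 = c then 1 else if c.IsDiag then (if n = 0 then 1 else 0)
  else ann s n (pos G c.out.1 x - pos G c.out.2 x)

/-- The factor of scale `n` of a pair of vertices. -/
def pairFac (c : Sym2 V) (n : ℤ) (x : Conf G d) : ℝ :=
  (∏ e : Neg G with G.ends e.1 = c, epiece s G K I e n x) * freeFac s G c n x

/-- The factors that are not decomposed. -/
def restFac (φ : ℝ^d → ℝ) (x : Conf G d) : ℝ :=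
  (∏ e : {e : E // 0 ≤ G.r e}, RGraph.hatK s (G.r e) (K e) (pos G (G.src e) x) (pos G (G.tgt e) x))
    * ∏ i, φ (pos G (G.tgt (G.star i)) x)

/-- The contribution of the scales `n`. -/
def scaleFun (φ : ℝ^d → ℝ) (n : Scale V) (x : Conf G d) : ℝ :=
  (∏ c, pairFac s G K I c (n c) x) * restFac s G K φ x

variable {s G K I}

lemma prod_pairFac (n : Scale V) (x : Conf G d) : ∏ c, pairFac s G K I c (n c) x =
    (∏ e : Neg G, epiece s G K I e (n (G.ends e)) x) * ∏ c, freeFac s G c (n c) x := by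
  unfold pairFac
  rw [prod_mul_distrib, ← prod_fiberwise univ fun e : Neg G => G.ends e.1]
  congr 1
  refine prod_congr rfl fun c _ => prod_congr rfl fun e he => ?_
  rw [(mem_filter.1 he).2]

lemma mem_out {c : Sym2 V} {v w : V} (h : s(v, w) = c) : c.out = (v, w) ∨ c.out = (w, v) := by
  have h1 : s(c.out.1, c.out.2) = s(v, w) := by rw [h]; exact c.out_eq
  rcases Sym2.eq_iff.1 h1 with h2 | h2
  · exact Or.inl (Prod.ext h2.1 h2.2)
  · exact Or.inr (Prod.ext h2.1 h2.2)

lemma freeFac_support {v w : V} (hvw : v ≠ w)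
    (hc : ∀ e : Neg G, G.ends e.1 ≠ s(v, w)) {n : ℤ} {x : Conf G d}
    (h : freeFac s G s(v, w) n x ≠ 0) :
    2 ^ (-n) ≤ snorm s (pos G v x - pos G w x) ∧ snorm s (pos G v x - pos G w x) ≤ 2 ^ (-n + 3) := by
  unfold freeFac at h
  rw [if_neg (by push Not; exact hc), if_neg (by simpa using hvw)] at h
  have := ann_support h
  rcases mem_out (rfl : s(v, w) = s(v, w)) with h1 | h1 <;> rw [h1] at this
  · exact this
  · rwa [snorm_sub_comm] at this

lemma contDiff_freeFac (c : Sym2 V) (n : ℤ) : Smooth (freeFac (d := d) s G c n) := by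
  unfold freeFac
  split_ifs
  · exact contDiff_const
  · exact contDiff_const
  · exact contDiff_const
  · exact (contDiff_ann n).comp ((pos G _).contDiff.sub (pos G _).contDiff)

lemma exists_isSymb_freeFac (m : ℕ) : ∃ B, 0 ≤ B ∧ ∀ (M : V → ℝ) (c : Sym2 V) (n : ℤ), (∀ v, 0 ≤ M
    v) → (∀ v w, v ≠ w → s(v, w) = c → (∀ e : Neg G, G.ends e.1 ≠ c) → 2 ^ n ≤ M v) → IsSymb (dir G)
    (cost s G M) Set.univ m B (freeFac s G c n) := by
  obtain ⟨B, hB, h⟩ := exists_isSymb_ann (s := s) m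
  refine ⟨B, by linarith, fun M c n hM hc => ?_⟩
  have hν : ∀ c, 0 ≤ cost s G M c := fun c => pow_nonneg (hM _) _
  have h1 : IsSymb (dir G) (cost s G M) Set.univ m B fun _ => 1 :=
    (IsSymb.one hν).mono hν (fun _ => le_rfl) zero_le_one hB le_rfl
  by_cases hneg : ∃ e : Neg G, G.ends e.1 = c
  · unfold freeFac; simp only [if_pos hneg]; exact h1
  by_cases hdi : c.IsDiag
  · unfold freeFac; simp only [if_neg hneg, if_pos hdi]; split_ifs
    · exact h1
    · exact IsSymb.zero hν isOpen_univ (by linarith) fun _ _ => rfl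
  have hout : s(c.out.1, c.out.2) = c := c.out_eq
  have hne : c.out.1 ≠ c.out.2 := fun h => hdi (by rw [← hout]; exact Sym2.mk_isDiag_iff.2 h)
  unfold freeFac
  simp only [if_neg hneg, if_neg hdi]
  push Not at hneg
  refine isSymb_diff hM (Λ := 2 ^ n) (by positivity) hne isOpen_univ isOpen_univ
    (fun _ _ => trivial) (by linarith) (contDiff_ann n).contDiffOn
    (fun _ => hc _ _ hne hout hneg) (fun _ => hc _ _ hne.symm ?_ hneg) (h n)
  rw [Sym2.eq_swap]; exact hout

lemma isSymb_rescale {φ : ℝ^d → ℝ} (hφ : Smooth φ) {m : ℕ} {T lam : ℝ} (hlam : 0 < lam) (hT : ∀ k,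
    sdeg s k ≤ m * sdim s → ∀ x, |multiD k φ x| ≤ T) : Smooth (rescale s lam φ) ∧ IsSymb stdB (fun i
    => lam⁻¹ ^ s i) Set.univ m ((lam ^ sdim s)⁻¹ * T) (rescale s lam φ) := by
  have h1 : IsSymb stdB (fun i => (1 : ℝ) ^ s i) Set.univ m T φ :=
    isSymb_of_mD isOpen_univ hφ.contDiffOn fun k hk x _ => by rw [one_pow, mul_one]; exact hT k hk x
  have h2 := h1.comp_dil (s := s) (t := lam⁻¹) (by positivity) hφ
  have h3 := h2.const_mul isOpen_univ (contDiff_comp_dil hφ _).contDiffOn (lam ^ sdim s)⁻¹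
  have e : rescale s lam φ = fun x => (lam ^ sdim s)⁻¹ * φ (dil s lam⁻¹ x) := by
    funext x; unfold rescale dil; congr 2; funext i
    rw [inv_pow, div_eq_inv_mul]
  rw [e]
  refine ⟨contDiff_const.mul (contDiff_comp_dil hφ _), ?_⟩
  rw [abs_of_nonneg (by positivity)] at h3
  simpa using h3

/-! ### Admissible scales -/

/-- Scales that are the distances, up to constants, of a configuration in the support of the
integrand. -/
structure Adm (G : RGraph V E) (D ρ : ℝ) (n : Scale V) : Prop where
  tri : ∀ u v w, u ≠ v → v ≠ w → u ≠ w → scl n u w ≤ 8 * (scl n u v + scl n v w)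
  le : ∀ v w, v ≠ w → scl n v w ≤ D
  star : ∀ i, scl n G.root (G.tgt (G.star i)) ≤ ρ
  diag : ∀ v, n s(v, v) = 0

/-- The configurations with distances of the order prescribed by `n`. -/
def shell (s : ℕ^d) (G : RGraph V E) (n : Scale V) (P : Finset (Sym2 V)) : Set (Conf G d) :=
  {x | ∀ v w, v ≠ w → s(v, w) ∉ P → 2 ^ (-n s(v, w)) ≤ snorm s (pos G v x - pos G w x) ∧
    snorm s (pos G v x - pos G w x) ≤ 2 ^ (-n s(v, w) + 3)}

lemma isClosed_shell (n : Scale V) (P : Finset (Sym2 V)) : IsClosed (shell s G n P) := by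
  have : shell s G n P = ⋂ (v : V) (w : V) (_ : v ≠ w) (_ : s(v, w) ∉ P), {x | 2 ^ (-n s(v, w)) ≤
    snorm s (pos G v x - pos G w x) ∧ snorm s (pos G v x - pos G w x) ≤ 2 ^ (-n s(v, w) + 3)} := by
    ext x; simp [shell]
  rw [this]
  have hc : ∀ v w, Continuous fun x : Conf G d => snorm s (pos G v x - pos G w x) := fun v w =>
    continuous_snorm.comp ((pos G v).continuous.sub (pos G w).continuous)
  exact isClosed_iInter fun v => isClosed_iInter fun w => isClosed_iInter fun _ =>
    isClosed_iInter fun _ => (isClosed_le continuous_const (hc v w)).inter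
      (isClosed_le (hc v w) continuous_const)

lemma shell_subset (n : Scale V) (P : Finset (Sym2 V)) :
    shell s G n P ⊆ scaleDom s G n P := fun x hx v w hvw hP =>
  ⟨lt_of_lt_of_le (two_zpow_lt (by omega)) (hx v w hvw hP).1,
    lt_of_le_of_lt (hx v w hvw hP).2 (two_zpow_lt (by omega))⟩

lemma mem_shell (hsupp : ∀ e : Neg G, ∀ x, 1 < snorm s x → K e x = 0) {n : Scale V} {P : Finset
    (Sym2 V)} {x : Conf G d} (hfree : ∀ c, freeFac s G c (n c) x ≠ 0) (hneg : ∀ e : Neg G, G.ends e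
    ∉ P → epiece s G K I e (n (G.ends e)) x ≠ 0) : x ∈ shell s G n P := by
  intro v w hvw hP
  by_cases h : ∃ e : Neg G, G.ends e.1 = s(v, w)
  · obtain ⟨e, he⟩ := h; have h1 := (pieceK_support (hsupp e) (hneg e (he ▸ hP))).2; rw [he] at h1
    rcases Sym2.eq_iff.1 he with ⟨h2, h3⟩ | ⟨h2, h3⟩ <;> rw [h2, h3] at h1
    · rwa [snorm_sub_comm]
    · exact h1
  · push Not at h; exact freeFac_support hvw h (hfree _)

lemma rescale_support {φ : ℝ^d → ℝ} {R lam : ℝ} (hφ : ∀ x, R < snorm s x → φ x = 0) (hlam : 0 < lam)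
    {x : ℝ^d} (h : rescale s lam φ x ≠ 0) : snorm s x ≤ R * lam := by
  by_contra! h1
  refine h (mul_eq_zero_of_right _ (hφ _ ?_))
  have e : (fun i => x i / lam ^ s i) = dil s lam⁻¹ x := by
    funext i; rw [dil, inv_pow, div_eq_inv_mul]
  rw [e, snorm_dil (by positivity), ← div_eq_inv_mul, lt_div_iff₀ hlam]
  exact h1

lemma hatK_support {r : ℤ} {k : ℝ^d → ℝ}
    (hk : ∀ x, 1 < snorm s x → k x = 0) {x y : ℝ^d} (h : RGraph.hatK s r k x y ≠ 0) :
    snorm s (y - x) ≤ 1 ∨ 0 < r ∧ snorm s x ≤ 1 := by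
  by_contra! h1
  refine h ?_
  unfold RGraph.hatK
  rw [hk _ h1.1, zero_sub, neg_eq_zero]
  refine sum_eq_zero fun j hj => ?_
  have hr : 0 < r := by by_contra! hr; rw [mem_lowIdx hs.pos, Int.toNat_of_nonpos hr] at hj; omega
  rw [multiD_eq_mD, mD_eq_zero _ (isOpen_lt_snorm 1) hk j _
    (show 1 < snorm s (-x) by rw [snorm_neg]; exact h1.2 hr), mul_zero]

lemma adm_of_ne_zero {a : E → ℝ} (h : G.PowerCounting s a) (hsupp : ∀ e x, 1 < snorm s x → K e x =
    0) {φ : ℝ^d → ℝ} {R lam : ℝ} (hR : 0 < R) (hφ : ∀ x, R < snorm s x → φ x = 0) (hlam : 0 < lam)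
    (hlam1 : lam ≤ 1) {n : Scale V} {x : Conf G d} (hx : scaleFun s G K I (rescale s lam φ) n x ≠ 0)
    : Adm G (2 * (max R 4 + Fintype.card V * 4)) (R * lam) n ∧ x ∈ shell s G n ∅ ∧ ∀ i, snorm s (pos
    G (G.tgt (G.star i)) x) ≤ R * lam := by
  unfold scaleFun at hx
  have h1 := left_ne_zero_of_mul hx
  rw [prod_pairFac] at h1
  have hfree := fun c => prod_ne_zero_iff.1 (right_ne_zero_of_mul h1) c (mem_univ c)
  have hneg := fun e => prod_ne_zero_iff.1 (left_ne_zero_of_mul h1) e (mem_univ e)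
  have h2 := right_ne_zero_of_mul hx
  unfold restFac at h2
  have hhat := fun e => prod_ne_zero_iff.1 (left_ne_zero_of_mul h2) e (mem_univ e)
  have hst := fun i => rescale_support hφ hlam
    (prod_ne_zero_iff.1 (right_ne_zero_of_mul h2) i (mem_univ i))
  have hsh : x ∈ shell s G n ∅ := mem_shell (fun e => hsupp e) hfree fun e _ => hneg e
  have hle := fun v w hvw => hsh v w hvw (notMem_empty _)
  have h8 : ∀ v w, v ≠ w → snorm s (pos G v x - pos G w x) ≤ 8 * scl n v w := fun v w hvw => by
    refine (hle v w hvw).2.trans (le_of_eq ?_); unfold scl; rw [two_zpow_add]; norm_num; ring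
  have hb := snorm_le_of_support h (x := fun v => pos G v x) (pos_root x) (R := R) (ϱ := 4)
    (by norm_num) (fun i => (hst i).trans (by nlinarith)) (fun e he => ?_) (fun e he => ?_)
  · refine ⟨⟨fun u v w huv hvw huw => ?_, fun v w hvw => ?_, fun i => ?_, fun v => ?_⟩, hsh, hst⟩
    · have := snorm_tri (pos G u x) (pos G v x) (pos G w x); have := (hle u w huw).1
      have := h8 u v huv; have := h8 v w hvw; unfold scl at *; linarith
    · have h3 := (hle v w hvw).1.trans (snorm_sub_le _ _); unfold scl; have h4 := hb v
      have h5 := hb w; linarith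
    · have hne := star_ne_root G i
      have h3 := (hle G.root _ hne.symm).1; rw [pos_root, zero_sub, snorm_neg] at h3
      exact h3.trans (hst i)
    · have h3 := hfree s(v, v); unfold freeFac at h3
      rw [if_neg, if_pos (Sym2.mk_isDiag_iff.2 rfl)] at h3
      · by_contra h4; exact h3 (if_neg h4)
      · rintro ⟨e, he⟩; refine G.no_loop e ?_
        rcases Sym2.eq_iff.1 he with h4 | h4 <;> rw [h4.1, h4.2]
  · rcases he.lt_or_eq with he | he
    · obtain ⟨h3, -, h4⟩ := pieceK_support (hsupp e) (hneg ⟨e, he⟩)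
      refine h4.trans ((two_zpow_le
        (show -n (G.ends e) + 3 ≤ 2 by simp only at h3; omega)).trans (by norm_num))
    · rcases hatK_support (hsupp e) (hhat ⟨e, he.ge⟩) with h3 | h3
      · exact h3.trans (by norm_num)
      · simp only [he] at h3; exact absurd h3.1 (lt_irrefl _)
  · rcases hatK_support (hsupp e) (hhat ⟨e, he.le⟩) with h3 | h3
    · exact Or.inl (h3.trans (by norm_num))
    · exact Or.inr (h3.2.trans (by norm_num))

end Scales

/-! ### Edges that form isolated clusters -/

open scoped Classical in
/-- The edges with `r < 0` whose end points are much closer to each other than to any other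
vertex. -/
def tight (G : RGraph V E) (C₀ : ℕ) (n : Scale V) : Finset (Neg G) :=
  univ.filter fun e => 2 ≤ n (G.ends e) ∧ ∀ v, v ≠ G.src e → v ≠ G.tgt e →
    n s(G.src e, v) + C₀ ≤ n (G.ends e) ∧ n s(G.tgt e, v) + C₀ ≤ n (G.ends e)

lemma mem_tight {C₀ : ℕ} {n : Scale V} {e : Neg G} : e ∈ tight G C₀ n ↔ 2 ≤ n (G.ends e) ∧ ∀ v, v ≠
    G.src e → v ≠ G.tgt e → n s(G.src e, v) + C₀ ≤ n (G.ends e) ∧ n s(G.tgt e, v) + C₀ ≤ n (G.ends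
    e) := by
  simp [tight]

lemma le_of_mem_tight {C₀ : ℕ} {n : Scale V} {e e' : Neg G} (he : e ∈ tight G C₀ n) (hne : e ≠ e')
    {x : V} (hx : x ∈ G.ends e) (hx' : x ∈ G.ends e') : n (G.ends e') + C₀ ≤ n (G.ends e) := by
  obtain ⟨y, hy⟩ := hx'
  have hends : G.ends e.1 ≠ G.ends e'.1 := fun h => hne (Subtype.ext (eq_of_neg_of_ends_eq e.2 h))
  have hxy : y ≠ x := by
    rintro rfl; refine G.no_loop e' ?_; rcases Sym2.eq_iff.1 hy with h | h <;> rw [h.1, h.2]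
  have h2 := (mem_tight.1 he).2 y
  rw [hy]
  rw [hy] at hends
  rcases Sym2.mem_iff.1 hx with rfl | rfl
  · exact (h2 hxy fun h => hends (by rw [h]; rfl)).1
  · exact (h2 (fun h => hends (by rw [h, Sym2.eq_swap]; rfl)) hxy).2

lemma tight_disjoint {C₀ : ℕ} (hC : 0 < C₀) {n : Scale V} {e e' : Neg G} (he : e ∈ tight G C₀ n)
    (he' : e' ∈ tight G C₀ n) (hne : e ≠ e') : G.src e ≠ G.src e' ∧ G.src e ≠ G.tgt e' := by
  have key : ∀ x, x ∈ G.ends e → x ∉ G.ends e' := fun x hx hx' => by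
    have h1 := le_of_mem_tight he hne hx hx'; have h2 := le_of_mem_tight he' hne.symm hx' hx; omega
  have hs : G.src e ∈ G.ends e := Sym2.mem_mk_left _ _
  exact ⟨fun h => key _ hs (h ▸ Sym2.mem_mk_left _ _), fun h => key _ hs (h ▸ Sym2.mem_mk_right _ _)⟩

/-- The cost of a derivative with respect to the position of a vertex. -/
def costM (c₀ : ℝ) (n : Scale V) (P : Finset (Sym2 V)) (v : V) : ℝ :=
  c₀ * ∑ w, if v ≠ w ∧ s(v, w) ∉ P then 2 ^ n s(v, w) else 0

lemma le_costM {c₀ : ℝ} (hc : 0 ≤ c₀) (n : Scale V) {P : Finset (Sym2 V)} {v w : V}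
    (hvw : v ≠ w) (hP : s(v, w) ∉ P) : c₀ * 2 ^ n s(v, w) ≤ costM c₀ n P v := by
  refine mul_le_mul_of_nonneg_left ?_ hc
  have := single_le_sum (f := fun w => if v ≠ w ∧ s(v, w) ∉ P then (2 : ℝ) ^ n s(v, w) else 0)
    (fun w _ => by split_ifs <;> positivity) (mem_univ w)
  rwa [if_pos ⟨hvw, hP⟩] at this

lemma costM_nonneg {c₀ : ℝ} (hc : 0 ≤ c₀) (n : Scale V) (P : Finset (Sym2 V)) (v : V) :
    0 ≤ costM c₀ n P v :=
  mul_nonneg hc (sum_nonneg fun w _ => by split_ifs <;> positivity)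

lemma inv_scl (n : Scale V) (v w : V) : (scl n v w)⁻¹ = 2 ^ n s(v, w) := by
  unfold scl; rw [zpow_neg, inv_inv]

/-- The ratio of the length of an edge to the distance to the nearest other vertex. -/
def ratio (G : RGraph V E) (n : Scale V) (e : E) : ℝ := scl n (G.src e) (G.tgt e) /
  max (scl n (G.src e) (G.tgt e)) (nearDist (scl n) (G.src e) (G.tgt e))

lemma tight_gain (h : G.PowerCounting s a) {c₀ : ℝ} (hc : 0 ≤ c₀) {C₀ : ℕ} (hC : 16 * c₀ *
    Fintype.card V ≤ 2 ^ C₀) {n : Scale V} {P : Finset (Sym2 V)} {e : Neg G} (he : e ∈ tight G C₀ n)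
    (hP : G.ends e ∈ P) : 2 ^ (-n (G.ends e) + 4) * costM c₀ n P (G.src e) ≤ 1 ∧ 2 ^ (-n (G.ends e)
    + 4) * costM c₀ n P (G.src e) ≤ 16 * c₀ * Fintype.card V * ratio G n e := by
  have hroot := root_ne_ends (h.r_root e) e.2.ne
  obtain ⟨v, hv1, hv2, hv⟩ := exists_nearDist (scl n) hroot.1 hroot.2
  set δ := nearDist (scl n) (G.src e) (G.tgt e) with hδ
  set q := scl n (G.src e) (G.tgt e) with hq
  have hδ0 : 0 < δ := hv ▸ scl_pos n _ _
  have hq0 : 0 < q := scl_pos n _ _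
  have hqδ : q * 2 ^ C₀ ≤ δ := by
    rw [hv, hq]; unfold scl; rw [← zpow_natCast, ← two_zpow_add]
    refine two_zpow_le ?_; have := ((mem_tight.1 he).2 v hv1 hv2).1
    unfold RGraph.ends at this; omega
  have hM : costM c₀ n P (G.src e) ≤ c₀ * (Fintype.card V * δ⁻¹) := by
    refine mul_le_mul_of_nonneg_left ?_ hc; rw [← nsmul_eq_mul, ← card_univ, ← sum_const]
    refine sum_le_sum fun w _ => ?_; split_ifs with hw
    · rw [← inv_scl]; refine inv_anti₀ hδ0 (nearDist_le _ hw.1.symm fun h' => hw.2 ?_)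
      rw [h']; exact hP
    · positivity
  have h1 : 2 ^ (-n (G.ends e) + 4) * costM c₀ n P (G.src e) ≤
      16 * c₀ * Fintype.card V * (q / δ) := by
    have e1 : (2 : ℝ) ^ (-n (G.ends e) + 4) = 16 * q := by
      rw [hq, two_zpow_add]; unfold scl RGraph.ends; norm_num; ring
    rw [e1]
    calc 16 * q * costM c₀ n P (G.src e) ≤ 16 * q * (c₀ * (Fintype.card V * δ⁻¹)) := by gcongr
      _ = _ := by rw [div_eq_mul_inv]; ring
  have hle : q ≤ δ := le_trans (le_mul_of_one_le_right hq0.le (one_le_pow₀ (by norm_num))) hqδ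
  refine ⟨h1.trans ?_, ?_⟩
  · calc 16 * c₀ * Fintype.card V * (q / δ) ≤ 2 ^ C₀ * (q / δ) := by gcongr
      _ ≤ 1 := by rw [mul_div_assoc', div_le_one hδ0, mul_comm]; exact hqδ
  · rw [ratio, max_eq_right hle]; exact h1

lemma one_le_ratio (h : G.PowerCounting s a) {D ρ : ℝ} (hD : 0 ≤ D) {C₀ : ℕ} {n : Scale V} (hn : Adm
    G D ρ n) {e : Neg G} (he : e ∉ tight G C₀ n) : 1 ≤ (2 * D + 16 * 2 ^ C₀) * ratio G n e := by
  have hroot := root_ne_ends (h.r_root e) e.2.ne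
  have hst := G.no_loop e.1
  set q := scl n (G.src e) (G.tgt e) with hq
  have hq0 : 0 < q := scl_pos n _ _
  have h2 : (1 : ℝ) ≤ 2 ^ C₀ := one_le_pow₀ (by norm_num)
  suffices hδ : nearDist (scl n) (G.src e) (G.tgt e) ≤ (2 * D + 16 * 2 ^ C₀) * q by
    unfold ratio; rw [mul_div_assoc', le_div_iff₀ (lt_max_of_lt_left (scl_pos n _ _)), one_mul]
    exact max_le (le_mul_of_one_le_left hq0.le (by linarith)) hδ
  rw [mem_tight, not_and_or] at he
  rcases he with he | he
  · have h3 : (1 / 2 : ℝ) ≤ q := by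
      have : (2 : ℝ) ^ (-1 : ℤ) ≤ q := two_zpow_le (by unfold RGraph.ends at he; omega)
      simpa using this
    have h4 := (nearDist_le (scl n) hroot.1 hroot.2).trans (hn.le _ _ hroot.1.symm); nlinarith
  · push Not at he; obtain ⟨v, hv1, hv2, hv⟩ := he; have hle := nearDist_le (scl n) hv1 hv2
    have hcmp : ∀ y, n (G.ends e) < n s(y, v) + C₀ → scl n y v ≤ 2 ^ C₀ * q := fun y hy => by
      rw [hq]; unfold scl; rw [← zpow_natCast, ← two_zpow_add]
      refine two_zpow_le ?_; unfold RGraph.ends at hy; omega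
    have h0 : 0 ≤ D * q := by positivity
    by_cases h3 : n s(G.src e, v) + C₀ ≤ n (G.ends e)
    · have h4 := hcmp _ (hv h3); have h5 := hn.tri (G.src e) (G.tgt e) v hst hv2.symm hv1.symm
      nlinarith
    · have h4 := hcmp _ (not_le.1 h3); have := scl_pos n (G.src e) (G.tgt e); nlinarith

lemma edgeWeight_neg (n : Scale V) (e : Neg G) : ew G a n e =
    ((2 : ℝ) ^ n (G.ends e)) ^ a e * ratio G n e ^ (-G.r e).toNat := by
  unfold edgeWeight
  rw [if_neg (not_lt.2 e.2.le), if_pos e.2, mul_one, rpow_neg (scl_pos n _ _).le,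
    ← inv_rpow (scl_pos n _ _).le, inv_scl, gain, rpow_natCast]
  rfl

lemma IsSymb.prod_le {X ι κ : Type*} [NormedAddCommGroup X] [NormedSpace ℝ X] {b : ι → X}
    {μ : ι → ℝ} {D : Set X} {m : ℕ} [Fintype κ] (S : Finset κ) {F : κ → X → ℝ} {B : κ → ℝ} {c : ℝ}
    (hc : 1 ≤ c) (hμ : ∀ i, 0 ≤ μ i) (hB : ∀ j ∈ S, 0 ≤ B j) (hD : IsOpen D)
    (hF : ∀ j ∈ S, SmoothOn (F j) D) (h : ∀ j ∈ S, IsSymb b μ D m (c * B j) (F j)) :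
    IsSymb b μ D m ((2 ^ m * c) ^ Fintype.card κ * ∏ j ∈ S, B j) (fun x => ∏ j ∈ S, F j x) := by
  have hP := prod_nonneg hB
  have hc' : ∀ j ∈ S, 0 ≤ c * B j := fun j hj => mul_nonneg (by linarith) (hB j hj)
  refine (IsSymb.prod S hμ hc' hD hF h).mono hμ (fun _ => le_rfl)
    (mul_nonneg (by positivity) (prod_nonneg hc')) ?_ le_rfl
  rw [prod_mul_distrib, prod_const, ← mul_assoc, pow_mul, ← mul_pow]
  refine mul_le_mul_of_nonneg_right (pow_le_pow_right₀ ?_ (card_le_univ S)) hP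
  nlinarith [one_le_pow₀ (M₀ := ℝ) (n := m) one_le_two]

/-! ### Symbol estimates at fixed scales -/

open scoped Classical in
/-- The contribution of the scales `n` without the factors in `A`. -/
def core (s : ℕ^d) (G : RGraph V E) (K : E → ℝ^d → ℝ) (I : E → ℕ^d → ℝ)
    (φ : ℝ^d → ℝ) (n : Scale V) (A : Finset (Neg G)) (x : Conf G d) : ℝ :=
  (∏ e : Neg G with e ∉ A, epiece s G K I e (n (G.ends e)) x) * (∏ c, freeFac s G c (n c) x) *
    restFac s G K φ x

/-- An upper bound for all orders of derivatives that are used. -/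
def ord (G : RGraph V E) : ℕ := ∑ e, (G.r e).natAbs

lemma natAbs_le_ord (G : RGraph V E) (e : E) : (G.r e).natAbs ≤ ord G :=
  single_le_sum (f := fun e => (G.r e).natAbs) (fun _ _ => Nat.zero_le _) (mem_univ e)

/-- The size of the kernel of an edge. -/
def sizeE (s : ℕ^d) (G : RGraph V E) (N : E → ℝ) (I : E → ℕ^d → ℝ) (e : E) : ℝ :=
  N e + ∑ k ∈ lowIdx s (-G.r e).toNat, |I e k|

lemma ends_notMem (h : G.PowerCounting s a) (A : Finset (Neg G)) :
    (∀ v, s(G.root, v) ∉ A.image fun e => G.ends e.1) ∧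
    (∀ e, 0 ≤ G.r e → s(G.src e, G.tgt e) ∉ A.image fun e => G.ends e.1) ∧
    (∀ e : Neg G, e ∉ A → G.ends e.1 ∉ A.image fun e => G.ends e.1) ∧
    ∀ c, (∀ e : Neg G, G.ends e.1 ≠ c) → c ∉ A.image fun e => G.ends e.1 := by
  have key : ∀ c, c ∈ (A.image fun e => G.ends e.1) ↔ ∃ e ∈ A, G.ends e.1 = c := fun c => by
    rw [mem_image]
  simp only [key]
  push Not
  refine ⟨fun v e _ he => e.2.ne (h.r_root e ?_), fun e he e' _ hee => ?_, fun e he e' he' hee => ?_,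
    fun c hc e _ => hc e⟩
  · rcases Sym2.eq_iff.1 he with h1 | h1
    · exact Or.inl h1.1
    · exact Or.inr h1.2
  · have h1 := e'.2; rw [eq_of_neg_of_ends_eq e'.2 hee] at h1; omega
  · exact he (Subtype.ext (eq_of_neg_of_ends_eq e'.2 hee) ▸ he')

open scoped Classical in
lemma core_eq_zero {K : E → ℝ^d → ℝ}
    {I : E → ℕ^d → ℝ} (hsupp : ∀ e x, 1 < snorm s x → K e x = 0) {φ : ℝ^d → ℝ}
    {ρ : ℝ} (hφ : ∀ x, φ x ≠ 0 → snorm s x ≤ ρ) {n : Scale V} {A : Finset (Neg G)}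
    {x : Conf G d} (hx : x ∉ shell s G n (A.image fun e => G.ends e.1) ∩
      {x | ∀ i, snorm s (pos G (G.tgt (G.star i)) x) ≤ ρ}) : core s G K I φ n A x = 0 := by
  by_contra h0
  unfold core restFac at h0
  refine hx ⟨mem_shell (fun e => hsupp e) (fun c => prod_ne_zero_iff.1
    (right_ne_zero_of_mul (left_ne_zero_of_mul h0)) c (mem_univ c)) fun e he =>
    prod_ne_zero_iff.1 (left_ne_zero_of_mul (left_ne_zero_of_mul h0)) e
      (mem_filter.2 ⟨mem_univ e, fun h => he (mem_image_of_mem _ h)⟩),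
    fun i => hφ _ (prod_ne_zero_iff.1 (right_ne_zero_of_mul (right_ne_zero_of_mul h0)) i
      (mem_univ i))⟩

lemma edgeWeight_nonneg_of_nonneg {q : V → V → ℝ} (h : ∀ v w, 0 ≤ q v w) (κ : E → ℝ) (e : E) :
    0 ≤ edgeWeight G a κ q e := by
  unfold edgeWeight
  refine mul_nonneg (mul_nonneg (rpow_nonneg (h _ _) _) ?_) ?_
  · split_ifs
    · exact mul_nonneg (rpow_nonneg (div_nonneg (h _ _) (le_max_of_le_left (h _ _))) _)
        (rpow_nonneg (div_nonneg (le_max_of_le_left (h _ _)) (h _ _)) _)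
    · exact zero_le_one
  · split_ifs
    · exact rpow_nonneg (div_nonneg (h _ _) (le_max_of_le_left (h _ _))) _
    · exact zero_le_one

lemma edgeWeight_nonneg (n : Scale V) (κ : E → ℝ) (e : E) : 0 ≤ edgeWeight G a κ (scl n) e :=
  edgeWeight_nonneg_of_nonneg (fun v w => (scl_pos n v w).le) κ e

lemma exists_abs_isSymb_epiece (h : G.PowerCounting s a)
    (hnc : G.NonCritical s a) (m : ℕ) : ∃ C : ℝ, 1 ≤ C ∧ ∀ (e : Neg G)
      (K : E → ℝ^d → ℝ) (I : E → ℕ^d → ℝ) (N : E → ℝ) (p : ℕ),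
      m * sdim s < p → KerBound s (a e) p (N e) (K e) →
      MomentsCompatible s (a e) (G.r e) (K e) (I e) → ∀ n : ℤ,
      IsSymb stdB (fun i => ((2 : ℝ) ^ (n + 1)) ^ s i) Set.univ m
        (C * (sizeE s G N I e * ((2 : ℝ) ^ n) ^ a e)) (pieceK s (-G.r e).toNat (K e) (I e) n) := by
  choose C hC hC' using fun e : Neg G => exists_isSymb_pieceK (a := a e) (q := (-G.r e).toNat) (h.a_nonneg e) m (hnc e)
  refine ⟨1 + ∑ e, C e, by simpa using sum_nonneg fun e _ => hC e, fun e K I N p hp hK hI n => ?_⟩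
  have h0 : 0 ≤ sizeE s G N I e := add_nonneg hK.nonneg (sum_nonneg fun _ _ => abs_nonneg _)
  refine (hC' e (K e) (I e) (N e) p hp hK hI n).mono (fun i => by positivity) (fun _ => le_rfl)
    (mul_nonneg (mul_nonneg (hC e) h0) (by positivity)) ?_ le_rfl
  rw [mul_assoc]
  have h1 := single_le_sum (f := C) (fun e _ => hC e) (mem_univ e)
  exact mul_le_mul_of_nonneg_right (by linarith) (mul_nonneg h0 (by positivity))

open scoped Classical in
lemma exists_isSymb_core (h : G.PowerCounting s a)
    (hnc : G.NonCritical s a) (m : ℕ) {W : ℝ} (hW : 1 ≤ W) : ∃ C : ℝ, 0 ≤ C ∧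
    ∀ (K : E → ℝ^d → ℝ) (I : E → ℕ^d → ℝ) (N : E → ℝ) (p : ℕ)
      (φ : ℝ^d → ℝ) (R T lam D ρ : ℝ) (n : Scale V) (A : Finset (Neg G)) (M : V → ℝ),
      (∀ e, KerBound s (a e) p (N e) (K e)) →
      (∀ e, MomentsCompatible s (a e) (G.r e) (K e) (I e)) → (m + ord G) * sdim s < p →
      IsTest s R φ → 0 ≤ T → (∀ k, sdeg s k < p → ∀ x, |multiD k φ x| ≤ T) → 0 < lam →
      Adm G D ρ n → (∀ v, 0 ≤ M v) →
      (∀ v w, v ≠ w → (s(v, w) ∉ A.image fun e => G.ends e.1) → 4 * 2 ^ n s(v, w) ≤ M v) →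
      (∀ i, lam⁻¹ ≤ M (G.tgt (G.star i))) →
      (∀ e : Neg G, e ∉ A → ((2 : ℝ) ^ n (G.ends e)) ^ a e ≤ W * ew G a n e) →
      Smooth (core s G K I (rescale s lam φ) n A) ∧
      IsSymb (dir G) (cost s G M) Set.univ m (C * ((lam ^ sdim s)⁻¹ * T) ^ G.M *
          ((∏ e : Neg G with e ∉ A, sizeE s G N I e * ew G a n e) *
            ∏ e : {e // 0 ≤ G.r e}, sizeE s G N I e * ew G a n e))
        (core s G K I (rescale s lam φ) n A) := by
  obtain ⟨C₁, hC₁, h₁⟩ := exists_abs_isSymb_epiece h hnc m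
  obtain ⟨C₂, hC₂, h₂⟩ := exists_isSymb_freeFac (s := s) (G := G) m
  choose C₃ hC₃ h₃ using fun e : {e // 0 ≤ G.r e} => exists_isSymb_hatK (κ := gain G) (d := d)
    (h.a_nonneg e) e.2 (fun h' => (root_ne_ends (h.r_root e) h'.ne').imp Ne.symm Ne.symm) m
  set c₁ := (2 ^ m * (C₁ * W)) ^ Fintype.card (Neg G)
  set c₂ := (2 ^ m * (1 + C₂)) ^ Fintype.card (Sym2 V)
  set c₃ := (2 ^ m * 1 : ℝ) ^ Fintype.card (Fin G.M)
  set c₄ := (2 ^ m * (1 + ∑ e, C₃ e)) ^ Fintype.card {e // 0 ≤ G.r e}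
  have hS : 0 ≤ ∑ e, C₃ e := sum_nonneg fun e _ => hC₃ e
  refine ⟨2 ^ m * (2 ^ m * (2 ^ m * (c₁ * c₂) * c₃) * c₄), by positivity, ?_⟩
  intro K I N p φ R T lam D ρ n A M hK hI hp hφ hT hφT hlam hn hM0 hM hMstar hAw
  set P := A.image fun e => G.ends e.1 with hP
  obtain ⟨hP1, hP2, hP3, hP4⟩ := ends_notMem h A
  have hν : ∀ c, 0 ≤ cost s G M c := fun c => pow_nonneg (hM0 _) _
  have hSz : ∀ e, 0 ≤ sizeE s G N I e := fun e =>
    add_nonneg (hK e).nonneg (sum_nonneg fun _ _ => abs_nonneg _)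
  have hb : ∀ e, 0 ≤ sizeE s G N I e * ew G a n e := fun e =>
    mul_nonneg (hSz e) (edgeWeight_nonneg _ _ _)
  have hmp : m * sdim s < p := lt_of_le_of_lt (Nat.mul_le_mul_right _ (by omega)) hp
  have hr := isSymb_rescale hφ.smooth hlam (m := m) (s := s)
    (fun k hk x => hφT k (lt_of_le_of_lt hk hmp) x)
  have hTl : 0 ≤ (lam ^ sdim s)⁻¹ * T := by positivity
  have hposd : ∀ v w, Smooth fun x : Conf G d => pos G v x - pos G w x := fun v w =>
    (pos G v).contDiff.sub (pos G w).contDiff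
  -- the factors
  have s1 : ∀ e : Neg G, Smooth (epiece s G K I e (n (G.ends e))) := fun e =>
    (contDiff_pieceK (hK e).smooth _).comp (hposd _ _)
  have b1 : ∀ e : Neg G, e ∉ A → IsSymb (dir G) (cost s G M) Set.univ m (C₁ * W * (sizeE s G N I e *
    ew G a n e)) (epiece s G K I e (n (G.ends e))) := fun e he => by
    have hle : (2 : ℝ) ^ (n (G.ends e) + 1) ≤ 4 * 2 ^ n (G.ends e) := by
      rw [two_zpow_add, zpow_one]; have : (0 : ℝ) < 2 ^ n (G.ends e) := by positivity
      linarith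
    have hB : 0 ≤ C₁ * (sizeE s G N I e * ((2 : ℝ) ^ n (G.ends e)) ^ a e) :=
      mul_nonneg (by linarith) (mul_nonneg (hSz e) (by positivity))
    refine (isSymb_diff hM0 (Λ := 2 ^ (n (G.ends e) + 1)) (by positivity) (G.no_loop e).symm
      isOpen_univ isOpen_univ (fun _ _ => trivial) hB
      (contDiff_pieceK (hK e).smooth _).contDiffOn
      (fun _ => hle.trans ?_) (fun _ => hle.trans (hM _ _ (G.no_loop e) (hP3 e he)))
      (h₁ e K I N p hmp (hK e) (hI e) _)).mono hν (fun _ => le_rfl) hB ?_ le_rfl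
    · have := hM _ _ (G.no_loop e).symm (by rw [Sym2.eq_swap]; exact hP3 e he)
      rwa [Sym2.eq_swap] at this
    · have := mul_le_mul_of_nonneg_left (hAw e he) (hSz e); nlinarith
  have p1 := IsSymb.prod_le (univ.filter fun e : Neg G => e ∉ A) (by nlinarith) hν
    (fun e _ => hb e) isOpen_univ (fun e _ => (s1 e).contDiffOn)
    fun e he => b1 e (mem_filter.1 he).2
  have p2 := IsSymb.prod_le (B := fun _ => 1) (D := Set.univ) (m := m)
    (F := fun c => freeFac s G c (n c)) univ (show 1 ≤ 1 + C₂ by linarith) hν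
    (fun _ _ => zero_le_one) isOpen_univ
    (fun c _ => (contDiff_freeFac c _).contDiffOn) fun c _ =>
      (h₂ M c (n c) hM0 fun v w hvw hc hne => by
        have h4 := hM v w hvw (hc ▸ hP4 c hne); rw [hc] at h4
        have : (0 : ℝ) < 2 ^ n c := by positivity
        linarith).mono hν (fun _ => le_rfl) hC₂ (by linarith) le_rfl
  have s3 : ∀ i, Smooth fun x : Conf G d => rescale s lam φ (pos G (G.tgt (G.star i)) x) :=
    fun i => hr.1.comp (pos G _).contDiff
  have p3 := IsSymb.prod_le (B := fun _ => (lam ^ sdim s)⁻¹ * T) (D := Set.univ) (m := m)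
    (F := fun i (x : Conf G d) => rescale s lam φ (pos G (G.tgt (G.star i)) x)) univ
    le_rfl hν (fun _ _ => hTl) isOpen_univ (fun i _ => (s3 i).contDiffOn) fun i _ => by
      have := isSymb_diff (G := G) (D := Set.univ) hM0 (Λ := lam⁻¹) (by positivity)
        (star_ne_root G i)
        isOpen_univ isOpen_univ (fun _ _ => trivial) hTl hr.1.contDiffOn (fun _ => hMstar i)
        (fun h => absurd rfl h) hr.2
      simpa only [pos_root, sub_zero, one_mul] using this
  have h4 := fun e : {e // 0 ≤ G.r e} => h₃ e (K e) (N e) p n P M (hK e)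
    (lt_of_le_of_lt (Nat.mul_le_mul_right _ (Nat.add_le_add_left (by
      have := natAbs_le_ord G e; omega) m)) hp) hM0 hM hP1 (hP2 e e.2) hn.tri
  have hO := isOpen_scaleDom (s := s) (G := G) n P
  have p4 := IsSymb.prod_le (B := fun e : {e // 0 ≤ G.r e} => sizeE s G N I e * ew G a n e) univ
    (show 1 ≤ 1 + ∑ e, C₃ e by linarith) hν (fun e _ => hb e) hO (fun e _ => (h4 e).1)
    fun e _ => (h4 e).2.mono hν (fun _ => le_rfl)
      (mul_nonneg (mul_nonneg (hC₃ e) (hK e).nonneg) (edgeWeight_nonneg _ _ _)) (by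
        have h5 := single_le_sum (f := C₃) (fun e _ => hC₃ e) (mem_univ e)
        have h6 : N e ≤ sizeE s G N I e :=
          le_add_of_nonneg_right (sum_nonneg fun _ _ => abs_nonneg _)
        have h7 := edgeWeight_nonneg (G := G) (a := a) n (gain G) e; have h8 := (hK e).nonneg
        rw [mul_assoc]; gcongr
        · linarith) le_rfl
  -- their product
  have s123 := ((contDiff_prod (t := univ.filter fun e : Neg G => e ∉ A)
    fun e _ => s1 e).mul (contDiff_prod (t := univ) fun c _ =>
      contDiff_freeFac (G := G) c (n c))).mul (contDiff_prod (t := univ) fun i _ => s3 i)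
  have s4 : SmoothOn (fun x : Conf G d => ∏ e : {e // 0 ≤ G.r e}, RGraph.hatK s (G.r e) (K e) (pos G
    (G.src e) x) (pos G (G.tgt e) x)) (scaleDom s G n P) := contDiffOn_prod fun e _ => (h4 e).1
  have q1 : 0 ≤ ∏ e : Neg G with e ∉ A, sizeE s G N I e * ew G a n e := prod_nonneg fun e _ => hb e
  have q4 : 0 ≤ ∏ e : {e // 0 ≤ G.r e}, sizeE s G N I e * ew G a n e := prod_nonneg fun e _ => hb e
  have r12 := p1.mul hν (by positivity) (by positivity) isOpen_univ
    (contDiff_prod fun e _ => s1 e).contDiffOn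
    (contDiff_prod fun c _ => contDiff_freeFac c (n c)).contDiffOn p2
  have r123 := r12.mul hν (by positivity) (by positivity) isOpen_univ
    ((contDiff_prod fun e _ => s1 e).mul
      (contDiff_prod fun c _ => contDiff_freeFac c (n c))).contDiffOn
    (contDiff_prod fun i _ => s3 i).contDiffOn p3
  have r := (r123.mono hν (fun _ => le_rfl) (by positivity) le_rfl
    (Set.subset_univ (scaleDom s G n P))).mul hν (by positivity) (by positivity) hO
    s123.contDiffOn s4 p4
  have hcore : core s G K I (rescale s lam φ) n A = fun x =>
      (∏ e : Neg G with e ∉ A, epiece s G K I e (n (G.ends e)) x) * (∏ c, freeFac s G c (n c) x) *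
      (∏ i, rescale s lam φ (pos G (G.tgt (G.star i)) x)) *
      ∏ e : {e // 0 ≤ G.r e}, RGraph.hatK s (G.r e) (K e) (pos G (G.src e) x) (pos G (G.tgt e) x) := by
    funext x; unfold core restFac; ring
  have hz : ∀ x ∈ (shell s G n P)ᶜ, core s G K I (rescale s lam φ) n A x = 0 := fun x hx =>
    core_eq_zero (fun e => (hK e).support) (ρ := R * lam)
      (fun x hx => rescale_support hφ.support hlam hx) fun h' => hx h'.1
  have hzo := (isClosed_shell (s := s) (G := G) n P).isOpen_compl
  have hun : scaleDom s G n P ∪ (shell s G n P)ᶜ = Set.univ :=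
    Set.eq_univ_of_forall fun x => (em (x ∈ shell s G n P)).imp_left fun hx => shell_subset n P hx
  constructor
  · refine contDiff_iff_contDiffAt.2 fun x => ?_
    rcases (hun ▸ Set.mem_univ x : x ∈ scaleDom s G n P ∪ (shell s G n P)ᶜ) with hx | hx
    · rw [hcore]; exact (s123.contDiffOn.mul s4).contDiffAt (hO.mem_nhds hx)
    · exact (contDiffAt_const (c := (0 : ℝ))).congr_of_eventuallyEq
        (eventually_of_mem (hzo.mem_nhds hx) hz)
  · rw [← hun]
    have hC : 2 ^ m * (2 ^ m * (2 ^ m * (c₁ * (∏ e : Neg G with e ∉ A, sizeE s G N I e *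
        ew G a n e) * (c₂ * ∏ c : Sym2 V, 1)) *
        (c₃ * ∏ i : Fin G.M, (lam ^ sdim s)⁻¹ * T)) * (c₄ * ∏ e : {e // 0 ≤ G.r e},
          sizeE s G N I e * ew G a n e)) =
        2 ^ m * (2 ^ m * (2 ^ m * (c₁ * c₂) * c₃) * c₄) * ((lam ^ sdim s)⁻¹ * T) ^ G.M *
          ((∏ e : Neg G with e ∉ A, sizeE s G N I e * ew G a n e) *
            ∏ e : {e // 0 ≤ G.r e}, sizeE s G N I e * ew G a n e) := by
      rw [prod_const, prod_const, one_pow, card_univ, Fintype.card_fin]; ring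
    rw [← hC]; refine IsSymb.union ?_ (IsSymb.zero hν hzo (by positivity) hz); rw [hcore]; exact r

/-! ### The bound on the contribution of fixed scales -/

/-- The configurations over which the contribution of the scales `n` is spread out. -/
def scaleSet (s : ℕ^d) (G : RGraph V E) (ρ : ℝ) (n : Scale V) : Set (Conf G d) :=
  {x | x ∈ scaleDom s G n ∅ ∧ (∀ w ∈ G.Vstar, snorm s (G.extend x w) ≤ ρ) ∧ ∀ v, n s(v, v) = 0}

lemma pos_of_ne {v : V} (h : v ≠ G.root) (x : Conf G d) : pos G v x = x ⟨v, h⟩ := by simp [pos, h]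

lemma hasCompactSupport_core (h : G.PowerCounting s a) {n : Scale V}
    {A : Finset (Neg G)} {F : Conf G d → ℝ}
    (hF : ∀ x ∉ shell s G n (A.image fun e => G.ends e.1), F x = 0) : HasCompactSupport F := by
  refine HasCompactSupport.intro (isCompact_univ_pi fun v : 𝕍 G =>
    isCompact_snorm_le (2 ^ (-n s(v.1, G.root) + 3))) fun x hx => hF x fun hx' => hx fun v _ => ?_
  have := (hx' v.1 G.root v.2 (by rw [Sym2.eq_swap]; exact (ends_notMem h A).1 v)).2
  rwa [pos_root, sub_zero, pos_of_ne v.2] at this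

lemma mem_scaleSet_of_near (h : G.PowerCounting s a) {C₀ : ℕ} (hC : 7 ≤ C₀)
    {n : Scale V} (hn : ∀ v, n s(v, v) = 0) {ρ : ℝ} {x x' : Conf G d}
    (hx' : x' ∈ shell s G n ((tight G C₀ n).image fun e => G.ends e.1))
    (hst : ∀ i, snorm s (pos G (G.tgt (G.star i)) x') ≤ ρ)
    (hx : ∀ e ∈ tight G C₀ n, 2 ^ (-n (G.ends e)) ≤ snorm s (pos G (G.tgt e) x - pos G (G.src e) x) ∧
      snorm s (pos G (G.tgt e) x - pos G (G.src e) x) ≤ 2 ^ (-n (G.ends e) + 3))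
    (hxx : ∀ v, x v = x' v ∨ ∃ e ∈ tight G C₀ n, G.src e = v.1 ∧
      snorm s (x v - x' v) ≤ 2 ^ (-n (G.ends e) + 4)) : x ∈ scaleSet s G (2 * ρ) n := by
  set P := (tight G C₀ n).image fun e => G.ends e.1 with hP
  have hclose : ∀ v w, v ≠ w → s(v, w) ∉ P → snorm s (pos G v x - pos G v x') ≤ scl n v w / 8 := by
    intro v w hvw hvP; have h0 := scl_pos n v w
    by_cases hv : v = G.root
    · rw [hv, pos_root, pos_root, sub_zero, snorm_zero, ← hv]; positivity
    rw [pos_of_ne hv, pos_of_ne hv]; rcases hxx ⟨v, hv⟩ with h1 | ⟨e, he, h1, h2⟩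
    · rw [h1, sub_self, snorm_zero]; positivity
    · refine h2.trans ?_; simp only at h1
      have h3 := ((mem_tight.1 he).2 w (h1 ▸ hvw.symm) fun h4 => hvP (mem_image.2
        ⟨e, he, by rw [← h1, h4]; rfl⟩)).1
      rw [h1] at h3
      have : scl n v w / 8 = 2 ^ (-n s(v, w) - 3) := by unfold scl; rw [two_zpow_sub]; norm_num
      rw [this]; exact two_zpow_le (by omega)
  have e8 : ∀ v w : V, (2 : ℝ) ^ (-n s(v, w) + 3) = 8 * scl n v w := fun v w => by
    unfold scl; rw [two_zpow_add]; norm_num; ring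
  have e2 : ∀ v w : V, (2 : ℝ) ^ (-n s(v, w) - 1) = scl n v w / 2 := fun v w => by
    unfold scl; rw [two_zpow_sub]; norm_num
  have e16 : ∀ v w : V, (2 : ℝ) ^ (-n s(v, w) + 4) = 16 * scl n v w := fun v w => by
    unfold scl; rw [two_zpow_add]; norm_num; ring
  refine ⟨fun v w hvw _ => ?_, fun w hw => ?_, hn⟩
  · rw [e2, e16]; have hq := scl_pos n v w
    by_cases hvP : s(v, w) ∈ P
    · obtain ⟨e, he, hee⟩ := mem_image.1 hvP; have h1 := hx e he; rw [hee, e8] at h1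
      have h2 : snorm s (pos G (G.tgt e) x - pos G (G.src e) x) =
          snorm s (pos G v x - pos G w x) := by
        rcases Sym2.eq_iff.1 hee with ⟨h2, h3⟩ | ⟨h2, h3⟩
        · rw [h2, h3, snorm_sub_comm]
        · rw [h2, h3]
      rw [h2] at h1; change scl n v w ≤ _ ∧ _ at h1; constructor <;> linarith
    · have h1 := hx' v w hvw hvP; rw [e8] at h1; change scl n v w ≤ _ ∧ _ at h1
      have h2 := hclose v w hvw hvP; have h3 := hclose w v hvw.symm (by rwa [Sym2.eq_swap])
      rw [show scl n w v = scl n v w by unfold scl; rw [Sym2.eq_swap]] at h3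
      have t1 := snorm_tri (pos G v x) (pos G v x') (pos G w x)
      have t2 := snorm_tri (pos G v x') (pos G w x') (pos G w x)
      have t3 := snorm_tri (pos G v x') (pos G v x) (pos G w x')
      have t4 := snorm_tri (pos G v x) (pos G w x) (pos G w x')
      rw [snorm_sub_comm (pos G w x') (pos G w x)] at t2
      rw [snorm_sub_comm (pos G v x') (pos G v x)] at t3; constructor <;> linarith
  · rw [← pos_apply]; rcases mem_insert.1 hw with rfl | hw
    · rw [pos_root, snorm_zero]; have := (snorm_nonneg _).trans (hst ⟨0, G.M_pos⟩); linarith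
    · obtain ⟨i, -, rfl⟩ := mem_image.1 hw; have hne := star_ne_root G i
      have hPi : s(G.tgt (G.star i), G.root) ∉ P := by
        rw [Sym2.eq_swap]; exact (ends_notMem h _).1 _
      have h1 := hclose _ _ hne hPi; have h2 := (hx' _ _ hne hPi).1; change scl n _ _ ≤ _ at h2
      rw [pos_root, sub_zero] at h2; have h3 := hst i
      have h4 := snorm_nonneg (s := s) (pos G (G.tgt (G.star i)) x')
      have t1 := snorm_tri (pos G (G.tgt (G.star i)) x) (pos G (G.tgt (G.star i)) x') 0
      rw [sub_zero, sub_zero] at t1; linarith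

lemma exists_weight_scl_le {κ : E → ℝ} (ha : ∀ e, 0 ≤ a e) (hκ : ∀ e, 0 ≤ κ e) (hr : ∀ e, G.src e =
    G.root ∨ G.tgt e = G.root → G.r e = 0) : ∃ C : ℝ, 0 < C ∧ ∀ (n : Scale V) (x : Conf G d), x ∈
    scaleDom s G n ∅ → weight G a κ (scl n) ≤ C * weight G a κ (dist' s (G.extend x)) := by
  obtain ⟨C, hC, hw⟩ := exists_weight_le G a κ ha hκ hr (show (1 : ℝ) ≤ 16 by norm_num)
  refine ⟨C, hC, fun n x hx => ?_⟩
  have key : ∀ v w, v ≠ w → scl n v w / 2 < dist' s (G.extend x) v w ∧ dist' s (G.extend x) v w < 16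
    * scl n v w := fun v w hvw => by
    have h1 := hx v w hvw (notMem_empty _)
    rw [pos_apply, pos_apply, two_zpow_add, two_zpow_sub] at h1
    unfold scl dist'; norm_num at h1 ⊢; constructor <;> linarith
  have h0 := scl_pos n
  refine (hw (scl n) (dist' s (G.extend x)) (fun v w _ => h0 v w) (fun v w hvw => ?_)
    (fun v w hvw => ?_) fun v w hvw => (key v w hvw).2.le).2
  · have := (key v w hvw).1; have := h0 v w; linarith
  · have := (key v w hvw).1; have := h0 v w; linarith

lemma prod_neg_mul_prod (f : E → ℝ) :
    (∏ e : Neg G, f e) * ∏ e : {e // 0 ≤ G.r e}, f e = ∏ e, f e := by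
  rw [← Fintype.prod_subtype_mul_prod_subtype (fun e => G.r e < 0) f]
  congr 1
  exact Fintype.prod_equiv (Equiv.subtypeEquivRight fun e => by simp) _ _ fun _ => rfl

set_option maxHeartbeats 1000000 in
theorem exists_abs_integral_scaleFun_le (h : G.PowerCounting s a)
    (hnc : G.NonCritical s a) {R : ℝ} (hR : 0 < R) : ∃ C : ℝ, 0 ≤ C ∧
    ∀ (K : E → ℝ^d → ℝ) (I : E → ℕ^d → ℝ) (N : E → ℝ) (p : ℕ)
      (φ : ℝ^d → ℝ) (T lam : ℝ) (n : Scale V),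
      (∀ e, KerBound s (a e) p (N e) (K e)) →
      (∀ e, MomentsCompatible s (a e) (G.r e) (K e) (I e)) → (ord G + ord G) * sdim s < p →
      IsTest s R φ → 0 ≤ T → (∀ k, sdeg s k < p → ∀ x, |multiD k φ x| ≤ T) → 0 < lam → lam ≤ 1 →
      ENNReal.ofReal |∫ x, scaleFun s G K I (rescale s lam φ) n x| ≤
        ENNReal.ofReal (C * ((lam ^ sdim s)⁻¹ * T) ^ G.M * ∏ e, sizeE s G N I e) *
          ∫⁻ x, (scaleSet s G (2 * (R * lam)) n).indicator
            (fun x => ENNReal.ofReal (weight G a (gain G) (dist' s (G.extend x)))) x := by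
  classical
  set c₀ := max 4 R with hc₀
  have hc₀' : 0 ≤ c₀ := le_max_of_le_left (by norm_num)
  set D := 2 * (max R 4 + Fintype.card V * 4) with hD
  have hD0 : 0 ≤ D := by have : 0 ≤ max R 4 := le_max_of_le_left hR.le; positivity
  obtain ⟨k, hk⟩ := pow_unbounded_of_one_lt (16 * c₀ * Fintype.card V) (show (1 : ℝ) < 2 by norm_num)
  set C₀ := k + 7 with hC₀
  have hCk : 16 * c₀ * Fintype.card V ≤ 2 ^ C₀ :=
    hk.le.trans (pow_le_pow_right₀ (by norm_num) (by omega))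
  set w₁ := 2 * D + 16 * 2 ^ C₀ with hw₁
  set w₂ := 16 * c₀ * Fintype.card V with hw₂
  have hw₁0 : 0 ≤ w₁ := by positivity
  have hw₂0 : 0 ≤ w₂ := by positivity
  set W := (1 + w₁ + w₂) ^ ord G with hWdef
  have hW : 1 ≤ W := one_le_pow₀ (by linarith)
  have hrN : ∀ e : Neg G, (-G.r e).toNat ≤ ord G := fun e => by have := natAbs_le_ord G e; omega
  have hroot : ∀ e : Neg G, G.src e ≠ G.root ∧ G.tgt e ≠ G.root := fun e =>
    (root_ne_ends (h.r_root e) e.2.ne).imp Ne.symm Ne.symm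
  let u : Neg G → 𝕍 G := fun e => ⟨G.src e, (hroot e).1⟩
  let w : Neg G → 𝕍 G := fun e => ⟨G.tgt e, (hroot e).2⟩
  have huw : ∀ e, u e ≠ w e := fun e h' => G.no_loop e (congrArg Subtype.val h')
  choose Ci hCi hI' using fun A : {A : Finset (Neg G) // ∀ e ∈ A, ∀ e' ∈ A, e ≠ e' → u e ≠ u e' ∧ u
    e ≠ w e'} => exists_iterated_locRem (s := s) u w (fun e => (-G.r e).toNat) A.1 (fun e _ => huw
    e) A.2 0
  obtain ⟨Cc, hCc, hcore⟩ := exists_isSymb_core h hnc (ord G) hW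
  obtain ⟨Ce, hCe, hep⟩ := exists_abs_isSymb_epiece h hnc 0
  obtain ⟨Cw, hCw, hwt⟩ := exists_weight_scl_le (s := s) h.a_nonneg (κ := gain G)
    (fun e => Nat.cast_nonneg _) h.r_root
  set ι := ∑ A, Ci A with hι
  have hι0 : 0 ≤ ι := sum_nonneg fun A _ => hCi A
  clear_value ι W w₁ w₂
  refine ⟨(Ce * W) ^ Fintype.card (Neg G) * ι * Cc * Cw, by positivity, ?_⟩
  intro K I N p φ T lam n hK hI hp hφ hT hφT hlam hlam1
  by_cases hz : ∀ x, scaleFun s G K I (rescale s lam φ) n x = 0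
  · simp [hz]
  push Not at hz
  obtain ⟨x₀, hx₀⟩ := hz
  have hadm := (adm_of_ne_zero h (fun e => (hK e).support) hR hφ.support hlam hlam1 hx₀).1
  rw [← hD] at hadm
  set A := tight G C₀ n with hA
  set P := A.image fun e => G.ends e.1 with hP
  set M := costM c₀ n P with hM
  have hM0 : ∀ v, 0 ≤ M v := costM_nonneg hc₀' n P
  have hSz : ∀ e, 0 ≤ sizeE s G N I e := fun e =>
    add_nonneg (hK e).nonneg (sum_nonneg fun _ _ => abs_nonneg _)
  set b : E → ℝ := fun e => sizeE s G N I e * ew G a n e with hb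
  have hb0 : ∀ e, 0 ≤ b e := fun e => mul_nonneg (hSz e) (edgeWeight_nonneg _ _ _)
  have hρ0 : ∀ e, 0 ≤ ratio G n e := fun e =>
    div_nonneg (scl_pos n _ _).le (le_max_of_le_left (scl_pos n _ _).le)
  have hpowW : ∀ (e : Neg G) (w' : ℝ), 0 ≤ w' → w' ≤ 1 + w₁ + w₂ → (w' * ratio G n e) ^ (-G.r
    e).toNat ≤ W * ratio G n e ^ (-G.r e).toNat := fun e w' h0 h1 => by
    rw [mul_pow, hWdef]; refine mul_le_mul_of_nonneg_right ?_ (pow_nonneg (hρ0 e) _)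
    exact (pow_le_pow_left₀ h0 h1 _).trans (pow_le_pow_right₀ (by linarith) (hrN e))
  have hP1 := (ends_notMem h A).1
  have hstar : ∀ i, lam⁻¹ ≤ M (G.tgt (G.star i)) := fun i => by
    have hne := star_ne_root G i
    have h1 := le_costM hc₀' n hne (P := P) (by rw [Sym2.eq_swap]; exact hP1 _)
    refine le_trans ?_ h1
    rw [Sym2.eq_swap, ← inv_scl, ← div_eq_mul_inv, le_div_iff₀ (scl_pos n _ _),
      inv_mul_le_iff₀ hlam]
    calc scl n G.root (G.tgt (G.star i)) ≤ R * lam := hadm.star i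
      _ ≤ lam * c₀ := by rw [mul_comm]; exact mul_le_mul_of_nonneg_left (le_max_right _ _) hlam.le
  obtain ⟨hsm, hsy⟩ := hcore K I N p φ R T lam D (R * lam) n A M hK hI hp hφ hT hφT hlam hadm hM0
    (fun v w hvw hvP => le_trans (mul_le_mul_of_nonneg_right (le_max_left _ _) (by positivity))
      (le_costM hc₀' n hvw hvP)) hstar (fun e he => by
      rw [edgeWeight_neg]; have h1 := one_le_pow₀ (n := (-G.r e).toNat) (one_le_ratio h hD0 hadm he)
      rw [← hw₁] at h1; have h2 := h1.trans (hpowW e w₁ hw₁0 (by linarith))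
      have h3 : 0 ≤ ((2 : ℝ) ^ n (G.ends e)) ^ a e := by positivity
      nlinarith)
  set B := Cc * ((lam ^ sdim s)⁻¹ * T) ^ G.M * ((∏ e : Neg G with e ∉ A, b e) *
    ∏ e : {e // 0 ≤ G.r e}, b e) with hB
  have q1 : 0 ≤ ∏ e : Neg G with e ∉ A, b e := prod_nonneg fun e _ => hb0 e
  have q2 : 0 ≤ ∏ e : {e // 0 ≤ G.r e}, b e := prod_nonneg fun e _ => hb0 e
  have hB0 : 0 ≤ B := by positivity
  clear_value B
  have hdisj : ∀ e ∈ A, ∀ e' ∈ A, e ≠ e' → u e ≠ u e' ∧ u e ≠ w e' := fun e he e' he' hne => by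
    have := tight_disjoint (by omega) he he' hne
    exact ⟨fun h' => this.1 (congrArg Subtype.val h'), fun h' => this.2 (congrArg Subtype.val h')⟩
  let f : Neg G → ℝ^d → ℝ := fun e => pieceK s (-G.r e).toNat (K e) (I e) (n (G.ends e))
  let Z : Set (Conf G d) := shell s G n P ∩
    {x | ∀ i, snorm s (pos G (G.tgt (G.star i)) x) ≤ R * lam}
  have hZ : IsClosed Z := (isClosed_shell n P).inter (by
    rw [Set.ofPred_forall]
    exact isClosed_iInter fun i => isClosed_le
      (continuous_snorm.comp (pos G _).continuous) continuous_const)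
  have hFZ : ∀ x ∉ Z, core s G K I (rescale s lam φ) n A x = 0 := fun x hx =>
    core_eq_zero (fun e => (hK e).support) (fun x hx => rescale_support hφ.support hlam hx) hx
  have hgain : ∀ e ∈ A, 2 ^ (-n (G.ends e) + 4) * M (G.src e) ≤ 1 ∧ 2 ^ (-n (G.ends e) + 4) * M
    (G.src e) ≤ w₂ * ratio G n e := fun e he =>
    hw₂ ▸ tight_gain h hc₀' (hw₂ ▸ hCk) he (mem_image_of_mem (fun e : Neg G => G.ends e.1) he)
  obtain ⟨F', Z', hF', hFc', hsy', hZ', hFZ', hnear, hin⟩ := hI' ⟨A, hdisj⟩ (fun e => n (G.ends e))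
    (fun v => M v) B (core s G K I (rescale s lam φ) n A) f Z (fun v => hM0 v) hB0 (fun e he =>
    (hgain e he).1) hsm (hasCompactSupport_core h fun x hx => hFZ x fun h' => hx h'.1) hZ hFZ (fun e
    _ => (contDiff_pieceK (hK e).smooth _).continuous) (fun e _ x hx => (pieceK_support (hK
    e).support hx).2.2) (fun e he k hk => integral_monom_mul_pieceK (hK e).smooth (hK e).support hk
    (mem_tight.1 he).1) (hsy.of_le (by
      rw [zero_add]; refine (sum_le_sum_of_subset (subset_univ A)).trans ?_; unfold ord
      rw [← Fintype.sum_subtype_add_sum_subtype (fun e => G.r e < 0)]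
      exact le_add_right (sum_le_sum fun e _ => by omega)))
  have hval := hsy'.bound
  have hid : ∫ x, scaleFun s G K I (rescale s lam φ) n x = ∫ x, (∏ e ∈ A, f e (x (w e) - x (u e))) *
    F' x := by
    have := hin (fun _ => 1) continuous_const fun _ _ _ _ => rfl; simp only [one_mul] at this
    rw [← this]; refine integral_congr_ae (Eventually.of_forall fun x => ?_)
    have hsplit := prod_filter_mul_prod_filter_not univ (fun e => e ∈ A)
      fun e : Neg G => epiece s G K I e (n (G.ends e)) x
    simp only [filter_univ_mem] at hsplit
    have hA' : ∏ e ∈ A, f e (x (w e) - x (u e)) = ∏ e ∈ A, epiece s G K I e (n (G.ends e)) x :=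
      prod_congr rfl fun e _ => by unfold epiece; rw [pos_of_ne (hroot e).1, pos_of_ne (hroot e).2]
    simp only [scaleFun, core]; rw [prod_pairFac, ← hsplit, hA']; ring
  rw [hid, ← enorm_eq_ofReal_abs]
  refine (enorm_integral_le_lintegral_enorm _).trans ?_
  rw [← lintegral_const_mul' _ _ ENNReal.ofReal_ne_top]
  refine lintegral_mono fun x => ?_
  rw [enorm_eq_ofReal_abs]
  by_cases hx : (∏ e ∈ A, f e (x (w e) - x (u e))) * F' x = 0
  · simp [hx]
  have hxA := fun e he => pieceK_support (hK e.1).support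
    (prod_ne_zero_iff.1 (left_ne_zero_of_mul hx) e he)
  obtain ⟨x', hx', hxx⟩ := hnear x (by_contra fun h' => right_ne_zero_of_mul hx (hFZ' x h'))
  have hmem : x ∈ scaleSet s G (2 * (R * lam)) n := by
    refine mem_scaleSet_of_near h (C₀ := C₀) (by omega) hadm.diag hx'.1 hx'.2 (fun e he => ?_)
      fun v => (hxx v).imp_right fun ⟨e, he, h1, h2⟩ => ⟨e, he, congrArg Subtype.val h1, h2⟩
    rw [pos_of_ne (hroot e).1, pos_of_ne (hroot e).2]; exact (hxA e he).2
  rw [Set.indicator_of_mem hmem, ← ENNReal.ofReal_mul (mul_nonneg (by positivity)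
    (prod_nonneg fun e _ => hSz e))]
  refine ENNReal.ofReal_le_ofReal ?_
  have hX : 0 ≤ ((lam ^ sdim s)⁻¹ * T) ^ G.M := by positivity
  have h1 : |∏ e ∈ A, f e (x (w e) - x (u e))| ≤ ∏ e ∈ A, Ce * (sizeE s G N I e * ((2 : ℝ) ^ n
    (G.ends e)) ^ a e) := by
    rw [abs_prod]
    exact prod_le_prod (fun _ _ => abs_nonneg _) fun e _ =>
      hep e K I N p (by omega) (hK e) (hI e) (n (G.ends e)) _ trivial
  have hfac : ∀ e ∈ A, 0 ≤ Ce * (sizeE s G N I e * ((2 : ℝ) ^ n (G.ends e)) ^ a e) := fun e _ =>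
    mul_nonneg (by linarith) (mul_nonneg (hSz e) (by positivity))
  have hg0 : ∀ e ∈ A, 0 ≤ (2 ^ (-n (G.ends e) + 4) * M (G.src e)) ^ (-G.r e).toNat := fun e _ => by
    have := hM0 (G.src e); positivity
  have h2 : (∏ e ∈ A, Ce * (sizeE s G N I e * ((2 : ℝ) ^ n (G.ends e)) ^ a e)) * ∏ e ∈ A, (2 ^ (-n
    (G.ends e) + 4) * M (G.src e)) ^ (-G.r e).toNat ≤ (Ce * W) ^ Fintype.card (Neg G) * ∏ e ∈ A, b e
    := by
    rw [← prod_mul_distrib]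
    have h3 : ∀ e ∈ A, Ce * (sizeE s G N I e * ((2 : ℝ) ^ n (G.ends e)) ^ a e) * (2 ^ (-n (G.ends e)
      + 4) * M (G.src e)) ^ (-G.r e).toNat ≤ Ce * W * b e := fun e he => by
      have h4 : (2 ^ (-n (G.ends e) + 4) * M (G.src e)) ^ (-G.r e).toNat ≤
          W * ratio G n e ^ (-G.r e).toNat :=
        (pow_le_pow_left₀ (by have := hM0 (G.src e); positivity) (hgain e he).2 _).trans
          (hpowW e w₂ hw₂0 (by linarith))
      refine (mul_le_mul_of_nonneg_left h4 (hfac e he)).trans (le_of_eq ?_); simp only [hb]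
      rw [edgeWeight_neg]; ring
    refine (prod_le_prod (fun e he => mul_nonneg (hfac e he) (hg0 e he)) h3).trans ?_
    rw [prod_mul_distrib, prod_const]
    exact mul_le_mul_of_nonneg_right (pow_le_pow_right₀ (by nlinarith) (card_le_univ A))
      (prod_nonneg fun e _ => hb0 e)
  have hCiι : Ci ⟨A, hdisj⟩ ≤ ι := hι ▸ single_le_sum (fun A _ => hCi A) (mem_univ _)
  have hsplit : (∏ e ∈ A, b e) * ((∏ e : Neg G with e ∉ A, b e) * ∏ e : {e // 0 ≤ G.r e}, b e) =
      (∏ e, sizeE s G N I e) * weight G a (gain G) (scl n) := by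
    have h4 := prod_filter_mul_prod_filter_not univ (fun e => e ∈ A) fun e : Neg G => b e
    simp only [filter_univ_mem] at h4
    rw [← mul_assoc, h4, prod_neg_mul_prod, weight, ← prod_mul_distrib]
  rw [abs_mul]
  have hgp : 0 ≤ ∏ e ∈ A, (2 ^ (-n (G.ends e) + 4) * M (G.src e)) ^ (-G.r e).toNat :=
    prod_nonneg hg0
  have hfp := prod_nonneg hfac
  have hSp : 0 ≤ ∏ e, sizeE s G N I e := prod_nonneg fun e _ => hSz e
  calc _ ≤ (∏ e ∈ A, Ce * (sizeE s G N I e * ((2 : ℝ) ^ n (G.ends e)) ^ a e)) *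
        (Ci ⟨A, hdisj⟩ * B * ∏ e ∈ A, (2 ^ (-n (G.ends e) + 4) * M (G.src e)) ^ (-G.r e).toNat) :=
        mul_le_mul h1 (hval x trivial) (abs_nonneg _) hfp
    _ ≤ (∏ e ∈ A, Ce * (sizeE s G N I e * ((2 : ℝ) ^ n (G.ends e)) ^ a e)) * (ι * B *
          ∏ e ∈ A, (2 ^ (-n (G.ends e) + 4) * M (G.src e)) ^ (-G.r e).toNat) := by gcongr
    _ = (ι * B) * ((∏ e ∈ A, Ce * (sizeE s G N I e * ((2 : ℝ) ^ n (G.ends e)) ^ a e)) *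
          ∏ e ∈ A, (2 ^ (-n (G.ends e) + 4) * M (G.src e)) ^ (-G.r e).toNat) := by ring
    _ ≤ (ι * B) * ((Ce * W) ^ Fintype.card (Neg G) * ∏ e ∈ A, b e) := by gcongr
    _ = (Ce * W) ^ Fintype.card (Neg G) * ι * Cc * ((lam ^ sdim s)⁻¹ * T) ^ G.M *
          ((∏ e ∈ A, b e) * ((∏ e : Neg G with e ∉ A, b e) * ∏ e : {e // 0 ≤ G.r e}, b e)) := by
        rw [hB]; ring
    _ ≤ (Ce * W) ^ Fintype.card (Neg G) * ι * Cc * ((lam ^ sdim s)⁻¹ * T) ^ G.M *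
          ((∏ e, sizeE s G N I e) * (Cw * weight G a (gain G) (dist' s (G.extend x)))) := by
        rw [hsplit]; have := hwt n x hmem.1; gcongr
    _ = _ := by ring

/-! ### Convergence of derivatives -/

section Conv

variable {D : Set X}

lemma abs_slope_sub_lineD_le {f : X → ℝ} (hD : IsOpen D) (hf : SmoothOn f D) {x v : X} {B t : ℝ}
    (ht : 0 < t) (hx : ∀ u ∈ Set.Icc 0 t, x + u • v ∈ D)
    (hB : ∀ y ∈ D, |lineD v (lineD v f) y| ≤ B) :
    |(f (x + t • v) - f x) / t - lineD v f x| ≤ B * t := by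
  have hder : ∀ g : X → ℝ, SmoothOn g D → ∀ u ∈ Set.Icc 0 t, HasDerivAt (fun u : ℝ => g (x + u • v))
    (lineD v g (x + u • v)) u := fun g hg u hu => by
    have h1 := (diffAt hD hg (hx u hu)).hasFDerivAt
    have h2 : HasDerivAt (fun u : ℝ => x + u • v) v u := by
      simpa using ((hasDerivAt_id u).smul_const v).const_add x
    exact h1.comp_hasDerivAt u h2
  have hmv : ∀ g : X → ℝ, SmoothOn g D → ∀ u, 0 < u → u ≤ t → ∃ c ∈ Set.Ioo 0 u, lineD v g (x + c •
    v) = (g (x + u • v) - g x) / u := fun g hg u hu hut => by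
    obtain ⟨c, hc, h⟩ := exists_hasDerivAt_eq_slope (fun u : ℝ => g (x + u • v)) (fun u => lineD v g
      (x + u • v)) hu (fun w hw => (hder g hg w ⟨hw.1, hw.2.trans
      hut⟩).continuousAt.continuousWithinAt) fun w hw => hder g hg w ⟨hw.1.le, hw.2.le.trans hut⟩
    exact ⟨c, hc, by simpa using h⟩
  obtain ⟨c, hc, h1⟩ := hmv f hf t ht le_rfl
  obtain ⟨c', hc', h2⟩ := hmv _ (contDiffOn_lineD hD hf v) c hc.1 hc.2.le
  rw [← h1, show lineD v f (x + c • v) - lineD v f x = lineD v (lineD v f) (x + c' • v) * c by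
    rw [h2, div_mul_cancel₀ _ hc.1.ne'], abs_mul, abs_of_pos hc.1]
  have h3 := hB _ (hx c' ⟨hc'.1.le, hc'.2.le.trans hc.2.le⟩)
  exact mul_le_mul h3 hc.2.le hc.1.le ((abs_nonneg _).trans h3)

lemma tendsto_lineD {f : ℕ → X → ℝ} {g : X → ℝ} (hD : IsOpen D) (hf : ∀ m, SmoothOn (f m) D)
    (hg : SmoothOn g D) {v : X} {B : ℝ} (hB : ∀ m, ∀ y ∈ D, |lineD v (lineD v (f m)) y| ≤ B)
    (hB' : ∀ y ∈ D, |lineD v (lineD v g) y| ≤ B)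
    (hlim : ∀ y ∈ D, Tendsto (fun m => f m y) atTop (nhds (g y))) {x : X} (hx : x ∈ D) :
    Tendsto (fun m => lineD v (f m) x) atTop (nhds (lineD v g x)) := by
  have hc : ContinuousAt (fun u : ℝ => x + u • v) 0 := by fun_prop
  obtain ⟨δ, hδ, hball⟩ := Metric.eventually_nhds_iff.1
    (hc.eventually (hD.mem_nhds (by simpa using hx)))
  have hB0 : 0 ≤ B := (abs_nonneg _).trans (hB' x hx)
  refine Metric.tendsto_atTop.2 fun ε hε => ?_
  set t := min (δ / 2) (ε / (4 * (B + 1))) with ht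
  have ht0 : 0 < t := by positivity
  have hBt : B * t ≤ ε / 4 := by
    have h1 : t * (4 * (B + 1)) ≤ ε := (le_div_iff₀ (by positivity)).1 (min_le_right _ _); nlinarith
  have hseg : ∀ u ∈ Set.Icc 0 t, x + u • v ∈ D := fun u hu => by
    refine hball ?_; rw [dist_0_eq_abs, abs_of_nonneg hu.1]
    have := min_le_left (δ / 2) (ε / (4 * (B + 1))); linarith [hu.2]
  have hlt := ((hlim _ (hseg t ⟨ht0.le, le_rfl⟩)).sub (hlim x hx)).div_const t
  obtain ⟨m₀, hm₀⟩ := Metric.tendsto_atTop.1 hlt (ε / 2) (by positivity)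
  refine ⟨m₀, fun m hm => ?_⟩
  have h1 := abs_slope_sub_lineD_le hD (hf m) ht0 hseg (hB m)
  have h2 := abs_slope_sub_lineD_le hD hg ht0 hseg hB'
  have h3 := hm₀ m hm
  rw [dist_eq] at h3 ⊢
  rw [abs_le] at h1 h2
  rw [abs_lt] at h3 ⊢
  constructor <;> linarith [h1.1, h1.2, h2.1, h2.2, h3.1, h3.2]

lemma tendsto_mD {d : ℕ} {b : Fin d → X} {μ : ℝ^d} (hD : IsOpen D) (k : ℕ^d) {f : ℕ → X → ℝ} {g : X
    → ℝ} {B : ℝ} (hf : ∀ m, SmoothOn (f m) D) (hg : SmoothOn g D) (hB : ∀ m, IsSymb b μ D (∑ i, k i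
    + 1) B (f m)) (hB' : IsSymb b μ D (∑ i, k i + 1) B g) (hlim : ∀ y ∈ D, Tendsto (fun m => f m y)
    atTop (nhds (g y))) {x : X} (hx : x ∈ D) : Tendsto (fun m => mD b k (f m) x) atTop (nhds (mD b k
    g x)) := by
  induction hl : ∑ i, k i generalizing k f g B with
  | zero =>
    have : k = 0 := by funext i; exact sum_eq_zero_iff.1 hl i (mem_univ i)
    subst this; simpa only [mD_zero] using hlim x hx
  | succ l ih =>
    obtain ⟨i, k', rfl, hl'⟩ := exists_eq_add_single_of_sum hl; rw [hl, ← hl'] at hB hB'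
    have h2 : ∀ {f : X → ℝ}, IsSymb b μ D (∑ j, k' j + 1 + 1) B f → ∀ y ∈ D, |lineD (b i) (lineD (b
      i) f) y| ≤ B * μ i * μ i := fun h => ((h.2 i).2 i).bound
    rw [mD_succ b hD hg k' i hx]; simp only [fun m => mD_succ b hD (hf m) k' i hx]
    exact ih k' (fun m => contDiffOn_lineD hD (hf m) _) (contDiffOn_lineD hD hg _)
      (fun m => (hB m).2 i) (hB'.2 i)
      (fun y hy => tendsto_lineD hD hf hg (fun m => h2 (hB m)) (h2 hB') hlim hy) hl'

lemma KerBound.tendsto_multiD {d : ℕ} {s : ℕ^d} [hs : Scaling s] {a : ℝ} (ha : 0 ≤ a)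
    {p : ℕ} {N : ℝ} {K : ℝ^d → ℝ} {Km : ℕ → ℝ^d → ℝ}
    (hKm : ∀ m, KerBound s a p N (Km m)) (hK : KerBound s a p N K)
    (hlim : ∀ x, x ≠ 0 → Tendsto (fun m => Km m x) atTop (nhds (K x))) {k : ℕ^d}
    (hk : (sdeg s k + 1) * sdim s < p) {x : ℝ^d} (hx : x ≠ 0) :
    Tendsto (fun m => multiD k (Km m) x) atTop (nhds (multiD k K x)) := by
  have hx0 := snorm_pos hx
  have hΛ : 0 < 2 / snorm s x := by positivity
  have hsub : {y : ℝ^d | (2 / snorm s x)⁻¹ < snorm s y} ⊆ {0}ᶜ := lt_snorm_subset (by positivity)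
  have hle : (∑ i, k i + 1) * sdim s < p := lt_of_le_of_lt (Nat.mul_le_mul_right _
    (Nat.add_le_add_right (sum_le_sum fun i _ => Nat.le_mul_of_pos_left _ (hs.pos i)) 1)) hk
  refine tendsto_mD (isOpen_lt_snorm _) k (fun m => (hKm m).smooth.mono hsub) (hK.smooth.mono hsub)
    (fun m => (hKm m).isSymb ha hle hΛ) (hK.isSymb ha hle hΛ) (fun y hy => hlim y (hsub hy)) ?_
  rw [Set.mem_ofPred_eq, inv_div]
  linarith

end Conv

section Sum

/-! ### Summation over the scales -/

lemma tsum_lintegral_le {α ι : Type*} [MeasurableSpace α] {μ : Measure α} (f : ι → α → ℝ≥0∞) :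
    ∑' i, ∫⁻ x, f i x ∂μ ≤ ∫⁻ x, ∑' i, f i x ∂μ := by
  classical
  rw [ENNReal.tsum_eq_iSup_sum]
  refine iSup_le fun S => le_trans ?_ (lintegral_mono fun x => ENNReal.sum_le_tsum S)
  induction S using Finset.induction_on with
  | empty => simp
  | insert i S hi ih =>
    simp only [sum_insert hi]; exact (add_le_add le_rfl ih).trans (le_lintegral_add _ _)

/-- The power-counting weight of the scales `n`. -/
def mass (s : ℕ^d) (G : RGraph V E) (a : E → ℝ) (ρ : ℝ) (n : Scale V) : ℝ≥0∞ :=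
  ∫⁻ x, (scaleSet s G ρ n).indicator
    (fun x => ENNReal.ofReal (weight G a (gain G) (dist' s (G.extend x)))) x

lemma abs_sub_le_of_mem_scaleSet {ρ : ℝ} {n n' : Scale V} {x : Conf G d}
    (h : x ∈ scaleSet s G ρ n) (h' : x ∈ scaleSet s G ρ n') (c : Sym2 V) : n' c ≤ n c + 4 := by
  induction c using Sym2.ind with
  | _ v w =>
    by_cases hvw : v = w
    · subst hvw; rw [h.2.2, h'.2.2]; norm_num
    · have h1 := (h.1 v w hvw (notMem_empty _)).1; have h2 := (h'.1 v w hvw (notMem_empty _)).2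
      have := (zpow_lt_zpow_iff_right₀ (one_lt_two (α := ℝ))).1 (h1.trans h2); omega

lemma card_piFinset_Icc {ι : Type*} [Fintype ι] [DecidableEq ι] (n : ι → ℤ) :
    (Fintype.piFinset fun c => Icc (n c - 4) (n c + 4)).card = 9 ^ Fintype.card ι := by
  have h9 : ∀ m : ℤ, (Icc (m - 4) (m + 4)).card = 9 := fun m => by
    rw [Int.card_Icc, show m + 4 + 1 - (m - 4) = 9 by ring]; rfl
  simp [Fintype.card_piFinset, h9]

lemma tsum_indicator_scaleSet_le {ρ : ℝ} (w : Conf G d → ℝ≥0∞) (x : Conf G d)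
    {n₀ : Scale V} (hn₀ : x ∈ scaleSet s G ρ n₀) :
    ∑' n, (scaleSet s G ρ n).indicator w x ≤ (9 ^ Fintype.card (Sym2 V) : ℕ) * w x := by
  rw [tsum_eq_sum (s := Fintype.piFinset fun c => Icc (n₀ c - 4) (n₀ c + 4)) fun n hn =>
    Set.indicator_of_notMem (fun hxn => hn ?_) _, ← card_piFinset_Icc n₀, ← nsmul_eq_mul]
  · exact sum_le_card_nsmul _ _ _ fun n _ => Set.indicator_le_self _ _ x
  · refine Fintype.mem_piFinset.2 fun c => mem_Icc.2 ?_
    have h1 := abs_sub_le_of_mem_scaleSet hn₀ hxn c; have h2 := abs_sub_le_of_mem_scaleSet hxn hn₀ c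
    omega

lemma injective_of_mem_scaleSet {ρ : ℝ} {n : Scale V} {x : Conf G d} (hx : x ∈ scaleSet s G ρ n) : x
    ∈ {x | Function.Injective (G.extend x) ∧ ∀ w ∈ G.Vstar, snorm s (G.extend x w) ≤ ρ} := by
  refine ⟨fun v w hvw => by_contra fun hne => ?_, hx.2.1⟩
  have h1 := (hx.1 v w hne (notMem_empty _)).1
  rw [pos_apply, pos_apply, hvw, sub_self, snorm_zero] at h1
  exact h1.not_ge (by positivity)

lemma exists_tsum_mass_le (h : G.PowerCounting s a) : ∃ C : ℝ≥0, ∀ ρ, 0 < ρ → ∑' n, mass s G a ρ n ≤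
    C * ENNReal.ofReal (ρ ^ ((sdim s : ℝ) * Fintype.card 𝕍 G - ∑ e, a e)) := by
  obtain ⟨C, hC⟩ := (edgeCounting_of_powerCounting h).lintegral_weight_le
  generalize hw : (fun x : Conf G d => ENNReal.ofReal (weight G a (gain G) (dist' s (G.extend x))))
    = w at hC
  obtain ⟨c, hc⟩ : ∃ c : ℝ≥0, (c : ℝ≥0∞) = ((9 ^ Fintype.card (Sym2 V) : ℕ) : ℝ≥0∞) :=
    ⟨((9 ^ Fintype.card (Sym2 V) : ℕ) : ℝ≥0), ENNReal.coe_natCast _⟩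
  refine ⟨c * C, fun ρ hρ => ?_⟩
  have hm : ∀ n, mass s G a ρ n = ∫⁻ x, (scaleSet s G ρ n).indicator w x := fun n => by
    rw [← hw]; rfl
  simp only [hm]
  refine (tsum_lintegral_le _).trans ?_
  rw [ENNReal.coe_mul, mul_assoc]
  refine le_trans ?_ (mul_le_mul_right (hC ρ hρ) _)
  rw [← lintegral_const_mul' _ _ ENNReal.coe_ne_top]
  refine lintegral_mono fun x => ?_
  by_cases hx : ∃ n, x ∈ scaleSet s G ρ n
  · obtain ⟨n₀, hn₀⟩ := hx; rw [Set.indicator_of_mem (injective_of_mem_scaleSet hn₀), hc]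
    exact tsum_indicator_scaleSet_le w x hn₀
  · have h0 : ∀ n, (scaleSet s G ρ n).indicator w x = 0 := fun n =>
      Set.indicator_of_notMem (fun hn => hx ⟨n, hn⟩) _
    simp only [h0, tsum_zero, zero_le]

/-- The generalised convolution as a sum over scales. -/
def genConv (s : ℕ^d) (G : RGraph V E) (K : E → ℝ^d → ℝ) (I : E → ℕ^d → ℝ)
    (φ : ℝ^d → ℝ) : ℝ := ∑' n : Scale V, ∫ x, scaleFun s G K I φ n x

/-- The hypotheses on kernels and constants under which all estimates are uniform. -/
structure Data (s : ℕ^d) (G : RGraph V E) (a : E → ℝ) (p : ℕ) (N S : E → ℝ)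
    (K : E → ℝ^d → ℝ) (I : E → ℕ^d → ℝ) : Prop where
  ker : ∀ e, KerBound s (a e) p (N e) (K e)
  mom : ∀ e, MomentsCompatible s (a e) (G.r e) (K e) (I e)
  size : ∀ e, sizeE s G N I e ≤ S e
  ord : (ord G + ord G) * sdim s < p

lemma Data.nonneg {p : ℕ} {N S : E → ℝ} {K : E → ℝ^d → ℝ} {I : E → ℕ^d → ℝ}
    (h : Data s G a p N S K I) (e : E) : 0 ≤ sizeE s G N I e :=
  add_nonneg (h.ker e).nonneg (sum_nonneg fun _ _ => abs_nonneg _)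

theorem exists_summable_bound (h : G.PowerCounting s a)
    (hnc : G.NonCritical s a) {R : ℝ} (hR : 0 < R) : ∃ (C : ℝ) (β : ℝ → (Scale V) → ℝ), 0 ≤ C ∧
    (∀ lam, 0 < lam → Summable (β lam) ∧ ∑' n, β lam n ≤
      C * lam ^ ((sdim s : ℝ) * Fintype.card 𝕍 G - ∑ e, a e)) ∧
    ∀ (K : E → ℝ^d → ℝ) (I : E → ℕ^d → ℝ) (N S : E → ℝ) (p : ℕ)
      (φ : ℝ^d → ℝ) (T lam : ℝ) (n : Scale V), Data s G a p N S K I →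
      IsTest s R φ → 0 ≤ T → (∀ k, sdeg s k < p → ∀ x, |multiD k φ x| ≤ T) → 0 < lam → lam ≤ 1 →
      |∫ x, scaleFun s G K I (rescale s lam φ) n x| ≤
        ((lam ^ sdim s)⁻¹ * T) ^ G.M * (∏ e, S e) * β lam n := by
  obtain ⟨C₁, hC₁, h₁⟩ := exists_abs_integral_scaleFun_le h hnc hR
  obtain ⟨C₂, h₂⟩ := exists_tsum_mass_le h
  set q := (sdim s : ℝ) * Fintype.card 𝕍 G - ∑ e, a e with hq
  have hfin : ∀ lam, 0 < lam → ∑' n, mass s G a (2 * (R * lam)) n ≠ ⊤ := fun lam hlam =>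
    ne_top_of_le_ne_top (ENNReal.mul_ne_top ENNReal.coe_ne_top ENNReal.ofReal_ne_top)
      (h₂ _ (by positivity))
  refine ⟨C₁ * (C₂ * (2 * R) ^ q), fun lam n => C₁ * (mass s G a (2 * (R * lam)) n).toReal,
    by positivity, fun lam hlam => ⟨(ENNReal.summable_toReal (hfin lam hlam)).mul_left _, ?_⟩, ?_⟩
  · rw [tsum_mul_left, ← ENNReal.tsum_toReal_eq fun n => ENNReal.ne_top_of_tsum_ne_top
      (hfin lam hlam) n, mul_assoc]
    refine mul_le_mul_of_nonneg_left ?_ hC₁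
    refine (ENNReal.toReal_mono (ENNReal.mul_ne_top ENNReal.coe_ne_top ENNReal.ofReal_ne_top)
      (h₂ _ (by positivity))).trans (le_of_eq ?_)
    rw [ENNReal.toReal_mul, ENNReal.coe_toReal, ENNReal.toReal_ofReal (by positivity), mul_assoc,
      ← mul_rpow (by positivity) hlam.le, mul_assoc]
  · intro K I N S p φ T lam n hdat hφ hT hφT hlam hlam1
    have h3 := h₁ K I N p φ T lam n hdat.ker hdat.mom hdat.ord hφ hT hφT hlam hlam1
    have hSp := prod_nonneg fun e (_ : e ∈ univ) => hdat.nonneg e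
    have hm : mass s G a (2 * (R * lam)) n ≠ ⊤ := ENNReal.ne_top_of_tsum_ne_top (hfin lam hlam) n
    have h4 := ENNReal.toReal_mono (ENNReal.mul_ne_top ENNReal.ofReal_ne_top hm) h3
    rw [ENNReal.toReal_ofReal (abs_nonneg _), ENNReal.toReal_mul,
      ENNReal.toReal_ofReal (by positivity)] at h4
    refine h4.trans ?_
    have h5 : ∏ e, sizeE s G N I e ≤ ∏ e, S e :=
      prod_le_prod (fun e _ => hdat.nonneg e) fun e _ => hdat.size e
    have h6 : 0 ≤ ((lam ^ sdim s)⁻¹ * T) ^ G.M := by positivity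
    calc _ ≤ C₁ * ((lam ^ sdim s)⁻¹ * T) ^ G.M * (∏ e, S e) *
          (mass s G a (2 * (R * lam)) n).toReal := by gcongr
      _ = _ := by ring

lemma ae_injective {s : ℕ^d} [hs : Scaling s] : ∀ᵐ x : Conf G d, Function.Injective (G.extend x) := by
  obtain ⟨i⟩ : Nonempty (Fin d) := by
    by_contra hd'; rw [not_nonempty_iff] at hd'; simpa [sdim] using hs.dim
  have hne : ∀ v w, v ≠ w → v ≠ G.root → ∀ᵐ x : Conf G d, pos G v x - pos G w x ≠ 0 := by
    intro v w hvw hv; let L : Conf G d →L[ℝ] ℝ^d := pos G v - pos G w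
    have h1 : L.toLinearMap.ker ≠ ⊤ := by
      intro h; have h2 : dir G (⟨v, hv⟩, i) ∈ L.toLinearMap.ker := h ▸ trivial
      rw [LinearMap.mem_ker, ContinuousLinearMap.coe_coe, sub_apply, pos_dir, pos_dir, if_pos rfl,
        if_neg (by exact hvw), sub_zero] at h2
      have := congrFun h2 i; simp at this
    have h3 := Measure.addHaar_submodule (volume : Measure (Conf G d)) _ h1; rw [ae_iff]
    convert h3 using 2; ext x; simp [L, sub_eq_zero]
  have : ∀ᵐ x : Conf G d, ∀ v w, v ≠ w → v ≠ G.root → pos G v x - pos G w x ≠ 0 := by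
    simp only [eventually_all]; exact hne
  filter_upwards [this] with x hx v w hvw
  by_contra h
  rw [← pos_apply, ← pos_apply] at hvw
  by_cases hv : v = G.root
  · exact hx w v (Ne.symm h) (fun hw => h (hv.trans hw.symm)) (sub_eq_zero.2 hvw.symm)
  · exact hx v w h hv (sub_eq_zero.2 hvw)

lemma core_empty (K : E → ℝ^d → ℝ) (I : E → ℕ^d → ℝ) (φ : ℝ^d → ℝ)
    (n : Scale V) : core s G K I φ n ∅ = scaleFun s G K I φ n := by
  funext x
  simp [core, scaleFun, prod_pairFac]

variable {p : ℕ} {N S : E → ℝ} {K : E → ℝ^d → ℝ} {I : E → ℕ^d → ℝ} {Km : ℕ → E → ℝ^d → ℝ}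
  {Im : ℕ → E → ℕ^d → ℝ}

/-- Convergence of kernels and constants, with uniform bounds. -/
structure DataTendsto (s : ℕ^d) (G : RGraph V E) (a : E → ℝ) (p : ℕ) (N S : E → ℝ)
    (Km : ℕ → E → ℝ^d → ℝ) (Im : ℕ → E → ℕ^d → ℝ) (K : E → ℝ^d → ℝ) (I : E → ℕ^d → ℝ) : Prop where
  approx : ∀ m, Data s G a p N S (Km m) (Im m)
  limit : Data s G a p N S K I
  ker : ∀ e x, x ≠ 0 → Tendsto (fun m => Km m e x) atTop (nhds (K e x))
  const : ∀ e, ∀ k ∈ lowIdx s (-G.r e).toNat, Tendsto (fun m => Im m e k) atTop (nhds (I e k))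

lemma tendsto_scaleFun (h : G.PowerCounting s a) (hc : DataTendsto s G a p N S Km Im K I) (φ : ℝ^d →
    ℝ) (n : Scale V) {x : Conf G d} (hx : Function.Injective (G.extend x)) : Tendsto (fun m =>
    scaleFun s G (Km m) (Im m) φ n x) atTop (nhds (scaleFun s G K I φ n x)) := by
  have hp : 0 < p := by have := hc.limit.ord; omega
  refine Tendsto.mul (tendsto_finsetProd _ fun c _ => Tendsto.mul (tendsto_finsetProd _ fun e _ =>
    tendsto_pieceK (h.a_nonneg e) hp (fun m => (hc.approx m).ker e) (hc.ker e) (hc.const e) _ _)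
    tendsto_const_nhds) (Tendsto.mul (tendsto_finsetProd _ fun e _ => ?_) tendsto_const_nhds)
  have hne : ∀ v w, v ≠ w → pos G v x - pos G w x ≠ 0 := fun v w hvw h0 => by
    rw [pos_apply, pos_apply] at h0; exact hvw (hx (sub_eq_zero.1 h0))
  refine (hc.ker e _ (hne _ _ (G.no_loop e).symm)).sub (tendsto_finsetSum _ fun j hj => ?_)
  rw [mem_lowIdx hs.pos] at hj
  have hsrc : G.src e ≠ G.root := fun h' => by rw [h.r_root e (Or.inl h')] at hj; simp at hj
  have h1 := hne _ _ hsrc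
  rw [pos_root, sub_zero] at h1
  refine Tendsto.const_mul _ (KerBound.tendsto_multiD (h.a_nonneg e) (fun m => (hc.approx m).ker e)
    (hc.limit.ker e) (hc.ker e) (lt_of_le_of_lt (Nat.mul_le_mul_right _ ?_) hc.limit.ord) (neg_ne_zero.2 h1))
  have := natAbs_le_ord G e; omega

lemma exists_bound_scaleFun (h : G.PowerCounting s a)
    (hnc : G.NonCritical s a) {R T lam : ℝ} (hR : 0 < R) {φ : ℝ^d → ℝ} (hφ : IsTest s R φ)
    (hT : 0 ≤ T) (hφT : ∀ k, sdeg s k < p → ∀ x, |multiD k φ x| ≤ T) (hlam : 0 < lam)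
    (hlam1 : lam ≤ 1) (n : Scale V) : ∃ b : Conf G d → ℝ, Integrable b ∧
    ∀ {K I}, Data s G a p N S K I → Continuous (scaleFun s G K I (rescale s lam φ) n) ∧
      ∀ x, ‖scaleFun s G K I (rescale s lam φ) n x‖ ≤ b x := by
  by_cases hA : Adm G (2 * (max R 4 + Fintype.card V * 4)) (R * lam) n
  swap
  · have hz : ∀ {K I}, Data s G a p N S K I → scaleFun s G K I (rescale s lam φ) n = 0 := fun hdat
      => funext fun x => by_contra fun hx => hA (adm_of_ne_zero h (fun e => (hdat.ker e).support) hR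
      hφ.support hlam hlam1 hx).1
    exact ⟨0, integrable_zero _ _ _, fun hdat => by
      rw [hz hdat]; exact ⟨continuous_zero, fun x => by simp⟩⟩
  have hew : ∀ e : Neg G, 0 < ew G a n e := fun e => by
    rw [edgeWeight_neg]
    have : 0 < ratio G n e := div_pos (scl_pos n _ _) (lt_max_of_lt_left (scl_pos n _ _))
    positivity
  have hq : ∀ e : Neg G, 0 ≤ ((2 : ℝ) ^ n (G.ends e)) ^ a e / ew G a n e :=
    fun e => div_nonneg (by positivity) (hew e).le
  obtain ⟨C, hC, hcore⟩ := exists_isSymb_core h hnc 0 (W := 1 + ∑ e : Neg G, ((2 : ℝ) ^ n (G.ends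
    e)) ^ a e / ew G a n e) (le_add_of_nonneg_right (sum_nonneg fun e _ => hq e))
  have hs4 : ∀ c, (4 : ℝ) * 2 ^ n c ≤ ∑ c, 4 * 2 ^ n c := fun c =>
    single_le_sum (f := fun c => (4 : ℝ) * 2 ^ n c) (fun _ _ => by positivity) (mem_univ c)
  have hb := fun {K I} (hdat : Data s G a p N S K I) => hcore K I N p φ R T lam _ _ n ∅
    (fun _ => lam⁻¹ + ∑ c, 4 * 2 ^ n c) hdat.ker hdat.mom (lt_of_le_of_lt
      (Nat.mul_le_mul_right _ (by omega)) hdat.ord) hφ hT hφT hlam hA (fun _ => by positivity)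
    (fun v w _ _ => (hs4 _).trans (le_add_of_nonneg_left (by positivity)))
    (fun i => le_add_of_nonneg_right (by positivity)) fun e _ => by
      have h1 := single_le_sum (f := fun e : Neg G => ((2 : ℝ) ^ n (G.ends e)) ^ a e /
        ew G a n e) (fun e _ => hq e) (mem_univ e)
      rw [div_le_iff₀ (hew e)] at h1; have := hew e; nlinarith
  simp only [core_empty] at hb
  set B := C * ((lam ^ sdim s)⁻¹ * T) ^ G.M * ((∏ e : Neg G, S e * ew G a n e) *
      ∏ e : {e // 0 ≤ G.r e}, S e * ew G a n e) with hB
  let Z : Set (Conf G d) := Set.univ.pi fun v : 𝕍 G => {x | snorm s x ≤ 2 ^ (-n s(v.1, G.root) + 3)}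
  have hZ : IsCompact Z := isCompact_univ_pi fun v => isCompact_snorm_le _
  have hbd : ∀ {K I}, Data s G a p N S K I → ∀ x, ‖scaleFun s G K I (rescale s lam φ) n x‖ ≤
    Z.indicator (fun _ => B) x := fun {K I} hdat x => by
    by_cases hx : scaleFun s G K I (rescale s lam φ) n x = 0
    · rw [hx, norm_zero]; refine Set.indicator_nonneg (fun _ _ => ?_) x
      have : ∀ e, 0 ≤ S e * ew G a n e := fun e =>
        mul_nonneg ((hdat.nonneg e).trans (hdat.size e)) (edgeWeight_nonneg _ _ _)
      exact mul_nonneg (by positivity) (mul_nonneg (prod_nonneg fun e _ => this e)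
        (prod_nonneg fun e _ => this e))
    · have h1 := (adm_of_ne_zero h (fun e => (hdat.ker e).support) hR hφ.support hlam hlam1 hx).2.1
      have hxZ : x ∈ Z := fun v _ => by
        have := (h1 v.1 G.root v.2 (notMem_empty _)).2
        rwa [pos_root, sub_zero, pos_of_ne v.2] at this
      rw [Set.indicator_of_mem hxZ]; refine ((hb hdat).2.bound x trivial).trans ?_
      have h2 : ∀ e, sizeE s G N I e * ew G a n e ≤ S e * ew G a n e := fun e =>
        mul_le_mul_of_nonneg_right (hdat.size e) (edgeWeight_nonneg _ _ _)
      have h3 : ∀ e, 0 ≤ sizeE s G N I e * ew G a n e := fun e =>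
        mul_nonneg (hdat.nonneg e) (edgeWeight_nonneg _ _ _)
      simp only [notMem_empty, not_false_eq_true, filter_true]
      refine mul_le_mul_of_nonneg_left (mul_le_mul (prod_le_prod (fun e _ => h3 e)
        fun e _ => h2 e) (prod_le_prod (fun e _ => h3 e) fun e _ => h2 e)
        (prod_nonneg fun e _ => h3 e)
        (prod_nonneg fun e _ => (h3 e).trans (h2 e))) (by positivity)
  exact ⟨Z.indicator fun _ => B, (integrable_indicator_iff hZ.measurableSet).2
    (integrableOn_const hZ.measure_lt_top.ne), fun hdat => ⟨(hb hdat).1.continuous, hbd hdat⟩⟩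

lemma tendsto_integral_scaleFun (h : G.PowerCounting s a)
    (hnc : G.NonCritical s a) (hc : DataTendsto s G a p N S Km Im K I)
    {R T lam : ℝ} (hR : 0 < R) {φ : ℝ^d → ℝ} (hφ : IsTest s R φ) (hT : 0 ≤ T)
    (hφT : ∀ k, sdeg s k < p → ∀ x, |multiD k φ x| ≤ T) (hlam : 0 < lam) (hlam1 : lam ≤ 1)
    (n : Scale V) :
    Tendsto (fun m => ∫ x, scaleFun s G (Km m) (Im m) (rescale s lam φ) n x) atTop
      (nhds (∫ x, scaleFun s G K I (rescale s lam φ) n x)) := by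
  obtain ⟨b, hb, hbd⟩ := exists_bound_scaleFun (N := N) (S := S) h hnc hR hφ hT hφT hlam hlam1 n
  refine tendsto_integral_of_dominated_convergence b (fun m => (hbd (hc.approx
    m)).1.aestronglyMeasurable) hb (fun m => Eventually.of_forall (hbd (hc.approx m)).2) ?_
  filter_upwards [ae_injective] with x hx
  exact tendsto_scaleFun h hc _ n hx

theorem tendsto_genConv (h : G.PowerCounting s a) (hnc : G.NonCritical s a) (hc : DataTendsto s G a
    p N S Km Im K I) {R T lam : ℝ} (hR : 0 < R) {φ : ℝ^d → ℝ} (hφ : IsTest s R φ) (hT : 0 ≤ T) (hφT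
    : ∀ k, sdeg s k < p → ∀ x, |multiD k φ x| ≤ T) (hlam : 0 < lam) (hlam1 : lam ≤ 1) : Tendsto (fun
    m => genConv s G (Km m) (Im m) (rescale s lam φ)) atTop (nhds (genConv s G K I (rescale s lam
    φ))) := by
  obtain ⟨C, β, -, hβ, hbd⟩ := exists_summable_bound h hnc hR
  exact tendsto_tsum_of_dominated_convergence ((hβ lam hlam).1.mul_left _)
    (tendsto_integral_scaleFun h hnc hc hR hφ hT hφT hlam hlam1)
    (Eventually.of_forall fun m n => hbd _ _ N S p φ T lam n (hc.approx m) hφ hT hφT hlam hlam1)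

end Sum

section Approx

variable {p : ℕ} {N S : E → ℝ} {K : E → ℝ^d → ℝ} {I : E → ℕ^d → ℝ}

/-! ### The integral for smooth kernels -/

lemma edgeWeight_zero_gain (q : V → V → ℝ) (e : E) : edgeWeight G a 0 q e = q (G.src e) (G.tgt e) ^
    (-a e) * if 0 < G.r e then (q G.root (G.tgt e) / max (q G.root (G.src e)) (q G.root (G.tgt e)))
    ^ (G.r e : ℝ) * (max (q G.root (G.src e)) (q G.root (G.tgt e)) / q G.root (G.src e)) ^ (a e +
    G.r e - 1) else 1 := by
  simp [edgeWeight]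

lemma integrable_weight (h : G.PowerCounting s a) {Λ : ℝ} (hΛ : 0 < Λ) :
    Integrable ({x : Conf G d | ∀ w, snorm s (G.extend x w) ≤ Λ}.indicator fun x =>
      weight G (fun e => if G.r e < 0 then 0 else a e) 0 (dist' s (G.extend x))) := by
  obtain ⟨C, hC⟩ := (edgeCounting_bounded h).lintegral_weight_le
  have hsn := fun v => continuous_snorm.measurable.comp (measurable_extend (G := G) (d := d) v)
  have hdm : ∀ v w, Measurable fun x : Conf G d => dist' s (G.extend x) v w := fun v w =>
    continuous_snorm.measurable.comp ((measurable_extend v).sub (measurable_extend w))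
  have hm : Measurable fun x : Conf G d =>
      weight G (fun e => if G.r e < 0 then 0 else a e) 0 (dist' s (G.extend x)) := by
    unfold weight; refine measurable_fun_prod _ fun e _ => ?_; simp only [edgeWeight_zero_gain]
    refine ((hdm _ _).pow_const _).mul ?_
    by_cases hr : 0 < G.r e
    · simp only [if_pos hr]
      exact (((hdm _ _).div ((hdm _ _).max (hdm _ _))).pow_const _).mul
        ((((hdm _ _).max (hdm _ _)).div (hdm _ _)).pow_const _)
    · simp only [if_neg hr]; exact measurable_const
  have hZ : MeasurableSet {x : Conf G d | ∀ w, snorm s (G.extend x w) ≤ Λ} := by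
    rw [Set.ofPred_forall]
    exact MeasurableSet.iInter fun w => measurableSet_le (hsn w) measurable_const
  refine ⟨(hm.indicator hZ).aestronglyMeasurable, ?_⟩
  refine lt_of_le_of_lt ?_ ((hC Λ hΛ).trans_lt (ENNReal.mul_lt_top ENNReal.coe_lt_top
    ENNReal.ofReal_lt_top))
  refine lintegral_mono_ae ?_
  filter_upwards [ae_injective] with x hx
  by_cases hxZ : x ∈ {x : Conf G d | ∀ w, snorm s (G.extend x w) ≤ Λ}
  · have hxZ' : x ∈ {x : Conf G d | Function.Injective (G.extend x) ∧ ∀ w ∈ univ,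
      snorm s (G.extend x w) ≤ Λ} := ⟨hx, fun w _ => hxZ w⟩
    rw [Set.indicator_of_mem hxZ, Set.indicator_of_mem hxZ', enorm_eq_ofReal]
    exact prod_nonneg fun e _ => edgeWeight_nonneg_of_nonneg (fun v w => snorm_nonneg _) _ e
  · rw [Set.indicator_of_notMem hxZ, enorm_zero]; exact zero_le

lemma exists_mem_scaleDom {x : Conf G d} (hx : Function.Injective (G.extend x)) : ∃ n, x ∈ scaleDom
    s G n ∅ ∧ ∀ u v w, u ≠ v → v ≠ w → u ≠ w → scl n u w ≤ 8 * (scl n u v + scl n v w) := by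
  have : ∀ c : Sym2 V, ∃ k : ℤ, ∀ v w, v ≠ w → s(v, w) = c → (2 : ℝ) ^ (-k) ≤ snorm s (pos G v x -
    pos G w x) ∧ snorm s (pos G v x - pos G w x) < 2 ^ (-k + 1) := by
    refine Sym2.ind fun v w => ?_
    by_cases hvw : v = w
    · exact ⟨0, fun v' w' h1 h2 => absurd ((Sym2.mk_isDiag_iff (x := v') (y := w')).1
        (h2 ▸ Sym2.mk_isDiag_iff.2 hvw)) h1⟩
    have hpos : 0 < snorm s (pos G v x - pos G w x) := snorm_pos (sub_ne_zero.2 (by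
      rw [pos_apply, pos_apply]; exact fun h' => hvw (hx h')))
    obtain ⟨k, hk⟩ := exists_mem_Ico_zpow hpos (one_lt_two (α := ℝ))
    refine ⟨-k, fun v' w' _ h2 => ?_⟩; rw [neg_neg]
    rcases Sym2.eq_iff.1 h2 with ⟨rfl, rfl⟩ | ⟨rfl, rfl⟩
    · exact hk
    · rw [snorm_sub_comm]; exact hk
  choose n hn using this
  have hn' := fun v w hvw => hn s(v, w) v w hvw rfl
  refine ⟨n, fun v w hvw _ => ⟨(two_zpow_lt (by omega)).trans_le (hn' v w hvw).1,
    (hn' v w hvw).2.trans (two_zpow_lt (by omega))⟩,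
    fun u v w huv hvw huw => ?_⟩
  have h1 := snorm_tri (pos G u x) (pos G v x) (pos G w x)
  have h2 := hn' u v huv
  have h3 := hn' v w hvw
  have h4 := hn' u w huw
  rw [two_zpow_add, zpow_one] at h2 h3
  unfold scl
  have : (0 : ℝ) < 2 ^ (-n s(u, v)) := by positivity
  have : (0 : ℝ) < 2 ^ (-n s(v, w)) := by positivity
  linarith

lemma exists_abs_restFac_le (h : G.PowerCounting s a)
    (hdat : Data s G a p N S K I) {φ : ℝ^d → ℝ} {B : ℝ} (hB : ∀ x, |φ x| ≤ B) :
    ∃ C : ℝ, 0 ≤ C ∧ ∀ x : Conf G d, Function.Injective (G.extend x) →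
      |restFac s G K φ x| ≤
        C * weight G (fun e => if G.r e < 0 then 0 else a e) 0 (dist' s (G.extend x)) := by
  have hB0 : 0 ≤ B := (abs_nonneg _).trans (hB 0)
  set a₀ : E → ℝ := fun e => if G.r e < 0 then 0 else a e with ha₀
  have ha0 : ∀ e, 0 ≤ a₀ e := fun e => by
    simp only [ha₀]; split_ifs
    · exact le_rfl
    · exact h.a_nonneg e
  obtain ⟨C₁, hC₁, hw⟩ := exists_weight_scl_le (s := s) (κ := 0) ha0 (fun _ => le_rfl) h.r_root
  choose C hC hCK using fun e : {e // 0 ≤ G.r e} => exists_isSymb_hatK (κ := 0) (d := d)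
    (ha0 e) e.2 (fun h' => (root_ne_ends (h.r_root e) h'.ne').imp Ne.symm Ne.symm) 0
  have hCN : 0 ≤ ∏ e : {e // 0 ≤ G.r e}, C e * N e := prod_nonneg fun e _ =>
    mul_nonneg (hC e) (hdat.ker e).nonneg
  refine ⟨(∏ e : {e // 0 ≤ G.r e}, C e * N e) * C₁ * B ^ G.M, by positivity, fun x hx => ?_⟩
  obtain ⟨n, hn, htri⟩ := exists_mem_scaleDom hx
  have hs4 : ∀ c, (4 : ℝ) * 2 ^ n c ≤ ∑ c, 4 * 2 ^ n c := fun c =>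
    single_le_sum (f := fun c => (4 : ℝ) * 2 ^ n c) (fun _ _ => by positivity) (mem_univ c)
  have h1 : ∀ e : {e // 0 ≤ G.r e}, |RGraph.hatK s (G.r e) (K e) (pos G (G.src e) x) (pos G (G.tgt
    e) x)| ≤ C e * N e * edgeWeight G a₀ 0 (scl n) e := fun e => by
    refine (hCK e (K e) (N e) p n ∅ (fun _ => ∑ c, 4 * 2 ^ n c) ?_ ?_ (fun _ => by positivity)
      (fun v w _ _ => hs4 _) (fun _ => notMem_empty _) (notMem_empty _)
      htri).2.bound x hn
    · simp only [ha₀, if_neg (not_lt.2 e.2)]; exact hdat.ker e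
    · refine lt_of_le_of_lt (Nat.mul_le_mul_right _ ?_) hdat.ord; have := natAbs_le_ord G e; omega
  have h2 : ∏ e : {e // 0 ≤ G.r e}, edgeWeight G a₀ 0 (scl n) e = weight G a₀ 0 (scl n) := by
    rw [weight, ← prod_neg_mul_prod (G := G), prod_eq_one (s := (univ : Finset (Neg G))), one_mul]
    intro e _; rw [edgeWeight_zero_gain, if_neg (not_lt.2 e.2.le)]; simp [ha₀, e.2]
  unfold restFac
  rw [abs_mul, abs_prod, abs_prod]
  have h3 := prod_le_prod (s := univ) (fun _ _ => abs_nonneg _) fun e _ => h1 e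
  rw [prod_mul_distrib, h2] at h3
  have h4 := prod_le_prod (s := univ) (fun _ _ => abs_nonneg _)
    fun i _ => hB (pos G (G.tgt (G.star i)) x)
  rw [prod_const, card_univ, Fintype.card_fin] at h4
  calc _ ≤ (∏ e : {e // 0 ≤ G.r e}, C e * N e) * (C₁ * weight G a₀ 0 (dist' s (G.extend x))) *
        B ^ G.M := mul_le_mul (h3.trans (mul_le_mul_of_nonneg_left (hw n x hn) hCN)) h4
          (prod_nonneg fun _ _ => abs_nonneg _) (((prod_nonneg fun _ _ =>
            abs_nonneg _).trans h3).trans (mul_le_mul_of_nonneg_left (hw n x hn) hCN))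
    _ = _ := by ring

open scoped Classical in
/-- The sum of the partition factors of the pair `c` over the scales `-m, …, m`. -/
def freeSum (s : ℕ^d) (G : RGraph V E) (c : Sym2 V) (m : ℕ) (x : Conf G d) : ℝ :=
  if ∃ e : Neg G, G.ends e = c then 1 else ∑ n ∈ Icc (-(m : ℤ)) m, freeFac s G c n x

lemma freeSum_eq (c : Sym2 V) (m : ℕ) (x : Conf G d) : freeSum s G c m x = 1 ∨ ¬c.IsDiag ∧ freeSum s
    G c m x = chiN s (-m - 1) (pos G (Quot.out c).1 x - pos G (Quot.out c).2 x) - chiN s m (pos G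
    (Quot.out c).1 x - pos G (Quot.out c).2 x) := by
  unfold freeSum
  by_cases h : ∃ e : Neg G, G.ends e = c
  · exact Or.inl (if_pos h)
  rw [if_neg h]
  unfold freeFac
  simp only [if_neg h]
  by_cases hc : c.IsDiag
  · left
    simp [hc]
  · right
    refine ⟨hc, ?_⟩; simp only [if_neg hc, ann]
    have := sum_Icc_sub (fun n => -chiN s n (pos G (Quot.out c).1 x - pos G (Quot.out c).2 x)) m
    rw [neg_sub_neg] at this; rw [← this]; exact sum_congr rfl fun n _ => by ring

lemma sum_scaleFun (φ : ℝ^d → ℝ) (m : ℕ) (x : Conf G d) :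
    ∑ n ∈ Fintype.piFinset fun _ => Icc (-(m : ℤ)) m, scaleFun s G K I φ n x =
      (∏ e : Neg G, regK s (-G.r e).toNat (K e) (I e) m (pos G (G.tgt e) x - pos G (G.src e) x)) *
        (∏ c, freeSum s G c m x) * restFac s G K φ x := by
  unfold scaleFun
  rw [← sum_mul, ← prod_univ_sum (fun _ => Icc (-(m : ℤ)) m) fun c j => pairFac s G K I c j x, ←
    prod_fiberwise univ fun e : Neg G => G.ends e.1, ← prod_mul_distrib]
  congr 1
  refine prod_congr rfl fun c _ => ?_
  unfold pairFac freeSum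
  by_cases h : ∃ e : Neg G, G.ends e = c
  · obtain ⟨e, rfl⟩ := h
    have hf : univ.filter (fun e' : Neg G => G.ends e'.1 = G.ends e.1) = {e} := by
      ext e'; simp only [mem_filter, mem_univ, true_and, mem_singleton]
      exact ⟨fun h' => Subtype.ext (eq_of_neg_of_ends_eq e'.2 h'), fun h' => h' ▸ rfl⟩
    have he : ∃ e' : Neg G, G.ends e' = G.ends e := ⟨e, rfl⟩
    simp only [hf, prod_singleton, if_pos he, mul_one, freeFac, epiece]; exact sum_pieceK m _
  · have hf : univ.filter (fun e' : Neg G => G.ends e'.1 = c) = ∅ :=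
      filter_eq_empty_iff.2 fun e' _ h' => h ⟨e', h'⟩
    simp only [hf, prod_empty, one_mul, if_neg h]

lemma abs_freeSum_le (c : Sym2 V) (m : ℕ) (x : Conf G d) :
    |freeSum s G c m x| ≤ 1 := by
  rcases freeSum_eq (s := s) c m x with h | ⟨-, h⟩
  · simp [h]
  · have h1 := chiN_mem (-m - 1) (pos G (Quot.out c).1 x - pos G (Quot.out c).2 x)
    have h2 := chiN_mem m (pos G (Quot.out c).1 x - pos G (Quot.out c).2 x); rw [h, abs_le]
    constructor <;> linarith [h1.1, h1.2, h2.1, h2.2]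

lemma tendsto_freeSum (c : Sym2 V) {x : Conf G d} (hx : Function.Injective (G.extend x)) :
    Tendsto (fun m => freeSum s G c m x) atTop (nhds 1) := by
  set z := pos G (Quot.out c).1 x - pos G (Quot.out c).2 x with hz
  by_cases hc : c.IsDiag
  · exact tendsto_const_nhds.congr fun m => ((freeSum_eq c m x).resolve_right fun h => h.1 hc).symm
  have hz0 : 0 < snorm s z := snorm_pos (sub_ne_zero.2 fun h => hc (by
    rw [pos_apply, pos_apply] at h; rw [← Quot.out_eq c]; exact Sym2.mk_isDiag_iff.2 (hx h)))
  obtain ⟨m₁, hm₁⟩ := pow_unbounded_of_one_lt (snorm s z) (one_lt_two (α := ℝ))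
  obtain ⟨m₂, hm₂⟩ := exists_pow_lt_of_lt_one (show 0 < snorm s z / 2 by positivity)
    (show (1 / 2 : ℝ) < 1 by norm_num)
  refine tendsto_const_nhds.congr' ?_
  filter_upwards [eventually_ge_atTop (max m₁ m₂)] with m hm
  rcases freeSum_eq (s := s) c m x with h | ⟨-, h⟩
  · exact h.symm
  · rw [h, ← hz, chiN_eq_one, chiN_eq_zero, sub_zero]
    · rw [two_zpow_add, zpow_one, zpow_neg, zpow_natCast, ← inv_pow]
      have : ((2 : ℝ)⁻¹) ^ m ≤ (1 / 2) ^ m₂ := by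
        rw [one_div]
        exact pow_le_pow_of_le_one (by norm_num) (by norm_num) ((le_max_right _ _).trans hm)
      linarith
    · refine hm₁.le.trans ?_; rw [← zpow_natCast]; refine two_zpow_le ?_
      have := (le_max_left m₁ m₂).trans hm; omega

lemma integrand_eq (φ : ℝ^d → ℝ) (x : Conf G d) : G.integrand s φ K x =
    (∏ e : Neg G, K e (pos G (G.tgt e) x - pos G (G.src e) x)) * 1 * restFac s G K φ x := by
  unfold RGraph.integrand restFac
  rw [← prod_neg_mul_prod (G := G), mul_one, mul_assoc]
  refine congrArg₂ _ (prod_congr rfl fun e _ => ?_) ?_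
  · have h0 : (G.r e).toNat = 0 := by have := e.2; omega
    simp [RGraph.hatK, h0, lowIdx, pos_apply]
  · simp only [pos_apply]

theorem integral_integrand (h : G.PowerCounting s a) (hnc : G.NonCritical s a) (hdat : Data s G a p
    N S K I) (hsm : ∀ e, G.r e < 0 → Smooth (K e)) (hmom : ∀ e, G.r e < 0 → ∀ k ∈ lowIdx s (-G.r
    e).toNat, I e k = ∫ x, monom k x * K e x) {R T lam : ℝ} (hR : 0 < R) {φ : ℝ^d → ℝ} (hφ : IsTest
    s R φ) (hT : 0 ≤ T) (hφT : ∀ k, sdeg s k < p → ∀ x, |multiD k φ x| ≤ T) (hlam : 0 < lam) (hlam1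
    : lam ≤ 1) : Integrable (G.integrand s (rescale s lam φ) K) ∧ ∫ x, G.integrand s (rescale s lam
    φ) K x = genConv s G K I (rescale s lam φ) := by
  have hp0 : 0 < p := by have := hdat.ord; omega
  have hφB : ∀ x, |rescale s lam φ x| ≤ (lam ^ sdim s)⁻¹ * T := fun x => by
    have := (isSymb_rescale hφ.smooth hlam (m := 0) (s := s) (T := T)
      fun k hk x => hφT k (by omega) x).2.bound x trivial
    exact this
  obtain ⟨C₁, hC₁, hrest⟩ := exists_abs_restFac_le h hdat hφB
  choose C₂ hC₂ using fun e : Neg G => exists_abs_regK_le (I := I e) (hsm e e.2)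
    (hdat.ker e).support (hmom e e.2)
  set D := 2 * (max R 4 + Fintype.card V * 4) with hD
  have hD0 : 0 < D := by have : 0 < max R 4 := lt_max_of_lt_left hR; positivity
  set b : Conf G d → ℝ := fun x => (∏ e, C₂ e) * C₁ *
    {x : Conf G d | ∀ w, snorm s (G.extend x w) ≤ 8 * D}.indicator (fun x =>
      weight G (fun e => if G.r e < 0 then 0 else a e) 0 (dist' s (G.extend x))) x with hb
  have hbi : Integrable b := (integrable_weight h (by positivity)).const_mul _
  set F : ℕ → Conf G d → ℝ := fun m x => ∑ n ∈ Fintype.piFinset fun _ => Icc (-(m : ℤ)) m,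
    scaleFun s G K I (rescale s lam φ) n x with hF
  have hscale := fun n => exists_bound_scaleFun (N := N) (S := S) h hnc hR hφ hT hφT hlam hlam1 n
  have hC₂0 : ∀ e, 0 ≤ C₂ e := fun e => (abs_nonneg _).trans (hC₂ e 0 0)
  have hFb : ∀ x, Function.Injective (G.extend x) → ∀ m, ‖F m x‖ ≤ b x := fun x hx m => by
    have hr := hrest x hx
    by_cases h0 : F m x = 0
    · rw [h0, norm_zero]; refine mul_nonneg (mul_nonneg (prod_nonneg fun e _ => hC₂0 e) hC₁) ?_
      exact Set.indicator_nonneg (fun x _ => prod_nonneg fun e _ =>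
        edgeWeight_nonneg_of_nonneg (fun v w => snorm_nonneg _) _ e) x
    · obtain ⟨n, -, hn⟩ := exists_ne_zero_of_sum_ne_zero h0
      obtain ⟨hadm, hsh, -⟩ := adm_of_ne_zero h (fun e => (hdat.ker e).support) hR hφ.support
        hlam hlam1 hn
      have hxZ : x ∈ {x : Conf G d | ∀ w, snorm s (G.extend x w) ≤ 8 * D} := fun w => by
        by_cases hw : w = G.root
        · rw [← pos_apply, hw, pos_root, snorm_zero]; positivity
        · have h1 := (hsh w G.root hw (notMem_empty _)).2; have h2 := hadm.le w G.root hw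
          unfold scl at h2; rw [pos_root, sub_zero, pos_apply, two_zpow_add] at h1
          rw [← hD] at h2; norm_num at h1 h2; linarith
      simp only [hb, Set.indicator_of_mem hxZ]; simp only [hF]
      rw [sum_scaleFun, norm_eq_abs, abs_mul, abs_mul, abs_prod, abs_prod, mul_assoc (∏ e, C₂ e)]
      refine mul_le_mul ?_ hr (abs_nonneg _) (prod_nonneg fun e _ => hC₂0 e)
      rw [← mul_one (∏ e, C₂ e)]
      exact mul_le_mul (prod_le_prod (fun _ _ => abs_nonneg _) fun e _ => hC₂ e _ _)
        (prod_le_one (fun _ _ => abs_nonneg _) fun c _ => abs_freeSum_le c m x)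
        (prod_nonneg fun _ _ => abs_nonneg _) (prod_nonneg fun e _ => hC₂0 e)
  have hlim : ∀ x, Function.Injective (G.extend x) → Tendsto (fun m => F m x) atTop (nhds
    (G.integrand s (rescale s lam φ) K x)) := fun x hx => by
    simp only [hF, sum_scaleFun, integrand_eq]
    refine Tendsto.mul_const _ (Tendsto.mul (tendsto_finsetProd _ fun e _ => tendsto_regK
      (sub_ne_zero.2 ?_)) ?_)
    · rw [pos_apply, pos_apply]; exact fun h' => G.no_loop e (hx h').symm
    · rw [← prod_const_one (s := (univ : Finset (Sym2 V)))]
      exact tendsto_finsetProd _ fun c _ => tendsto_freeSum c hx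
  have hsi : ∀ n, Integrable (scaleFun s G K I (rescale s lam φ) n) := fun n => by
    obtain ⟨b', hb', h'⟩ := hscale n
    exact hb'.mono' (h' hdat).1.aestronglyMeasurable (Eventually.of_forall (h' hdat).2)
  have hFm : ∀ m, AEStronglyMeasurable (F m) := fun m =>
    (integrable_finsetSum _ fun n _ => hsi n).aestronglyMeasurable
  have hinj := ae_injective (G := G) (s := s)
  refine ⟨hbi.mono' (aestronglyMeasurable_of_tendsto_ae _ hFm (hinj.mono hlim)) ?_, ?_⟩
  · filter_upwards [hinj] with x hx
    exact le_of_tendsto (hlim x hx).norm (Eventually.of_forall (hFb x hx))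
  have h1 := tendsto_integral_of_dominated_convergence b hFm hbi
    (fun m => hinj.mono fun x hx => hFb x hx m) (hinj.mono hlim)
  obtain ⟨C, β, -, hβ, hbd⟩ := exists_summable_bound h hnc hR
  have hsum : Summable fun n => ∫ x, scaleFun s G K I (rescale s lam φ) n x :=
    Summable.of_norm_bounded ((hβ lam hlam).1.mul_left _) fun n =>
      hbd K I N S p φ T lam n hdat hφ hT hφT hlam hlam1
  have hbox : Tendsto (fun m : ℕ => Fintype.piFinset fun _ : Sym2 V => Icc (-(m : ℤ)) m) atTop atTop
    := by
    refine tendsto_atTop_finset_of_monotone (fun m m' hm => Fintype.piFinset_subset _ _ fun _ =>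
      Icc_subset_Icc (by omega) (by omega)) fun n => ⟨∑ c, (n c).natAbs, ?_⟩
    refine Fintype.mem_piFinset.2 fun c => mem_Icc.2 ?_
    have := single_le_sum (f := fun c => (n c).natAbs) (fun _ _ => Nat.zero_le _) (mem_univ c)
    omega
  refine tendsto_nhds_unique h1 ((hsum.hasSum.comp hbox).congr fun m => ?_)
  simp only [hF, Function.comp_apply]
  exact (integral_finsetSum _ fun n _ => hsi n).symm

end Approx

section Regularisation

variable {a : ℝ} {q : ℕ}

/-! ### Regularisations -/

lemma IsSymb.abs_mD_le {b : Fin d → X}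
    {D : Set X} {F : X → ℝ} {B Λ : ℝ} {m : ℕ} (hD : IsOpen D) (hF : SmoothOn F D)
    (k : ℕ^d) (h : IsSymb b (fun i => Λ ^ s i) D m B F) (hm : ∑ i, k i ≤ m) {x : X}
    (hx : x ∈ D) : |mD b k F x| ≤ B * Λ ^ sdeg s k := by
  induction hl : ∑ j, k j generalizing k F B m with
  | zero =>
    have hk : k = 0 := funext fun j => by simpa using (sum_eq_zero_iff.1 hl) j (mem_univ j)
    subst hk; simpa [mD_zero, sdeg] using h.bound x hx
  | succ l ih =>
    obtain ⟨i, k', rfl, hk'⟩ := exists_eq_add_single_of_sum hl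
    obtain ⟨m, rfl⟩ : ∃ m', m = m' + 1 := ⟨m - 1, by omega⟩
    rw [mD_succ b hD hF k' i hx, sdeg_add_single]
    refine (ih (contDiffOn_lineD hD hF _) k' (h.2 i) (by omega) (by omega)).trans (le_of_eq ?_)
    rw [pow_add]; ring

lemma mD_monom_zero (j k : ℕ^d) (c : ℝ) :
    mD stdB j (fun x => c * monom k x) 0 = if j = k then c * mfact k else 0 := by
  induction hl : ∑ i, j i generalizing j k c with
  | zero =>
    have hj : j = 0 := funext fun i => by simpa using (sum_eq_zero_iff.1 hl) i (mem_univ i)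
    subst hj; rw [mD_zero]
    by_cases hk : k = 0
    · subst hk; simp [monom, mfact]
    · obtain ⟨i, hi⟩ := Function.ne_iff.1 hk
      rw [if_neg (Ne.symm hk), monom, prod_eq_zero (mem_univ i), mul_zero]; exact zero_pow hi
  | succ l ih =>
    obtain ⟨i, j', rfl, hj'⟩ := exists_eq_add_single_of_sum hl; have hm := contDiff_monom k
    have hL : lineD (stdB i) (fun x => c * monom k x) = fun x => (c * k i) * monom (k - Pi.single i
      1) x := funext fun x => by
      rw [lineD_const_mul_apply _ _ (hm.differentiable (by simp) x), lineD_monom]; ring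
    rw [mD_succ stdB isOpen_univ (contDiff_const.mul hm).contDiffOn j' i (Set.mem_univ _), hL,
      ih _ _ _ (by omega)]
    by_cases hki : k i = 0
    · have : j' + Pi.single i 1 ≠ k := fun h' => by have := congrFun h' i; simp at this; omega
      simp [hki, this]
    · obtain ⟨k', rfl⟩ := exists_eq_add_single hki; rw [add_tsub_cancel_right, mfact_add_single]
      by_cases hjk : j' = k'
      · subst hjk; simp; ring
      · simp [hjk]

/-- The shell of points whose distance to the origin is comparable to `t`. -/
def near (s : ℕ^d) (t : ℝ) : Set ℝ^d := {y | t / 2 < snorm s y} ∩ {y | snorm s y < 2 * t}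

lemma isOpen_near (t : ℝ) : IsOpen (near s t) := (isOpen_lt_snorm _).inter (isOpen_snorm_lt _)

/-- Scale-invariant bounds of order `m` on a function with a singularity of order `a` at `0`. -/
def Homog (s : ℕ^d) (a : ℝ) (m : ℕ) (B : ℝ) (F : ℝ^d → ℝ) : Prop :=
  ∀ t, 0 < t → IsSymb stdB (fun i => (8 / t) ^ s i) (near s t) m (B * (8 / t) ^ a) F

lemma Homog.abs_multiD_le {m : ℕ} {B : ℝ} {F : ℝ^d → ℝ}
    (h : Homog s a m B F) (hF : Smooth F) {k : ℕ^d} (hk : ∑ i, k i ≤ m)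
    {x : ℝ^d} (hx : x ≠ 0) :
    |multiD k F x| ≤ B * 8 ^ (a + sdeg s k) * snorm s x ^ (-(a + sdeg s k)) := by
  have ht := snorm_pos hx
  have := (h _ ht).abs_mD_le (isOpen_near _) hF.contDiffOn k hk
    (x := x) ⟨by rw [Set.mem_ofPred_eq]; linarith, by rw [Set.mem_ofPred_eq]; linarith⟩
  rw [multiD_eq_mD]
  refine this.trans (le_of_eq ?_)
  rw [mul_assoc, ← rpow_natCast, ← rpow_add (by positivity),
    div_rpow (by norm_num) ht.le, rpow_neg ht.le]
  ring

lemma exists_homog_cutoff (ha : 0 ≤ a) {K : ℝ^d → ℝ} (hK : IsKernel s a K) (m : ℕ) :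
    ∃ B, 0 ≤ B ∧ ∀ n : ℤ, Homog s a m B fun x => K x * (1 - chiN s n x) := by
  obtain ⟨N, hN⟩ : ∃ N, KerBound s a (m * sdim s + 1) N K := ⟨_, hK.kerBound _⟩
  obtain ⟨B, hB, hχ⟩ := exists_isSymb_chiN (s := s) m
  obtain ⟨C, hC, hcut⟩ := exists_isSymb_mul_cutoff (s := s) ha m (B := 1 + B) (by positivity)
  have hN0 := hN.nonneg
  refine ⟨C * N + N, by positivity, fun n t ht => ?_⟩
  have h8 : (0 : ℝ) < 8 / t := by positivity
  rcases le_or_gt (2 ^ (-n + 2)) t with hn | hn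
  · have h1 := hN.isSymb ha (m := m) (by omega) (Λ := 2 / t) (by positivity)
    refine ((h1.mono (ν := fun i => (8 / t) ^ s i) (D' := near s t) (fun i => by positivity)
      (fun i => ?_) (by positivity) ?_ ?_).congr (isOpen_near t) fun x hx => ?_)
    · gcongr; norm_num
    · have : (2 / t) ^ a ≤ (8 / t) ^ a := by gcongr; norm_num
      have : 0 ≤ C * N * (8 / t) ^ a := by positivity
      nlinarith
    · intro x hx; rw [Set.mem_ofPred_eq, inv_div]; exact hx.1
    · rw [chiN_eq_zero, sub_zero, mul_one]; have h2 := hx.1; rw [Set.mem_ofPred_eq] at h2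
      rw [show -n + 2 = (-n + 1) + 1 by ring, zpow_add_one₀ two_ne_zero] at hn; linarith
  · have hy : (2 : ℝ) ^ n ≤ 4 / t := by
      rw [two_zpow_add, zpow_neg] at hn; rw [le_div_iff₀ ht]; norm_num at hn
      have : (0 : ℝ) < 2 ^ n := by positivity
      rw [inv_mul_eq_div, lt_div_iff₀ this] at hn; linarith
    have h1 := hcut K N _ (Nat.lt_succ_self _) hN n (fun x => 1 - chiN s n x)
      (contDiff_const.sub (contDiff_chiN n)) (by
        have := (IsSymb.one (b := stdB) (D := Set.univ) (m := m) (μ := fun i => ((2 : ℝ) ^ n) ^ s i)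
          fun i => by positivity).add isOpen_univ contDiffOn_const
          (contDiff_const.mul (contDiff_chiN n)).contDiffOn
          ((hχ n).const_mul isOpen_univ (contDiff_chiN n).contDiffOn (-1))
        simpa [sub_eq_add_neg] using this) fun x hx => by rw [chiN_eq_one hx.le, sub_self]
    refine h1.mono (fun i => by positivity) (fun i => ?_) (by positivity) ?_ (Set.subset_univ _)
    · rw [zpow_add_one₀ two_ne_zero]; refine pow_le_pow_left₀ (by positivity) ?_ _
      rw [show 8 / t = 4 / t * 2 by ring]; linarith
    · have h2 : ((2 : ℝ) ^ n) ^ a ≤ (8 / t) ^ a := by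
        refine rpow_le_rpow (by positivity) (hy.trans ?_) ha; gcongr; norm_num
      have : 0 ≤ N * (8 / t) ^ a := by positivity
      nlinarith [mul_nonneg hC hN0]

lemma exists_bump (ha : 0 ≤ a) {k : ℕ^d}
    (hk : k ∈ lowIdx s q) {n : ℤ} (hn : 0 ≤ n) {T C : ℝ} (hC : 1 ≤ C)
    (hT : a < (sdim s : ℝ) + sdeg s k → |T| ≤ C * ((2 : ℝ) ^ n) ^ (a - sdim s - sdeg s k)) :
    ∃ f, Smooth f ∧ (∀ x, 2 ^ (-n + 2) < snorm s x → f x = 0) ∧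
      (∀ j ∈ lowIdx s q, ∫ x, monom j x * f x = if j = k then T else 0) ∧
      ∀ m B, 0 ≤ B → (∀ n : ℤ, IsSymb stdB (fun i => ((2 : ℝ) ^ n) ^ s i) Set.univ m
        (((2 : ℝ) ^ n) ^ (sdim s + sdeg s k) * B) (rhoN s q n k)) → Homog s a m (C * B) f := by
  obtain ⟨J, hJ, hcj⟩ : ∃ J : ℕ, 0 < J ∧ ∀ j < J,
      |T / J| ≤ C * ((2 : ℝ) ^ (n + 4 * j)) ^ (a - sdim s - sdeg s k) := by
    rcases lt_or_ge a ((sdim s : ℝ) + sdeg s k) with h | h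
    · exact ⟨1, one_pos, fun j hj => by
        obtain rfl : j = 0 := by omega
        simpa using hT h⟩
    · refine ⟨⌈|T|⌉₊ + 1, by omega, fun j _ => ?_⟩
      have h1 : |T / (⌈|T|⌉₊ + 1 : ℕ)| ≤ 1 := by
        rw [abs_div, Nat.abs_cast, div_le_one (by positivity)]; push_cast
        linarith [Nat.le_ceil |T|]
      have h2 := one_le_rpow (one_le_zpow₀ (one_le_two (α := ℝ))
        (show 0 ≤ n + 4 * j by omega)) (show 0 ≤ a - sdim s - sdeg s k by linarith)
      nlinarith
  have hrho := fun j : ℕ => contDiff_rhoN q (n + 4 * j) k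
  have hsupp := fun (j : ℕ) x (h : rhoN s q (n + 4 * j) k x ≠ 0) => rhoN_support h
  refine ⟨fun x => ∑ j ∈ range J, T / J * rhoN s q (n + 4 * j) k x,
    ContDiff.sum fun j _ => contDiff_const.mul (hrho j), fun x hx => ?_, fun i hi => ?_, ?_⟩
  · refine sum_eq_zero fun j _ => ?_; by_contra h0
    have h1 := (hsupp j x (right_ne_zero_of_mul h0)).2
    exact absurd (h1.trans (two_zpow_le (by omega))) (not_le.2 hx)
  · simp only [mul_sum]; rw [integral_finsetSum]
    · have : ∀ j ∈ range J, ∫ x, monom i x * (T / J * rhoN s q (n + 4 * j) k x) = T / J * if i = k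
        then 1 else 0 := fun j _ => by
        rw [← integral_monom_mul_rhoN (n + 4 * j) hi hk, ← integral_const_mul]; congr 1; ext x; ring
      rw [sum_congr rfl this, sum_const, card_range, nsmul_eq_mul]
      have : (J : ℝ) ≠ 0 := by positivity
      split_ifs
      · field_simp
      · simp
    · intro j _
      refine ((contDiff_monom i).continuous.mul (continuous_const.mul
        (hrho j).continuous)).integrable_of_hasCompactSupport
        (hasCompactSupport_of_snorm (ρ := 2 ^ (-(n + 4 * j) + 2)) fun x hx => ?_)
      by_contra h0
      exact absurd (hsupp j x (right_ne_zero_of_mul (right_ne_zero_of_mul h0))).2 (not_le.2 hx)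
  · intro m B hB hsy t ht; have h8 : (0 : ℝ) < 8 / t := by positivity
    have hD := isOpen_near (s := s) t
    by_cases hit : ∃ j ∈ range J, ∃ x ∈ near s t, rhoN s q (n + 4 * j) k x ≠ 0
    swap
    · push Not at hit
      exact IsSymb.zero (fun i => by positivity) hD (by positivity) fun x hx =>
        sum_eq_zero fun j hj => by rw [hit j hj x hx, mul_zero]
    obtain ⟨j, hj, x₀, hx₀, h₀⟩ := hit
    have hlt : ∀ j j' : ℕ, ∀ x ∈ near s t, ∀ x' ∈ near s t, rhoN s q (n + 4 * j) k x ≠ 0 → rhoN s q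
      (n + 4 * j') k x' ≠ 0 → ¬j < j' := fun j j' x hx x' hx' h h' hjj => by
      have h1 := (hsupp j x h).1.trans_lt hx.2; have h2 := hx'.1.trans_le (hsupp j' x' h').2
      have h3 : (2 : ℝ) ^ (-(n + 4 * (j' : ℤ)) + 2) ≤ 2 ^ (-(n + 4 * (j : ℤ)) + (-2 : ℤ)) :=
        two_zpow_le (by omega)
      rw [two_zpow_add (-(n + 4 * (j : ℤ)))] at h3; norm_num at h1 h2 h3; linarith
    have heq : Set.EqOn (fun x => T / J * rhoN s q (n + 4 * j) k x) (fun x => ∑ j ∈ range J, T / J *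
      rhoN s q (n + 4 * j) k x) (near s t) := by
      intro x hx
      refine (sum_eq_single_of_mem (f := fun j : ℕ => T / J * rhoN s q (n + 4 * j) k x) j hj fun j' _ hne => ?_).symm
      by_contra h'; have h' := right_ne_zero_of_mul h'; have := hlt j j' x₀ hx₀ x hx h₀ h'
      have := hlt j' j x hx x₀ hx₀ h' h₀; omega
    have hy0 : (0 : ℝ) < 2 ^ (n + 4 * (j : ℤ)) := by positivity
    have hy : (2 : ℝ) ^ (n + 4 * (j : ℤ)) ≤ 8 / t := by
      have h2 := hx₀.1.trans_le (hsupp j x₀ h₀).2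
      rw [two_zpow_add, zpow_neg, inv_mul_eq_div, lt_div_iff₀ hy0] at h2
      rw [le_div_iff₀ ht]; norm_num at h2; linarith
    refine (((hsy (n + 4 * j)).const_mul isOpen_univ (hrho j).contDiffOn (T / J)).mono
      (fun i => by positivity) (fun i => pow_le_pow_left₀ hy0.le hy _) (by positivity) ?_
      (Set.subset_univ _)).congr hD heq
    have h1 := hcj j (mem_range.1 hj); set y := (2 : ℝ) ^ (n + 4 * (j : ℤ)) with hyd
    have h2 : y ^ (a - sdim s - sdeg s k) * y ^ (sdim s + sdeg s k) = y ^ a := by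
      rw [← rpow_natCast, ← rpow_add hy0]; congr 1; push_cast; ring
    calc |T / J| * (y ^ (sdim s + sdeg s k) * B)
        ≤ C * y ^ (a - sdim s - sdeg s k) * (y ^ (sdim s + sdeg s k) * B) := by gcongr
      _ = C * B * y ^ a := by rw [← h2]; ring
      _ ≤ C * B * (8 / t) ^ a := by gcongr

lemma tendsto_integral_sub_taylor (haq : a < (sdim s : ℝ) + q) {p : ℕ} (hp : 0 < p) {N : ℝ} {Kn : ℕ
    → ℝ^d → ℝ} {K ψ : ℝ^d → ℝ} (hKn : ∀ n, KerBound s a p N (Kn n)) (hlim : ∀ x, x ≠ 0 → Tendsto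
    (fun n => Kn n x) atTop (nhds (K x))) (hψ : Smooth ψ) (hc : HasCompactSupport ψ) : Tendsto (fun
    n => ∫ x, Kn n x * (ψ x - ∑ k ∈ lowIdx s q, monom k x / mfact k * multiD k ψ 0)) atTop (nhds (∫
    x, K x * (ψ x - ∑ k ∈ lowIdx s q, monom k x / mfact k * multiD k ψ 0))) := by
  obtain ⟨C, hC, hrem⟩ := abs_taylorRem_le (s := s) (X := ℝ^d) q
  obtain ⟨B, hB, hsy⟩ := exists_isSymb hψ hc q
  have hN := (hKn 0).nonneg
  have hT : ∀ x, snorm s x ≤ 1 →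
      |ψ x - ∑ k ∈ lowIdx s q, monom k x / mfact k * multiD k ψ 0| ≤ C * B * snorm s x ^ q := by
    intro x hx
    have := hrem stdB Set.univ ψ B 1 isOpen_univ hψ.contDiffOn hB zero_le_one (by simpa using hsy) 0 x
      (fun _ _ => trivial) (by simpa using hx)
    simpa [taylorRem, stdB_sum, multiD_eq_mD] using this
  let g : ℝ^d → ℝ := {x | snorm s x ≤ 1}.indicator fun x => N * (C * B) * snorm s x ^ ((q : ℝ) - a)
  have hg0 : ∀ x, 0 ≤ N * (C * B) * snorm s x ^ ((q : ℝ) - a) := fun x => by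
    have := snorm_nonneg (s := s) x; positivity
  have hgm : Measurable g := (measurable_const.mul (continuous_snorm.measurable.pow_const
    _)).indicator (measurableSet_le continuous_snorm.measurable measurable_const)
  have hgi : Integrable g := by
    obtain ⟨C', -, h'⟩ := abs_integral_inner_le (s := s) (ε := sdim s + q - a) (by linarith)
    refine integrable_of_lintegral hgm.aestronglyMeasurable (h' g (N * (C * B)) 1 (by positivity)
      one_pos (fun x hx => ?_) fun x hx => Set.indicator_of_notMem
        (s := {x | snorm s x ≤ 1}) (fun h => not_le.2 hx h) _).2
    rw [abs_of_nonneg (Set.indicator_nonneg (fun x _ => hg0 x) x),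
      show -(sdim s : ℝ) + (sdim s + q - a) = q - a by ring]
    exact Set.indicator_le_self' (fun _ _ => hg0 x) x
  refine tendsto_integral_of_dominated_convergence g (fun n => ?_) hgi (fun n => ?_) ?_
  · refine aestronglyMeasurable_of_continuousOn ((hKn n).smooth.continuousOn.mul ?_)
    exact (hψ.continuous.sub (continuous_finsetSum _ fun k _ =>
      ((contDiff_monom k).continuous.div_const _).mul continuous_const)).continuousOn
  · filter_upwards [ae_ne_zero] with x hx
    by_cases hx1 : snorm s x ≤ 1
    · have h0 := snorm_pos hx; rw [norm_mul, norm_eq_abs, norm_eq_abs]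
      refine (mul_le_mul ((hKn n).abs_le hp hx) (hT x hx1) (abs_nonneg _) (by positivity)).trans
        (le_of_eq ?_)
      simp only [g]
      rw [Set.indicator_of_mem (by exact hx1), sub_eq_add_neg, rpow_add h0, rpow_natCast]; ring
    · rw [(hKn n).support x (not_le.1 hx1), zero_mul, norm_zero]
      exact Set.indicator_nonneg (fun x _ => hg0 x) x
  · filter_upwards [ae_ne_zero] with x hx; exact (hlim x hx).mul_const _

lemma integrable_mul_of_support {K g : ℝ^d → ℝ} (hK : Continuous K)
    (hsupp : ∀ x, 1 < snorm s x → K x = 0) (hg : Continuous g) : Integrable fun x => K x * g x :=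
  (hK.mul hg).integrable_of_hasCompactSupport
    (hasCompactSupport_of_snorm (ρ := 1) fun x hx => by simp [hsupp x hx])

lemma integral_sub_taylor_add {K ψ : ℝ^d → ℝ} (hK : Continuous K) (hsupp : ∀ x, 1 < snorm s x → K x
    = 0) (hψ : Continuous ψ) (q : ℕ) : (∫ x, K x * (ψ x - ∑ k ∈ lowIdx s q, monom k x / mfact k *
    multiD k ψ 0)) + ∑ k ∈ lowIdx s q, (∫ x, K x * monom k x) / mfact k * multiD k ψ 0 = ∫ x, K x *
    ψ x := by
  have hi := fun k => integrable_mul_of_support hK hsupp (g := fun x => monom k x / mfact k * multiD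
    k ψ 0) (((contDiff_monom k).continuous.div_const _).mul continuous_const)
  simp only [mul_sub, mul_sum]
  rw [integral_sub (integrable_mul_of_support hK hsupp hψ) (integrable_finsetSum _ fun k _ => hi k),
    integral_finsetSum _ fun k _ => hi k, sub_add_eq_add_sub, add_sub_assoc, add_eq_left, sub_eq_zero]
  refine sum_congr rfl fun k _ => ?_
  rw [div_mul_eq_mul_div, mul_div_assoc, ← integral_mul_const]
  congr 1; ext x; ring

lemma exists_isRegularisation (ha : 0 ≤ a) {r : ℤ} (har : a < (sdim s : ℝ) + (-r).toNat) {K : ℝ^d →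
    ℝ} {I : ℕ^d → ℝ} (hK : IsKernel s a K) (hI : MomentsCompatible s a r K I) : ∃ Kn,
    IsRegularisation s a r K I Kn := by
  set q := (-r).toNat with hq
  have hT : ∀ k ∈ lowIdx s q, ∃ C, 1 ≤ C ∧ (a < (sdim s : ℝ) + sdeg s k → ∀ n : ℤ, 0 ≤ n →
      |tailMom s K I n k| ≤ C * ((2 : ℝ) ^ n) ^ (a - sdim s - sdeg s k)) := fun k hk => by
    by_cases h : a < (sdim s : ℝ) + sdeg s k
    · obtain ⟨C, hC, hC'⟩ := exists_tailMom_le h.ne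
      obtain ⟨N, hN⟩ : ∃ N, KerBound s a 1 N K := ⟨_, hK.kerBound 1⟩
      refine ⟨1 + C * (N + |I k|), ?_, fun _ n hn => (hC' K I N 1 one_pos hN (hI k hk) n hn).trans ?_⟩
      · have := hN.nonneg; have : 0 ≤ C * (N + |I k|) := by positivity
        linarith
      · gcongr; linarith
    · exact ⟨1, le_rfl, fun h' => absurd h' h⟩
  choose! C hC hCT using hT
  have hb := fun (n : ℕ) (k : ℕ^d) (hk : k ∈ lowIdx s q) => exists_bump ha hk
    (n := n + 2) (by omega) (hC k hk) (T := tailMom s K I (n + 2) k)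
    fun h => hCT k hk h _ (by omega)
  choose! f hfs hf0 hfm hfh using hb
  have hKc := fun n : ℕ => contDiff_mul_one_sub_chiN hK.smooth (n + 2 : ℤ)
  have hfc := fun n : ℕ => ContDiff.sum (s := lowIdx s q) fun k hk => hfs n k hk
  have hsm : ∀ n : ℕ, Smooth fun x => K x * (1 - chiN s (n + 2) x) + ∑ k ∈ lowIdx s q, f n k x :=
    fun n => (hKc n).add (hfc n)
  have h41 : ∀ n : ℕ, (2 : ℝ) ^ (-((n : ℤ) + 2) + 2) ≤ 1 := fun n =>
    zpow_le_one_of_nonpos₀ one_le_two (by omega)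
  have hf1 : ∀ n, ∀ k ∈ lowIdx s q, ∀ x, 1 < snorm s x → f n k x = 0 := fun n k hk x hx =>
    hf0 n k hk x ((h41 n).trans_lt hx)
  have hsupp : ∀ (n : ℕ) x, 1 < snorm s x → K x * (1 - chiN s (n + 2) x) + ∑ k ∈ lowIdx s q, f n k x
    = 0 := fun n x hx => by
    rw [hK.support x hx, zero_mul, zero_add]; exact sum_eq_zero fun k hk => hf1 n k hk x hx
  have hpt : ∀ x, x ≠ 0 → Tendsto (fun n : ℕ => K x * (1 - chiN s (n + 2) x) + ∑ k ∈ lowIdx s q, f n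
    k x) atTop (nhds (K x)) := fun x hx => by
    obtain ⟨n₀, hn₀⟩ := exists_pow_lt_of_lt_one (snorm_pos hx) (show (1 / 2 : ℝ) < 1 by norm_num)
    refine tendsto_const_nhds.congr' ?_; filter_upwards [eventually_ge_atTop n₀] with n hn
    have h1 : (2 : ℝ) ^ (-((n : ℤ) + 2) + 2) < snorm s x := by
      refine lt_of_le_of_lt ?_ hn₀; rw [one_div, inv_pow, ← zpow_natCast, ← zpow_neg]
      exact two_zpow_le (by omega)
    rw [chiN_eq_zero ((two_zpow_le (by omega)).trans h1.le), sub_zero, mul_one,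
      sum_eq_zero fun k hk => hf0 n k hk x h1, add_zero]
  have hbd : ∀ p : ℕ, ∃ B : ℝ≥0, ∀ n : ℕ, kernelNorm s a p (fun x => K x * (1 - chiN s (n + 2) x) +
    ∑ k ∈ lowIdx s q, f n k x) ≤ B := fun p => by
    obtain ⟨B, hB, hB'⟩ := exists_homog_cutoff ha hK p
    choose B₁ hB₁ hB₁' using exists_isSymb_rhoN (s := s) q p
    set B₂ := B + ∑ k ∈ lowIdx s q, C k * B₁ k with hB₂
    have hB₂0 : 0 ≤ B₂ := add_nonneg hB (sum_nonneg fun k hk =>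
      mul_nonneg (by linarith [hC k hk]) (hB₁ k))
    refine ⟨(B₂ * 8 ^ (a + p)).toNNReal, fun n => ?_⟩
    have hh : Homog s a p B₂ fun x => K x * (1 - chiN s (n + 2) x) + ∑ k ∈ lowIdx s q, f n k x := by
      intro t ht; rw [hB₂, add_mul, sum_mul]
      exact IsSymb.add (isOpen_near t) (hKc n).contDiffOn (hfc n).contDiffOn (hB' _ t ht)
        (IsSymb.sum _ (fun i => by positivity) (isOpen_near t) (fun k hk => (hfs n k hk).contDiffOn)
          fun k hk => hfh n k hk p (B₁ k) (hB₁ k) (hB₁' k) t ht)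
    refine iSup_le fun x => iSup_le fun hx => iSup_le fun k => iSup_le fun hk => ?_
    refine ENNReal.ofReal_le_ofReal ?_; have hx0 := snorm_pos hx.1
    have hkp : ∑ i, k i ≤ p := (sum_le_sum fun i _ =>
      Nat.le_mul_of_pos_left (k i) (hs.pos i)).trans hk.le
    refine (mul_le_mul_of_nonneg_left (hh.abs_multiD_le (hsm n) hkp hx.1) (by positivity)).trans ?_
    rw [rpow_neg hx0.le, mul_comm, mul_assoc, inv_mul_cancel₀ (by positivity), mul_one]
    have : (sdeg s k : ℝ) ≤ p := by exact_mod_cast hk.le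
    gcongr; norm_num
  refine ⟨_, hsm, hsupp, hbd, hpt, fun ψ hψ hc => ?_⟩
  obtain ⟨N, hN⟩ := hbd 1
  have h1 := tendsto_integral_sub_taylor har one_pos (fun n => kerBound_of_kernelNorm
    (hsm n).contDiffOn (hsupp n) (hN n)) hpt hψ hc
  refine (h1.add_const _).congr fun n => ?_
  have hmom : ∀ k ∈ lowIdx s q, ∫ x, (K x * (1 - chiN s (n + 2) x) + ∑ k ∈ lowIdx s q, f n k x) *
    monom k x = I k := fun k hk => by
    have i1 := integrable_mul_of_support (hKc n).continuous (fun x hx => by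
      rw [hK.support x hx, zero_mul]) (contDiff_monom k).continuous
    have i2 : ∀ k' ∈ lowIdx s q, Integrable fun x => f n k' x * monom k x := fun k' hk' =>
      integrable_mul_of_support (hfs n k' hk').continuous (hf1 n k' hk')
        (contDiff_monom k).continuous
    simp only [add_mul, sum_mul]
    rw [integral_add i1 (integrable_finsetSum _ i2), integral_finsetSum _ i2]
    have : ∀ k' ∈ lowIdx s q, ∫ x, f n k' x * monom k x = if k = k' then tailMom s K I (n + 2) k'
      else 0 := fun k' hk' => by
      rw [← hfm n k' hk' k hk]; simp only [mul_comm]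
    rw [sum_congr rfl this, sum_ite_eq, if_pos hk, tailMom]; simp only [mul_comm (monom k _)]; ring
  rw [← integral_sub_taylor_add (hsm n).continuous (hsupp n) hψ.continuous q]
  exact congrArg _ (sum_congr rfl fun k hk => by rw [hmom k hk])

lemma IsRegularisation.tendsto_moment {r : ℤ} {K : ℝ^d → ℝ} {I : ℕ^d → ℝ} {Kn : ℕ → ℝ^d → ℝ}
    (hK : ∀ x, 1 < snorm s x → K x = 0) (h : IsRegularisation s a r K I Kn) {k : ℕ^d}
    (hk : k ∈ lowIdx s (-r).toNat) :
    Tendsto (fun n => ∫ x, monom k x * Kn n x) atTop (nhds (I k)) := by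
  have hone : ∀ x, snorm s x ≤ 1 → chiN s 0 x = 1 := fun x hx => chiN_eq_one (by simpa using hx)
  have h1 := h.distrib (fun x => monom k x * chiN s 0 x)
    ((contDiff_monom k).mul (contDiff_chiN 0)) (hasCompactSupport_of_snorm (ρ := 2)
      fun x hx => by rw [chiN_eq_zero (by simpa using hx.le), mul_zero])
  have hD : ∀ j, multiD j (fun x => monom k x * chiN s 0 x) 0 = if j = k then mfact k else 0 := by
    intro j; rw [multiD_eq_mD, ← one_mul (mfact k), ← mD_monom_zero]
    refine mD_congr stdB (isOpen_snorm_lt 1) (fun x hx => ?_) j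
      (by rw [Set.mem_ofPred_eq, snorm_zero]; exact one_pos)
    simp only [hone x hx.le, mul_one, one_mul]
  have hf := (mfact_pos k).ne'
  have hr : renorm s r K I (fun x => monom k x * chiN s 0 x) = I k := by
    unfold renorm; simp only [hD, mul_ite, mul_zero, sum_ite_eq', if_pos hk, div_mul_cancel₀ _ hf]
    rw [integral_congr_ae (g := fun _ => (0 : ℝ)) (Eventually.of_forall fun x => ?_)]
    · simp
    · rcases le_or_gt (snorm s x) 1 with hx | hx
      · simp [hone x hx]
      · simp [hK x hx]
  rw [hr] at h1
  refine h1.congr fun n => integral_congr_ae (Eventually.of_forall fun x => ?_)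
  rcases le_or_gt (snorm s x) 1 with hx | hx
  · simp [hone x hx, mul_comm]
  · simp [h.support n x hx]

end Regularisation

section Final

variable {a' : E → ℝ} {p : ℕ} {K : E → ℝ^d → ℝ} {I : E → ℕ^d → ℝ}

/-! ### Conclusion -/

lemma exists_nonCritical (h : G.PowerCounting s a) :
    ∃ a', (∀ e, a e ≤ a' e) ∧ G.PowerCounting s a' ∧ G.NonCritical s a' := by
  let A : ℝ → E → ℝ := fun ε e => a e + if G.r e < 0 then ε else 0
  have hA0 : A 0 = a := funext fun e => by simp [A]
  have hAc : ∀ c, Continuous fun ε => G.hatA (A ε) c := fun c =>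
    continuous_finsetSum _ fun e _ => continuous_const.add (by
      by_cases he : G.r e < 0
      · simp only [he, if_true]; exact continuous_id
      · simpa [he] using continuous_const)
  have hlt : ∀ {f : ℝ → ℝ} {b : ℝ}, Continuous f → f 0 < b → ∀ᶠ ε in nhdsWithin 0 (Set.Ioi 0), f ε < b :=
    fun hf hb => ((hf.tendsto 0).mono_left nhdsWithin_le_nhds).eventually_lt_const hb
  have h1 : ∀ᶠ ε in nhdsWithin 0 (Set.Ioi 0), ∀ c, c ∈ G.hatE →
      G.hatA (A ε) c + (min (G.hatR c) 0 : ℤ) < sdim s := eventually_all.2 fun c =>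
    eventually_imp_distrib_left.2 fun hc => hlt ((hAc c).add continuous_const)
      (by rw [hA0]; exact h.edge c hc)
  have h2 : ∀ᶠ ε in nhdsWithin 0 (Set.Ioi 0), ∀ U : Finset V, G.root ∉ U → 3 ≤ U.card → ∑ c ∈
    G.internal U, G.hatA (A ε) c < ((U.card : ℝ) - 1) * sdim s := eventually_all.2 fun U =>
    eventually_imp_distrib_left.2 fun hU => eventually_imp_distrib_left.2 fun hU' =>
      hlt (continuous_finsetSum _ fun c _ => hAc c) (by rw [hA0]; exact h.subgraph U hU hU')
  have h3 : ∀ᶠ ε in nhdsWithin 0 (Set.Ioi 0), ∀ U : Finset V, G.root ∈ U → 2 ≤ U.card → ∑ c ∈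
    G.internal U, G.hatA (A ε) c + ∑ c ∈ G.outPos U, (G.hatA (A ε) c + G.hatR c - 1) - ∑ c ∈ G.inPos
    U, (G.hatR c : ℝ) < ((U.card : ℝ) - 1) * sdim s := eventually_all.2 fun U =>
    eventually_imp_distrib_left.2 fun hU =>
      eventually_imp_distrib_left.2 fun hU' => hlt (((continuous_finsetSum _ fun c _ => hAc c).add
        (continuous_finsetSum _ fun c _ => ((hAc c).add continuous_const).sub
          continuous_const)).sub continuous_const) (by rw [hA0]; exact h.subgraph_root U hU hU')
  have h4 : ∀ᶠ ε in nhdsWithin 0 (Set.Ioi 0), ∀ U : Finset V, U.Nonempty → Disjoint U G.Vstar →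
    (U.card : ℝ) * sdim s < ∑ c ∈ G.incident U \ G.inPos U, G.hatA (A ε) c + ∑ c ∈ G.outPos U,
    (G.hatR c : ℝ) - ∑ c ∈ G.inPos U, ((G.hatR c : ℝ) - 1) := eventually_all.2 fun U =>
    eventually_imp_distrib_left.2 fun hU =>
      eventually_imp_distrib_left.2 fun hU' => (((((continuous_finsetSum _ fun c _ => hAc c).add
        continuous_const).sub continuous_const).tendsto 0).mono_left
        nhdsWithin_le_nhds).eventually_const_lt (by
            simp only [Pi.sub_apply, Pi.add_apply, hA0]; exact h.large U hU hU')
  have h5 : ∀ᶠ ε in nhdsWithin 0 (Set.Ioi 0), ∀ e, ∀ k ∈ lowIdx s (-G.r e).toNat,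
      A ε e ≠ (sdim s : ℝ) + sdeg s k := eventually_all.2 fun e =>
    (Finset.eventually_all _).2 fun k hk => by
      have hr : G.r e < 0 := by have := (mem_filter.1 hk).2; omega
      simp only [A, if_pos hr]; rcases eq_or_ne (a e) ((sdim s : ℝ) + sdeg s k) with h' | h'
      · filter_upwards [self_mem_nhdsWithin] with ε hε; rw [h']
        exact fun h'' => (Set.mem_Ioi.1 hε).ne' (by linarith)
      · exact ((((continuous_const.add continuous_id).tendsto (0 : ℝ)).mono_left
          nhdsWithin_le_nhds).eventually_ne (by simpa using h'))
  obtain ⟨ε, ⟨⟨⟨⟨⟨h1, h2⟩, h3⟩, h4⟩, h5⟩, hε⟩⟩ :=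
    (((((h1.and h2).and h3).and h4).and h5).and self_mem_nhdsWithin).exists
  have hε0 : 0 < ε := hε
  have hle : ∀ e, a e ≤ A ε e := fun e => le_add_of_nonneg_right (by split_ifs <;> linarith)
  exact ⟨A ε, hle, ⟨fun e => (h.a_nonneg e).trans (hle e), fun i => by
    simp [A, h.a_star i, G.star_r i], h.r_root, h.r_star, h.r_neg, h1, h2, h3, h4⟩, h5⟩

lemma exists_abs_multiD_le {R : ℝ} {φ : ℝ^d → ℝ} (hφ : IsTest s R φ)
    (p : ℕ) : ∃ T, 0 ≤ T ∧ ∀ k, sdeg s k < p → ∀ x, |multiD k φ x| ≤ T := by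
  obtain ⟨B, hB, h⟩ := exists_isSymb hφ.smooth (hasCompactSupport_of_snorm hφ.support) p
  refine ⟨B, hB, fun k hk x => ?_⟩
  have h' : IsSymb stdB (fun i => (1 : ℝ) ^ s i) Set.univ p B φ := by simpa using h
  rw [multiD_eq_mD]
  simpa using h'.abs_mD_le isOpen_univ hφ.smooth.contDiffOn k ((sum_le_sum fun i _ =>
    Nat.le_mul_of_pos_left (k i) (hs.pos i)).trans hk.le) (Set.mem_univ x)

lemma abs_multiD_le_testNorm {R : ℝ} {φ : ℝ^d → ℝ} (hφ : IsTest s R φ)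
    {k : ℕ^d} (hk : sdeg s k < p) (x : ℝ^d) :
    |multiD k φ x| ≤ (testNorm s p φ).toReal := by
  obtain ⟨T, hT, h⟩ := exists_abs_multiD_le hφ p
  have hfin : testNorm s p φ ≠ ⊤ := ne_top_of_le_ne_top ENNReal.ofReal_ne_top
    (iSup_le fun x => iSup₂_le fun k hk => ENNReal.ofReal_le_ofReal (h k hk x))
  rw [← ENNReal.ofReal_le_iff_le_toReal hfin]
  exact (le_iSup₂ (f := fun k (_ : sdeg s k < p) => ENNReal.ofReal |multiD k φ x|) k hk).trans
    (le_iSup (fun x => ⨆ (k : ℕ^d) (_ : sdeg s k < p), ENNReal.ofReal |multiD k φ x|) x)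

lemma exists_size_bound {N : E → ℝ} {Im : ℕ → E → ℕ^d → ℝ}
    (hI : ∀ e, ∀ k ∈ lowIdx s (-G.r e).toNat, Tendsto (fun m => Im m e k) atTop (nhds (I e k))) :
    ∃ S : E → ℝ, ∀ e, sizeE s G N I e ≤ S e ∧ ∀ m, sizeE s G N (Im m) e ≤ S e := by
  have h1 : ∀ e, Tendsto (fun m => sizeE s G N (Im m) e) atTop (nhds (sizeE s G N I e)) := fun e =>
    tendsto_const_nhds.add (tendsto_finsetSum _ fun k hk => (hI e k hk).abs)
  choose S hS using fun e => (h1 e).bddAbove_range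
  exact ⟨S, fun e => ⟨le_of_tendsto' (h1 e) fun m => hS e (Set.mem_range_self m),
    fun m => hS e (Set.mem_range_self m)⟩⟩

lemma MomentsCompatible.mono {b b' : ℝ} {r : ℤ} {K : ℝ^d → ℝ} {I : ℕ^d → ℝ}
    (h : MomentsCompatible s b r K I) (hb : b ≤ b') : MomentsCompatible s b' r K I :=
  fun k hk h' => h k hk (hb.trans_lt h')

lemma exists_data (haa : ∀ e, a e ≤ a' e) (hp : (ord G + ord G) * sdim s < p) {Km : ℕ → E → ℝ^d → ℝ}
    {Im : ℕ → E → ℕ^d → ℝ} (hK : G.IsKernelFamily s a K I) (hKm : ∀ e, ∃ N, ∀ m, KerBound s (a e) p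
    N (Km m e)) (hIm : ∀ m e, MomentsCompatible s (a e) (G.r e) (Km m e) (Im m e)) (hI : ∀ e, ∀ k ∈
    lowIdx s (-G.r e).toNat, Tendsto (fun m => Im m e k) atTop (nhds (I e k))) : ∃ N S, (∀ m, Data s
    G a' p N S (Km m) (Im m)) ∧ Data s G a' p N S K I := by
  choose N hN using hKm
  set N' : E → ℝ := fun e => max (N e) (kernelNorm s (a e) p (K e)).toReal
  obtain ⟨S, hS⟩ := exists_size_bound (N := N') hI
  exact ⟨N', S, fun m => ⟨fun e => ((hN e m).mono (le_max_left _ _) le_rfl).mono_exponent (haa e),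
    fun e => (hIm m e).mono (haa e), fun e => (hS e).2 m, hp⟩,
    fun e => (((hK e).1.kerBound p).mono (le_max_right _ _) le_rfl).mono_exponent (haa e),
    fun e => (hK e).2.mono (haa e), fun e => (hS e).1, hp⟩

lemma IsTest.pos {R : ℝ} {φ : ℝ^d → ℝ} (hφ : IsTest s R φ) : IsTest s (max R 1) φ :=
  ⟨hφ.smooth, fun x hx => hφ.support x ((le_max_left _ _).trans_lt hx)⟩

theorem isGenConv_genConv (h : G.PowerCounting s a)
    (hK : G.IsKernelFamily s a K I) {R lam : ℝ} {φ : ℝ^d → ℝ} (hφ : IsTest s R φ)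
    (hlam : 0 < lam) (hlam1 : lam ≤ 1) :
    G.IsGenConv s a (rescale s lam φ) K I (genConv s G K I (rescale s lam φ)) := by
  intro Kn hreg hKn
  obtain ⟨a', haa, h', hnc⟩ := exists_nonCritical h
  obtain ⟨T, hT, hφT⟩ := exists_abs_multiD_le hφ ((ord G + ord G) * sdim s + 1)
  have hR : 0 < max R 1 := lt_max_of_lt_right one_pos
  let Im : ℕ → E → ℕ^d → ℝ := fun n e k => ∫ x, monom k x * Kn e n x
  have hneg : ∀ e, ∀ k ∈ lowIdx s (-G.r e).toNat, G.r e < 0 := fun e k hk => by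
    have := (mem_filter.1 hk).2; omega
  have hI : ∀ e, ∀ k ∈ lowIdx s (-G.r e).toNat, Tendsto (fun n => Im n e k) atTop (nhds (I e k)) :=
    fun e k hk => (hreg e (hneg e k hk)).tendsto_moment (hK e).1.support hk
  obtain ⟨N, S, hdm, hd⟩ := exists_data (Km := fun n e => Kn e n) haa (Nat.lt_succ_self _) hK
    (fun e => by
      rcases lt_or_ge (G.r e) 0 with he | he
      · obtain ⟨B, hB⟩ := (hreg e he).bounded ((ord G + ord G) * sdim s + 1)
        exact ⟨B, fun n => kerBound_of_kernelNorm ((hreg e he).smooth n).contDiffOn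
          ((hreg e he).support n) (hB n)⟩
      · exact ⟨_, fun n => by simp only [hKn e he n]; exact (hK e).1.kerBound _⟩)
    (fun _ _ _ _ _ => rfl) hI
  have key := fun n => integral_integrand h' hnc (hdm n) (fun e he => (hreg e he).smooth n)
    (fun _ _ _ _ => rfl) hR hφ.pos hT hφT hlam hlam1
  refine ⟨fun n => (key n).1, ?_⟩
  simp only [fun n => (key n).2]
  refine tendsto_genConv h' hnc ⟨hdm, hd, fun e x hx => ?_, hI⟩ hR hφ.pos hT hφT hlam hlam1
  rcases lt_or_ge (G.r e) 0 with he | he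
  · exact (hreg e he).pointwise x hx
  · simp only [hKn e he]; exact tendsto_const_nhds

theorem isGenConv_iff (h : G.PowerCounting s a) (hK : G.IsKernelFamily s a K I) {R lam : ℝ} {φ : ℝ^d
    → ℝ} (hφ : IsTest s R φ) (hlam : 0 < lam) (hlam1 : lam ≤ 1) {L : ℝ} : G.IsGenConv s a (rescale s
    lam φ) K I L ↔ L = genConv s G K I (rescale s lam φ) := by
  refine ⟨fun hL => ?_, fun hL => hL ▸ isGenConv_genConv h hK hφ hlam hlam1⟩
  have hreg : ∀ e, ∃ Kn, (G.r e < 0 → IsRegularisation s (a e) (G.r e) (K e) (I e) Kn) ∧ (0 ≤ G.r e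
    → ∀ n, Kn n = K e) := fun e => by
    rcases lt_or_ge (G.r e) 0 with he | he
    · have h1 := h.edge (G.ends e) (mem_image_of_mem _ (mem_univ e))
      rw [hatA_of_neg he, hatR_of_neg he, min_eq_left he.le] at h1
      have h2 : ((-G.r e).toNat : ℝ) = -(G.r e : ℝ) := by
        have : ((-G.r e).toNat : ℤ) = -G.r e := by omega
        exact_mod_cast congrArg (Int.cast (R := ℝ)) this
      obtain ⟨Kn, hKn⟩ := exists_isRegularisation (h.a_nonneg e)
        (by rw [h2]; linarith) (hK e).1 (hK e).2
      exact ⟨Kn, fun _ => hKn, fun h' => absurd he (not_lt.2 h')⟩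
    · exact ⟨fun _ => K e, fun h' => absurd he (not_le.2 h'), fun _ _ => rfl⟩
  choose Kn h1 h2 using hreg
  exact tendsto_nhds_unique (hL Kn h1 h2).2 (isGenConv_genConv h hK hφ hlam hlam1 Kn h1 h2).2

lemma card_ne_root : Fintype.card 𝕍 G = (univ \ G.Vstar).card + G.M := by
  have hroot : G.root ∉ univ.image fun i => G.tgt (G.star i) := fun h => by
    obtain ⟨i, -, hi⟩ := mem_image.1 h; exact G.no_loop (G.star i) ((G.star_src i).trans hi.symm)
  have h1 : G.Vstar.card = G.M + 1 := by
    rw [RGraph.Vstar, card_insert_of_notMem hroot, card_image_of_injective _ G.star_tgt,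
      card_univ, Fintype.card_fin]
  have h2 := card_le_univ G.Vstar
  rw [Fintype.card_subtype_compl, Fintype.card_subtype_eq, card_sdiff_of_subset
    (subset_univ _), card_univ]
  omega

theorem abs_genConv_le (h : G.PowerCounting s a) (hnc : G.NonCritical s a)
    (hp : (ord G + ord G) * sdim s < p) {R : ℝ} (hR : 0 < R) : ∃ C : ℝ, 0 ≤ C ∧
    ∀ (K : E → ℝ^d → ℝ) (I : E → ℕ^d → ℝ), G.IsKernelFamily s a K I →
      ∀ φ, IsTest s R φ → ∀ lam : ℝ, 0 < lam → lam ≤ 1 →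
        |genConv s G K I (rescale s lam φ)| ≤ C * lam ^ G.expo s a * (testNorm s p φ).toReal ^ G.M
          * ∏ e, G.edgeSize s a p K I e := by
  obtain ⟨C, β, hC, hβ, hb⟩ := exists_summable_bound h hnc hR
  refine ⟨C, hC, fun K I hK φ hφ lam hlam hlam1 => ?_⟩
  set T := (testNorm s p φ).toReal with hTdef
  have hT : 0 ≤ T := ENNReal.toReal_nonneg
  have hbd := fun n => hb K I (fun e => (kernelNorm s (a e) p (K e)).toReal) (G.edgeSize s a p K I) p
    φ T lam n ⟨fun e => (hK e).1.kerBound p, fun e => (hK e).2, fun e => le_rfl, hp⟩ hφ hT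
    (fun k hk x => abs_multiD_le_testNorm hφ hk x) hlam hlam1
  have hS : 0 ≤ ∏ e, G.edgeSize s a p K I e := prod_nonneg fun e _ =>
    add_nonneg ENNReal.toReal_nonneg (sum_nonneg fun _ _ => abs_nonneg _)
  have hX : 0 ≤ ((lam ^ sdim s)⁻¹ * T) ^ G.M * ∏ e, G.edgeSize s a p K I e := by positivity
  have h1 := tsum_of_norm_bounded (f := fun n => ∫ x, scaleFun s G K I (rescale s lam φ) n x) ((hβ lam hlam).1.mul_left
    (((lam ^ sdim s)⁻¹ * T) ^ G.M * ∏ e, G.edgeSize s a p K I e)).hasSum hbd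
  rw [tsum_mul_left] at h1
  refine h1.trans ((mul_le_mul_of_nonneg_left (hβ lam hlam).2 hX).trans (le_of_eq ?_))
  have h2 : lam ^ ((sdim s : ℝ) * Fintype.card 𝕍 G - ∑ e, a e) = lam ^ G.expo s a * (lam ^ sdim s) ^
    G.M := by
    rw [← pow_mul, ← rpow_natCast, ← rpow_add hlam, card_ne_root, RGraph.expo]; congr 1; push_cast
    ring
  have h3 : (lam ^ sdim s) ^ G.M ≠ 0 := by positivity
  rw [h2, mul_pow, inv_pow]
  field_simp

end Final

end GenConv

end

open GenConv
theorem mainTheorem6 {d : ℕ} (s : Fin d → ℕ) (hs : ∀ i, 0 < s i)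
    {V E : Type*} [Fintype V] [DecidableEq V] [Fintype E] (G : RGraph V E) :
    ∃ p : ℕ, ∀ a : E → ℝ, G.PowerCounting s a →
      -- the generalised convolution is well defined
      (∀ (K : E → (Fin d → ℝ) → ℝ) (I : E → (Fin d → ℕ) → ℝ), G.IsKernelFamily s a K I →
        ∀ (R : ℝ) (φ : (Fin d → ℝ) → ℝ), IsTest s R φ →
        ∀ lam : ℝ, 0 < lam → lam ≤ 1 →
          ∃! L : ℝ, G.IsGenConv s a (rescale s lam φ) K I L) ∧
      -- it is bounded
      (G.NonCritical s a → ∀ R : ℝ, 0 < R → ∃ C : ℝ, 0 ≤ C ∧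
        ∀ (K : E → (Fin d → ℝ) → ℝ) (I : E → (Fin d → ℕ) → ℝ), G.IsKernelFamily s a K I →
        ∀ φ : (Fin d → ℝ) → ℝ, IsTest s R φ →
        ∀ lam : ℝ, 0 < lam → lam ≤ 1 →
        ∀ L : ℝ, G.IsGenConv s a (rescale s lam φ) K I L →
          |L| ≤ C * lam ^ G.expo s a * (testNorm s p φ).toReal ^ G.M
            * ∏ e, G.edgeSize s a p K I e) ∧
      -- it is continuous under pointwise convergence of the kernels with uniform bounds
      (∀ (K : E → (Fin d → ℝ) → ℝ) (I : E → (Fin d → ℕ) → ℝ)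
          (Km : ℕ → E → (Fin d → ℝ) → ℝ) (Im : ℕ → E → (Fin d → ℕ) → ℝ),
        G.IsKernelFamily s a K I → (∀ m, G.IsKernelFamily s a (Km m) (Im m)) →
        (∀ e, ∃ B : ℝ≥0, ∀ m, kernelNorm s (a e) p (Km m e) ≤ B) →
        (∀ e x, x ≠ 0 → Filter.Tendsto (fun m => Km m e x) Filter.atTop (nhds (K e x))) →
        (∀ e, ∀ k ∈ lowIdx s (-G.r e).toNat,
          Filter.Tendsto (fun m => Im m e k) Filter.atTop (nhds (I e k))) →
        ∀ (R : ℝ) (φ : (Fin d → ℝ) → ℝ), IsTest s R φ →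
        ∀ lam : ℝ, 0 < lam → lam ≤ 1 →
        ∀ (L : ℝ) (Lm : ℕ → ℝ), G.IsGenConv s a (rescale s lam φ) K I L →
          (∀ m, G.IsGenConv s a (rescale s lam φ) (Km m) (Im m) (Lm m)) →
          Filter.Tendsto Lm Filter.atTop (nhds L)) := by
  refine ⟨(ord G + ord G) * sdim s + 1, fun a h => ?_⟩
  have : Scaling s := ⟨hs, sdim_pos h⟩
  refine ⟨?_, ?_, ?_⟩
  · intro K I hK R φ hφ lam hlam hlam1
    exact ⟨_, isGenConv_genConv h hK hφ hlam hlam1,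
      fun L hL => (isGenConv_iff h hK hφ hlam hlam1).1 hL⟩
  · intro hnc R hR
    obtain ⟨C, hC, hb⟩ := abs_genConv_le h hnc (Nat.lt_succ_self _) hR
    refine ⟨C, hC, fun K I hK φ hφ lam hlam hlam1 L hL => ?_⟩
    rw [(isGenConv_iff h hK hφ hlam hlam1).1 hL]
    exact hb K I hK φ hφ lam hlam hlam1
  · intro K I Km Im hK hKm hB hlim hI R φ hφ lam hlam hlam1 L Lm hL hLm
    obtain ⟨a', haa, h', hnc⟩ := exists_nonCritical h
    obtain ⟨T, hT, hφT⟩ := exists_abs_multiD_le hφ ((ord G + ord G) * sdim s + 1)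
    obtain ⟨N, S, hdm, hd⟩ := exists_data haa (Nat.lt_succ_self _) hK (fun e => by
      obtain ⟨B, hB⟩ := hB e
      exact ⟨B, fun m => kerBound_of_kernelNorm (hKm m e).1.smooth (hKm m e).1.support (hB m)⟩)
      (fun m e => (hKm m e).2) hI
    rw [(isGenConv_iff h hK hφ hlam hlam1).1 hL,
      funext fun m => (isGenConv_iff h (hKm m) hφ hlam hlam1).1 (hLm m)]
    exact tendsto_genConv h' hnc ⟨hdm, hd, hlim, hI⟩ (lt_max_of_lt_right one_pos) hφ.pos hT hφT
      hlam hlam1
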